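/- **Conventions.** A compact quantum group $\mathbb{G}$ is described by its Hopf $*$-algebra $\mathcal{O}(\mathbb{G})$; its dual is the discrete quantum group $\widehat{\mathbb{G}}$, and an isomorphism of duals is an isomorphism of the Hopf $*$-algebras. "The universal compact quantum group generated by the entries of a unitary representation $U=(u_{ij})_{i,j\in X}$ with certain relations" has as $\mathcal{O}(\mathbb{G})$ the universal unital $*$-algebra with generators $u_{ij}$, the relations that $U$ is unitary, and the given relations, with $\Delta(u_{ij})=\sum_k u_{ik}\otimes u_{kj}$ and $\varepsilon(u_{ij})=\delta_{ij}$. A vector $\xi\in(\mathbb{C}^X)^{\otimes n}$ is invariant under $U^{\otimes n}$ if $\sum_{t\in X^n}\xi(t)\,u_{k_1t_1}\cdots u_{k_nt_n}=\xi(k)1$ for all $k\in X^n$. * For a group $\Gamma$ with finite symmetric generating set $S$, the *planar quantization* of $(\Gamma,S)$ is the dual of the universal compact quantum group generated by the entries of an $S\times S$ unitary representation $U$ such that for every $n\ge 1$ the vector $\xi_n\in\ell^2(S^n)$, with $\xi_n(s)=1$ if $s_1\cdots s_n=e$ and $\xi_n(s)=0$ otherwise, is invariant under $U^{\otimes n}$.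 * $H^+(d)$ is the universal compact quantum group generated by the entries of a $d\times d$ unitary representation with self-adjoint entries satisfying $u_{ij}u_{ik}=0=u_{ji}u_{ki}$ for $j\neq k$. * Let $J_{2d}=\begin{pmatrix}0&I_d\\ I_d&0\end{pmatrix}$, a $2d\times 2d$ matrix. $H^+(J_{2d})$ is the universal compact quantum group generated by the entries of a $2d$-dimensional unitary representation $U$ such that $\sum_{i=1}^{2d}e_i\otimes J_{2d}e_i$ and $\sum_{i=1}^{2d}e_i\otimes J_{2d}e_i\otimes e_i\otimes J_{2d}e_i$ are invariant under $U^{\otimes 2}$ and $U^{\otimes 4}$. * A bi-labeled graph of type $(n,m)$ is a finite graph $K$ with tuples $x\in V(K)^n$, $y\in V(K)^m$, taken up to isomorphism. A graph category is a collection of bi-labeled graphs that contains $\mathcal{M}^{1,1}$ and $\mathcal{M}^{2,0}$ and is closed under composition (gluing the $y$-labels of the first to the $x$-labels of the second), tensor product (disjoint union) and transpose (exchanging $x$ and $y$); here $\mathcal{M}^{n,m}$ has one vertex, no edges and all labels equal. The graph category $\mathcal{P}$ of planar bi-labeled graphs is the smallest one containing $\mathcal{M}^{1,0}$, $\mathcal{M}^{1,2}$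 and the graph with two vertices $0,1$, one edge and $x_1=0$, $y_1=1$. * Let $\Pi$ be a connected locally finite graph with vertex set $I$. Let $\mathcal{L}(n,m)$ be the set of connected $(K,x,y)\in\mathcal{P}$ of type $(n+1,m+1)$ with $x_0=y_0$ and $x_n=y_m$. Let $T^{\mathcal{K}}$ be the $I^{n+1}\times I^{m+1}$ matrix whose $(i,j)$ entry is the number of graph homomorphisms $\varphi:K\to\Pi$ with $\varphi(x)=i$, $\varphi(y)=j$, and let $\mathrm{Mor}(n,m)$ be the linear span of the $T^{\mathcal{K}}$, $\mathcal{K}\in\mathcal{L}(n,m)$. The $0$-cells are the classes of the equivalence relation $i\approx j$ iff $T_{ii}=T_{jj}$ for all $T\in\mathrm{Mor}(0,0)$. If there is only one $0$-cell, then $\mathcal{C}(\mathcal{P},\Pi)$ is the unitary tensor category whose objects are the formal finite direct sums of self-adjoint projections $p\in\mathrm{Mor}(n,n)$, $n\ge0$, with morphisms from $q\in\mathrm{Mor}(m,m)$ to $p\in\mathrm{Mor}(n,n)$ given by $p\,\mathrm{Mor}(n,m)\,q$, and with tensor product $(T\otimes S)_{ij}=T_{i_0\cdots i_n,\,j_0\cdots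 j_m}\,S_{i_n\cdots i_{n+n'},\,j_m\cdots j_{m+m'}}$. **Proposition.** Let $d\ge0$ be an integer. 1. The planar quantization of the free group $\mathbb{F}_d$, with generating set $S$ given by the free generators $a_1,\dots,a_d$ and their inverses, is isomorphic with the dual of $H^+(J_{2d})$: there is an isomorphism of Hopf $*$-algebras that maps generating matrix to generating matrix, where the index set $S$ is listed as $a_1,\dots,a_d,a_1^{-1},\dots,a_d^{-1}$. 2. The planar quantization of $(\mathbb{Z}/2\mathbb{Z})^{*d}$, with generating set the $d$ canonical free generators of order $2$, is isomorphic with the dual of $H^+(d)$, by an isomorphism of Hopf $*$-algebras that maps generating matrix to generating matrix. 3. Let $\Pi$ be a $d$-regular tree. Then there is only one $0$-cell, and the unitary tensor category $\mathcal{C}(\mathcal{P},\Pi)$ is equivalent, as a unitary tensor category, with the category of finite-dimensional unitary representations of $H^+(d)$. The equivalence can be chosen to send the orthogonal projection $P_1\in\mathrm{Mor}(1,1)$ onto the paths of length one to (a representation unitarily equivalent with) the fundamental representation $U$. 4. The categories in 3 are described by noncrossing partitions with even blocks: for all $n,m\ge0$, the space of morphisms from $U^{\otimes m}$ to $U^{\otimes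 n}$, where $U$ is the fundamental representation of $H^+(d)$, is the linear span of the matrices $T_\pi$, where $\pi$ runs over the noncrossing partitions of $n$ upper and $m$ lower points all of whose blocks have an even number of points, and where $(T_\pi)_{st}=1$ if the labeling of the upper points by $s$ and of the lower points by $t$ is constant on the blocks of $\pi$, and $(T_\pi)_{st}=0$ otherwise. -/

import Mathlib

open scoped TensorProduct
open CategoryTheory

noncomputable section

namespace PlanarQ

/-! ### Free unital star-algebras on the entries of a square matrix -/

/-- The free unital complex algebra on symbols `u i j` and their formal adjoints; the symbol
`((i, j), false)` stands for `u i j` and `((i, j), true)` for its adjoint. -/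
def FreeStar (X : Type) : Type := FreeAlgebra ℂ ((X × X) × Bool)

namespace FreeStar

variable {X : Type}

instance : Ring (FreeStar X) := inferInstanceAs (Ring (FreeAlgebra ℂ ((X × X) × Bool)))

instance : Algebra ℂ (FreeStar X) :=
  inferInstanceAs (Algebra ℂ (FreeAlgebra ℂ ((X × X) × Bool)))

/-- The free generators together with their formal adjoints. -/
def gen (g : (X × X) × Bool) : FreeStar X := FreeAlgebra.ι ℂ g

/-- The generator `u i j`. -/
def u (i j : X) : FreeStar X := gen ((i, j), false)

theorem induction {C : FreeStar X → Prop} (h1 : ∀ c : ℂ, C (algebraMap ℂ _ c))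
    (h2 : ∀ g, C (gen g)) (h3 : ∀ a b, C a → C b → C (a * b))
    (h4 : ∀ a b, C a → C b → C (a + b)) (a : FreeStar X) : C a :=
  FreeAlgebra.induction ℂ _ (motive := C) h1 h2 h3 h4 a

/-- The opposite algebra with complex conjugate scalar multiplication. -/
def Twist (X : Type) : Type := (FreeStar X)ᵐᵒᵖ

instance : Ring (Twist X) := inferInstanceAs (Ring (FreeStar X)ᵐᵒᵖ)

instance : Algebra ℂ (Twist X) :=
  RingHom.toAlgebra' ((algebraMap ℂ (FreeStar X)ᵐᵒᵖ).comp (starRingEnd ℂ))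
    (fun c x => Algebra.commutes (A := (FreeStar X)ᵐᵒᵖ) (starRingEnd ℂ c) x)

/-- The conjugate linear anti-homomorphism exchanging `u i j` and its formal adjoint. -/
def starAux : FreeStar X →ₐ[ℂ] Twist X :=
  FreeAlgebra.lift ℂ (fun g => (MulOpposite.op (gen (g.1, !g.2)) : (FreeStar X)ᵐᵒᵖ))

/-- Underlying element of the twisted opposite algebra. -/
def Twist.un (a : Twist X) : FreeStar X := MulOpposite.unop (α := FreeStar X) a

theorem un_mul (a b : Twist X) : (a * b).un = b.un * a.un := rfl
theorem un_add (a b : Twist X) : (a + b).un = a.un + b.un := rfl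
theorem un_algebraMap (c : ℂ) :
    (algebraMap ℂ (Twist X) c).un = algebraMap ℂ (FreeStar X) (starRingEnd ℂ c) := rfl
theorem un_starAux_gen (g : (X × X) × Bool) :
    (starAux (gen g)).un = gen (g.1, !g.2) := by
  have : starAux (gen g) = (MulOpposite.op (gen (g.1, !g.2)) : (FreeStar X)ᵐᵒᵖ) :=
    FreeAlgebra.lift_ι_apply _ _
  rw [this]; rfl

instance : StarRing (FreeStar X) where
  star a := (starAux a).un
  star_involutive a := by
    induction a using FreeStar.induction with
    | h1 c => simp only [AlgHom.commutes, un_algebraMap, Complex.conj_conj]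
    | h2 g => simp only [un_starAux_gen, Bool.not_not]
    | h3 a b ha hb => simp only [map_mul, un_mul, ha, hb]
    | h4 a b ha hb => simp only [map_add, un_add, ha, hb]
  star_mul a b := by simp only [map_mul, un_mul]
  star_add a b := by simp only [map_add, un_add]

theorem star_gen (g : (X × X) × Bool) : star (gen g) = gen (g.1, !g.2) := un_starAux_gen g

theorem star_algebraMap (c : ℂ) :
    star (algebraMap ℂ (FreeStar X) c) = algebraMap ℂ (FreeStar X) (star c) := by
  change (starAux _).un = _
  rw [AlgHom.commutes, un_algebraMap]; rfl

instance : StarModule ℂ (FreeStar X) where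
  star_smul c a := by
    rw [Algebra.smul_def, star_mul, star_algebraMap, Algebra.smul_def, Algebra.commutes]

/-- The universal property: the algebra homomorphism with `u i j ↦ f i j` and
`star (u i j) ↦ star (f i j)`. -/
def lift {B : Type*} [Ring B] [StarRing B] [Algebra ℂ B] (f : X → X → B) : FreeStar X →ₐ[ℂ] B :=
  FreeAlgebra.lift ℂ (fun g => if g.2 then star (f g.1.1 g.1.2) else f g.1.1 g.1.2)

section
variable {B : Type*} [Ring B] [StarRing B] [Algebra ℂ B]

theorem lift_gen (f : X → X → B) (g : (X × X) × Bool) :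
    lift f (gen g) = if g.2 then star (f g.1.1 g.1.2) else f g.1.1 g.1.2 :=
  FreeAlgebra.lift_ι_apply _ _

@[simp] theorem lift_u (f : X → X → B) (i j : X) : lift f (u i j) = f i j := by
  simp [u, lift_gen]

theorem lift_star [StarModule ℂ B] (f : X → X → B) (a : FreeStar X) :
    lift f (star a) = star (lift f a) := by
  induction a using FreeStar.induction with
  | h1 c =>
    rw [star_algebraMap, AlgHom.commutes, AlgHom.commutes, algebraMap_star_comm]
  | h2 g => rw [star_gen, lift_gen, lift_gen]; rcases g with ⟨p, _ | _⟩ <;> simp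
  | h3 a b ha hb => simp only [map_mul, star_mul, ha, hb]
  | h4 a b ha hb => simp only [map_add, star_add, ha, hb]

end

end FreeStar

/-! ### Tensor powers of a square matrix with entries in an algebra -/

/-- The `n`-fold tensor power of a square matrix `U` over `A`: the matrix with entries
`U (s 1) (t 1) * ⋯ * U (s n) (t n)`. -/
def tpow {X A : Type*} [Monoid A] (U : X → X → A) (n : ℕ) (s t : Fin n → X) : A :=
  (List.ofFn fun i => U (s i) (t i)).prod

theorem tpow_zero {X A : Type*} [Monoid A] (U : X → X → A) (s t : Fin 0 → X) :
    tpow U 0 s t = 1 := by simp [tpow]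

theorem tpow_succ {X A : Type*} [Monoid A] (U : X → X → A) (n : ℕ) (s t : Fin (n + 1) → X) :
    tpow U (n + 1) s t = U (s 0) (t 0) * tpow U n (Fin.tail s) (Fin.tail t) := by
  simp [tpow, List.ofFn_succ, Fin.tail]

theorem map_tpow {X A B F : Type*} [Monoid A] [Monoid B] [FunLike F A B] [MonoidHomClass F A B]
    (φ : F) (U : X → X → A) (n : ℕ) (s t : Fin n → X) :
    φ (tpow U n s t) = tpow (fun i j => φ (U i j)) n s t := by
  simp [tpow, map_list_prod, List.map_ofFn, Function.comp_def]

theorem tpow_tmul {X A : Type*} [Fintype X] [Ring A] [Algebra ℂ A] (U : X → X → A) (n : ℕ)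
    (s t : Fin n → X) :
    tpow (fun i j => ∑ k, U i k ⊗ₜ[ℂ] U k j) n s t =
      ∑ r : Fin n → X, tpow U n s r ⊗ₜ[ℂ] tpow U n r t := by
  induction n with
  | zero => simp [tpow_zero, Algebra.TensorProduct.one_def]
  | succ n ih =>
    rw [tpow_succ, ih, Finset.sum_mul_sum, ← Fintype.sum_prod_type',
      ← (Fin.consEquiv (fun _ => X)).sum_comp]
    refine Finset.sum_congr rfl fun p _ => ?_
    rw [tpow_succ, tpow_succ, Algebra.TensorProduct.tmul_mul_tmul]
    simp [Fin.consEquiv]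

/-! ### Compact quantum groups given by generators and relations -/

section Universal

variable {X : Type} [Fintype X] [DecidableEq X]

/-- The relations saying that `U = (u i j)` is unitary and that the elements of `R` vanish
(together with the adjoints of these relations). -/
inductive Rel (R : Set (FreeStar X)) : FreeStar X → FreeStar X → Prop
  | unitary_left (i j : X) :
      Rel R (∑ k, FreeStar.u i k * star (FreeStar.u j k)) (if i = j then 1 else 0)
  | unitary_right (i j : X) :
      Rel R (∑ k, star (FreeStar.u k i) * FreeStar.u k j) (if i = j then 1 else 0)
  | of_mem (r : FreeStar X) (hr : r ∈ R) : Rel R r 0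
  | adj (a b : FreeStar X) (h : Rel R a b) : Rel R (star a) (star b)

/-- The universal unital star-algebra generated by the entries of a unitary matrix satisfying the
relations `R`. -/
def UnivAlg (R : Set (FreeStar X)) : Type := RingQuot (Rel R)

namespace UnivAlg

variable (R : Set (FreeStar X))

instance : Ring (UnivAlg R) := inferInstanceAs (Ring (RingQuot (Rel R)))
instance : Algebra ℂ (UnivAlg R) := inferInstanceAs (Algebra ℂ (RingQuot (Rel R)))
instance : StarRing (UnivAlg R) := RingQuot.starRing (Rel R) (fun a b h => Rel.adj a b h)

/-- The quotient map. -/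
def mk : FreeStar X →ₐ[ℂ] UnivAlg R := RingQuot.mkAlgHom ℂ (Rel R)

theorem mk_surjective : Function.Surjective (mk R) := RingQuot.mkAlgHom_surjective ℂ (Rel R)

theorem mk_star (a : FreeStar X) : mk R (star a) = star (mk R a) := by
  have h : ∀ b : FreeStar X, mk R b = (⟨Quot.mk _ b⟩ : RingQuot (Rel R)) := fun b => by
    simp [mk, RingQuot.mkAlgHom_def, RingQuot.mkRingHom_def]
    rfl
  rw [h, h]
  rfl

instance : StarModule ℂ (UnivAlg R) where
  star_smul c a := by
    obtain ⟨a, rfl⟩ := mk_surjective R a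
    rw [← map_smul, ← mk_star, star_smul, map_smul, mk_star]

/-- The generating matrix. -/
def u (i j : X) : UnivAlg R := mk R (FreeStar.u i j)

variable {R}

theorem sum_left (i j : X) : ∑ k, u R i k * star (u R j k) = if i = j then 1 else 0 := by
  have h := RingQuot.mkAlgHom_rel ℂ (Rel.unitary_left (R := R) i j)
  change mk R _ = mk R _ at h
  rw [map_sum] at h
  simp only [map_mul, mk_star] at h
  refine h.trans ?_
  split <;> simp

theorem sum_right (i j : X) : ∑ k, star (u R k i) * u R k j = if i = j then 1 else 0 := by
  have h := RingQuot.mkAlgHom_rel ℂ (Rel.unitary_right (R := R) i j)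
  change mk R _ = mk R _ at h
  rw [map_sum] at h
  simp only [map_mul, mk_star] at h
  refine h.trans ?_
  split <;> simp

theorem mk_rel {r : FreeStar X} (hr : r ∈ R) : mk R r = 0 := by
  have h := RingQuot.mkAlgHom_rel ℂ (Rel.of_mem (R := R) r hr)
  change mk R _ = mk R _ at h
  rw [h, map_zero]

theorem lift_u_eq : FreeStar.lift (u R) = mk R := by
  apply FreeAlgebra.hom_ext
  funext g
  change FreeStar.lift (u R) (FreeStar.gen g) = mk R (FreeStar.gen g)
  rw [FreeStar.lift_gen]
  rcases g with ⟨⟨i, j⟩, _ | _⟩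
  · rfl
  · simp only [if_true]
    rw [u, ← mk_star, FreeStar.u, FreeStar.star_gen]; rfl

/-- The universal property of `UnivAlg R`. -/
def lift {B : Type*} [Ring B] [StarRing B] [Algebra ℂ B] [StarModule ℂ B] (f : X → X → B)
    (hl : ∀ i j, ∑ k, f i k * star (f j k) = if i = j then 1 else 0)
    (hr : ∀ i j, ∑ k, star (f k i) * f k j = if i = j then 1 else 0)
    (hR : ∀ r ∈ R, FreeStar.lift f r = 0) : UnivAlg R →ₐ[ℂ] B :=
  RingQuot.liftAlgHom ℂ ⟨FreeStar.lift f, fun a b h => by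
    induction h with
    | unitary_left i j =>
      rw [map_sum]; simp only [map_mul, FreeStar.lift_star, FreeStar.lift_u, hl]
      split <;> simp
    | unitary_right i j =>
      rw [map_sum]; simp only [map_mul, FreeStar.lift_star, FreeStar.lift_u, hr]
      split <;> simp
    | of_mem r h => rw [hR r h, map_zero]
    | adj a b _ ih => rw [FreeStar.lift_star, FreeStar.lift_star, ih]⟩

section
variable {B : Type*} [Ring B] [StarRing B] [Algebra ℂ B] [StarModule ℂ B] (f : X → X → B)
    (hl : ∀ i j, ∑ k, f i k * star (f j k) = if i = j then 1 else 0)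
    (hr : ∀ i j, ∑ k, star (f k i) * f k j = if i = j then 1 else 0)
    (hR : ∀ r ∈ R, FreeStar.lift f r = 0)

theorem lift_mk (a : FreeStar X) : lift f hl hr hR (mk R a) = FreeStar.lift f a :=
  RingQuot.liftAlgHom_mkAlgHom_apply _ _ _ _

theorem lift_u (i j : X) : lift f hl hr hR (u R i j) = f i j := by
  rw [u, lift_mk, FreeStar.lift_u]

theorem lift_star (a : UnivAlg R) : lift f hl hr hR (star a) = star (lift f hl hr hR a) := by
  obtain ⟨a, rfl⟩ := mk_surjective R a
  rw [← mk_star, lift_mk, lift_mk, FreeStar.lift_star]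

end

/-- Star-preserving algebra homomorphisms agreeing on the generators are equal. -/
theorem hom_ext {B : Type*} [Ring B] [StarRing B] [Algebra ℂ B] {φ ψ : UnivAlg R →ₐ[ℂ] B}
    (hφ : ∀ a, φ (star a) = star (φ a)) (hψ : ∀ a, ψ (star a) = star (ψ a))
    (h : ∀ i j, φ (u R i j) = ψ (u R i j)) : φ = ψ := by
  have key : φ.comp (mk R) = ψ.comp (mk R) := by
    apply FreeAlgebra.hom_ext
    funext g
    change φ (mk R (FreeStar.gen g)) = ψ (mk R (FreeStar.gen g))
    rcases g with ⟨⟨i, j⟩, _ | _⟩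
    · exact h i j
    · have : mk R (FreeStar.gen ((i, j), true)) = star (u R i j) := by
        rw [u, ← mk_star, FreeStar.u, FreeStar.star_gen]; rfl
      rw [this, hφ, hψ, h]
  ext a
  obtain ⟨a, rfl⟩ := mk_surjective R a
  exact DFunLike.congr_fun key a

end UnivAlg

/-- A presentation of a compact (matrix) quantum group: relations between the entries of a
universal unitary matrix that are compatible with `Δ (u i j) = ∑ k, u i k ⊗ u k j` and
`ε (u i j) = δ i j`. -/
structure Presentation (X : Type) [Fintype X] [DecidableEq X] where
  /-- the elements set equal to zero -/
  rels : Set (FreeStar X)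
  comul_rels : ∀ r ∈ rels, FreeStar.lift
    (fun i j => ∑ k, UnivAlg.u rels i k ⊗ₜ[ℂ] UnivAlg.u rels k j) r = 0
  counit_rels : ∀ r ∈ rels, FreeStar.lift (fun i j => if i = j then (1 : ℂ) else 0) r = 0

/-- The algebra `𝒪(𝔾)` of the compact quantum group `𝔾` with presentation `P`: the universal
unital star-algebra generated by the entries of a unitary representation satisfying the given
relations. -/
abbrev Presentation.O (P : Presentation X) : Type := UnivAlg P.rels

namespace Presentation

variable (P : Presentation X)

/-- The fundamental unitary representation. -/
abbrev u (i j : X) : P.O := UnivAlg.u P.rels i j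

theorem comul_unitary_left (i j : X) :
    ∑ k, (∑ l, P.u i l ⊗ₜ[ℂ] P.u l k) * star (∑ l, P.u j l ⊗ₜ[ℂ] P.u l k) =
      if i = j then 1 else 0 := by
  simp only [star_sum, TensorProduct.star_tmul, Finset.sum_mul_sum,
    Algebra.TensorProduct.tmul_mul_tmul]
  rw [Finset.sum_comm]
  have : ∀ l, ∑ k, ∑ m, (P.u i l * star (P.u j m)) ⊗ₜ[ℂ] (P.u l k * star (P.u m k)) =
      (P.u i l * star (P.u j l)) ⊗ₜ[ℂ] (1 : P.O) := fun l => by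
    rw [Finset.sum_comm]
    simp only [← TensorProduct.tmul_sum, UnivAlg.sum_left]
    simp [TensorProduct.tmul_ite, Finset.sum_ite_eq]
  simp only [this, ← TensorProduct.sum_tmul, UnivAlg.sum_left]
  split <;> simp [Algebra.TensorProduct.one_def]

theorem comul_unitary_right (i j : X) :
    ∑ k, star (∑ l, P.u k l ⊗ₜ[ℂ] P.u l i) * (∑ l, P.u k l ⊗ₜ[ℂ] P.u l j) =
      if i = j then 1 else 0 := by
  simp only [star_sum, TensorProduct.star_tmul, Finset.sum_mul_sum,
    Algebra.TensorProduct.tmul_mul_tmul]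
  rw [Finset.sum_comm]
  have : ∀ l, ∑ k, ∑ m, (star (P.u k l) * P.u k m) ⊗ₜ[ℂ] (star (P.u l i) * P.u m j) =
      (1 : P.O) ⊗ₜ[ℂ] (star (P.u l i) * P.u l j) := fun l => by
    rw [Finset.sum_comm]
    simp only [← TensorProduct.sum_tmul, UnivAlg.sum_right]
    simp [TensorProduct.ite_tmul, Finset.sum_ite_eq]
  simp only [this, ← TensorProduct.tmul_sum, UnivAlg.sum_right]
  split <;> simp [Algebra.TensorProduct.one_def]

/-- The comultiplication `Δ (u i j) = ∑ k, u i k ⊗ u k j`. -/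
def comulHom : P.O →ₐ[ℂ] P.O ⊗[ℂ] P.O :=
  UnivAlg.lift (fun i j => ∑ k, P.u i k ⊗ₜ[ℂ] P.u k j) P.comul_unitary_left
    P.comul_unitary_right P.comul_rels

/-- The counit `ε (u i j) = δ i j`. -/
def counitHom : P.O →ₐ[ℂ] ℂ :=
  UnivAlg.lift (fun i j => if i = j then (1 : ℂ) else 0)
    (fun i j => by simp [apply_ite star])
    (fun i j => by simpa [apply_ite star] using if_congr eq_comm rfl rfl)
    P.counit_rels

theorem comulHom_u (i j : X) : P.comulHom (P.u i j) = ∑ k, P.u i k ⊗ₜ[ℂ] P.u k j :=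
  UnivAlg.lift_u _ _ _ _ _ _

theorem counitHom_u (i j : X) : P.counitHom (P.u i j) = if i = j then 1 else 0 :=
  UnivAlg.lift_u _ _ _ _ _ _

theorem comulHom_star (a : P.O) : P.comulHom (star a) = star (P.comulHom a) :=
  UnivAlg.lift_star _ _ _ _ _

theorem counitHom_star (a : P.O) : P.counitHom (star a) = star (P.counitHom a) :=
  UnivAlg.lift_star _ _ _ _ _

theorem map_star {A B C D : Type*} [Ring A] [Ring B] [Ring C] [Ring D] [StarRing A] [StarRing B]
    [StarRing C] [StarRing D] [Algebra ℂ A] [Algebra ℂ B] [Algebra ℂ C] [Algebra ℂ D]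
    [StarModule ℂ A] [StarModule ℂ B] [StarModule ℂ C] [StarModule ℂ D]
    (f : A →ₐ[ℂ] C) (g : B →ₐ[ℂ] D) (hf : ∀ a, f (star a) = star (f a))
    (hg : ∀ a, g (star a) = star (g a)) (x : A ⊗[ℂ] B) :
    Algebra.TensorProduct.map f g (star x) = star (Algebra.TensorProduct.map f g x) := by
  induction x with
  | zero => simp
  | tmul a b => simp [TensorProduct.star_tmul, hf, hg]
  | add a b ha hb => simp [star_add, ha, hb]

instance : Bialgebra ℂ P.O :=
  Bialgebra.ofAlgHom P.comulHom P.counitHom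
    (by
      apply UnivAlg.hom_ext
      · intro a
        simp only [AlgHom.comp_apply, comulHom_star]
        rw [map_star _ _ P.comulHom_star (fun _ => rfl)]
        generalize Algebra.TensorProduct.map P.comulHom (AlgHom.id ℂ P.O) (P.comulHom a) = x
        induction x with
        | zero => simp
        | tmul x c =>
          induction x with
          | zero => simp
          | tmul a b => simp [TensorProduct.star_tmul]
          | add a b ha hb => simp only [TensorProduct.add_tmul, star_add, map_add, ha, hb]
        | add a b ha hb => simp only [star_add, map_add, ha, hb]
      · intro a
        simp only [AlgHom.comp_apply, comulHom_star]
        rw [map_star _ _ (fun _ => rfl) P.comulHom_star]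
      · intro i j
        simp only [AlgHom.comp_apply, comulHom_u, map_sum, Algebra.TensorProduct.map_tmul,
          AlgHom.id_apply, TensorProduct.sum_tmul, TensorProduct.tmul_sum]
        rw [Finset.sum_comm]
        simp)
    (by
      apply UnivAlg.hom_ext
      · intro a
        simp only [AlgHom.comp_apply, comulHom_star]
        rw [map_star _ _ P.counitHom_star (fun _ => rfl)]
      · intro a
        simp [TensorProduct.star_tmul]
      · intro i j
        simp [comulHom_u, counitHom_u, TensorProduct.ite_tmul])
    (by
      apply UnivAlg.hom_ext
      · intro a
        simp only [AlgHom.comp_apply, comulHom_star]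
        rw [map_star _ _ (fun _ => rfl) P.counitHom_star]
      · intro a
        simp [TensorProduct.star_tmul]
      · intro i j
        simp [comulHom_u, counitHom_u, TensorProduct.tmul_ite])

theorem comul_u (i j : X) :
    Coalgebra.comul (R := ℂ) (P.u i j) = ∑ k, P.u i k ⊗ₜ[ℂ] P.u k j := P.comulHom_u i j

end Presentation

/-! ### Invariant vectors -/

/-- The relations saying that the vector `ξ` is invariant under the `n`-fold tensor power of the
matrix `U` with entries `u i j`: `∑ t, ξ t • u (k 1) (t 1) ⋯ u (k n) (t n) = ξ k • 1` for all
`k`. -/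
def invRels {n : ℕ} (ξ : (Fin n → X) → ℂ) : Set (FreeStar X) :=
  Set.range fun k => (∑ t, ξ t • tpow FreeStar.u n k t) - ξ k • 1

theorem invRels_comul {R : Set (FreeStar X)} {n : ℕ} {ξ : (Fin n → X) → ℂ} (hξ : invRels ξ ⊆ R)
    (r : FreeStar X) (hr : r ∈ invRels ξ) :
    FreeStar.lift (fun i j => ∑ k, UnivAlg.u R i k ⊗ₜ[ℂ] UnivAlg.u R k j) r = 0 := by
  have key : ∀ k, ∑ t, ξ t • tpow (UnivAlg.u R) n k t = ξ k • 1 := fun k => by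
    have h := UnivAlg.mk_rel (hξ ⟨k, rfl⟩)
    simp only [map_sub, map_sum, map_smul, map_one, map_tpow] at h
    exact sub_eq_zero.1 h
  obtain ⟨k, rfl⟩ := hr
  simp only [map_sub, map_sum, map_smul, map_one, map_tpow, FreeStar.lift_u, tpow_tmul,
    Finset.smul_sum]
  rw [Finset.sum_comm]
  simp only [← TensorProduct.tmul_smul, ← TensorProduct.tmul_sum, key]
  have h : ∀ x : Fin n → X, tpow (UnivAlg.u R) n k x ⊗ₜ[ℂ] (ξ x • (1 : UnivAlg R)) =
      (ξ x • tpow (UnivAlg.u R) n k x) ⊗ₜ[ℂ] (1 : UnivAlg R) := fun x => by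
    rw [TensorProduct.tmul_smul, TensorProduct.smul_tmul']
  simp only [h, ← TensorProduct.sum_tmul, key]
  rw [Algebra.TensorProduct.one_def, TensorProduct.smul_tmul', sub_self]

theorem tpow_one {X : Type} [DecidableEq X] {A : Type*} [CommRing A] {n : ℕ} (s t : Fin n → X) :
    tpow (fun i j => if i = j then (1 : A) else 0) n s t = if s = t then 1 else 0 := by
  simp only [tpow, List.prod_ofFn, Finset.prod_ite_zero, Finset.prod_const_one]
  simp [funext_iff]

theorem invRels_counit {n : ℕ} {ξ : (Fin n → X) → ℂ} (r : FreeStar X) (hr : r ∈ invRels ξ) :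
    FreeStar.lift (fun i j => if i = j then (1 : ℂ) else 0) r = 0 := by
  obtain ⟨k, rfl⟩ := hr
  simp [map_tpow, tpow_one]

/-- The universal compact quantum group generated by the entries of an `X × X` unitary
representation `U` such that each vector of the family `ξ` is invariant under the corresponding
tensor power of `U`. -/
def invPresentation {J : Type} (n : J → ℕ) (ξ : ∀ a, (Fin (n a) → X) → ℂ) : Presentation X where
  rels := ⋃ a, invRels (ξ a)
  comul_rels r hr := by
    obtain ⟨a, ha⟩ := Set.mem_iUnion.1 hr
    exact invRels_comul (Set.subset_iUnion (fun a => invRels (ξ a)) a) r ha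
  counit_rels r hr := by
    obtain ⟨a, ha⟩ := Set.mem_iUnion.1 hr
    exact invRels_counit r ha

end Universal

/-! ### Planar quantizations -/

/-- The vector `ξ n` with value `1` at those `n`-tuples of elements of `S` whose product
is the identity and value `0` elsewhere. -/
def cycleVector {Γ : Type} [Group Γ] [DecidableEq Γ] (S : Finset Γ) (n : ℕ) (t : Fin n → S) : ℂ :=
  if (List.ofFn fun i => (t i : Γ)).prod = 1 then 1 else 0

/-- The compact quantum group whose dual is the planar quantization of `(Γ, S)`, where `S` is a
finite symmetric generating set of the group `Γ`: it is universal for the property that, for every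
`n ≥ 1`, the vector `ξ n` is invariant under the `n`-fold tensor power of the `S × S` unitary
representation `U`. -/
def planarQuantization {Γ : Type} [Group Γ] [DecidableEq Γ] (S : Finset Γ) : Presentation S :=
  invPresentation (J := {n : ℕ // 1 ≤ n}) (fun n => n.1) (fun n => cycleVector S n.1)

/-- The free generators of the free group and their inverses. -/
def freeGen (d : ℕ) : Fin d ⊕ Fin d → FreeGroup (Fin d)
  | .inl i => FreeGroup.of i
  | .inr i => (FreeGroup.of i)⁻¹

/-- The canonical symmetric generating set of the free group. -/
def freeGens (d : ℕ) : Finset (FreeGroup (Fin d)) := Finset.univ.image (freeGen d)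

/-- The generators as elements of the canonical generating set. -/
def freeGenMem (d : ℕ) (s : Fin d ⊕ Fin d) : freeGens d :=
  ⟨freeGen d s, Finset.mem_image_of_mem _ (Finset.mem_univ s)⟩

/-- The free product of `d` copies of `ℤ / 2ℤ`. -/
abbrev Z2Free (d : ℕ) : Type := Monoid.CoprodI fun _ : Fin d => Multiplicative (ZMod 2)

instance (d : ℕ) : DecidableEq (Z2Free d) := Classical.decEq _

/-- The canonical free generators of order two. -/
def z2Gen (d : ℕ) (i : Fin d) : Z2Free d := Monoid.CoprodI.of (i := i) (Multiplicative.ofAdd 1)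

/-- The canonical symmetric generating set of the free product of `d` copies of `ℤ / 2ℤ`. -/
def z2Gens (d : ℕ) : Finset (Z2Free d) := Finset.univ.image (z2Gen d)

/-- The generators as elements of the canonical generating set. -/
def z2GenMem (d : ℕ) (i : Fin d) : z2Gens d :=
  ⟨z2Gen d i, Finset.mem_image_of_mem _ (Finset.mem_univ i)⟩

/-! ### Hyperoctahedral quantum groups -/

/-- The defining relations of the hyperoctahedral quantum group: the entries of `U` are
self-adjoint, and distinct entries in the same row or column have product zero. -/
inductive HyperRel (d : ℕ) : FreeStar (Fin d) → Prop
  | selfAdjoint (i j : Fin d) : HyperRel d (FreeStar.u i j - star (FreeStar.u i j))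
  | row (i j k : Fin d) (h : j ≠ k) : HyperRel d (FreeStar.u i j * FreeStar.u i k)
  | col (i j k : Fin d) (h : j ≠ k) : HyperRel d (FreeStar.u j i * FreeStar.u k i)

/-- The hyperoctahedral quantum group `H⁺(d)`. -/
def hyperoctahedral (d : ℕ) : Presentation (Fin d) where
  rels := {r | HyperRel d r}
  comul_rels r hr := by
    have hs : ∀ i j, star (UnivAlg.u {r | HyperRel d r} i j) = UnivAlg.u {r | HyperRel d r} i j :=
      fun i j => by
        have h := UnivAlg.mk_rel (R := {r | HyperRel d r}) (HyperRel.selfAdjoint i j)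
        rw [map_sub, UnivAlg.mk_star] at h
        exact (sub_eq_zero.1 h).symm
    have h0 : ∀ i j k, j ≠ k →
        UnivAlg.u {r | HyperRel d r} i j * UnivAlg.u {r | HyperRel d r} i k = 0 :=
      fun i j k hjk => by
        have h := UnivAlg.mk_rel (R := {r | HyperRel d r}) (HyperRel.row i j k hjk)
        rwa [map_mul] at h
    have h1 : ∀ i j k, j ≠ k →
        UnivAlg.u {r | HyperRel d r} j i * UnivAlg.u {r | HyperRel d r} k i = 0 :=
      fun i j k hjk => by
        have h := UnivAlg.mk_rel (R := {r | HyperRel d r}) (HyperRel.col i j k hjk)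
        rwa [map_mul] at h
    cases hr with
    | selfAdjoint i j =>
      simp only [map_sub, FreeStar.lift_star, FreeStar.lift_u, star_sum, TensorProduct.star_tmul,
        hs, sub_self]
    | row i j k hjk =>
      simp only [map_mul, FreeStar.lift_u, Finset.sum_mul_sum, Algebra.TensorProduct.tmul_mul_tmul]
      refine Finset.sum_eq_zero fun a _ => Finset.sum_eq_zero fun b _ => ?_
      by_cases hab : a = b
      · rw [hab, h0 b j k hjk, TensorProduct.tmul_zero]
      · rw [h0 i a b hab, TensorProduct.zero_tmul]
    | col i j k hjk =>
      simp only [map_mul, FreeStar.lift_u, Finset.sum_mul_sum, Algebra.TensorProduct.tmul_mul_tmul]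
      refine Finset.sum_eq_zero fun a _ => Finset.sum_eq_zero fun b _ => ?_
      by_cases hab : a = b
      · rw [hab, h1 b j k hjk, TensorProduct.zero_tmul]
      · rw [h1 i a b hab, TensorProduct.tmul_zero]
  counit_rels r hr := by
    cases hr with
    | selfAdjoint i j =>
      simp [FreeStar.lift_star, apply_ite star]
    | row i j k hjk =>
      simp only [map_mul, FreeStar.lift_u]
      split_ifs <;> simp_all
    | col i j k hjk =>
      simp only [map_mul, FreeStar.lift_u]
      split_ifs <;> simp_all

/-- The block matrix `J` of size `2 d` with identity blocks off the diagonal. -/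
def matJ (d : ℕ) : Matrix (Fin d ⊕ Fin d) (Fin d ⊕ Fin d) ℂ := Matrix.fromBlocks 0 1 1 0

/-- The canonical basis vectors. -/
def basisVec {X : Type} [DecidableEq X] (i : X) : X → ℂ := Pi.single i 1

/-- The vector `∑ i, e i ⊗ J (e i)`. -/
def twoVector (d : ℕ) (t : Fin 2 → Fin d ⊕ Fin d) : ℂ :=
  ∑ i, basisVec i (t 0) * (matJ d).mulVec (basisVec i) (t 1)

/-- The vector `∑ i, e i ⊗ J (e i) ⊗ e i ⊗ J (e i)`. -/
def fourVector (d : ℕ) (t : Fin 4 → Fin d ⊕ Fin d) : ℂ :=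
  ∑ i, basisVec i (t 0) * (matJ d).mulVec (basisVec i) (t 1) *
    basisVec i (t 2) * (matJ d).mulVec (basisVec i) (t 3)

/-- The twisted hyperoctahedral quantum group: the universal compact quantum group generated by the
entries of a `2 d`-dimensional unitary representation for which the two vectors above are
invariant. -/
def twistedHyperoctahedral (d : ℕ) : Presentation (Fin d ⊕ Fin d) :=
  invPresentation (J := Bool) (fun b => cond b 4 2)
    (fun b => match b with
      | false => twoVector d
      | true => fourVector d)

/-! ### The unitary tensor category of finite-dimensional unitary representations -/

/-- A finite-dimensional unitary representation of the compact quantum group with polynomial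
algebra `A`, in matrix form: a unitary matrix `U` over `A` with
`Δ (U i j) = ∑ k, U i k ⊗ U k j`. -/
structure URep (A : Type) [Ring A] [StarRing A] [Bialgebra ℂ A] where
  /-- index set of an orthonormal basis of the underlying Hilbert space -/
  ι : Type
  [fin : Fintype ι]
  [dec : DecidableEq ι]
  U : ι → ι → A
  unitary_left : ∀ i j, ∑ k, U i k * star (U j k) = if i = j then 1 else 0
  unitary_right : ∀ i j, ∑ k, star (U k i) * U k j = if i = j then 1 else 0
  comul_U : ∀ i j, Coalgebra.comul (R := ℂ) (U i j) = ∑ k, U i k ⊗ₜ[ℂ] U k j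

attribute [instance] URep.fin URep.dec

/-- The intertwiners between two matrices over `A`: the scalar matrices `T` with
`(T ⊗ 1) U = V (T ⊗ 1)`. -/
def intertwiners {A ι κ : Type} [Ring A] [Algebra ℂ A] [Fintype ι] [Fintype κ]
    (U : ι → ι → A) (V : κ → κ → A) : Submodule ℂ (Matrix κ ι ℂ) where
  carrier := {T | ∀ k i, ∑ j, T k j • U j i = ∑ l, T l i • V k l}
  zero_mem' := by simp
  add_mem' {S T} hS hT k i := by
    simp only [Matrix.add_apply, add_smul, Finset.sum_add_distrib, hS k i, hT k i]
  smul_mem' c T hT k i := by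
    simp only [Matrix.smul_apply, smul_assoc, ← Finset.smul_sum, hT k i]

section Intertwiners

variable {A : Type} [Ring A] [Algebra ℂ A]

theorem intertwiners_one {ι : Type} [Fintype ι] [DecidableEq ι] (U : ι → ι → A) :
    (1 : Matrix ι ι ℂ) ∈ intertwiners U U := fun k i => by
  simp [Matrix.one_apply, ite_smul]

theorem intertwiners_mul {ι κ μ : Type} [Fintype ι] [Fintype κ] [Fintype μ] {U : ι → ι → A}
    {V : κ → κ → A} {W : μ → μ → A} {S : Matrix μ κ ℂ} {T : Matrix κ ι ℂ}
    (hS : S ∈ intertwiners V W) (hT : T ∈ intertwiners U V) : S * T ∈ intertwiners U W :=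
  fun m i => by
    simp only [Matrix.mul_apply, Finset.sum_smul, mul_smul]
    rw [Finset.sum_comm]
    simp only [← Finset.smul_sum, hT _ i]
    simp only [Finset.smul_sum]
    rw [Finset.sum_comm]
    have : ∀ k, ∑ l, S m l • T k i • V l k = T k i • ∑ l, S l k • W m l := fun k => by
      rw [← hS m k, Finset.smul_sum]
      exact Finset.sum_congr rfl fun l _ => smul_comm _ _ _
    simp only [this, Finset.smul_sum]
    rw [Finset.sum_comm]
    refine Finset.sum_congr rfl fun k _ => Finset.sum_congr rfl fun l _ => smul_comm _ _ _

theorem intertwiners_kron {ι ι' κ κ' : Type} [Fintype ι] [Fintype κ] [Fintype ι'] [Fintype κ']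
    {U : ι → ι → A} {V : κ → κ → A} {U' : ι' → ι' → A} {V' : κ' → κ' → A} {S : Matrix κ ι ℂ}
    {T : Matrix κ' ι' ℂ} (hS : S ∈ intertwiners U V) (hT : T ∈ intertwiners U' V') :
    S.kronecker T ∈ intertwiners (fun p q : ι × ι' => U p.1 q.1 * U' p.2 q.2)
      (fun p q : κ × κ' => V p.1 q.1 * V' p.2 q.2) := fun k i => by
  simp only [Matrix.kronecker, Matrix.kroneckerMap_apply, Fintype.sum_prod_type]
  have h1 := hS k.1 i.1
  have h2 := hT k.2 i.2
  calc _ = (∑ j, S k.1 j • U j i.1) * ∑ j, T k.2 j • U' j i.2 := by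
        simp only [Finset.sum_mul_sum, smul_mul_smul_comm]
    _ = _ := by
        rw [h1, h2]; simp only [Finset.sum_mul_sum, smul_mul_smul_comm]

/-- The matrix of a bijection between bases. -/
def permMat {ι κ : Type} [DecidableEq κ] (e : ι ≃ κ) : Matrix κ ι ℂ :=
  fun k i => if k = e i then 1 else 0

theorem intertwiners_perm {ι κ : Type} [Fintype ι] [Fintype κ] [DecidableEq ι] [DecidableEq κ]
    {U : ι → ι → A} {V : κ → κ → A} (e : ι ≃ κ) (h : ∀ i j, U i j = V (e i) (e j)) :
    permMat e ∈ intertwiners U V := fun k i => by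
  obtain ⟨k, rfl⟩ := e.surjective k
  simp [permMat, ite_smul, h]

theorem permMat_mul {ι κ μ : Type} [Fintype κ] [DecidableEq κ] [DecidableEq μ] (e : κ ≃ μ)
    (T : Matrix κ ι ℂ) : permMat e * T = fun m i => T (e.symm m) i := by
  funext m i
  have : ∀ k, (m = e k) = (e.symm m = k) := fun k => propext (by
    rw [Equiv.symm_apply_eq])
  simp [Matrix.mul_apply, permMat, this]

theorem mul_permMat {ι κ μ : Type} [Fintype κ] [DecidableEq κ] (e : ι ≃ κ)
    (T : Matrix μ κ ℂ) : T * permMat e = fun m i => T m (e i) := by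
  funext m i
  simp [Matrix.mul_apply, permMat]

theorem permMat_pentagon {ι κ μ ν : Type} [Fintype ι] [Fintype κ] [Fintype μ] [Fintype ν]
    [DecidableEq ι] [DecidableEq κ] [DecidableEq μ] [DecidableEq ν] :
    ((1 : Matrix ι ι ℂ).kronecker (permMat (Equiv.prodAssoc κ μ ν)) *
      permMat (Equiv.prodAssoc ι (κ × μ) ν)) *
        (permMat (Equiv.prodAssoc ι κ μ)).kronecker (1 : Matrix ν ν ℂ) =
    permMat (Equiv.prodAssoc ι κ (μ × ν)) * permMat (Equiv.prodAssoc (ι × κ) μ ν) := by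
  have h1 : (1 : Matrix ι ι ℂ).kronecker (permMat (Equiv.prodAssoc κ μ ν)) =
      permMat ((Equiv.refl ι).prodCongr (Equiv.prodAssoc κ μ ν)) := by
    funext i j
    simp [Matrix.kronecker, permMat, Matrix.one_apply, Prod.ext_iff, ← ite_and, and_comm]
  have h2 : (permMat (Equiv.prodAssoc ι κ μ)).kronecker (1 : Matrix ν ν ℂ) =
      permMat ((Equiv.prodAssoc ι κ μ).prodCongr (Equiv.refl ν)) := by
    funext i j
    simp [Matrix.kronecker, permMat, Matrix.one_apply, Prod.ext_iff, ← ite_and, and_comm]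
  rw [h1, h2, mul_permMat, mul_permMat, mul_permMat]
  rfl

end Intertwiners

namespace URep

variable {A : Type} [Ring A] [StarRing A] [Bialgebra ℂ A]

/-- Morphisms of representations are intertwiners, composed as matrices. -/
instance : Category (URep A) where
  Hom X Y := intertwiners X.U Y.U
  id X := ⟨1, intertwiners_one X.U⟩
  comp f g := ⟨g.1 * f.1, intertwiners_mul g.2 f.2⟩
  id_comp _ := Subtype.ext (Matrix.mul_one _)
  comp_id _ := Subtype.ext (Matrix.one_mul _)
  assoc _ _ _ := Subtype.ext (Matrix.mul_assoc _ _ _).symm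

/-- The matrix of a morphism. -/
def mat {X Y : URep A} (f : X ⟶ Y) : Matrix Y.ι X.ι ℂ := f.1

theorem hom_ext {X Y : URep A} {f g : X ⟶ Y} (h : mat f = mat g) : f = g := Subtype.ext h

theorem mat_comp {X Y Z : URep A} (f : X ⟶ Y) (g : Y ⟶ Z) : mat (f ≫ g) = mat g * mat f := rfl

theorem mat_id (X : URep A) : mat (𝟙 X) = 1 := rfl

instance : Preadditive (URep A) where
  homGroup X Y := inferInstanceAs (AddCommGroup (intertwiners X.U Y.U))
  add_comp _ _ _ f f' g := Subtype.ext (Matrix.mul_add g.1 f.1 f'.1)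
  comp_add _ _ _ f g g' := Subtype.ext (Matrix.add_mul g.1 g'.1 f.1)

instance : Linear ℂ (URep A) where
  homModule X Y := inferInstanceAs (Module ℂ (intertwiners X.U Y.U))
  smul_comp _ _ _ r f g := Subtype.ext (Matrix.mul_smul g.1 r f.1)
  comp_smul _ _ _ f r g := Subtype.ext (Matrix.smul_mul r g.1 f.1)

/-- The morphisms `f` and `g` are each other's adjoint. -/
def IsAdj {X Y : URep A} (f : X ⟶ Y) (g : Y ⟶ X) : Prop := mat g = (mat f).conjTranspose

/-- The tensor product of representations. -/
def tensor (X Y : URep A) : URep A where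
  ι := X.ι × Y.ι
  U p q := X.U p.1 q.1 * Y.U p.2 q.2
  unitary_left p q := by
    simp only [star_mul, Fintype.sum_prod_type]
    have : ∀ k, ∑ l, X.U p.1 k * Y.U p.2 l * (star (Y.U q.2 l) * star (X.U q.1 k)) =
        X.U p.1 k * (∑ l, Y.U p.2 l * star (Y.U q.2 l)) * star (X.U q.1 k) := fun k => by
      simp only [Finset.mul_sum, Finset.sum_mul, mul_assoc]
    simp only [this, Y.unitary_left]
    by_cases h : p.2 = q.2
    · simp [h, X.unitary_left, Prod.ext_iff]
    · simp [h, Prod.ext_iff]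
  unitary_right p q := by
    simp only [star_mul, Fintype.sum_prod_type]
    rw [Finset.sum_comm]
    have : ∀ l, ∑ k, star (Y.U l p.2) * star (X.U k p.1) * (X.U k q.1 * Y.U l q.2) =
        star (Y.U l p.2) * (∑ k, star (X.U k p.1) * X.U k q.1) * Y.U l q.2 := fun k => by
      simp only [Finset.mul_sum, Finset.sum_mul, mul_assoc]
    simp only [this, X.unitary_right]
    by_cases h : p.1 = q.1
    · simp [h, Y.unitary_right, Prod.ext_iff]
    · simp [h, Prod.ext_iff]
  comul_U p q := by
    simp only [Bialgebra.comul_mul, X.comul_U, Y.comul_U, Finset.sum_mul_sum,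
      Algebra.TensorProduct.tmul_mul_tmul, Fintype.sum_prod_type]

/-- The trivial representation. -/
def unit : URep A where
  ι := Unit
  U _ _ := 1
  unitary_left _ _ := by simp
  unitary_right _ _ := by simp
  comul_U _ _ := by simp [Algebra.TensorProduct.one_def]

/-- A bijection of orthonormal bases identifying the matrix entries is an isomorphism. -/
def permIso {X Y : URep A} (e : X.ι ≃ Y.ι) (h : ∀ i j, X.U i j = Y.U (e i) (e j)) : X ≅ Y where
  hom := ⟨permMat e, intertwiners_perm e h⟩
  inv := ⟨permMat e.symm, intertwiners_perm e.symm fun i j => by simp [h]⟩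
  hom_inv_id := Subtype.ext (by
    change permMat e.symm * permMat e = 1
    rw [permMat_mul]; funext i j; simp [permMat, Matrix.one_apply])
  inv_hom_id := Subtype.ext (by
    change permMat e * permMat e.symm = 1
    rw [permMat_mul]; funext i j
    simp [permMat, Matrix.one_apply])

theorem mat_permIso {X Y : URep A} (e : X.ι ≃ Y.ι) (h : ∀ i j, X.U i j = Y.U (e i) (e j)) :
    mat (permIso e h).hom = permMat e := rfl

instance : MonoidalCategoryStruct (URep A) where
  tensorObj := tensor
  tensorUnit := unit
  tensorHom f g := ⟨f.1.kronecker g.1, intertwiners_kron f.2 g.2⟩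
  whiskerLeft X _ _ f := ⟨(1 : Matrix X.ι X.ι ℂ).kronecker f.1,
    intertwiners_kron (intertwiners_one X.U) f.2⟩
  whiskerRight f Y := ⟨f.1.kronecker (1 : Matrix Y.ι Y.ι ℂ),
    intertwiners_kron f.2 (intertwiners_one Y.U)⟩
  associator X Y Z := permIso (X := tensor (tensor X Y) Z) (Y := tensor X (tensor Y Z))
    (Equiv.prodAssoc X.ι Y.ι Z.ι) (fun _ _ => mul_assoc _ _ _)
  leftUnitor X := permIso (X := tensor unit X) (Equiv.punitProd X.ι) (fun _ _ => one_mul _)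
  rightUnitor X := permIso (X := tensor X unit) (Equiv.prodPUnit X.ι) (fun _ _ => mul_one _)

open scoped MonoidalCategory

theorem mat_tensorHom {X Y X' Y' : URep A} (f : X ⟶ Y) (g : X' ⟶ Y') :
    mat (f ⊗ₘ g) = (mat f).kronecker (mat g) := rfl

theorem mat_associator (X Y Z : URep A) :
    mat (α_ X Y Z).hom = permMat (Equiv.prodAssoc X.ι Y.ι Z.ι) := rfl
theorem mat_leftUnitor (X : URep A) : mat (λ_ X).hom = permMat (Equiv.punitProd X.ι) := rfl
theorem mat_rightUnitor (X : URep A) : mat (ρ_ X).hom = permMat (Equiv.prodPUnit X.ι) := rfl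

/-- The tensor category of finite-dimensional unitary representations. -/
instance : MonoidalCategory (URep A) :=
  MonoidalCategory.ofTensorHom
    (id_tensorHom_id := fun X Y => hom_ext Matrix.one_kronecker_one)
    (id_tensorHom := fun _ _ _ _ => rfl)
    (tensorHom_id := fun _ _ => rfl)
    (tensorHom_comp_tensorHom := fun f₁ f₂ g₁ g₂ => hom_ext
      (Matrix.mul_kronecker_mul (mat g₁) (mat f₁) (mat g₂) (mat f₂)).symm)
    (associator_naturality := fun {X₁ X₂ X₃ Y₁ Y₂ Y₃} f₁ f₂ f₃ => hom_ext (by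
      change permMat (Equiv.prodAssoc Y₁.ι Y₂.ι Y₃.ι) *
          ((mat f₁).kronecker (mat f₂)).kronecker (mat f₃) =
        (mat f₁).kronecker ((mat f₂).kronecker (mat f₃)) *
          permMat (Equiv.prodAssoc X₁.ι X₂.ι X₃.ι)
      rw [permMat_mul, mul_permMat]
      funext i j
      simp [Matrix.kronecker, Matrix.kroneckerMap_apply, mul_assoc]))
    (leftUnitor_naturality := fun {X Y} f => hom_ext (by
      change permMat (Equiv.punitProd Y.ι) * (1 : Matrix Unit Unit ℂ).kronecker (mat f) =
        mat f * permMat (Equiv.punitProd X.ι)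
      rw [permMat_mul, mul_permMat]
      funext i j
      simp [Matrix.kronecker, Matrix.kroneckerMap_apply]))
    (rightUnitor_naturality := fun {X Y} f => hom_ext (by
      change permMat (Equiv.prodPUnit Y.ι) * (mat f).kronecker (1 : Matrix Unit Unit ℂ) =
        mat f * permMat (Equiv.prodPUnit X.ι)
      rw [permMat_mul, mul_permMat]
      funext i j
      simp [Matrix.kronecker, Matrix.kroneckerMap_apply]))
    (pentagon := fun W X Y Z => hom_ext (permMat_pentagon (ι := W.ι) (κ := X.ι) (μ := Y.ι) (ν := Z.ι)))
    (triangle := fun X Y => hom_ext (by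
      change (1 : Matrix X.ι X.ι ℂ).kronecker (permMat (Equiv.punitProd Y.ι)) *
          permMat (Equiv.prodAssoc X.ι Unit Y.ι) =
        (permMat (Equiv.prodPUnit X.ι)).kronecker (1 : Matrix Y.ι Y.ι ℂ)
      rw [mul_permMat]
      funext i j
      simp [Matrix.kronecker, Matrix.kroneckerMap_apply, permMat, Matrix.one_apply]))

end URep

/-! ### Bi-labeled graphs and graph categories -/

/-- A bi-labeled graph: a finite graph (loops are allowed, multiple edges are not) with two tuples
of vertices `x` and `y`. Its type is `(n, m)` with `n = x.length` and `m = y.length`. -/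
structure BiLabeledGraph where
  V : Type
  [fin : Finite V]
  adj : V → V → Prop
  symm : ∀ v w, adj v w → adj w v
  x : List V
  y : List V

attribute [instance] BiLabeledGraph.fin

namespace BiLabeledGraph

/-- The bi-labeled graph `M n m` with one vertex, no edges, and all labels equal. -/
def M (n m : ℕ) : BiLabeledGraph where
  V := Unit
  adj _ _ := False
  symm _ _ h := h
  x := List.replicate n ()
  y := List.replicate m ()

/-- The bi-labeled graph with two vertices joined by one edge, labeled by `x = (0)`, `y = (1)`. -/
def edge : BiLabeledGraph where
  V := Bool
  adj v w := v ≠ w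
  symm _ _ h := Ne.symm h
  x := [false]
  y := [true]

/-- The transpose exchanges the two tuples of labels. -/
def transpose (K : BiLabeledGraph) : BiLabeledGraph where
  V := K.V
  adj := K.adj
  symm := K.symm
  x := K.y
  y := K.x

/-- The tensor product: disjoint union with concatenated labels. -/
def tensor (K K' : BiLabeledGraph) : BiLabeledGraph where
  V := K.V ⊕ K'.V
  adj := Sum.LiftRel K.adj K'.adj
  symm := by
    rintro _ _ (⟨h⟩ | ⟨h⟩)
    · exact .inl (K.symm _ _ h)
    · exact .inr (K'.symm _ _ h)
  x := K.x.map Sum.inl ++ K'.x.map Sum.inr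
  y := K.y.map Sum.inl ++ K'.y.map Sum.inr

/-- The identifications made in a composition: the `i`-th `y`-label of `K` is identified with the
`i`-th `x`-label of `K'`. -/
def Glue (K K' : BiLabeledGraph) (a b : K.V ⊕ K'.V) : Prop :=
  ∃ p ∈ K.y.zip K'.x, a = .inl p.1 ∧ b = .inr p.2

/-- The composition of `K` of type `(n, k)` and `K'` of type `(k, m)`: the disjoint union of the
graphs with the `y`-labels of `K` glued to the `x`-labels of `K'`. -/
def comp (K K' : BiLabeledGraph) : BiLabeledGraph where
  V := Quot (Glue K K')
  adj a b := ∃ v w, Sum.LiftRel K.adj K'.adj v w ∧ a = Quot.mk _ v ∧ b = Quot.mk _ w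
  symm := by
    rintro _ _ ⟨v, w, h, rfl, rfl⟩
    exact ⟨w, v, (tensor K K').symm _ _ h, rfl, rfl⟩
  x := K.x.map fun v => Quot.mk _ (.inl v)
  y := K'.y.map fun v => Quot.mk _ (.inr v)

/-- Isomorphism of bi-labeled graphs. -/
def IsIso (K K' : BiLabeledGraph) : Prop :=
  ∃ e : K.V ≃ K'.V, (∀ v w, K.adj v w ↔ K'.adj (e v) (e w)) ∧ K.x.map e = K'.x ∧ K.y.map e = K'.y

/-- A bi-labeled graph is connected if its underlying graph is. -/
def IsConnected (K : BiLabeledGraph) : Prop :=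
  Nonempty K.V ∧ ∀ v w, Relation.ReflTransGen K.adj v w

end BiLabeledGraph

open BiLabeledGraph

/-- A graph category: a collection of bi-labeled graphs (considered up to isomorphism) that contains
`M 1 1` and `M 2 0` and that is closed under composition, tensor product and transpose. -/
structure IsGraphCategory (D : Set BiLabeledGraph) : Prop where
  iso_mem : ∀ K K', K ∈ D → K.IsIso K' → K' ∈ D
  one_mem : M 1 1 ∈ D
  cup_mem : M 2 0 ∈ D
  comp_mem : ∀ K K', K ∈ D → K' ∈ D → K.y.length = K'.x.length → K.comp K' ∈ D
  tensor_mem : ∀ K K', K ∈ D → K' ∈ D → K.tensor K' ∈ D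
  transpose_mem : ∀ K, K ∈ D → K.transpose ∈ D

/-- The graph category of planar bi-labeled graphs: the smallest graph category containing `M 1 0`,
`M 1 2` and the single edge. -/
def planarGraphs : Set BiLabeledGraph :=
  ⋂₀ {D | IsGraphCategory D ∧ M 1 0 ∈ D ∧ M 1 2 ∈ D ∧ edge ∈ D}

theorem planarGraphs_isGraphCategory : IsGraphCategory planarGraphs where
  iso_mem K K' h e D hD := hD.1.iso_mem K K' (h D hD) e
  one_mem _ hD := hD.1.one_mem
  cup_mem _ hD := hD.1.cup_mem
  comp_mem K K' h h' e D hD := hD.1.comp_mem K K' (h D hD) (h' D hD) e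
  tensor_mem K K' h h' D hD := hD.1.tensor_mem K K' (h D hD) (h' D hD)
  transpose_mem K h D hD := hD.1.transpose_mem K (h D hD)

theorem M12_mem : M 1 2 ∈ planarGraphs := fun _ hD => hD.2.2.1

/-! ### The matrices of homomorphism counts -/

/-- Linear operators on the space of finitely supported functions on the set of all tuples of
elements of `I`. A matrix with rows indexed by `I ^ n` and columns indexed by `I ^ m`, having
finitely many nonzero entries in each column, is viewed as such an operator, sending the basis
vectors of tuples whose length is not `m` to `0`. -/
abbrev Op (I : Type*) : Type _ := Module.End ℂ (List I →₀ ℂ)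

/-- The basis vector of a tuple. -/
abbrev bv {I : Type*} (l : List I) : List I →₀ ℂ := Finsupp.single l 1

section Graph

universe w
variable {I : Type w} (Pi : SimpleGraph I)

/-- Graph homomorphisms from `K` to `Pi` sending the `y`-labels to the tuple `l`. -/
def Fib (K : BiLabeledGraph) (l : List I) : Type w :=
  {φ : K.V → I // (∀ v w, K.adj v w → Pi.Adj (φ v) (φ w)) ∧ K.y.map φ = l}

/-- The matrix of the bi-labeled graph `K`: the `(i, j)` entry is the number of graph homomorphisms
`φ` from `K` to `Pi` with `φ x = i` and `φ y = j`, see `homMat_apply`. -/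
def homMat (K : BiLabeledGraph) : Op I :=
  Finsupp.lift (List I →₀ ℂ) ℂ (List I) fun l => ∑ᶠ φ : Fib Pi K l, bv (K.x.map φ.1)

theorem homMat_bv (K : BiLabeledGraph) (l : List I) :
    homMat Pi K (bv l) = ∑ᶠ φ : Fib Pi K l, bv (K.x.map φ.1) := by
  simp [homMat]

theorem homMat_apply (K : BiLabeledGraph) (i j : List I) [Finite (Fib Pi K j)] :
    homMat Pi K (bv j) i = Nat.card {φ : K.V → I //
      (∀ v w, K.adj v w → Pi.Adj (φ v) (φ w)) ∧ K.x.map φ = i ∧ K.y.map φ = j} := by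
  classical
  have := Fintype.ofFinite (Fib Pi K j)
  rw [homMat_bv, finsum_eq_sum_of_fintype, Finsupp.finsetSum_apply]
  simp only [Finsupp.single_apply]
  rw [Finset.sum_boole, ← Fintype.card_subtype, ← Nat.card_eq_fintype_card]
  congr 1
  exact Nat.card_congr
    { toFun := fun φ => ⟨φ.1.1, φ.1.2.1, φ.2, φ.1.2.2⟩
      invFun := fun φ => ⟨⟨φ.1, φ.2.1, φ.2.2.2⟩, φ.2.2.1⟩
      left_inv := fun _ => rfl
      right_inv := fun _ => rfl }

variable (n m : ℕ)

/-- The planar connected bi-labeled graphs `(K, x, y)` with `x = (x 0, …, x n)`,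
`y = (y 0, …, y m)`, `x 0 = y 0` and `x n = y m`. -/
structure IsL (K : BiLabeledGraph) : Prop where
  planar : K ∈ planarGraphs
  connected : K.IsConnected
  length_x : K.x.length = n + 1
  length_y : K.y.length = m + 1
  head : K.x.head? = K.y.head?
  last : K.x.getLast? = K.y.getLast?

/-- `Mor n m` is the linear span of the matrices, with rows indexed by `I ^ (n + 1)` and columns by
`I ^ (m + 1)`, of the bi-labeled graphs above. -/
def Mor : Submodule ℂ (Op I) :=
  Submodule.span ℂ {T | ∃ K, IsL n m K ∧ T = homMat Pi K}

/-- The equivalence relation on the vertices whose classes are the `0`-cells: `i` and `j` are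
equivalent if all functions in `Mor 0 0` have the same value at `i` and at `j`. -/
def ZeroCellEquiv (i j : I) : Prop :=
  ∀ T ∈ Mor Pi 0 0, T (bv [i]) [i] = T (bv [j]) [j]

/-! ### Auxiliary facts on bi-labeled graphs -/

/-- Canonical maps from the constituents to a composition and to a tensor product. -/
def cl (K K' : BiLabeledGraph) (v : K.V) : (K.comp K').V := Quot.mk _ (.inl v)
/-- See `cl`. -/
def cr (K K' : BiLabeledGraph) (v : K'.V) : (K.comp K').V := Quot.mk _ (.inr v)
/-- See `cl`. -/
def tl (K K' : BiLabeledGraph) (v : K.V) : (K.tensor K').V := .inl v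
/-- See `cl`. -/
def tr (K K' : BiLabeledGraph) (v : K'.V) : (K.tensor K').V := .inr v

theorem comp_cases {K K' : BiLabeledGraph} (v : (K.comp K').V) :
    (∃ w, v = cl K K' w) ∨ ∃ w, v = cr K K' w := by
  obtain ⟨v | v, rfl⟩ := Quot.exists_rep v
  · exact .inl ⟨v, rfl⟩
  · exact .inr ⟨v, rfl⟩

theorem tensor_cases {K K' : BiLabeledGraph} (v : (K.tensor K').V) :
    (∃ w, v = tl K K' w) ∨ ∃ w, v = tr K K' w :=
  match v with
  | .inl v => .inl ⟨v, rfl⟩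
  | .inr v => .inr ⟨v, rfl⟩

theorem adj_cl {K K' : BiLabeledGraph} {v w : K.V} (h : K.adj v w) :
    (K.comp K').adj (cl K K' v) (cl K K' w) := ⟨_, _, .inl h, rfl, rfl⟩
theorem adj_cr {K K' : BiLabeledGraph} {v w : K'.V} (h : K'.adj v w) :
    (K.comp K').adj (cr K K' v) (cr K K' w) := ⟨_, _, .inr h, rfl, rfl⟩
theorem adj_tl {K K' : BiLabeledGraph} {v w : K.V} (h : K.adj v w) :
    (K.tensor K').adj (tl K K' v) (tl K K' w) := .inl h
theorem adj_tr {K K' : BiLabeledGraph} {v w : K'.V} (h : K'.adj v w) :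
    (K.tensor K').adj (tr K K' v) (tr K K' w) := .inr h

section Maps
variable (K K' : BiLabeledGraph) {J : Type*}

theorem comp_x_map (φ : (K.comp K').V → J) :
    (K.comp K').x.map φ = K.x.map fun v => φ (cl K K' v) := List.map_map
theorem comp_y_map (φ : (K.comp K').V → J) :
    (K.comp K').y.map φ = K'.y.map fun v => φ (cr K K' v) := List.map_map
theorem tensor_x_map (φ : (K.tensor K').V → J) : (K.tensor K').x.map φ =
    (K.x.map fun v => φ (tl K K' v)) ++ K'.x.map fun v => φ (tr K K' v) :=
  List.map_append.trans (congrArg₂ (· ++ ·) List.map_map List.map_map)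
theorem tensor_y_map (φ : (K.tensor K').V → J) : (K.tensor K').y.map φ =
    (K.y.map fun v => φ (tl K K' v)) ++ K'.y.map fun v => φ (tr K K' v) :=
  List.map_append.trans (congrArg₂ (· ++ ·) List.map_map List.map_map)
theorem one_x_map (φ : (M 1 1).V → J) : (M 1 1).x.map φ = [φ ()] := rfl
theorem one_y_map (φ : (M 1 1).V → J) : (M 1 1).y.map φ = [φ ()] := rfl

theorem comp_x_length : (K.comp K').x.length = K.x.length := List.length_map _
theorem comp_y_length : (K.comp K').y.length = K'.y.length := List.length_map _
theorem tensor_x_length : (K.tensor K').x.length = K.x.length + K'.x.length := by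
  have : (K.x.map Sum.inl ++ K'.x.map Sum.inr : List (K.V ⊕ K'.V)).length =
      K.x.length + K'.x.length := by simp
  exact this
theorem tensor_y_length : (K.tensor K').y.length = K.y.length + K'.y.length := by
  have : (K.y.map Sum.inl ++ K'.y.map Sum.inr : List (K.V ⊕ K'.V)).length =
      K.y.length + K'.y.length := by simp
  exact this

end Maps

theorem zip_map_eq {A B J : Type*} (f : A → J) (g : B → J) :
    ∀ (l : List A) (l' : List B), l.length = l'.length →
      ((∀ p ∈ l.zip l', f p.1 = g p.2) ↔ l.map f = l'.map g)
  | [], [], _ => by simp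
  | a :: l, b :: l', h => by
    have ih := zip_map_eq f g l l' (by simpa using h)
    simp only [List.zip_cons_cons, List.mem_cons, forall_eq_or_imp, List.map_cons, List.cons.injEq,
      ih]

theorem comp_agree {K K' : BiLabeledGraph} (h : K.y.length = K'.x.length) {J : Type*}
    (φ : (K.comp K').V → J) :
    K.y.map (fun v => φ (cl K K' v)) = K'.x.map fun v => φ (cr K K' v) :=
  (zip_map_eq _ _ _ _ h).1 fun p hp => congrArg φ (Quot.sound ⟨p, hp, rfl, rfl⟩)

/-- Homomorphisms from a composition are compatible pairs of homomorphisms. -/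
def fibComp {K K' : BiLabeledGraph} (h : K.y.length = K'.x.length) (l : List I) :
    Fib Pi (K.comp K') l ≃ Σ ψ : Fib Pi K' l, Fib Pi K (K'.x.map ψ.1) where
  toFun φ := ⟨⟨fun v => φ.1 (cr K K' v), fun _ _ hvw => φ.2.1 _ _ (adj_cr hvw),
      (comp_y_map K K' φ.1).symm.trans φ.2.2⟩,
    ⟨fun v => φ.1 (cl K K' v), fun _ _ hvw => φ.2.1 _ _ (adj_cl hvw), comp_agree h φ.1⟩⟩
  invFun ψ := ⟨Quot.lift (Sum.elim ψ.2.1 ψ.1.1) (by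
      rintro _ _ ⟨p, hp, rfl, rfl⟩
      exact (zip_map_eq _ _ _ _ h).2 ψ.2.2.2 p hp),
    by
      rintro _ _ ⟨v, w, ⟨hvw⟩ | ⟨hvw⟩, rfl, rfl⟩
      · exact ψ.2.2.1 _ _ hvw
      · exact ψ.1.2.1 _ _ hvw,
    (comp_y_map K K' _).trans ψ.1.2.2⟩
  left_inv φ := by
    apply Subtype.ext
    funext v
    induction v using Quot.ind with
    | mk v => rcases v with v | v <;> rfl
  right_inv ψ := rfl

theorem homMat_comp {K K' : BiLabeledGraph} (h : K.y.length = K'.x.length)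
    (hK : ∀ l, Finite (Fib Pi K l)) (hK' : ∀ l, Finite (Fib Pi K' l)) :
    homMat Pi (K.comp K') = homMat Pi K * homMat Pi K' := by
  apply Finsupp.lhom_ext'
  intro l
  apply LinearMap.ext_ring
  change homMat Pi (K.comp K') (bv l) = homMat Pi K (homMat Pi K' (bv l))
  have := Fintype.ofFinite (Fib Pi K' l)
  have h2 : ∀ ψ : Fib Pi K' l, Fintype (Fib Pi K (K'.x.map ψ.1)) := fun ψ => Fintype.ofFinite _
  rw [homMat_bv, homMat_bv, finsum_eq_sum_of_fintype (α := Fib Pi K' l), map_sum]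
  simp only [homMat_bv]
  rw [← (finsum_comp_equiv (fibComp Pi h l).symm), finsum_eq_sum_of_fintype, Fintype.sum_sigma]
  refine Finset.sum_congr rfl fun ψ _ => ?_
  rw [finsum_eq_sum_of_fintype]
  refine Finset.sum_congr rfl fun φ _ => ?_
  exact congrArg bv (comp_x_map K K' _)

theorem finite_fib_comp {K K' : BiLabeledGraph} (h : K.y.length = K'.x.length)
    (hK : ∀ l, Finite (Fib Pi K l)) (hK' : ∀ l, Finite (Fib Pi K' l)) (l : List I) :
    Finite (Fib Pi (K.comp K') l) :=
  Finite.of_equiv _ (fibComp Pi h l).symm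

/-- Homomorphisms from a disjoint union are pairs of homomorphisms. -/
def fibTensor {K K' : BiLabeledGraph} {l l' : List I} (h : l.length = K.y.length) :
    Fib Pi (K.tensor K') (l ++ l') ≃ Fib Pi K l × Fib Pi K' l' where
  toFun φ :=
    have h2 := List.append_inj ((tensor_y_map K K' φ.1).symm.trans φ.2.2) (by simp [h])
    ⟨⟨fun v => φ.1 (tl K K' v), fun _ _ hvw => φ.2.1 _ _ (adj_tl hvw), h2.1⟩,
      ⟨fun v => φ.1 (tr K K' v), fun _ _ hvw => φ.2.1 _ _ (adj_tr hvw), h2.2⟩⟩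
  invFun ψ := ⟨Sum.elim ψ.1.1 ψ.2.1, by
      rintro _ _ (⟨hvw⟩ | ⟨hvw⟩)
      · exact ψ.1.2.1 _ _ hvw
      · exact ψ.2.2.1 _ _ hvw,
    (tensor_y_map K K' _).trans (congrArg₂ (· ++ ·) ψ.1.2.2 ψ.2.2.2)⟩
  left_inv φ := by
    apply Subtype.ext
    funext v
    rcases v with v | v <;> rfl
  right_inv ψ := rfl

theorem length_of_fib {K : BiLabeledGraph} {l : List I} (φ : Fib Pi K l) :
    l.length = K.y.length := by
  rw [← φ.2.2, List.length_map]

theorem homMat_bv_of_length {K : BiLabeledGraph} {l : List I} (h : l.length ≠ K.y.length) :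
    homMat Pi K (bv l) = 0 := by
  have : IsEmpty (Fib Pi K l) := ⟨fun φ => h (length_of_fib Pi φ)⟩
  rw [homMat_bv, finsum_of_isEmpty]

theorem finite_fib_tensor {K K' : BiLabeledGraph}
    (hK : ∀ l, Finite (Fib Pi K l)) (hK' : ∀ l, Finite (Fib Pi K' l)) (l : List I) :
    Finite (Fib Pi (K.tensor K') l) := by
  by_cases h : K.y.length ≤ l.length
  · have h2 := List.take_append_drop K.y.length l
    rw [← h2]
    exact Finite.of_equiv _ (fibTensor Pi (by simp [h])).symm
  · have : IsEmpty (Fib Pi (K.tensor K') l) := ⟨fun φ => h (by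
      rw [length_of_fib Pi φ, tensor_y_length]; omega)⟩
    infer_instance

/-- Bilinear concatenation of tuples. -/
def app : (List I →₀ ℂ) →ₗ[ℂ] (List I →₀ ℂ) →ₗ[ℂ] (List I →₀ ℂ) :=
  Finsupp.lift _ ℂ _ fun a => Finsupp.lift _ ℂ _ fun b => bv (a ++ b)

theorem app_bv (a b : List I) : app (bv a) (bv b) = bv (a ++ b) := by simp [app]

theorem homMat_tensor {K K' : BiLabeledGraph} (hK : ∀ l, Finite (Fib Pi K l))
    (hK' : ∀ l, Finite (Fib Pi K' l)) {l l' : List I} (h : l.length = K.y.length) :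
    homMat Pi (K.tensor K') (bv (l ++ l')) = app (homMat Pi K (bv l)) (homMat Pi K' (bv l')) := by
  have := Fintype.ofFinite (Fib Pi K l)
  have := Fintype.ofFinite (Fib Pi K' l')
  rw [homMat_bv, homMat_bv, homMat_bv, ← (finsum_comp_equiv (fibTensor Pi h).symm)]
  rw [finsum_eq_sum_of_fintype, finsum_eq_sum_of_fintype, finsum_eq_sum_of_fintype,
    LinearMap.map_sum₂, Fintype.sum_prod_type]
  refine Finset.sum_congr rfl fun φ _ => ?_
  rw [map_sum]
  refine Finset.sum_congr rfl fun ψ _ => ?_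
  rw [app_bv]
  exact congrArg bv (tensor_x_map K K' _)

theorem finite_fib {n m : ℕ} [Pi.LocallyFinite] {K : BiLabeledGraph} (hK : IsL n m K)
    (l : List I) : Finite (Fib Pi K l) := by
  have hne : K.y ≠ [] := List.ne_nil_of_length_eq_add_one hK.length_y
  obtain ⟨v₀, ys, hy⟩ := List.exists_cons_of_ne_nil hne
  have key : ∀ v, ∃ F : Set I, F.Finite ∧ ∀ φ : Fib Pi K l, φ.1 v ∈ F := fun v => by
    have := hK.connected.2 v₀ v
    induction this with
    | refl =>
      refine ⟨{i | l.head? = some i}, ?_, fun φ => ?_⟩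
      · refine Set.Subsingleton.finite fun i hi j hj => ?_
        exact Option.some_injective _ (hi.symm.trans hj)
      · have h1 : (K.y.map φ.1).head? = l.head? := congrArg _ φ.2.2
        have h2 : K.y.head? = some v₀ := by rw [hy]; rfl
        rw [List.head?_map] at h1
        exact h1.symm.trans (congrArg (Option.map φ.1) h2)
    | tail _ hvw ih =>
      obtain ⟨F, hF, h⟩ := ih
      refine ⟨⋃ i ∈ F, Pi.neighborSet i, hF.biUnion fun i _ => Set.toFinite _, fun φ => ?_⟩
      exact Set.mem_biUnion (h φ) (φ.2.1 _ _ hvw)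
  choose F hF h using key
  have : ∀ v, Finite (F v) := fun v => (hF v).to_subtype
  exact Finite.of_injective (β := ∀ v, F v) (fun φ v => ⟨φ.1 v, h v φ⟩) fun φ ψ e => by
    apply Subtype.ext
    funext v
    exact congrArg Subtype.val (congrFun e v)

/-! Connectedness through locally constant functions. -/

theorem isConnected_of {K : BiLabeledGraph} (hne : Nonempty K.V)
    (h : ∀ f : K.V → Prop, (∀ v w, K.adj v w → (f v ↔ f w)) → ∀ v w, f v → f w) :
    K.IsConnected :=
  ⟨hne, fun v w => h (fun w => Relation.ReflTransGen K.adj v w)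
    (fun _ _ hab => ⟨fun h => h.tail hab, fun h => h.tail (K.symm _ _ hab)⟩) v w .refl⟩

theorem IsConnected_const {K : BiLabeledGraph} (hK : K.IsConnected) (f : K.V → Prop)
    (h : ∀ v w, K.adj v w → (f v ↔ f w)) (v w : K.V) : f v → f w := by
  have := hK.2 v w
  induction this with
  | refl => exact id
  | tail _ hab ih => exact fun hv => (h _ _ hab).1 (ih hv)

theorem IsL.comp {n k m : ℕ} {K K' : BiLabeledGraph} (hK : IsL n k K) (hK' : IsL k m K') :
    IsL n m (K.comp K') := by
  have hl : K.y.length = K'.x.length := by rw [hK.length_y, hK'.length_x]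
  have hne : K.y ≠ [] := List.ne_nil_of_length_eq_add_one hK.length_y
  obtain ⟨v₀, ys, hy⟩ := List.exists_cons_of_ne_nil hne
  have hne' : K'.x ≠ [] := List.ne_nil_of_length_eq_add_one hK'.length_x
  obtain ⟨w₀, xs, hx⟩ := List.exists_cons_of_ne_nil hne'
  have hid := comp_agree hl (fun v => v)
  refine ⟨planarGraphs_isGraphCategory.comp_mem _ _ hK.planar hK'.planar hl,
    isConnected_of ⟨Quot.mk _ (.inl v₀)⟩ ?_, ?_, ?_, ?_, ?_⟩
  · intro f hf
    have h1 : ∀ v w : K.V, f (cl K K' v) → f (cl K K' w) :=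
      IsConnected_const hK.connected _ fun v w h => hf _ _ (adj_cl h)
    have h2 : ∀ v w : K'.V, f (cr K K' v) → f (cr K K' w) :=
      IsConnected_const hK'.connected _ fun v w h => hf _ _ (adj_cr h)
    have h0 : cl K K' v₀ = cr K K' w₀ := by
      rw [hy, hx] at hid
      exact (List.cons.inj hid).1
    intro v w
    obtain ⟨v, rfl⟩ | ⟨v, rfl⟩ := comp_cases v <;> obtain ⟨w, rfl⟩ | ⟨w, rfl⟩ := comp_cases w
    · exact h1 v w
    · exact fun h => h2 w₀ w (h0 ▸ h1 v v₀ h)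
    · exact fun h => h1 v₀ w (h0 ▸ h2 v w₀ h)
    · exact h2 v w
  · rw [comp_x_length, hK.length_x]
  · rw [comp_y_length, hK'.length_y]
  · have e := congrArg List.head? hid
    have e1 := congrArg List.head? (comp_x_map K K' fun v => v)
    have e2 := congrArg List.head? (comp_y_map K K' fun v => v)
    rw [List.map_id'] at e1 e2
    rw [e1, e2, List.head?_map, List.head?_map, hK.head, ← hK'.head, ← List.head?_map,
      ← List.head?_map]
    exact e
  · have e := congrArg List.getLast? hid
    have e1 := congrArg List.getLast? (comp_x_map K K' fun v => v)
    have e2 := congrArg List.getLast? (comp_y_map K K' fun v => v)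
    rw [List.map_id'] at e1 e2
    rw [e1, e2, List.getLast?_map, List.getLast?_map, hK.last, ← hK'.last, ← List.getLast?_map,
      ← List.getLast?_map]
    exact e

/-! The bi-labeled graphs `1 ⊗ ⋯ ⊗ 1 ⊗ M 1 2 ⊗ 1 ⊗ ⋯ ⊗ 1`. -/

/-- The tensor product of `n` copies of `M 1 1` with `K`. -/
def padL (K : BiLabeledGraph) : ℕ → BiLabeledGraph
  | 0 => K
  | n + 1 => (M 1 1).tensor (padL K n)

/-- The tensor product of `M 1 2` with `n` copies of `M 1 1`. -/
def padR : ℕ → BiLabeledGraph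
  | 0 => M 1 2
  | n + 1 => (padR n).tensor (M 1 1)

/-- `M 1 2` with identity strands on both sides. -/
def pad (n n' : ℕ) : BiLabeledGraph := padL (padR n') n

theorem pad_mem (n n' : ℕ) : pad n n' ∈ planarGraphs := by
  have hR : padR n' ∈ planarGraphs := by
    induction n' with
    | zero => exact M12_mem
    | succ n' ih =>
      exact planarGraphs_isGraphCategory.tensor_mem (padR n') (M 1 1) ih
        planarGraphs_isGraphCategory.one_mem
  induction n with
  | zero => exact hR
  | succ n ih =>
    exact planarGraphs_isGraphCategory.tensor_mem (M 1 1) (pad n n')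
      planarGraphs_isGraphCategory.one_mem ih

theorem padR_fun (n' : ℕ) {J : Type*} (f : (padR n').V → J) : ∃ a q, q.length = n' ∧
    (padR n').x.map f = a :: q ∧ (padR n').y.map f = a :: a :: q := by
  induction n' with
  | zero => exact ⟨f (), [], rfl, rfl, rfl⟩
  | succ n' ih =>
    obtain ⟨a, q, hq, hx, hy⟩ := ih (fun v => f (tl (padR n') (M 1 1) v))
    refine ⟨a, q ++ [f (tr (padR n') (M 1 1) ())], by simp [hq], ?_, ?_⟩
    · refine (tensor_x_map (padR n') (M 1 1) f).trans ?_
      rw [hx, one_x_map]; rfl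
    · refine (tensor_y_map (padR n') (M 1 1) f).trans ?_
      rw [hy, one_y_map]; rfl

theorem pad_fun (n n' : ℕ) {J : Type*} (f : (pad n n').V → J) : ∃ p a q, p.length = n ∧
    q.length = n' ∧ (pad n n').x.map f = p ++ a :: q ∧
    (pad n n').y.map f = p ++ a :: a :: q := by
  induction n with
  | zero =>
    obtain ⟨a, q, h⟩ := padR_fun n' f
    exact ⟨[], a, q, rfl, h⟩
  | succ n ih =>
    obtain ⟨p, a, q, hp, hq, hx, hy⟩ := ih (fun v => f (tr (M 1 1) (pad n n') v))
    refine ⟨f (tl (M 1 1) (pad n n') ()) :: p, a, q, by simp [hp], hq, ?_, ?_⟩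
    · refine (tensor_x_map (M 1 1) (pad n n') f).trans ?_
      rw [hx, one_x_map]; rfl
    · refine (tensor_y_map (M 1 1) (pad n n') f).trans ?_
      rw [hy, one_y_map]; rfl

theorem padR_exists (n' : ℕ) {J : Type*} (a : J) (q : List J) (hq : q.length = n') :
    ∃ f : (padR n').V → J, (padR n').x.map f = a :: q := by
  induction n' generalizing q with
  | zero => exact ⟨fun _ => a, by rw [List.length_eq_zero_iff.1 hq]; rfl⟩
  | succ n' ih =>
    obtain ⟨q, b, rfl⟩ := (List.eq_nil_or_concat' q).resolve_left (by rintro rfl; simp at hq)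
    obtain ⟨f, hf⟩ := ih q (by simpa using hq)
    refine ⟨Sum.elim f fun _ => b, (tensor_x_map (padR n') (M 1 1) _).trans ?_⟩
    exact congrArg (· ++ [b]) hf

theorem pad_exists (n n' : ℕ) {J : Type*} (p : List J) (a : J) (q : List J) (hp : p.length = n)
    (hq : q.length = n') : ∃ f : (pad n n').V → J, (pad n n').x.map f = p ++ a :: q := by
  induction n generalizing p with
  | zero => rw [List.length_eq_zero_iff.1 hp]; exact padR_exists n' a q hq
  | succ n ih =>
    obtain ⟨b, p, rfl⟩ := List.exists_cons_of_length_eq_add_one hp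
    obtain ⟨f, hf⟩ := ih p (by simpa using hp)
    refine ⟨Sum.elim (fun _ => b) f, (tensor_x_map (M 1 1) (pad n n') _).trans ?_⟩
    exact congrArg (b :: ·) hf

theorem mem_x_tensor {K K' : BiLabeledGraph} (h : ∀ v, v ∈ K.x) (h' : ∀ v, v ∈ K'.x)
    (v : (K.tensor K').V) : v ∈ (K.tensor K').x := by
  have e := tensor_x_map K K' fun v => v
  rw [List.map_id'] at e
  rw [e, List.mem_append]
  obtain ⟨v, rfl⟩ | ⟨v, rfl⟩ := tensor_cases v
  · exact .inl (List.mem_map_of_mem (h v))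
  · exact .inr (List.mem_map_of_mem (h' v))

theorem pad_mem_x (n n' : ℕ) (v : (pad n n').V) : v ∈ (pad n n').x := by
  have h1 : ∀ v, v ∈ (M 1 1).x := fun v => List.mem_cons_self
  have hR : ∀ v : (padR n').V, v ∈ (padR n').x := by
    clear v
    induction n' with
    | zero => exact fun v => List.mem_cons_self
    | succ n' ih => exact mem_x_tensor ih h1
  induction n with
  | zero => exact hR v
  | succ n ih => exact mem_x_tensor h1 ih v

theorem pad_mem_y (n n' : ℕ) (v : (pad n n').V) : v ∈ (pad n n').y := by
  obtain ⟨p, a, q, -, -, hx, hy⟩ := pad_fun n n' (fun v => v)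
  have := pad_mem_x n n' v
  simp only [List.map_id'] at hx hy
  rw [hx] at this
  rw [hy]
  simp only [List.mem_append, List.mem_cons] at this ⊢
  tauto

theorem pad_adj (n n' : ℕ) (v w : (pad n n').V) : ¬ (pad n n').adj v w := by
  have hR : ∀ v w, ¬ (padR n').adj v w := by
    clear v w
    induction n' with
    | zero => exact fun _ _ h => h
    | succ n' ih =>
      rintro _ _ (⟨h⟩ | ⟨h⟩)
      · exact ih _ _ h
      · exact h
  induction n with
  | zero => exact hR v w
  | succ n ih =>
    intro h
    rcases h with ⟨h⟩ | ⟨h⟩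
    · exact h
    · exact ih _ _ h

theorem map_inj_of_mem {A J : Type*} {l : List A} (h : ∀ v, v ∈ l) {f g : A → J}
    (e : l.map f = l.map g) : f = g :=
  funext fun v => List.map_inj_left.1 e v (h v)

theorem subsingleton_fib_pad (n n' : ℕ) (l : List I) : Subsingleton (Fib Pi (pad n n') l) :=
  ⟨fun φ ψ => Subtype.ext (map_inj_of_mem (pad_mem_y n n') (φ.2.2.trans ψ.2.2.symm))⟩

theorem subsingleton_fib_pad_transpose (n n' : ℕ) (l : List I) :
    Subsingleton (Fib Pi (pad n n').transpose l) :=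
  ⟨fun φ ψ => Subtype.ext (map_inj_of_mem (pad_mem_x n n') (φ.2.2.trans ψ.2.2.symm))⟩

theorem homMat_pad (p : List I) (a : I) (q : List I) :
    homMat Pi (pad p.length q.length) (bv (p ++ a :: a :: q)) = bv (p ++ a :: q) := by
  obtain ⟨f, hf⟩ := pad_exists p.length q.length p a q rfl rfl
  obtain ⟨p', a', q', hp, hq, hx, hy⟩ := pad_fun p.length q.length f
  obtain ⟨rfl, h⟩ := List.append_inj (hf.symm.trans hx) hp.symm
  obtain ⟨rfl, rfl⟩ := List.cons.inj h
  have := subsingleton_fib_pad Pi p.length q.length (p ++ a :: a :: q)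
  let g : Fib Pi (pad p.length q.length) (p ++ a :: a :: q) :=
    ⟨f, fun v w h => (pad_adj _ _ v w h).elim, hy⟩
  have : Unique (Fib Pi (pad p.length q.length) (p ++ a :: a :: q)) := uniqueOfSubsingleton g
  rw [homMat_bv, finsum_unique, Subsingleton.elim default g]
  exact congrArg bv hf

theorem homMat_pad_transpose (p : List I) (a : I) (q : List I) :
    homMat Pi (pad p.length q.length).transpose (bv (p ++ a :: q)) = bv (p ++ a :: a :: q) := by
  obtain ⟨f, hf⟩ := pad_exists p.length q.length p a q rfl rfl
  obtain ⟨p', a', q', hp, hq, hx, hy⟩ := pad_fun p.length q.length f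
  obtain ⟨rfl, h⟩ := List.append_inj (hf.symm.trans hx) hp.symm
  obtain ⟨rfl, rfl⟩ := List.cons.inj h
  have := subsingleton_fib_pad_transpose Pi p.length q.length (p ++ a :: q)
  let g : Fib Pi (pad p.length q.length).transpose (p ++ a :: q) :=
    ⟨f, fun v w h => (pad_adj _ _ v w h).elim, hf⟩
  have : Unique (Fib Pi (pad p.length q.length).transpose (p ++ a :: q)) := uniqueOfSubsingleton g
  rw [homMat_bv, finsum_unique, Subsingleton.elim default g]
  exact congrArg bv hy

/-- The relative tensor product of bi-labeled graphs of types `(n + 1, m + 1)` and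
`(n' + 1, m' + 1)`. -/
def relTensor (n m n' m' : ℕ) (K K' : BiLabeledGraph) : BiLabeledGraph :=
  (pad n n').comp ((K.tensor K').comp (pad m m').transpose)

theorem pad_length_x (n n' : ℕ) : (pad n n').x.length = n + 1 + n' := by
  obtain ⟨p, a, q, hp, hq, hx, hy⟩ := pad_fun n n' (fun v => v)
  rw [List.map_id'] at hx
  rw [hx]; simp [hp, hq]; omega

theorem pad_length_y (n n' : ℕ) : (pad n n').y.length = (n + 1) + (n' + 1) := by
  obtain ⟨p, a, q, hp, hq, hx, hy⟩ := pad_fun n n' (fun v => v)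
  rw [List.map_id'] at hy
  rw [hy]; simp [hp, hq]; omega

/-- The inclusions of the two main constituents of a relative tensor product. -/
def rl (n m n' m' : ℕ) (K K' : BiLabeledGraph) (v : K.V) : (relTensor n m n' m' K K').V :=
  cr _ _ (cl _ _ (tl K K' v))
/-- See `rl`. -/
def rr (n m n' m' : ℕ) (K K' : BiLabeledGraph) (v : K'.V) : (relTensor n m n' m' K K').V :=
  cr _ _ (cl _ _ (tr K K' v))

section RelTensor

variable {n m n' m' : ℕ} {K K' : BiLabeledGraph}

theorem relTensor_length₂ (hK : IsL n m K) (hK' : IsL n' m' K') :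
    (K.tensor K').y.length = (pad m m').transpose.x.length := by
  rw [tensor_y_length, hK.length_y, hK'.length_y]
  exact (pad_length_y m m').symm

theorem relTensor_length₁ (hK : IsL n m K) (hK' : IsL n' m' K') :
    (pad n n').y.length = ((K.tensor K').comp (pad m m').transpose).x.length := by
  rw [comp_x_length, tensor_x_length, hK.length_x, hK'.length_x]
  exact pad_length_y n n'

/-- The restrictions of a function on the vertices to the constituents. -/
theorem relTensor_fun (hK : IsL n m K) (hK' : IsL n' m' K') {J : Type}
    (φ : (relTensor n m n' m' K K').V → J) :
    ∃ (p : List J) (a : J) (q : List J) (p' : List J) (q' : List J), p.length = n ∧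
      q.length = n' ∧ p'.length = m ∧ q'.length = m' ∧
      (relTensor n m n' m' K K').x.map φ = p ++ a :: q ∧
      (relTensor n m n' m' K K').y.map φ = p' ++ a :: q' ∧
      K.x.map (fun v => φ (rl n m n' m' K K' v)) = p ++ [a] ∧
      K'.x.map (fun v => φ (rr n m n' m' K K' v)) = a :: q ∧
      K.y.map (fun v => φ (rl n m n' m' K K' v)) = p' ++ [a] ∧
      K'.y.map (fun v => φ (rr n m n' m' K K' v)) = a :: q' ∧
      ∀ v, (∃ w, v = rl n m n' m' K K' w) ∨ (∃ w, v = rr n m n' m' K K' w) ∨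
        φ v ∈ p ++ a :: a :: q ∨ φ v ∈ p' ++ a :: a :: q' := by
  have hl1 := relTensor_length₁ hK hK'
  have hl2 := relTensor_length₂ hK hK'
  have e1 := comp_agree hl1 φ
  have e2 := comp_agree hl2 (fun v => φ (cr _ _ v))
  obtain ⟨p, a, q, hp, hq, hx, hy⟩ := pad_fun n n' (fun v => φ (cl _ _ v))
  obtain ⟨p', a', q', hp', hq', hx', hy'⟩ := pad_fun m m' (fun v => φ (cr _ _ (cr _ _ v)))
  have e2' := e2.trans hy'
  rw [hy, comp_x_map, tensor_x_map] at e1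
  rw [tensor_y_map] at e2'
  have s1 : p ++ a :: a :: q = (p ++ [a]) ++ a :: q := by simp
  have s2 : p' ++ a' :: a' :: q' = (p' ++ [a']) ++ a' :: q' := by simp
  rw [s1] at e1
  rw [s2] at e2'
  obtain ⟨f1, f2⟩ := List.append_inj e1 (by simp [hp, hK.length_x])
  obtain ⟨f3, f4⟩ := List.append_inj e2' (by simp [hp', hK.length_y])
  have haa : a = a' := by
    have h1 := congrArg List.getLast? f1
    have h3 := congrArg List.getLast? f3
    rw [List.getLast?_map, hK.last] at h1
    rw [List.getLast?_map] at h3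
    have := h1.trans h3
    simpa using this
  subst haa
  refine ⟨p, a, q, p', q', hp, hq, hp', hq', ?_, ?_, f1.symm, f2.symm, f3, f4, ?_⟩
  · exact (comp_x_map _ _ φ).trans hx
  · exact ((comp_y_map _ _ φ).trans (comp_y_map _ _ _)).trans hx'
  · intro v
    obtain ⟨v, rfl⟩ | ⟨v, rfl⟩ := comp_cases v
    · exact .inr (.inr (.inl (hy ▸ List.mem_map_of_mem (pad_mem_y n n' v))))
    · obtain ⟨v, rfl⟩ | ⟨v, rfl⟩ := comp_cases v
      · obtain ⟨v, rfl⟩ | ⟨v, rfl⟩ := tensor_cases v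
        · exact .inl ⟨v, rfl⟩
        · exact .inr (.inl ⟨v, rfl⟩)
      · exact .inr (.inr (.inr (hy' ▸ List.mem_map_of_mem (pad_mem_y m m' v))))

theorem isL_relTensor (hK : IsL n m K) (hK' : IsL n' m' K') :
    IsL (n + n') (m + m') (relTensor n m n' m' K K') := by
  have hcat := planarGraphs_isGraphCategory
  obtain ⟨p, a, q, p', q', hp, hq, hp', hq', hx, hy, h1, h2, h3, h4, -⟩ :=
    relTensor_fun hK hK' (fun v => v)
  rw [List.map_id'] at hx hy
  refine ⟨hcat.comp_mem _ _ (pad_mem n n') (hcat.comp_mem _ _ (hcat.tensor_mem _ _ hK.planar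
    hK'.planar) (hcat.transpose_mem _ (pad_mem m m')) (relTensor_length₂ hK hK'))
    (relTensor_length₁ hK hK'), isConnected_of ⟨a⟩ ?_, ?_, ?_, ?_, ?_⟩
  · intro f hf
    obtain ⟨p, a, q, p', q', hp, hq, hp', hq', hx, hy, h1, h2, h3, h4, h5⟩ :=
      relTensor_fun hK hK' f
    have c1 : ∀ v w : K.V, f (rl n m n' m' K K' v) → f (rl n m n' m' K K' w) :=
      IsConnected_const hK.connected _ fun v w h => hf _ _ (adj_cr (adj_cl (adj_tl h)))
    have c2 : ∀ v w : K'.V, f (rr n m n' m' K K' v) → f (rr n m n' m' K K' w) :=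
      IsConnected_const hK'.connected _ fun v w h => hf _ _ (adj_cr (adj_cl (adj_tr h)))
    have d1 : ∀ v, f (rl n m n' m' K K' v) = a := fun v => by
      have : a ∈ K.x.map (fun v => f (rl n m n' m' K K' v)) := by rw [h1]; simp
      obtain ⟨w, -, rfl⟩ := List.mem_map.1 this
      exact propext ⟨c1 v w, c1 w v⟩
    have d2 : ∀ v, f (rr n m n' m' K K' v) = a := fun v => by
      have : a ∈ K'.x.map (fun v => f (rr n m n' m' K K' v)) := by rw [h2]; simp
      obtain ⟨w, -, rfl⟩ := List.mem_map.1 this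
      exact propext ⟨c2 v w, c2 w v⟩
    have mem1 : ∀ b ∈ p ++ [a], b = a := fun b hb => by
      rw [← h1] at hb
      obtain ⟨w, -, rfl⟩ := List.mem_map.1 hb
      exact d1 w
    have mem2 : ∀ b ∈ a :: q, b = a := fun b hb => by
      rw [← h2] at hb
      obtain ⟨w, -, rfl⟩ := List.mem_map.1 hb
      exact d2 w
    have mem3 : ∀ b ∈ p' ++ [a], b = a := fun b hb => by
      rw [← h3] at hb
      obtain ⟨w, -, rfl⟩ := List.mem_map.1 hb
      exact d1 w
    have mem4 : ∀ b ∈ a :: q', b = a := fun b hb => by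
      rw [← h4] at hb
      obtain ⟨w, -, rfl⟩ := List.mem_map.1 hb
      exact d2 w
    have all : ∀ v, f v = a := by
      intro v
      obtain ⟨w, rfl⟩ | ⟨w, rfl⟩ | h | h := h5 v
      · exact d1 w
      · exact d2 w
      · rw [show p ++ a :: a :: q = (p ++ [a]) ++ a :: q by simp, List.mem_append] at h
        exact h.elim (mem1 _) (mem2 _)
      · rw [show p' ++ a :: a :: q' = (p' ++ [a]) ++ a :: q' by simp, List.mem_append] at h
        exact h.elim (mem3 _) (mem4 _)
    intro v w
    rw [all v, all w]
    exact id
  · rw [hx]; simp [hp, hq]; omega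
  · rw [hy]; simp [hp', hq']; omega
  · have e : (p ++ [a]).head? = (p' ++ [a]).head? := by
      have e1 := congrArg List.head? h1
      have e2 := congrArg List.head? h3
      rw [List.head?_map] at e1 e2
      rw [← e1, ← e2, hK.head]
    rw [hx, hy]
    simpa using e
  · have e : (a :: q).getLast? = (a :: q').getLast? := by
      have e1 := congrArg List.getLast? h2
      have e2 := congrArg List.getLast? h4
      rw [List.getLast?_map] at e1 e2
      rw [← e1, ← e2, hK'.last]
    rw [hx, hy, List.getLast?_append, List.getLast?_append, e]
    simp [List.getLast?_cons]

end RelTensor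

end Graph

/-! ### The relative tensor product of operators -/

section Operators

universe w
variable {I : Type w}

/-- The tuples of length `n + 1` with the same first and last entries as `l`. -/
def Ends (n : ℕ) (l : List I) : Set (List I) :=
  {a | a.length = n + 1 ∧ a.head? = l.head? ∧ a.getLast? = l.getLast?}

/-- The operators given by `I ^ (n + 1) × I ^ (m + 1)` matrices `T` that are bimodular, i.e. satisfy
`T i j = 0` unless `i 0 = j 0` and `i n = j m`. -/
def Bim (n m : ℕ) : Submodule ℂ (Op I) where
  carrier := {T | (∀ l, l.length = m + 1 → T (bv l) ∈ Finsupp.supported ℂ ℂ (Ends n l)) ∧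
    ∀ l, l.length ≠ m + 1 → T (bv l) = 0}
  zero_mem' := ⟨fun _ _ => Submodule.zero_mem _, fun _ _ => rfl⟩
  add_mem' hS hT := ⟨fun l h => Submodule.add_mem _ (hS.1 l h) (hT.1 l h), fun l h => by
    rw [LinearMap.add_apply, hS.2 l h, hT.2 l h, add_zero]⟩
  smul_mem' c T hT := ⟨fun l h => Submodule.smul_mem _ c (hT.1 l h), fun l h => by
    rw [LinearMap.smul_apply, hT.2 l h, smul_zero]⟩

/-- The bilinear map gluing two tuples `(i 0, …, i n)` and `(j 0, …, j m)` with `i n = j 0` to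
`(i 0, …, i n, j 1, …, j m)`. -/
def glue : (List I →₀ ℂ) →ₗ[ℂ] (List I →₀ ℂ) →ₗ[ℂ] (List I →₀ ℂ) :=
  Finsupp.lift _ ℂ _ fun a => Finsupp.lift _ ℂ _ fun b => bv (a ++ b.tail)

theorem glue_bv (a b : List I) : glue (bv a) (bv b) = bv (a ++ b.tail) := by simp [glue]

/-- The relative tensor product of a bimodular operator `T` with columns indexed by `I ^ (m + 1)`
and a bimodular operator `S`; its matrix entries are given by
`(T ⊗ S) i j = T (i 0, …, i n) (j 0, …, j m) * S (i n, …, i (n + n')) (j m, …, j (m + m'))`,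
see `ten_apply`. -/
def ten (m : ℕ) : Op I →ₗ[ℂ] Op I →ₗ[ℂ] Op I :=
  LinearMap.mk₂ ℂ
    (fun T S => Finsupp.lift _ ℂ _ fun l => glue (T (bv (l.take (m + 1)))) (S (bv (l.drop m))))
    (fun _ _ _ => by apply Finsupp.lhom_ext'; intro l; apply LinearMap.ext_ring; simp)
    (fun _ _ _ => by apply Finsupp.lhom_ext'; intro l; apply LinearMap.ext_ring; simp)
    (fun _ _ _ => by apply Finsupp.lhom_ext'; intro l; apply LinearMap.ext_ring; simp)
    (fun _ _ _ => by apply Finsupp.lhom_ext'; intro l; apply LinearMap.ext_ring; simp)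

theorem ten_bv (m : ℕ) (T S : Op I) (l : List I) :
    ten m T S (bv l) = glue (T (bv (l.take (m + 1)))) (S (bv (l.drop m))) := by
  simp [ten]

theorem op_ext {S T : Op I} (h : ∀ l, S (bv l) = T (bv l)) : S = T := by
  apply Finsupp.lhom_ext'; intro l; apply LinearMap.ext_ring; exact h l

theorem eq_of_supported {N : Type*} [AddCommMonoid N] [Module ℂ N] {s : Set (List I)}
    {f : List I →₀ ℂ} (hf : f ∈ Finsupp.supported ℂ ℂ s) (A B : (List I →₀ ℂ) →ₗ[ℂ] N)
    (h : ∀ a ∈ s, A (bv a) = B (bv a)) : A f = B f := by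
  rw [Finsupp.supported_eq_span_single] at hf
  refine LinearMap.eqOn_span (f := A) (g := B) ?_ hf
  rintro _ ⟨a, ha, rfl⟩
  exact h a ha

theorem eq_of_supported₂ {N : Type*} [AddCommMonoid N] [Module ℂ N] {s t : Set (List I)}
    {f g : List I →₀ ℂ} (hf : f ∈ Finsupp.supported ℂ ℂ s) (hg : g ∈ Finsupp.supported ℂ ℂ t)
    (A B : (List I →₀ ℂ) →ₗ[ℂ] (List I →₀ ℂ) →ₗ[ℂ] N)
    (h : ∀ a ∈ s, ∀ b ∈ t, A (bv a) (bv b) = B (bv a) (bv b)) : A f g = B f g :=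
  eq_of_supported (N := N) hf (A.flip g) (B.flip g) fun a ha =>
    eq_of_supported hg (A (bv a)) (B (bv a)) (h a ha)

theorem length_of_ends {n : ℕ} {l a : List I} (ha : a ∈ Ends n l) : a.length = n + 1 := ha.1

/-- The two pieces of a glued tuple. -/
theorem ends_glue {m n n' : ℕ} {l a b : List I} (hl : m < l.length)
    (ha : a ∈ Ends n (l.take (m + 1))) (hb : b ∈ Ends n' (l.drop m)) :
    ∃ (p q : List I) (c : I), p.length = n ∧ q.length = n' ∧ a = p ++ [c] ∧ b = c :: q := by
  obtain ⟨c, q, rfl⟩ := List.exists_cons_of_length_eq_add_one hb.1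
  obtain ⟨p, d, rfl⟩ := (List.eq_nil_or_concat' a).resolve_left (by
    rintro rfl; simpa using ha.1)
  have h1 := ha.2.2
  have h2 := hb.2.1
  have h3 : (l.take (m + 1)).getLast? = (l.drop m).head? := by
    rw [List.getLast?_take]
    simp [List.head?_drop, hl]
  have hdc : d = c := by
    rw [h3, ← h2] at h1
    simpa using h1
  subst hdc
  exact ⟨p, q, d, by simpa using ha.1, by simpa using hb.1, rfl, rfl⟩

theorem glue_take_drop {n : ℕ} (p q : List I) (c : I) (hp : p.length = n) :
    ((p ++ [c]) ++ (c :: q).tail).take (n + 1) = p ++ [c] ∧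
      ((p ++ [c]) ++ (c :: q).tail).drop n = c :: q := by
  subst hp
  constructor
  · rw [List.take_append_of_le_length (by simp), List.take_of_length_le (by simp)]
  · simp

theorem take_drop_length {l : List I} {m m' : ℕ} (h : l.length ≠ m + m' + 1) :
    (l.take (m + 1)).length ≠ m + 1 ∨ (l.drop m).length ≠ m' + 1 := by
  rw [List.length_take, List.length_drop]
  omega

theorem ten_eq_zero {n m n' m' : ℕ} {T S : Op I} (hT : T ∈ Bim n m) (hS : S ∈ Bim n' m')
    {l : List I} (h : l.length ≠ m + m' + 1) : ten m T S (bv l) = 0 := by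
  rw [ten_bv]
  rcases take_drop_length h with h | h
  · rw [hT.2 _ h, map_zero, LinearMap.zero_apply]
  · rw [hS.2 _ h, map_zero]

theorem ten_supported {n m n' m' : ℕ} {T S : Op I} (hT : T ∈ Bim n m) (hS : S ∈ Bim n' m')
    {l : List I} (h : l.length = m + m' + 1) :
    T (bv (l.take (m + 1))) ∈ Finsupp.supported ℂ ℂ (Ends n (l.take (m + 1))) ∧
      S (bv (l.drop m)) ∈ Finsupp.supported ℂ ℂ (Ends n' (l.drop m)) :=
  ⟨hT.1 _ (by rw [List.length_take]; omega), hS.1 _ (by rw [List.length_drop]; omega)⟩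

theorem bim_ten {n m n' m' : ℕ} {T S : Op I} (hT : T ∈ Bim n m) (hS : S ∈ Bim n' m') :
    ten m T S ∈ Bim (n + n') (m + m') := by
  refine ⟨fun l hl => ?_, fun l hl => ten_eq_zero hT hS hl⟩
  obtain ⟨h1, h2⟩ := ten_supported hT hS hl
  rw [ten_bv]
  have := eq_of_supported₂ h1 h2
    (glue.compr₂ (Submodule.mkQ (Finsupp.supported ℂ ℂ (Ends (n + n') l)))) 0 (by
      intro a ha b hb
      obtain ⟨p, q, c, hp, hq, rfl, rfl⟩ := ends_glue (by omega) ha hb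
      simp only [LinearMap.compr₂_apply, glue_bv, LinearMap.zero_apply]
      rw [Submodule.mkQ_apply, Submodule.Quotient.mk_eq_zero]
      refine Finsupp.single_mem_supported ℂ _ ⟨?_, ?_, ?_⟩
      · simp [hp, hq]; omega
      · have h := ha.2.1
        rw [List.head?_take, if_neg (by omega)] at h
        rw [← h]; simp
      · have h := hb.2.2
        rw [List.getLast?_drop, if_neg (by omega)] at h
        rw [← h]; simp [List.getLast?_append, List.getLast?_cons])
  simpa using this

theorem ten_comp {k n m k' n' m' : ℕ} {T' T S' S : Op I} (_hT' : T' ∈ Bim k n)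
    (hT : T ∈ Bim n m) (_hS' : S' ∈ Bim k' n') (hS : S ∈ Bim n' m') :
    ten n T' S' * ten m T S = ten m (T' * T) (S' * S) := by
  refine op_ext fun l => ?_
  change ten n T' S' (ten m T S (bv l)) = _
  by_cases hl : l.length = m + m' + 1
  · obtain ⟨h1, h2⟩ := ten_supported hT hS hl
    rw [ten_bv, ten_bv]
    exact eq_of_supported₂ h1 h2 (glue.compr₂ (ten n T' S')) (glue.compl₁₂ T' S') (by
      intro a ha b hb
      obtain ⟨p, q, c, hp, hq, rfl, rfl⟩ := ends_glue (by omega) ha hb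
      obtain ⟨e1, e2⟩ := glue_take_drop p q c hp
      rw [LinearMap.compr₂_apply, LinearMap.compl₁₂_apply, glue_bv, ten_bv, e1, e2])
  · rw [ten_eq_zero hT hS hl, map_zero, ten_bv]
    rcases take_drop_length hl with h | h
    · rw [Module.End.mul_apply, hT.2 _ h, map_zero, map_zero, LinearMap.zero_apply]
    · rw [Module.End.mul_apply, Module.End.mul_apply, hS.2 _ h, map_zero, map_zero]

theorem ten_apply {n m n' m' : ℕ} {T S : Op I} (hT : T ∈ Bim n m) (hS : S ∈ Bim n' m')
    (i j : List I) (hj : j.length = m + m' + 1) :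
    ten m T S (bv j) i =
      T (bv (j.take (m + 1))) (i.take (n + 1)) * S (bv (j.drop m)) (i.drop n) := by
  obtain ⟨h1, h2⟩ := ten_supported hT hS hj
  rw [ten_bv]
  exact eq_of_supported₂ h1 h2 (glue.compr₂ (Finsupp.lapply i))
    ((LinearMap.mul ℂ ℂ).compl₁₂ (Finsupp.lapply (i.take (n + 1))) (Finsupp.lapply (i.drop n))) (by
      intro a ha b hb
      obtain ⟨p, q, c, hp, hq, rfl, rfl⟩ := ends_glue (by omega) ha hb
      obtain ⟨e1, e2⟩ := glue_take_drop p q c hp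
      classical
      simp only [LinearMap.compr₂_apply, glue_bv, Finsupp.lapply_apply, LinearMap.compl₁₂_apply,
        LinearMap.mul_apply', Finsupp.single_apply]
      by_cases h : p ++ [c] ++ (c :: q).tail = i
      · subst h
        rw [e1, e2]; simp
      · rw [if_neg h]
        by_cases h3 : p ++ [c] = i.take (n + 1)
        · by_cases h4 : c :: q = i.drop n
          · exfalso
            apply h
            rw [h3, h4, List.tail_drop, List.take_append_drop]
          · simp [h4]
        · simp [h3])

theorem ten_assoc {n m n' m' n'' m'' : ℕ} {T S R : Op I} (hT : T ∈ Bim n m) (hS : S ∈ Bim n' m')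
    (hR : R ∈ Bim n'' m'') : ten (m + m') (ten m T S) R = ten m T (ten m' S R) := by
  refine op_ext fun l => ?_
  by_cases hl : l.length = m + m' + m'' + 1
  · rw [ten_bv, ten_bv, ten_bv, ten_bv]
    have t1 : (l.take (m + m' + 1)).take (m + 1) = l.take (m + 1) := by
      rw [List.take_take]; congr 1; omega
    have t2 : (l.take (m + m' + 1)).drop m = (l.drop m).take (m' + 1) := by
      rw [List.drop_take]; congr 1; omega
    have t3 : (l.drop m).drop m' = l.drop (m + m') := List.drop_drop
    rw [t1, t2, t3]
    have h1 := hT.1 (l.take (m + 1)) (by rw [List.length_take]; omega)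
    have h2 := hS.1 ((l.drop m).take (m' + 1)) (by
      rw [List.length_take, List.length_drop]; omega)
    have h3 := hR.1 (l.drop (m + m')) (by rw [List.length_drop]; omega)
    exact eq_of_supported h3 (glue (glue (T (bv (l.take (m + 1))))
        (S (bv ((l.drop m).take (m' + 1))))))
      ((glue (T (bv (l.take (m + 1))))).comp (glue (S (bv ((l.drop m).take (m' + 1)))))) (by
      intro c _
      exact eq_of_supported₂ h1 h2 (glue.compr₂ (glue.flip (bv c)))
        (glue.compl₂ (glue.flip (bv c))) (by
        intro a _ b hb
        obtain ⟨x, b, rfl⟩ := List.exists_cons_of_length_eq_add_one hb.1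
        simp [glue_bv]))
  · rw [ten_eq_zero (bim_ten hT hS) hR (by omega), ten_eq_zero hT (bim_ten hS hR) (by omega)]

/-- The identity operator of `I ^ 1`, i.e. the matrix of the bi-labeled graph `M 1 1`. -/
def unitOp : Op I := Finsupp.lift _ ℂ _ fun l => if l.length = 1 then bv l else 0

theorem unitOp_bv (l : List I) : unitOp (bv l) = if l.length = 1 then bv l else 0 := by
  simp [unitOp]

theorem unitOp_mem_bim : (unitOp : Op I) ∈ Bim 0 0 := by
  refine ⟨fun l hl => ?_, fun l hl => ?_⟩
  · rw [unitOp_bv, if_pos hl]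
    exact Finsupp.single_mem_supported ℂ _ ⟨hl, rfl, rfl⟩
  · rw [unitOp_bv, if_neg hl]

theorem unitOp_mul_self : (unitOp : Op I) * unitOp = unitOp := by
  refine op_ext fun l => ?_
  rw [Module.End.mul_apply, unitOp_bv]
  split_ifs with h
  · rw [unitOp_bv, if_pos h]
  · simp

theorem unit_ten {n m : ℕ} {T : Op I} (hT : T ∈ Bim n m) : ten 0 unitOp T = T := by
  refine op_ext fun l => ?_
  by_cases hl : l.length = m + 1
  · obtain ⟨x, l, rfl⟩ := List.exists_cons_of_length_eq_add_one hl
    rw [ten_bv, unitOp_bv, if_pos (by simp)]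
    exact eq_of_supported (hT.1 _ hl) (glue (bv [x])) LinearMap.id (by
      intro a ha
      obtain ⟨y, a, rfl⟩ := List.exists_cons_of_length_eq_add_one ha.1
      have : y = x := by simpa using ha.2.1
      simp [glue_bv, this])
  · rw [ten_eq_zero unitOp_mem_bim hT (by omega), hT.2 l hl]

theorem ten_unit {n m : ℕ} {T : Op I} (hT : T ∈ Bim n m) : ten m T unitOp = T := by
  refine op_ext fun l => ?_
  by_cases hl : l.length = m + 1
  · have h1 : l.take (m + 1) = l := List.take_of_length_le hl.le
    have h2 : (l.drop m).length = 1 := by rw [List.length_drop]; omega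
    rw [ten_bv, unitOp_bv, if_pos h2, h1]
    exact eq_of_supported (hT.1 _ hl) (glue.flip (bv (l.drop m))) LinearMap.id (by
      intro a ha
      obtain ⟨y, hy⟩ := List.length_eq_one_iff.1 h2
      simp [glue_bv, hy])
  · rw [ten_eq_zero hT unitOp_mem_bim (by omega), hT.2 l hl]

/-- The operators `T` and `S` are each other's adjoint: their matrices are conjugate transposes. -/
def OpAdj (T S : Op I) : Prop := ∀ i j : List I, S (bv j) i = star (T (bv i) j)

theorem unitOp_selfAdj : OpAdj (unitOp : Op I) unitOp := by
  classical
  intro i j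
  rw [unitOp_bv, unitOp_bv]
  by_cases h : i = j
  · subst h; split_ifs <;> simp
  · split_ifs <;> simp [h, Ne.symm h]

theorem bim_apply_eq_zero {n m : ℕ} {T : Op I} (hT : T ∈ Bim n m) {i j : List I}
    (h : i.length ≠ n + 1) : T (bv j) i = 0 := by
  by_cases hj : j.length = m + 1
  · by_contra h0
    exact h (Finsupp.mem_supported _ _ |>.1 (hT.1 j hj) (Finsupp.mem_support_iff.2 h0)).1
  · rw [hT.2 j hj]; rfl

theorem ten_adj {n m n' m' : ℕ} {T T' S S' : Op I} (hT : T ∈ Bim n m) (hT' : T' ∈ Bim m n)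
    (hS : S ∈ Bim n' m') (hS' : S' ∈ Bim m' n') (h : OpAdj T T') (h' : OpAdj S S') :
    OpAdj (ten m T S) (ten n T' S') := by
  intro i j
  by_cases hj : j.length = n + n' + 1
  · by_cases hi : i.length = m + m' + 1
    · rw [ten_apply hT' hS' i j hj, ten_apply hT hS j i hi, h, h', star_mul']
    · rw [ten_eq_zero hT hS hi, bim_apply_eq_zero (bim_ten hT' hS') hi]; simp
  · rw [ten_eq_zero hT' hS' hj, bim_apply_eq_zero (bim_ten hT hS) hj]; simp

variable (Pi : SimpleGraph I)

theorem homMat_mem_bim [Pi.LocallyFinite] {n m : ℕ} {K : BiLabeledGraph} (hK : IsL n m K) :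
    homMat Pi K ∈ Bim n m := by
  refine ⟨fun l hl => ?_, fun l hl => homMat_bv_of_length Pi (by rwa [hK.length_y])⟩
  have := finite_fib Pi hK l
  have := Fintype.ofFinite (Fib Pi K l)
  rw [homMat_bv, finsum_eq_sum_of_fintype]
  refine Submodule.sum_mem _ fun φ _ => Finsupp.single_mem_supported ℂ _ ⟨?_, ?_, ?_⟩
  · rw [List.length_map, hK.length_x]
  · have h := congrArg List.head? φ.2.2
    rw [List.head?_map] at h
    rw [List.head?_map, hK.head, h]
  · have h := congrArg List.getLast? φ.2.2
    rw [List.getLast?_map] at h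
    rw [List.getLast?_map, hK.last, h]

theorem mor_le_bim [Pi.LocallyFinite] (n m : ℕ) : Mor Pi n m ≤ Bim n m :=
  Submodule.span_le.2 (by
    rintro _ ⟨K, hK, rfl⟩
    exact homMat_mem_bim Pi hK)

theorem mor_mul [Pi.LocallyFinite] {n k m : ℕ} {S T : Op I} (hS : S ∈ Mor Pi n k)
    (hT : T ∈ Mor Pi k m) : S * T ∈ Mor Pi n m := by
  refine Submodule.span_induction₂ (p := fun S T _ _ => S * T ∈ Mor Pi n m) ?_ ?_ ?_ ?_ ?_ ?_ ?_
    hS hT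
  · rintro _ _ ⟨K, hK, rfl⟩ ⟨K', hK', rfl⟩
    rw [← homMat_comp Pi (by rw [hK.length_y, hK'.length_x]) (finite_fib Pi hK)
      (finite_fib Pi hK')]
    exact Submodule.subset_span ⟨_, hK.comp hK', rfl⟩
  · intro x _; rw [zero_mul]; exact Submodule.zero_mem _
  · intro x _; rw [mul_zero]; exact Submodule.zero_mem _
  · intro x y z _ _ _ h h'; rw [add_mul]; exact Submodule.add_mem _ h h'
  · intro x y z _ _ _ h h'; rw [mul_add]; exact Submodule.add_mem _ h h'
  · intro c x y _ _ h; rw [smul_mul_assoc]; exact Submodule.smul_mem _ c h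
  · intro c x y _ _ h; rw [mul_smul_comm]; exact Submodule.smul_mem _ c h

theorem homMat_relTensor [Pi.LocallyFinite] {n m n' m' : ℕ} {K K' : BiLabeledGraph}
    (hK : IsL n m K) (hK' : IsL n' m' K') :
    homMat Pi (relTensor n m n' m' K K') = ten m (homMat Pi K) (homMat Pi K') := by
  have hf := finite_fib Pi hK
  have hf' := finite_fib Pi hK'
  have hp : ∀ l, Finite (Fib Pi (pad n n') l) := fun l =>
    have := subsingleton_fib_pad Pi n n' l
    inferInstance
  have hp' : ∀ l, Finite (Fib Pi (pad m m').transpose l) := fun l =>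
    have := subsingleton_fib_pad_transpose Pi m m' l
    inferInstance
  have ht := finite_fib_tensor Pi hf hf'
  have hB := homMat_mem_bim Pi hK
  have hB' := homMat_mem_bim Pi hK'
  have hl2 := relTensor_length₂ hK hK'
  rw [relTensor, homMat_comp Pi (relTensor_length₁ hK hK') hp (finite_fib_comp Pi hl2 ht hp'),
    homMat_comp Pi hl2 ht hp']
  refine op_ext fun l => ?_
  rw [Module.End.mul_apply, Module.End.mul_apply]
  by_cases hl : l.length = m + m' + 1
  · obtain ⟨h1, h2⟩ := ten_supported hB hB' hl
    obtain ⟨p, q, c, hpm, hqm, e1, e2⟩ := ends_glue (n := m) (n' := m') (l := l) (by omega)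
      (⟨by rw [List.length_take]; omega, rfl, rfl⟩ : l.take (m + 1) ∈ Ends m (l.take (m + 1)))
      (⟨by rw [List.length_drop]; omega, rfl, rfl⟩ : l.drop m ∈ Ends m' (l.drop m))
    have hpq : l = p ++ c :: q := by
      have h3 := List.take_append_drop (m + 1) l
      have h4 : l.drop (m + 1) = q := by rw [← List.tail_drop, e2]; rfl
      rw [e1, h4] at h3
      rw [← h3]; simp
    have s : p ++ c :: c :: q = (p ++ [c]) ++ (c :: q) := by simp
    rw [ten_bv]
    rw [e1] at h1 ⊢
    rw [e2] at h2 ⊢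
    have := homMat_pad_transpose Pi p c q
    rw [hpm, hqm] at this
    rw [hpq, this, s, homMat_tensor Pi hf hf' (by rw [hK.length_y]; simp [hpm])]
    refine eq_of_supported₂ h1 h2 (app.compr₂ (homMat Pi (pad n n'))) glue ?_
    intro a ha b hb
    rw [← e1] at ha
    rw [← e2] at hb
    obtain ⟨p', q', c', hp', hq', rfl, rfl⟩ := ends_glue (by omega) ha hb
    rw [LinearMap.compr₂_apply, app_bv, glue_bv]
    have := homMat_pad Pi p' c' q'
    rw [hp', hq'] at this
    have s : (p' ++ [c']) ++ (c' :: q') = p' ++ c' :: c' :: q' := by simp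
    have s' : (p' ++ [c']) ++ (c' :: q').tail = p' ++ c' :: q' := by simp
    rw [s, s', this]
  · rw [ten_eq_zero hB hB' hl, homMat_bv_of_length, map_zero, map_zero]
    intro h
    apply hl
    rw [h]
    change (pad m m').x.length = _
    rw [pad_length_x]; omega

theorem mor_ten [Pi.LocallyFinite] {n m n' m' : ℕ} {T S : Op I} (hT : T ∈ Mor Pi n m)
    (hS : S ∈ Mor Pi n' m') : ten m T S ∈ Mor Pi (n + n') (m + m') := by
  refine Submodule.span_induction₂ (p := fun S T _ _ => ten m S T ∈ Mor Pi (n + n') (m + m'))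
    ?_ ?_ ?_ ?_ ?_ ?_ ?_ hT hS
  · rintro _ _ ⟨K, hK, rfl⟩ ⟨K', hK', rfl⟩
    rw [← homMat_relTensor Pi hK hK']
    exact Submodule.subset_span ⟨_, isL_relTensor hK hK', rfl⟩
  · intro x _; rw [map_zero, LinearMap.zero_apply]; exact Submodule.zero_mem _
  · intro x _; rw [map_zero]; exact Submodule.zero_mem _
  · intro x y z _ _ _ h h'; rw [map_add, LinearMap.add_apply]; exact Submodule.add_mem _ h h'
  · intro x y z _ _ _ h h'; rw [map_add]; exact Submodule.add_mem _ h h'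
  · intro c x y _ _ h; rw [map_smul, LinearMap.smul_apply]; exact Submodule.smul_mem _ c h
  · intro c x y _ _ h; rw [map_smul]; exact Submodule.smul_mem _ c h

theorem isL_one : IsL 0 0 (M 1 1) where
  planar := planarGraphs_isGraphCategory.one_mem
  connected := ⟨⟨()⟩, fun _ _ => .refl⟩
  length_x := rfl
  length_y := rfl
  head := rfl
  last := rfl

theorem homMat_one : homMat Pi (M 1 1) = unitOp := by
  refine op_ext fun l => ?_
  rw [unitOp_bv]
  split_ifs with h
  · obtain ⟨c, rfl⟩ := List.length_eq_one_iff.1 h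
    let g : Fib Pi (M 1 1) [c] := ⟨fun _ => c, fun _ _ h => h.elim, rfl⟩
    have hg : ∀ φ : Fib Pi (M 1 1) [c], φ = g := fun φ =>
      Subtype.ext (funext fun _ => List.cons.inj φ.2.2 |>.1)
    have : Unique (Fib Pi (M 1 1) [c]) := { default := g, uniq := hg }
    rw [homMat_bv, finsum_unique, hg default]
    rfl
  · exact homMat_bv_of_length Pi h

theorem unitOp_mem : unitOp ∈ Mor Pi 0 0 :=
  Submodule.subset_span ⟨_, isL_one, (homMat_one Pi).symm⟩

end Operators

/-! ### The unitary tensor category of planar bi-labeled graphs -/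

section PlanarCategory

universe w

/-- Objects of the unitary tensor category: formal finite direct sums of self-adjoint projections
`p i` in `Mor (n i) (n i)`. -/
structure PlanarObj {I : Type w} (Pi : SimpleGraph I) where
  ι : Type
  [fin : Fintype ι]
  [dec : DecidableEq ι]
  n : ι → ℕ
  p : ι → Op I
  mem : ∀ i, p i ∈ Mor Pi (n i) (n i)
  idem : ∀ i, p i * p i = p i
  selfAdj : ∀ i, OpAdj (p i) (p i)

attribute [instance] PlanarObj.fin PlanarObj.dec

namespace PlanarObj

variable {I : Type w} {Pi : SimpleGraph I}

/-- The morphisms between two formal direct sums: matrices `T` of operators with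
`T j i` in `q j * Mor (m j) (n i) * p i`. -/
def homs (X Y : PlanarObj Pi) : Submodule ℂ (Y.ι → X.ι → Op I) where
  carrier := {T | ∀ j i, T j i ∈ Mor Pi (Y.n j) (X.n i) ∧ Y.p j * T j i = T j i ∧
    T j i * X.p i = T j i}
  zero_mem' j i := ⟨Submodule.zero_mem _, mul_zero _, zero_mul _⟩
  add_mem' {S T} hS hT j i := ⟨Submodule.add_mem _ (hS j i).1 (hT j i).1, by
    simp only [_root_.Pi.add_apply, mul_add, (hS j i).2.1, (hT j i).2.1], by
    simp only [_root_.Pi.add_apply, add_mul, (hS j i).2.2, (hT j i).2.2]⟩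
  smul_mem' c T hT j i := ⟨Submodule.smul_mem _ c (hT j i).1, by
    simp only [_root_.Pi.smul_apply, mul_smul_comm, (hT j i).2.1], by
    simp only [_root_.Pi.smul_apply, smul_mul_assoc, (hT j i).2.2]⟩

/-- The matrix of the isomorphism identifying equal summands along a bijection. -/
def perm {X Y : PlanarObj Pi} (e : X.ι ≃ Y.ι) : Y.ι → X.ι → Op I :=
  fun j i => if j = e i then X.p i else 0

theorem perm_mem {X Y : PlanarObj Pi} (e : X.ι ≃ Y.ι) (hn : ∀ i, Y.n (e i) = X.n i)
    (hp : ∀ i, Y.p (e i) = X.p i) : perm e ∈ homs X Y := fun j i => by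
  unfold perm
  split_ifs with h
  · subst h
    exact ⟨hn i ▸ X.mem i, by rw [hp, X.idem], X.idem i⟩
  · exact ⟨Submodule.zero_mem _, mul_zero _, zero_mul _⟩

/-- Composition of matrices of operators. -/
def compMat {X Y Z : PlanarObj Pi} (S : Z.ι → Y.ι → Op I) (T : Y.ι → X.ι → Op I) :
    Z.ι → X.ι → Op I := fun k i => ∑ j, S k j * T j i

theorem compMat_mem [Pi.LocallyFinite] {X Y Z : PlanarObj Pi} {S : Z.ι → Y.ι → Op I} {T : Y.ι → X.ι → Op I}
    (hS : S ∈ homs Y Z) (hT : T ∈ homs X Y) : compMat S T ∈ homs X Z := fun k i => by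
  refine ⟨Submodule.sum_mem _ fun j _ => mor_mul Pi (hS k j).1 (hT j i).1, ?_, ?_⟩
  · simp only [compMat, Finset.mul_sum, ← mul_assoc, (hS k _).2.1]
  · simp only [compMat, Finset.sum_mul, mul_assoc, (hT _ i).2.2]

theorem compMat_perm {X Y Z : PlanarObj Pi} {S : Z.ι → Y.ι → Op I} (hS : S ∈ homs Y Z)
    (e : X.ι ≃ Y.ι) (hp : ∀ i, Y.p (e i) = X.p i) :
    compMat S (perm (X := X) (Y := Y) e) = fun k i => S k (e i) := by
  funext k i
  simp only [compMat, perm, mul_ite, mul_zero, Finset.sum_ite_eq', Finset.mem_univ, if_true]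
  rw [← hp, (hS k (e i)).2.2]

theorem perm_perm {X Y Z : PlanarObj Pi} (e : X.ι ≃ Y.ι) (e' : Y.ι ≃ Z.ι)
    (hp : ∀ i, Y.p (e i) = X.p i) :
    compMat (perm (X := Y) (Y := Z) e') (perm (X := X) (Y := Y) e) = perm (e.trans e') := by
  funext k i
  simp only [compMat, perm, mul_ite, mul_zero, Finset.sum_ite_eq', Finset.mem_univ, if_true,
    ite_mul, zero_mul, hp, X.idem, Equiv.trans_apply]
  rfl

theorem perm_compMat {X Y Z : PlanarObj Pi} {T : Y.ι → X.ι → Op I} (hT : T ∈ homs X Y)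
    (e : Y.ι ≃ Z.ι) : compMat (perm (X := Y) (Y := Z) e) T = fun k i => T (e.symm k) i := by
  funext k i
  have : ∀ j, (k = e j) = (e.symm k = j) := fun j => propext (by rw [Equiv.symm_apply_eq])
  simp only [compMat, perm, ite_mul, zero_mul, this, Finset.sum_ite_eq, Finset.mem_univ, if_true,
    (hT _ i).2.1]

variable [Pi.LocallyFinite]

instance : Category (PlanarObj Pi) where
  Hom X Y := homs X Y
  id X := ⟨perm (Equiv.refl X.ι), perm_mem _ (fun _ => rfl) (fun _ => rfl)⟩
  comp f g := ⟨compMat g.1 f.1, compMat_mem g.2 f.2⟩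
  id_comp f := Subtype.ext (compMat_perm f.2 _ fun _ => rfl)
  comp_id f := Subtype.ext (perm_compMat f.2 _)
  assoc f g h := Subtype.ext (by
    funext l i
    simp only [compMat, Finset.mul_sum, Finset.sum_mul, mul_assoc]
    exact Finset.sum_comm)

/-- The matrix of operators of a morphism. -/
def mat {X Y : PlanarObj Pi} (f : X ⟶ Y) : Y.ι → X.ι → Op I := f.1

theorem mat_mem {X Y : PlanarObj Pi} (f : X ⟶ Y) : mat f ∈ homs X Y := f.2

theorem hom_ext {X Y : PlanarObj Pi} {f g : X ⟶ Y} (h : mat f = mat g) : f = g := Subtype.ext h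

theorem mat_comp {X Y Z : PlanarObj Pi} (f : X ⟶ Y) (g : Y ⟶ Z) :
    mat (f ≫ g) = compMat (mat g) (mat f) := rfl

theorem mat_id (X : PlanarObj Pi) : mat (𝟙 X) = perm (Equiv.refl X.ι) := rfl

instance : Preadditive (PlanarObj Pi) where
  homGroup X Y := Module.addCommMonoidToAddCommGroup ℂ (M := homs X Y)
  add_comp _ _ _ f f' g := Subtype.ext (by
    funext k i
    exact (Finset.sum_congr rfl fun j _ => mul_add (g.1 k j) (f.1 j i) (f'.1 j i)).trans
      Finset.sum_add_distrib)
  comp_add _ _ _ f g g' := Subtype.ext (by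
    funext k i
    exact (Finset.sum_congr rfl fun j _ => add_mul (g.1 k j) (g'.1 k j) (f.1 j i)).trans
      Finset.sum_add_distrib)

instance : Linear ℂ (PlanarObj Pi) where
  homModule X Y := inferInstanceAs (Module ℂ (homs X Y))
  smul_comp _ _ _ r f g := Subtype.ext (by
    funext k i
    exact (Finset.sum_congr rfl fun j _ => mul_smul_comm r (g.1 k j) (f.1 j i)).trans
      Finset.smul_sum.symm)
  comp_smul _ _ _ f r g := Subtype.ext (by
    funext k i
    exact (Finset.sum_congr rfl fun j _ => smul_mul_assoc r (g.1 k j) (f.1 j i)).trans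
      Finset.smul_sum.symm)

/-- The morphisms `f` and `g` are each other's adjoint. -/
def IsAdj {X Y : PlanarObj Pi} (f : X ⟶ Y) (g : Y ⟶ X) : Prop :=
  ∀ i j, OpAdj (mat f j i) (mat g i j)

/-- The tensor product of objects, given by the relative tensor products of projections. -/
def tensor (X Y : PlanarObj Pi) : PlanarObj Pi where
  ι := X.ι × Y.ι
  n i := X.n i.1 + Y.n i.2
  p i := ten (X.n i.1) (X.p i.1) (Y.p i.2)
  mem i := mor_ten Pi (X.mem i.1) (Y.mem i.2)
  idem i := by
    have h1 := mor_le_bim Pi _ _ (X.mem i.1)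
    have h2 := mor_le_bim Pi _ _ (Y.mem i.2)
    rw [ten_comp h1 h1 h2 h2, X.idem, Y.idem]
  selfAdj i := by
    have h1 := mor_le_bim Pi _ _ (X.mem i.1)
    have h2 := mor_le_bim Pi _ _ (Y.mem i.2)
    exact ten_adj h1 h1 h2 h2 (X.selfAdj i.1) (Y.selfAdj i.2)

/-- The unit object, given by the identity operator in `Mor 0 0`. -/
def unit : PlanarObj Pi where
  ι := Unit
  n _ := 0
  p _ := unitOp
  mem _ := unitOp_mem Pi
  idem _ := unitOp_mul_self
  selfAdj _ := unitOp_selfAdj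

/-- The tensor product of matrices of operators. -/
def tenMat {X Y X' Y' : PlanarObj Pi} (T : Y.ι → X.ι → Op I) (S : Y'.ι → X'.ι → Op I) :
    (tensor Y Y').ι → (tensor X X').ι → Op I :=
  fun j i => ten (X.n i.1) (T j.1 i.1) (S j.2 i.2)

theorem tenMat_mem {X Y X' Y' : PlanarObj Pi} {T : Y.ι → X.ι → Op I} {S : Y'.ι → X'.ι → Op I}
    (hT : T ∈ homs X Y) (hS : S ∈ homs X' Y') :
    tenMat (X := X) (Y := Y) (X' := X') (Y' := Y') T S ∈ homs (tensor X X') (tensor Y Y') :=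
  fun j i => by
    have hT' := mor_le_bim Pi _ _ (hT j.1 i.1).1
    have hS' := mor_le_bim Pi _ _ (hS j.2 i.2).1
    refine ⟨mor_ten Pi (hT j.1 i.1).1 (hS j.2 i.2).1, ?_, ?_⟩
    · exact (ten_comp (mor_le_bim Pi _ _ (Y.mem j.1)) hT' (mor_le_bim Pi _ _ (Y'.mem j.2))
        hS').trans (by rw [(hT j.1 i.1).2.1, (hS j.2 i.2).2.1]; rfl)
    · exact (ten_comp hT' (mor_le_bim Pi _ _ (X.mem i.1)) hS'
        (mor_le_bim Pi _ _ (X'.mem i.2))).trans (by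
          rw [(hT j.1 i.1).2.2, (hS j.2 i.2).2.2]; rfl)

/-- A bijection identifying equal summands is an isomorphism. -/
def permIso {X Y : PlanarObj Pi} (e : X.ι ≃ Y.ι) (hn : ∀ i, Y.n (e i) = X.n i)
    (hp : ∀ i, Y.p (e i) = X.p i) : X ≅ Y where
  hom := ⟨perm e, perm_mem e hn hp⟩
  inv := ⟨perm e.symm, perm_mem e.symm (fun i => by rw [← hn, e.apply_symm_apply])
    (fun i => by rw [← hp, e.apply_symm_apply])⟩
  hom_inv_id := Subtype.ext ((perm_compMat (perm_mem e hn hp) e.symm).trans (by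
    funext j i
    change (if e j = e i then X.p i else 0) = if j = i then X.p i else 0
    simp only [e.apply_eq_iff_eq]))
  inv_hom_id := Subtype.ext ((perm_compMat (perm_mem e.symm
    (fun i => by rw [← hn, e.apply_symm_apply]) (fun i => by rw [← hp, e.apply_symm_apply]))
      e).trans (by
    funext j i
    change (if e.symm j = e.symm i then Y.p i else 0) = if j = i then Y.p i else 0
    simp only [e.symm.apply_eq_iff_eq]))

theorem mat_permIso {X Y : PlanarObj Pi} (e : X.ι ≃ Y.ι) (hn : ∀ i, Y.n (e i) = X.n i)
    (hp : ∀ i, Y.p (e i) = X.p i) : mat (permIso e hn hp).hom = perm e := rfl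

/-- Canonical bijections between index sets. -/
def assocE (X Y Z : PlanarObj Pi) : (tensor (tensor X Y) Z).ι ≃ (tensor X (tensor Y Z)).ι :=
  Equiv.prodAssoc X.ι Y.ι Z.ι
/-- See `assocE`. -/
def leftE (X : PlanarObj Pi) : (tensor unit X).ι ≃ X.ι := Equiv.punitProd X.ι
/-- See `assocE`. -/
def rightE (X : PlanarObj Pi) : (tensor X unit).ι ≃ X.ι := Equiv.prodPUnit X.ι
/-- See `assocE`. -/
def tensorE {X Y X' Y' : PlanarObj Pi} (e : X.ι ≃ Y.ι) (e' : X'.ι ≃ Y'.ι) :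
    (tensor X X').ι ≃ (tensor Y Y').ι := e.prodCongr e'

theorem assoc_p (X Y Z : PlanarObj Pi) (i : (tensor (tensor X Y) Z).ι) :
    (tensor X (tensor Y Z)).p (assocE X Y Z i) = (tensor (tensor X Y) Z).p i :=
  (ten_assoc (mor_le_bim Pi _ _ (X.mem _)) (mor_le_bim Pi _ _ (Y.mem _))
    (mor_le_bim Pi _ _ (Z.mem _))).symm

instance : MonoidalCategoryStruct (PlanarObj Pi) where
  tensorObj := tensor
  tensorUnit := unit
  tensorHom f g := ⟨tenMat (mat f) (mat g), tenMat_mem f.2 g.2⟩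
  whiskerLeft X _ _ f := ⟨tenMat (mat (𝟙 X)) (mat f), tenMat_mem (𝟙 X : X ⟶ X).2 f.2⟩
  whiskerRight f Y := ⟨tenMat (mat f) (mat (𝟙 Y)), tenMat_mem f.2 (𝟙 Y : Y ⟶ Y).2⟩
  associator X Y Z := permIso (assocE X Y Z) (fun _ => (add_assoc _ _ _).symm) (assoc_p X Y Z)
  leftUnitor X := permIso (leftE X)
    (fun _ => (zero_add _).symm) (fun i => (unit_ten (mor_le_bim Pi _ _ (X.mem i.2))).symm)
  rightUnitor X := permIso (rightE X)
    (fun _ => rfl) (fun i => (ten_unit (mor_le_bim Pi _ _ (X.mem i.1))).symm)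

theorem tenMat_perm {X Y X' Y' : PlanarObj Pi} (e : X.ι ≃ Y.ι) (e' : X'.ι ≃ Y'.ι) :
    tenMat (perm (X := X) (Y := Y) e) (perm (X := X') (Y := Y') e') =
      perm (tensorE e e') := by
  funext j i
  obtain ⟨j, j'⟩ := j
  obtain ⟨i, i'⟩ := i
  change ten (X.n i) (if j = e i then X.p i else 0) (if j' = e' i' then X'.p i' else 0) =
    if (j, j') = (e i, e' i') then ten (X.n i) (X.p i) (X'.p i') else 0
  by_cases h : j = e i
  · by_cases h' : j' = e' i'
    · simp [h, h']
    · simp [h, h']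
  · simp [h]

theorem tenMat_comp {X Y Z X' Y' Z' : PlanarObj Pi} (f : X ⟶ Y) (g : Y ⟶ Z) (f' : X' ⟶ Y')
    (g' : Y' ⟶ Z') :
    compMat (tenMat (mat g) (mat g')) (tenMat (mat f) (mat f')) =
      tenMat (X := X) (X' := X') (compMat (mat g) (mat f)) (compMat (mat g') (mat f')) := by
  funext k i
  obtain ⟨k, k'⟩ := k
  obtain ⟨i, i'⟩ := i
  change ∑ j : Y.ι × Y'.ι, ten (Y.n j.1) (mat g k j.1) (mat g' k' j.2) *
      ten (X.n i) (mat f j.1 i) (mat f' j.2 i') =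
    ten (X.n i) (∑ j, mat g k j * mat f j i) (∑ j, mat g' k' j * mat f' j i')
  rw [LinearMap.map_sum₂, Fintype.sum_prod_type]
  refine Finset.sum_congr rfl fun j _ => ?_
  rw [map_sum]
  refine Finset.sum_congr rfl fun j' _ => ?_
  exact ten_comp (mor_le_bim Pi _ _ (mat_mem g k j).1) (mor_le_bim Pi _ _ (mat_mem f j i).1)
    (mor_le_bim Pi _ _ (mat_mem g' k' j').1) (mor_le_bim Pi _ _ (mat_mem f' j' i').1)

open scoped MonoidalCategory

theorem mat_tensorHom {X Y X' Y' : PlanarObj Pi} (f : X ⟶ Y) (g : X' ⟶ Y') :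
    mat (f ⊗ₘ g) = tenMat (mat f) (mat g) := rfl

theorem triangle_mat (X Y : PlanarObj Pi) :
    compMat (tenMat (perm (Equiv.refl X.ι)) (perm (leftE Y))) (perm (assocE X unit Y)) =
      tenMat (perm (rightE X)) (perm (Equiv.refl Y.ι)) := by
  rw [tenMat_perm, tenMat_perm, perm_perm _ _ (assoc_p X unit Y)]
  rfl

theorem assoc_tensor_p (W X Y Z : PlanarObj Pi) (i : (tensor (tensor (tensor W X) Y) Z).ι) :
    (tensor (tensor W (tensor X Y)) Z).p (tensorE (assocE W X Y) (Equiv.refl Z.ι) i) =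
      (tensor (tensor (tensor W X) Y) Z).p i := by
  obtain ⟨⟨⟨i, j⟩, k⟩, l⟩ := i
  have h := assoc_p W X Y ((i, j), k)
  change ten (W.n i + (X.n j + Y.n k)) ((tensor W (tensor X Y)).p (assocE W X Y ((i, j), k)))
    (Z.p l) = ten (W.n i + X.n j + Y.n k) _ (Z.p l)
  rw [h, add_assoc]

theorem pentagon_mat (W X Y Z : PlanarObj Pi) :
    compMat (compMat (tenMat (perm (Equiv.refl W.ι)) (perm (assocE X Y Z)))
        (perm (assocE W (tensor X Y) Z)))
      (tenMat (perm (assocE W X Y)) (perm (Equiv.refl Z.ι))) =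
    compMat (perm (assocE W X (tensor Y Z))) (perm (assocE (tensor W X) Y Z)) := by
  rw [tenMat_perm, tenMat_perm, perm_perm _ _ (assoc_p W (tensor X Y) Z),
    perm_perm _ _ (assoc_tensor_p W X Y Z),
    perm_perm _ _ (assoc_p (tensor W X) Y Z)]
  rfl

/-- The tensor category `𝒞(𝒫, Pi)`. -/
instance : MonoidalCategory (PlanarObj Pi) :=
  MonoidalCategory.ofTensorHom
    (id_tensorHom_id := fun X Y => hom_ext (tenMat_perm (Equiv.refl X.ι) (Equiv.refl Y.ι)))
    (id_tensorHom := fun _ _ _ _ => rfl)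
    (tensorHom_id := fun _ _ => rfl)
    (tensorHom_comp_tensorHom := fun f₁ f₂ g₁ g₂ => hom_ext (tenMat_comp f₁ g₁ f₂ g₂))
    (associator_naturality := fun {X₁ X₂ X₃ Y₁ Y₂ Y₃} f₁ f₂ f₃ => hom_ext (by
      refine (perm_compMat (mat_mem ((f₁ ⊗ₘ f₂) ⊗ₘ f₃)) (assocE Y₁ Y₂ Y₃)).trans (Eq.trans ?_
        (compMat_perm (mat_mem (f₁ ⊗ₘ (f₂ ⊗ₘ f₃))) (assocE X₁ X₂ X₃) (assoc_p X₁ X₂ X₃)).symm)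
      funext k i
      exact ten_assoc (mor_le_bim Pi _ _ (mat_mem f₁ _ _).1)
        (mor_le_bim Pi _ _ (mat_mem f₂ _ _).1) (mor_le_bim Pi _ _ (mat_mem f₃ _ _).1)))
    (leftUnitor_naturality := fun {X Y} f => hom_ext (by
      refine (perm_compMat (Z := Y) (mat_mem (𝟙 (𝟙_ (PlanarObj Pi)) ⊗ₘ f))
        (leftE Y)).trans (Eq.trans ?_
        (compMat_perm (X := tensor unit X) (mat_mem f) (leftE X)
          (fun i => (unit_ten (mor_le_bim Pi _ _ (X.mem i.2))).symm)).symm)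
      funext k i
      exact unit_ten (mor_le_bim Pi _ _ (mat_mem f _ _).1)))
    (rightUnitor_naturality := fun {X Y} f => hom_ext (by
      refine (perm_compMat (Z := Y) (mat_mem (f ⊗ₘ 𝟙 (𝟙_ (PlanarObj Pi))))
        (rightE Y)).trans (Eq.trans ?_
        (compMat_perm (X := tensor X unit) (mat_mem f) (rightE X)
          (fun i => (ten_unit (mor_le_bim Pi _ _ (X.mem i.1))).symm)).symm)
      funext k i
      exact ten_unit (mor_le_bim Pi _ _ (mat_mem f _ _).1)))
    (pentagon := fun W X Y Z => hom_ext (pentagon_mat W X Y Z))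
    (triangle := fun X Y => hom_ext (triangle_mat X Y))

end PlanarObj

end PlanarCategory

/-! ### The fundamental representation, the path projection and partitions -/

/-- The fundamental representation of a compact quantum group given by a presentation. -/
def Presentation.fund {X : Type} [Fintype X] [DecidableEq X] (P : Presentation X) : URep P.O where
  ι := X
  U := P.u
  unitary_left := UnivAlg.sum_left
  unitary_right := UnivAlg.sum_right
  comul_U := P.comul_u

open Classical in
/-- The object of `𝒞(𝒫, Pi)` given by the orthogonal projection onto the paths of length one. -/
structure PlanarObj.IsPathObj {I : Type*} {Pi : SimpleGraph I} (E : PlanarObj Pi) : Prop where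
  card : Fintype.card E.ι = 1
  n_eq : ∀ i, E.n i = 1
  p_pair : ∀ i a b, E.p i (bv [a, b]) = if Pi.Adj a b then bv [a, b] else 0
  p_other : ∀ i l, l.length ≠ 2 → E.p i (bv l) = 0

/-- An equivalence of unitary tensor categories from `𝒞(𝒫, Pi)` to the representation category of
a compact quantum group: a monoidal equivalence that is linear and compatible with adjoints and
whose structure isomorphisms are unitary. -/
structure IsUnitaryTensorEquivalence {I : Type*} {Pi : SimpleGraph I} [Pi.LocallyFinite]
    {A : Type} [Ring A] [StarRing A] [Bialgebra ℂ A] (F : PlanarObj Pi ⥤ URep A) [F.Monoidal] :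
    Prop where
  equivalence : F.IsEquivalence
  additive : F.Additive
  linear : F.Linear ℂ
  map_adj : ∀ (X Y : PlanarObj Pi) (f : X ⟶ Y) (g : Y ⟶ X),
    PlanarObj.IsAdj f g → URep.IsAdj (F.map f) (F.map g)
  unitary_unit : URep.IsAdj (Functor.Monoidal.εIso F).hom (Functor.Monoidal.εIso F).inv
  unitary_tensor : ∀ X Y : PlanarObj Pi,
    URep.IsAdj (Functor.Monoidal.μIso F X Y).hom (Functor.Monoidal.μIso F X Y).inv

/-- Positions around a circle of `n` upper points (numbered from left to right) and `m` lower points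
(numbered from right to left). -/
def circlePos {n m : ℕ} : Fin n ⊕ Fin m → ℕ
  | .inl a => a
  | .inr b => n + (m - 1 - b)

/-- Noncrossing partitions of `n` upper points and `m` lower points in which each block contains an
even number of points. -/
structure IsNoncrossingEven {n m : ℕ} (p : Setoid (Fin n ⊕ Fin m)) : Prop where
  noncrossing : ∀ a b c e, circlePos a < circlePos b → circlePos b < circlePos c →
    circlePos c < circlePos e → p a c → p b e → p a b
  even : ∀ a, Even (Nat.card {b // p a b})

open Classical in
/-- The matrix of a partition: the entry at `(s, t)` is `1` if the labeling of the upper points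
by `s` and of the lower points by `t` is constant on blocks, and `0` otherwise. -/
def partitionMatrix (d : ℕ) {n m : ℕ} (p : Setoid (Fin n ⊕ Fin m)) :
    Matrix (Fin n → Fin d) (Fin m → Fin d) ℂ :=
  fun s t => if ∀ a b, p a b → Sum.elim s t a = Sum.elim s t b then 1 else 0

end PlanarQ

end

noncomputable section

set_option linter.unusedSectionVars false
set_option linter.unusedSimpArgs false

namespace PlanarQ

open Algebra.TensorProduct (includeLeft includeRight map_tmul tmul_mul_tmul)
open Equiv (Perm coe_fn_mk sum_comp)
open Fin (consEquiv)
open Finset (card_map mem_filter mem_image_of_mem mem_insert mem_univ mul_sum sum_add_distrib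
  sum_comm sum_congr sum_const_zero sum_eq_single sum_eq_zero sum_insert sum_ite_eq' sum_ite_irrel
  sum_mul univ)
open Finsupp (filter_apply finsetSum_apply induction_linear lapply lcomapDomain lhom_ext'
  linearCombination linearCombination_apply lmapDomain lmapDomain_apply lsingle lsum mapDomain
  mapDomain_apply mapDomain_single mem_supported single_apply single_eq_of_ne smul_single
  sum_single_index supported)
open Fintype (sum_prod_type sum_sigma)
open Function (Involutive comp_def mem_support update update_of_ne update_self)
open Function.Involutive (coe_toPerm)
open LinearMap (comp_assoc comp_zero ext_ring id_comp lTensor_tmul lcomp llcomp mulLeft mulRight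
  toMatrix' zero_comp)
open List (append_assoc append_inj append_inj' append_nil cons_append drop_left' eq_nil_or_concat'
  eq_of_mem_replicate exists_cons_of_ne_nil flatMap_cons getLast length_append length_cons
  length_drop length_map length_nil length_ofFn length_take map_append map_cons map_const'
  map_drop map_map map_replicate map_take nil_append ofFn ofFn_get ofFn_succ prod_cons replicate
  replicate_succ take_append_drop take_left' zipWith)
open Matrix (diagonal_apply_eq)
open Option (some_inj some_injective)
open Set (mem_ofPred_eq toFinite)
open Submodule (mem_comap mem_top smul_mem span_induction subset_span)
open Subtype (ext_iff val_injective)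
open TensorProduct (rid rid_tmul zero_tmul)
open AlgHom renaming comp_apply → acomp_apply
open Finsupp renaming smul_apply → fsmul_apply, add_apply → fadd_apply, ext → fext
open Finsupp (single)
open Function renaming Injective → Inj
open LinearMap renaming comp_apply → lcomp_apply, congr_fun → lcongr_fun, smul_apply → lsmul_apply,
  add_apply → ladd_apply, sum_apply → lsum_apply, id → lid, ext → lext
open Matrix renaming mul_assoc → mmul_assoc, mul_apply → mmul_apply, one_apply → mone_apply,
  mul_one → mmul_one, map_mul → mmap_mul
open Subtype renaming ext → sext
open Module.End renaming mul_apply → emul_apply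

open scoped Matrix

local notation "𝓦" d:max => List (Z2Free d)
local notation "𝓥" X:max => List X →₀ ℂ
local notation "𝓗" => hyperoctahedral
local notation "𝓜" => lmapDomain ℂ ℂ
local notation "𝓔" => (Eq : Prop → Prop → Prop)
local notation "𝓑" => BiLabeledGraph


/-! ### Reduced words and matrices adapted to an involution -/

section Words

variable {X : Type*} [DecidableEq X]

/-- Multiplication of a reduced word by a letter from the left. -/
def act (bar : X → X) (s : X) : List X → List X
  | [] => [s]
  | a :: l => if a = bar s then l else s :: a :: l

theorem act_cons (bar : X → X) (s a : X) (l : List X) :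
    act bar s (a :: l) = if a = bar s then l else s :: a :: l := rfl

/-- A word is reduced if no letter is followed by its inverse. -/
abbrev Reduced (bar : X → X) (l : List X) : Prop := l.IsChain fun a b => b ≠ bar a

variable {bar : X → X}

theorem reduced_act (s : X) {l : List X} (h : Reduced bar l) : Reduced bar (act bar s l) := by
  cases l with
  | nil => simp [act, Reduced]
  | cons a l =>
    rw [act_cons]
    split_ifs with h1
    exacts [h.tail, List.isChain_cons_cons.2 ⟨h1, h⟩]

theorem act_act (hb : Involutive bar) (s : X) {l : List X} (h : Reduced bar l) :
    act bar (bar s) (act bar s l) = l := by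
  cases l with
  | nil => simp [act, hb s]
  | cons a l =>
    simp only [act_cons]
    split_ifs with h1
    · cases l with
      | nil => simp [act, h1]
      | cons b l =>
        have := (List.isChain_cons_cons.1 h).1
        rw [h1] at this
        simp [act_cons, this, h1]
    · simp [act_cons, hb s]

theorem act_of_chain {s : X} {l : List X} (h : Reduced bar (s :: l)) : act bar s l = s :: l := by
  cases l with
  | nil => rfl
  | cons a l => simp [act, (List.isChain_cons_cons.1 h).1]

def reduce (bar : X → X) (l : List X) : List X := l.foldr (act bar) []

theorem reduce_cons (s : X) (l : List X) : reduce bar (s :: l) = act bar s (reduce bar l) := rfl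

theorem reduced_reduce (l : List X) : Reduced bar (reduce bar l) := by
  induction l with
  | nil => exact List.IsChain.nil
  | cons s l ih => exact reduced_act s ih

theorem reduce_of_reduced {l : List X} (h : Reduced bar l) : reduce bar l = l := by
  induction l with
  | nil => rfl
  | cons s l ih => rw [reduce_cons, ih h.tail, act_of_chain h]

def actPerm (hb : Involutive bar) (s : X) : Perm {l : List X // Reduced bar l} where
  toFun l := ⟨act bar s l.1, reduced_act s l.2⟩
  invFun l := ⟨act bar (bar s) l.1, reduced_act (bar s) l.2⟩
  left_inv l := sext (act_act hb s l.2)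
  right_inv l := sext (by have := act_act hb (bar s) l.2; rwa [hb s] at this)

theorem actPerm_bar (hb : Involutive bar) (s : X) :
    actPerm hb (bar s) = (actPerm hb s)⁻¹ := by ext l; rfl

theorem prod_act {G : Type*} [Group G] {f : X → G} (hf : ∀ s, f (bar s) = (f s)⁻¹) (s : X)
    (l : List X) : ((act bar s l).map f).prod = f s * (l.map f).prod := by
  cases l with
  | nil => simp [act]
  | cons a l =>
    rw [act_cons]
    split_ifs with h
    · simp [h, hf]
    · simp

theorem prod_reduce {G : Type*} [Group G] {f : X → G} (hf : ∀ s, f (bar s) = (f s)⁻¹)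
    (l : List X) : ((reduce bar l).map f).prod = (l.map f).prod := by
  induction l with
  | nil => rfl
  | cons s l ih => rw [reduce_cons, prod_act hf, ih, map_cons, prod_cons]

theorem prod_actPerm (hb : Involutive bar) (l : List X) :
    ((l.map (actPerm hb)).prod ⟨[], List.IsChain.nil⟩).1 = reduce bar l := by
  induction l with
  | nil => rfl
  | cons s l ih =>
    rw [map_cons, prod_cons, Equiv.Perm.mul_apply, reduce_cons, ← ih]; rfl

theorem prod_eq_one_iff (hb : Involutive bar) {G : Type*} [Group G] {f : X → G}
    (hf : ∀ s, f (bar s) = (f s)⁻¹)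
    (ρ : G →* Perm {l : List X // Reduced bar l}) (hρ : ∀ s, ρ (f s) = actPerm hb s)
    (l : List X) : (l.map f).prod = 1 ↔ reduce bar l = [] := by
  constructor
  · intro h
    rw [← prod_actPerm hb]
    have : (l.map (actPerm hb)).prod = ρ (l.map f).prod := by
      rw [map_list_prod, map_map]
      congr 2
      funext s; exact (hρ s).symm
    rw [this, h, map_one]; rfl
  · intro h; rw [← prod_reduce hf, h]; rfl

section Matrices

variable {A : Type*} [Ring A]

/-- The product of matrix entries along two words, and zero for words of different lengths. -/
def wordMat (U : X → X → A) : List X → List X → A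
  | [], [] => 1
  | a :: x, b :: y => U a b * wordMat U x y
  | _, _ => 0

@[simp] theorem wordMat_nil_nil (U : X → X → A) : wordMat U [] [] = 1 := rfl
@[simp] theorem wordMat_cons_cons (U : X → X → A) (a b : X) (x y : List X) :
    wordMat U (a :: x) (b :: y) = U a b * wordMat U x y := rfl
@[simp] theorem wordMat_nil_cons (U : X → X → A) (b : X) (y : List X) :
    wordMat U [] (b :: y) = 0 := rfl
@[simp] theorem wordMat_cons_nil (U : X → X → A) (b : X) (y : List X) :
    wordMat U (b :: y) [] = 0 := rfl

theorem wordMat_len (U : X → X → A) {x y : List X} (h : x.length ≠ y.length) :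
    wordMat U x y = 0 := by
  induction x generalizing y with
  | nil => cases y <;> simp_all
  | cons a x ih =>
    cases y with
    | nil => rfl
    | cons b y => rw [wordMat_cons_cons, ih (by simpa using h), mul_zero]

theorem wordMat_swap (U : X → X → A) (x y : List X) :
    wordMat (fun a b => U b a) x y = wordMat U y x := by
  induction x generalizing y with
  | nil => cases y <;> rfl
  | cons a x ih => cases y <;> simp [ih]

theorem wordMat_append (U : X → X → A) {x y : List X} (x' y' : List X) (h : x.length = y.length) :
    wordMat U (x ++ x') (y ++ y') = wordMat U x y * wordMat U x' y' := by
  induction x generalizing y with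
  | nil =>
    obtain rfl := List.length_eq_zero_iff.1 h.symm
    simp
  | cons a x ih =>
    obtain ⟨b, y, rfl⟩ := List.exists_cons_of_length_eq_add_one h.symm
    simp [ih (y := y) (by simpa using h), mul_assoc]

theorem wordMat_ofFn (U : X → X → A) (n : ℕ) (s t : Fin n → X) :
    wordMat U (ofFn s) (ofFn t) = tpow U n s t := by
  induction n with
  | zero => simp [tpow_zero]
  | succ n ih =>
    rw [ofFn_succ, ofFn_succ, wordMat_cons_cons, tpow_succ]
    exact congrArg _ (ih _ _)

/-- The relations between the entries of the generating matrix that express compatibility with the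
multiplication of reduced words. -/
structure FreeRel [Fintype X] (bar : X → X) (U : X → X → A) : Prop where
  row : ∀ a b, ∑ t, U a t * U b (bar t) = if b = bar a then 1 else 0
  col : ∀ a b, ∑ t, U t a * U (bar t) b = if b = bar a then 1 else 0
  row_zero : ∀ a b c, c ≠ bar b → U a b * U (bar a) c = 0
  col_zero : ∀ a b c, c ≠ bar a → U a b * U c (bar b) = 0

theorem FreeRel.swap [Fintype X] {U : X → X → A} (h : FreeRel bar U) :
    FreeRel bar fun a b => U b a :=
  ⟨h.col, h.row, fun a b c => h.col_zero b a c, fun a b c => h.row_zero b a c⟩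

variable [Fintype X] {U : X → X → A}

theorem wordMat_act_left (hb : Involutive bar) (h : FreeRel bar U) (a : X) {x w : List X}
    (hx : Reduced bar x) (hw : Reduced bar w) :
    wordMat U (act bar a x) w = ∑ b, U a b * wordMat U x (act bar (bar b) w) := by
  cases x with
  | nil =>
    cases w with
    | nil => simp [act]
    | cons c w =>
      have h1 : ∀ b, wordMat U [] (act bar (bar b) (c :: w)) =
          if c = b then wordMat U [] w else 0 := fun b => by
        simp only [act_cons, hb b]
        split_ifs <;> simp
      simp only [h1]
      simp [act]
  | cons y x =>
    by_cases hy : y = bar a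
    · subst hy
      have hact : act bar a (bar a :: x) = x := by simp [act]
      rw [hact]
      cases w with
      | nil =>
        simp only [act, wordMat_cons_cons, ← mul_assoc, ← sum_mul, h.row]
        simp
      | cons c w =>
        have hz : U a c * (U (bar a) (bar c) * wordMat U x (c :: w)) = 0 := by
          cases x with
          | nil => simp
          | cons y x =>
            have hya := (List.isChain_cons_cons.1 hx).1
            have := h.col_zero (bar a) (bar c) y hya
            rw [hb c] at this
            rw [wordMat_cons_cons, ← mul_assoc (U (bar a) _), this]
            simp
        have hz' : U a c * wordMat U (bar a :: x) w = 0 := by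
          cases w with
          | nil => simp
          | cons e w =>
            rw [wordMat_cons_cons, ← mul_assoc,
              h.row_zero a c e (List.isChain_cons_cons.1 hw).1, zero_mul]
        have h1 : ∀ b, U a b * wordMat U (bar a :: x) (act bar (bar b) (c :: w)) =
            U a b * (U (bar a) (bar b) * wordMat U x (c :: w)) := fun b => by
          simp only [act_cons, hb b]
          split_ifs with hcb
          · subst hcb; rw [hz, hz']
          · rfl
        simp only [h1, ← mul_assoc, ← sum_mul, h.row]
        simp
    · have hact : act bar a (y :: x) = a :: y :: x := by simp [act, hy]
      rw [hact]
      cases w with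
      | nil =>
        simp only [act, wordMat_cons_cons, ← mul_assoc, ← sum_mul, h.row]
        simp [hy]
      | cons c w =>
        have hz : U a c * (U y (bar c) * wordMat U x (c :: w)) = 0 := by
          rw [← mul_assoc, h.col_zero a c y hy, zero_mul]
        have h1 : ∀ b, U a b * wordMat U (y :: x) (act bar (bar b) (c :: w)) =
            U a b * (U y (bar b) * wordMat U x (c :: w)) +
              if c = b then U a b * wordMat U (y :: x) w else 0 := fun b => by
          simp only [act_cons, hb b]
          split_ifs with hcb
          · subst hcb; rw [hz, zero_add]
          · simp
        simp only [h1, sum_add_distrib, ← mul_assoc, ← sum_mul, h.row]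
        simp [hy]

theorem sum_tpow_reduce (hb : Involutive bar) (h : FreeRel bar U) (n : ℕ)
    (k : Fin n → X) {w : List X} (hw : Reduced bar w) :
    (∑ t : Fin n → X, if reduce bar (ofFn t) = w then tpow U n k t else 0) =
      wordMat U (reduce bar (ofFn k)) w := by
  induction n generalizing w with
  | zero =>
    cases w <;> simp [tpow_zero, reduce]
  | succ n ih =>
    rw [ofFn_succ, reduce_cons, wordMat_act_left hb h _ (reduced_reduce _) hw,
      ← (consEquiv (fun _ => X)).sum_comp, sum_prod_type]
    refine sum_congr rfl fun b _ => ?_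
    rw [show (ofFn fun i => k i.succ) = ofFn (Fin.tail k) from rfl,
      ← ih (Fin.tail k) (reduced_act (bar b) hw), mul_sum]
    refine sum_congr rfl fun t _ => ?_
    have e : (act bar b (reduce bar (ofFn t)) = w) ↔
        reduce bar (ofFn t) = act bar (bar b) w := by
      constructor
      · rintro rfl; exact (act_act hb b (reduced_reduce _)).symm
      · intro h; rw [h]; have := act_act hb (bar b) hw; rwa [hb b] at this
    simp only [consEquiv, coe_fn_mk, ofFn_succ, Fin.cons_zero, Fin.cons_succ,
      reduce_cons, e, tpow_succ, Fin.tail_cons, mul_ite, mul_zero]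

end Matrices

end Words

/-! ### Invariant vectors and relations -/

section Invariant

variable {X : Type} [Fintype X] [DecidableEq X] {A : Type*} [Ring A] [Algebra ℂ A]

/-- The vector `ξ` is invariant under the `n`-fold tensor power of `U`. -/
def Invariant (U : X → X → A) {n : ℕ} (ξ : (Fin n → X) → ℂ) : Prop :=
  ∀ k, ∑ t, ξ t • tpow U n k t = ξ k • 1

theorem lift_invRels_iff [StarRing A] (U : X → X → A) {n : ℕ} (ξ : (Fin n → X) → ℂ) :
    (∀ r ∈ invRels ξ, FreeStar.lift U r = 0) ↔ Invariant U ξ := by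
  simp only [invRels, Set.forall_mem_range, map_sub, map_sum, map_smul, map_one, map_tpow,
    FreeStar.lift_u, sub_eq_zero]
  rfl

theorem lift_invPresentation_iff [StarRing A] (U : X → X → A) {J : Type} (n : J → ℕ)
    (ξ : ∀ a, (Fin (n a) → X) → ℂ) :
    (∀ r ∈ (invPresentation n ξ).rels, FreeStar.lift U r = 0) ↔ ∀ a, Invariant U (ξ a) := by
  simp only [← lift_invRels_iff]
  constructor
  · intro h a r hr; exact h r (Set.mem_iUnion.2 ⟨a, hr⟩)
  · intro h r hr; obtain ⟨a, ha⟩ := Set.mem_iUnion.1 hr; exact h a r ha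

theorem Invariant.reindex {Y : Type} [Fintype Y] [DecidableEq Y] (e : Y ≃ X) {U : X → X → A}
    {n : ℕ} {ξ : (Fin n → X) → ℂ} (h : Invariant U ξ) :
    Invariant (fun i j => U (e i) (e j)) fun t => ξ fun i => e (t i) := by
  intro k
  rw [← h fun i => e (k i), ← (Equiv.arrowCongr (Equiv.refl (Fin n)) e).sum_comp]
  rfl

variable {bar : X → X}

theorem invariant_reduce (hb : Involutive bar) {U : X → X → A} (h : FreeRel bar U)
    (n : ℕ) : Invariant U fun t : Fin n → X => if reduce bar (ofFn t) = [] then 1 else 0 := by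
  intro k
  have := sum_tpow_reduce hb h n k List.IsChain.nil
  simp only [ite_smul, one_smul, zero_smul]
  rw [this]
  split_ifs with h0
  · rw [h0]; rfl
  · exact wordMat_len U (by simpa using h0)

/-- The vector `∑ s, e s ⊗ e (bar s)`. -/
def pairVec (bar : X → X) (t : Fin 2 → X) : ℂ := if t 1 = bar (t 0) then 1 else 0

/-- The vector `∑ s, e s ⊗ e (bar s) ⊗ e s ⊗ e (bar s)`. -/
def quadVec (bar : X → X) (t : Fin 4 → X) : ℂ :=
  if t 1 = bar (t 0) ∧ t 2 = t 0 ∧ t 3 = bar (t 0) then 1 else 0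

theorem sum_fin_two {M : Type*} [AddCommMonoid M] (f : (Fin 2 → X) → M) :
    ∑ t, f t = ∑ a, ∑ b, f ![a, b] := by
  rw [← (finTwoArrowEquiv X).symm.sum_comp, sum_prod_type]
  rfl

theorem sum_fin_four {M : Type*} [AddCommMonoid M] (f : (Fin 4 → X) → M) :
    ∑ t, f t = ∑ a, ∑ b, ∑ c, ∑ e, f ![a, b, c, e] := by
  rw [← (consEquiv (fun _ => X)).sum_comp, sum_prod_type]
  refine sum_congr rfl fun a _ => ?_
  rw [← (consEquiv (fun _ => X)).sum_comp, sum_prod_type]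
  refine sum_congr rfl fun b _ => ?_
  rw [sum_fin_two]
  rfl

theorem tpow_two (U : X → X → A) (a b a' b' : X) :
    tpow U 2 ![a, b] ![a', b'] = U a a' * U b b' := by simp [tpow, ofFn_succ]

theorem tpow_four (U : X → X → A) (a b c e a' b' c' e' : X) :
    tpow U 4 ![a, b, c, e] ![a', b', c', e'] = U a a' * (U b b' * (U c c' * U e e')) := by
  simp [tpow, ofFn_succ]

theorem invariant_pairVec {U : X → X → A} : Invariant U (pairVec bar) ↔
    ∀ a b, ∑ t, U a t * U b (bar t) = if b = bar a then 1 else 0 := by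
  have key : ∀ a b, (∑ t, pairVec bar t • tpow U 2 ![a, b] t = pairVec bar ![a, b] • 1) ↔
      ∑ t, U a t * U b (bar t) = if b = bar a then 1 else 0 := fun a b => by
    rw [sum_fin_two]
    simp [pairVec, tpow_two, ite_smul]
  constructor
  · intro h a b; exact (key a b).1 (h ![a, b])
  · intro h k
    have e : k = ![k 0, k 1] := by funext i; fin_cases i <;> rfl
    rw [e]
    exact (key _ _).2 (h _ _)

theorem invariant_quadVec {U : X → X → A} : Invariant U (quadVec bar) ↔
    ∀ a b c e, ∑ t, U a t * (U b (bar t) * (U c t * U e (bar t))) =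
      if b = bar a ∧ c = a ∧ e = bar a then 1 else 0 := by
  have key : ∀ a b c e, (∑ t, quadVec bar t • tpow U 4 ![a, b, c, e] t =
      quadVec bar ![a, b, c, e] • 1) ↔
      ∑ t, U a t * (U b (bar t) * (U c t * U e (bar t))) =
        if b = bar a ∧ c = a ∧ e = bar a then 1 else 0 := fun a b c e => by
    rw [sum_fin_four]
    have e1 : ∀ x y z w, quadVec bar ![x, y, z, w] =
        if w = bar x then if z = x then if y = bar x then 1 else 0 else 0 else 0 :=
      fun x y z w => by
        change (if y = bar x ∧ z = x ∧ w = bar x then (1 : ℂ) else 0) = _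
        split_ifs <;> simp_all
    simp only [e1, tpow_four, ite_smul, one_smul, zero_smul, sum_ite_irrel,
      sum_ite_eq', mem_univ, if_true, sum_const_zero]
    grind
  constructor
  · intro h a b c e; exact (key a b c e).1 (h ![a, b, c, e])
  · intro h k
    have e : k = ![k 0, k 1, k 2, k 3] := by funext i; fin_cases i <;> rfl
    rw [e]
    exact (key _ _ _ _).2 (h _ _ _ _)

section Star

variable [StarRing A] {U : X → X → A}

theorem star_of_pair (hb : Involutive bar)
    (hr : ∀ i j, ∑ k, star (U k i) * U k j = if i = j then 1 else 0)
    (h : ∀ a b, ∑ t, U a t * U b (bar t) = if b = bar a then 1 else 0) (a b : X) :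
    star (U a b) = U (bar a) (bar b) := by
  have h1 : ∑ k, star (U k b) * ∑ t, U k t * U (bar a) (bar t) = star (U a b) := by
    simp only [h, hb.injective.eq_iff]
    simp
  rw [← h1]
  simp only [mul_sum, ← mul_assoc]
  rw [sum_comm]
  simp only [← sum_mul, hr]
  simp

theorem freeRel_of_quad (hb : Involutive bar)
    (hr : ∀ i j, ∑ k, star (U k i) * U k j = if i = j then 1 else 0)
    (h2 : ∀ a b, ∑ t, U a t * U b (bar t) = if b = bar a then 1 else 0)
    (h4 : ∀ a b c e, ∑ t, U a t * (U b (bar t) * (U c t * U e (bar t))) =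
      if b = bar a ∧ c = a ∧ e = bar a then 1 else 0) : FreeRel bar U := by
  have hs := star_of_pair hb hr h2
  have col : ∀ a b, ∑ t, U t a * U (bar t) b = if b = bar a then 1 else 0 := fun a b => by
    have h := hr (bar a) b
    simp only [hs, hb a] at h
    rw [← sum_comp hb.toPerm] at h
    simp only [coe_toPerm, hb _] at h
    rw [h]
    simp only [eq_comm]
  have col' : ∀ a b, ∑ t, U t (bar a) * U (bar t) b = if b = a then 1 else 0 := fun a b => by
    rw [col, hb]
  have s1 : ∀ a b c s, U a s * (U b (bar s) * U c s) =
      if b = bar a ∧ c = a then U a s else 0 := fun a b c s => by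
    have : ∑ e, (∑ t, U a t * (U b (bar t) * (U c t * U e (bar t)))) * U (bar e) s =
        U a s * (U b (bar s) * U c s) := by
      simp only [sum_mul]
      rw [sum_comm]
      simp only [mul_assoc, ← mul_sum, col']
      simp
    rw [← this]
    simp only [h4]
    by_cases h : b = bar a ∧ c = a
    · simp [h, hb a]
    · rw [if_neg h]; refine sum_eq_zero fun e _ => ?_; rw [if_neg (by tauto), zero_mul]
  have s2 : ∀ a b s r, (if r = bar s then U a s * U b (bar s) else 0) =
      if b = bar a then U a s * U (bar a) r else 0 := fun a b s r => by
    have : ∑ c, (U a s * (U b (bar s) * U c s)) * U (bar c) r =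
        if r = bar s then U a s * U b (bar s) else 0 := by
      simp only [mul_assoc, ← mul_sum, col]
      simp
    rw [← this]
    simp only [s1]
    by_cases h : b = bar a
    · simp [h]
    · simp [h]
  refine ⟨h2, col, fun a b c hc => ?_, fun a b c hc => ?_⟩
  all_goals grind

end Star

end Invariant


/-! ### Isomorphisms between compact quantum groups given by presentations -/

section Isomorphism

variable {X Y : Type} [Fintype X] [DecidableEq X] [Fintype Y] [DecidableEq Y]

theorem sum_left_reindex (Q : Presentation Y) (e : X ≃ Y) (i j : X) :
    ∑ k, Q.u (e i) (e k) * star (Q.u (e j) (e k)) = if i = j then 1 else 0 := by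
  rw [sum_comp e (fun k => Q.u (e i) k * star (Q.u (e j) k)), UnivAlg.sum_left]
  simp

theorem sum_right_reindex (Q : Presentation Y) (e : X ≃ Y) (i j : X) :
    ∑ k, star (Q.u (e k) (e i)) * Q.u (e k) (e j) = if i = j then 1 else 0 := by
  rw [sum_comp e (fun k => star (Q.u k (e i)) * Q.u k (e j)), UnivAlg.sum_right]
  simp

def reindexHom (P : Presentation X) (Q : Presentation Y) (e : X ≃ Y)
    (h : ∀ r ∈ P.rels, FreeStar.lift (fun i j => Q.u (e i) (e j)) r = 0) : P.O →ₐ[ℂ] Q.O :=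
  UnivAlg.lift (fun i j => Q.u (e i) (e j)) (sum_left_reindex Q e) (sum_right_reindex Q e) h

theorem reindexHom_u (P : Presentation X) (Q : Presentation Y) (e : X ≃ Y)
    (h : ∀ r ∈ P.rels, FreeStar.lift (fun i j => Q.u (e i) (e j)) r = 0) (i j : X) :
    reindexHom P Q e h (P.u i j) = Q.u (e i) (e j) := UnivAlg.lift_u _ _ _ _ _ _

theorem reindexHom_star (P : Presentation X) (Q : Presentation Y) (e : X ≃ Y)
    (h : ∀ r ∈ P.rels, FreeStar.lift (fun i j => Q.u (e i) (e j)) r = 0) (a : P.O) :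
    reindexHom P Q e h (star a) = star (reindexHom P Q e h a) := UnivAlg.lift_star _ _ _ _ _

theorem exists_bialgEquiv (P : Presentation X) (Q : Presentation Y) (e : X ≃ Y)
    (h : ∀ r ∈ P.rels, FreeStar.lift (fun i j => Q.u (e i) (e j)) r = 0)
    (h' : ∀ r ∈ Q.rels, FreeStar.lift (fun i j => P.u (e.symm i) (e.symm j)) r = 0) :
    ∃ Φ : P.O ≃ₐc[ℂ] Q.O, (∀ a, Φ (star a) = star (Φ a)) ∧
      ∀ i j, Φ (P.u i j) = Q.u (e i) (e j) := by
  have hs := reindexHom_star P Q e h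
  have hs' := reindexHom_star Q P e.symm h'
  have hu := reindexHom_u P Q e h
  have hu' := reindexHom_u Q P e.symm h'
  let f : P.O ≃ₐ[ℂ] Q.O := AlgEquiv.ofAlgHom (reindexHom P Q e h) (reindexHom Q P e.symm h')
    (UnivAlg.hom_ext (fun a => by simp only [acomp_apply, hs, hs']) (fun _ => rfl)
      fun i j => by simp only [acomp_apply, AlgHom.id_apply]; grind)
    (UnivAlg.hom_ext (fun a => by simp only [acomp_apply, hs, hs']) (fun _ => rfl)
      fun i j => by simp only [acomp_apply, AlgHom.id_apply]; grind)
  have hf : ∀ a, (f : P.O →ₐ[ℂ] Q.O) a = reindexHom P Q e h a := fun _ => rfl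
  refine ⟨BialgEquiv.ofAlgEquiv f ?_ ?_, hs, hu⟩
  · refine UnivAlg.hom_ext (fun a => ?_) (fun a => P.counitHom_star a) fun i j => ?_
    · rw [acomp_apply, acomp_apply, hf, hf, hs]; exact Q.counitHom_star _
    · rw [acomp_apply, hf, hu]
      refine (Q.counitHom_u _ _).trans (Eq.trans ?_ (P.counitHom_u _ _).symm)
      simp
  · refine UnivAlg.hom_ext (fun a => ?_) (fun a => ?_) fun i j => ?_
    · rw [acomp_apply, acomp_apply]
      refine (congrArg _ (P.comulHom_star a)).trans ?_
      exact Presentation.map_star _ _ hs hs _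
    · rw [acomp_apply, acomp_apply, hf, hf, hs]; exact Q.comulHom_star _
    · rw [acomp_apply, acomp_apply, hf, hu]
      refine (congrArg _ (P.comulHom_u i j)).trans (Eq.trans ?_ (Q.comulHom_u _ _).symm)
      rw [map_sum, ← e.sum_comp]
      refine sum_congr rfl fun k _ => ?_
      rw [map_tmul, hf, hf, hu, hu]

end Isomorphism

/-! ### Planar quantizations of free products -/

section FreeProducts

variable {X : Type} [Fintype X] [DecidableEq X] {bar : X → X}

/-- The indicator function of the words that reduce to the empty word. -/
def reduceVec (bar : X → X) (n : ℕ) (t : Fin n → X) : ℂ :=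
  if reduce bar (ofFn t) = [] then 1 else 0

theorem reduce_two (a b : X) : reduce bar [a, b] = [] ↔ b = bar a := by
  simp only [reduce, List.foldr, act]
  split_ifs with h <;> simp [h]

theorem reduce_four (hb : Involutive bar) (a b c e : X) : reduce bar [a, b, c, e] = [] ↔
    (b = bar a ∧ e = bar c) ∨ (c = bar b ∧ e = bar a) := by
  have e0 : reduce bar [a, b, c, e] = act bar a (act bar b (act bar c [e])) := rfl
  rw [e0, act_cons]
  by_cases h1 : e = bar c
  · rw [if_pos h1]
    have e1 : act bar a (act bar b []) = if b = bar a then [] else [a, b] := rfl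
    rw [e1]
    by_cases h2 : b = bar a
    · simp [h1, h2]
    · have : ¬ (c = bar b ∧ e = bar a) := by
        rintro ⟨h3, h4⟩
        rw [h1] at h4
        rw [← hb.injective h4, h3, hb b] at h2
        exact h2 rfl
      simp [h2, this]
  · rw [if_neg h1, act_cons]
    by_cases h2 : c = bar b
    · rw [if_pos h2, act_cons]
      by_cases h3 : e = bar a
      · simp [h2, h3, act]
      · grind
    · rw [if_neg h2, act_cons]; split_ifs with h3 <;> simp [h1, h2]

theorem reduceVec_two : reduceVec bar 2 = pairVec bar := by
  funext t
  refine if_congr ?_ rfl rfl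
  rw [show ofFn t = [t 0, t 1] by simp [ofFn_succ], reduce_two]

theorem reduceVec_four (hb : Involutive bar) (t : Fin 4 → X) :
    quadVec bar t = (if t 1 = bar (t 0) ∧ t 3 = bar (t 2) then 1 else 0) +
      (if t 2 = bar (t 1) ∧ t 3 = bar (t 0) then 1 else 0) - reduceVec bar 4 t := by
  have hl : ofFn t = [t 0, t 1, t 2, t 3] := by simp [ofFn_succ]
  have h := reduce_four hb (t 0) (t 1) (t 2) (t 3)
  rw [← hl] at h
  have hq : (t 1 = bar (t 0) ∧ t 2 = t 0 ∧ t 3 = bar (t 0)) ↔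
      (t 1 = bar (t 0) ∧ t 3 = bar (t 2)) ∧ (t 2 = bar (t 1) ∧ t 3 = bar (t 0)) := by
    constructor
    · rintro ⟨h1, h2, h3⟩; exact ⟨⟨h1, by rw [h2, h3]⟩, by rw [h1, hb, h2], h3⟩
    · rintro ⟨⟨h1, h2⟩, h3, h4⟩; exact ⟨h1, by rw [h3, h1, hb], h4⟩
  simp only [quadVec, reduceVec, h, hq]
  grind

variable {A : Type*} [Ring A] [Algebra ℂ A] [StarRing A] {U : X → X → A}

theorem invariant_reduceVec (hb : Involutive bar) (h : FreeRel bar U) (n : ℕ) :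
    Invariant U (reduceVec bar n) := invariant_reduce hb h n

theorem quad_of_reduce (hb : Involutive bar) (h2 : Invariant U (pairVec bar))
    (h4 : Invariant U (reduceVec bar 4)) : Invariant U (quadVec bar) := by
  have h2' := invariant_pairVec.1 h2
  intro k
  have p1 : ∑ t : Fin 4 → X, (if t 1 = bar (t 0) ∧ t 3 = bar (t 2) then (1 : ℂ) else 0) •
      tpow U 4 k t = (if k 1 = bar (k 0) ∧ k 3 = bar (k 2) then (1 : ℂ) else 0) • 1 := by
    have e : k = ![k 0, k 1, k 2, k 3] := by funext i; fin_cases i <;> rfl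
    rw [e, sum_fin_four]
    simp only [tpow_four]
    have : ∀ x y z w : X, (if ![x, y, z, w] 1 = bar (![x, y, z, w] 0) ∧
        ![x, y, z, w] 3 = bar (![x, y, z, w] 2) then (1 : ℂ) else 0) •
        (U (k 0) x * (U (k 1) y * (U (k 2) z * U (k 3) w))) =
        if y = bar x then (if w = bar z then
          (U (k 0) x * U (k 1) y) * (U (k 2) z * U (k 3) w) else 0) else 0 := fun x y z w => by
      change (if y = bar x ∧ w = bar z then (1 : ℂ) else 0) • _ = _
      rw [ite_and, ite_smul, ite_smul, one_smul, zero_smul, mul_assoc]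
    simp only [this, sum_ite_irrel, sum_ite_eq', mem_univ, if_true,
      sum_const_zero, ← Finset.sum_mul_sum, h2']
    change _ = (if k 1 = bar (k 0) ∧ k 3 = bar (k 2) then (1 : ℂ) else 0) • (1 : A)
    rw [ite_and, ite_smul, ite_smul, one_smul, zero_smul, ite_mul, one_mul, zero_mul]
  have p2 : ∑ t : Fin 4 → X, (if t 2 = bar (t 1) ∧ t 3 = bar (t 0) then (1 : ℂ) else 0) •
      tpow U 4 k t = (if k 2 = bar (k 1) ∧ k 3 = bar (k 0) then (1 : ℂ) else 0) • 1 := by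
    have e : k = ![k 0, k 1, k 2, k 3] := by funext i; fin_cases i <;> rfl
    rw [e, sum_fin_four]
    simp only [tpow_four]
    have : ∀ x y z w : X, (if ![x, y, z, w] 2 = bar (![x, y, z, w] 1) ∧
        ![x, y, z, w] 3 = bar (![x, y, z, w] 0) then (1 : ℂ) else 0) •
        (U (k 0) x * (U (k 1) y * (U (k 2) z * U (k 3) w))) =
        if z = bar y then (if w = bar x then
          U (k 0) x * ((U (k 1) y * U (k 2) z) * U (k 3) w) else 0) else 0 := fun x y z w => by
      change (if z = bar y ∧ w = bar x then (1 : ℂ) else 0) • _ = _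
      rw [ite_and, ite_smul, ite_smul, one_smul, zero_smul, mul_assoc (U (k 1) y)]
    simp only [this, sum_ite_irrel, sum_ite_eq', mem_univ, if_true,
      sum_const_zero, ← mul_sum, ← sum_mul, h2']
    change _ = (if k 2 = bar (k 1) ∧ k 3 = bar (k 0) then (1 : ℂ) else 0) • _
    by_cases h : k 2 = bar (k 1)
    · simp [h, h2', ite_smul]
    · simp [h]
  have p3 := h4 k
  simp only [reduceVec_four hb, sub_smul, add_smul, Finset.sum_sub_distrib,
    sum_add_distrib, p1, p2, p3]

variable {Γ : Type} [Group Γ] [DecidableEq Γ] {gen : X → Γ}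

theorem gen_injective (hb : Involutive bar) (hf : ∀ s, gen (bar s) = (gen s)⁻¹)
    (h1 : ∀ l : List X, (l.map gen).prod = 1 ↔ reduce bar l = []) : Inj gen := by
  intro s t h
  have h2 : ([s, bar t].map gen).prod = 1 := by simp [hf, h]
  rw [h1] at h2
  simp only [reduce, List.foldr, act, act_cons] at h2
  split_ifs at h2 with h3
  exact (hb.injective h3).symm

def genEquiv (hg : Inj gen) : X ≃ (Finset.univ.image gen : Finset Γ) :=
  Equiv.ofBijective (fun s => ⟨gen s, mem_image_of_mem _ (mem_univ s)⟩)
    ⟨fun _ _ h => hg (congrArg Subtype.val h), fun ⟨x, hx⟩ => by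
      obtain ⟨s, -, rfl⟩ := Finset.mem_image.1 hx
      exact ⟨s, rfl⟩⟩

theorem cycleVector_gen (h1 : ∀ l : List X, (l.map gen).prod = 1 ↔ reduce bar l = [])
    (hg : Inj gen) (n : ℕ) (t : Fin n → X) :
    cycleVector (Finset.univ.image gen) n (fun i => genEquiv hg (t i)) = reduceVec bar n t := by
  refine if_congr ?_ rfl rfl
  rw [← h1, List.map_ofFn]
  rfl

theorem cycleVector_gen_symm (h1 : ∀ l : List X, (l.map gen).prod = 1 ↔ reduce bar l = [])
    (hg : Inj gen) (n : ℕ) :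
    (fun t : Fin n → (Finset.univ.image gen : Finset Γ) =>
      reduceVec bar n fun i => (genEquiv hg).symm (t i)) =
      cycleVector (Finset.univ.image gen) n := by funext t; rw [← cycleVector_gen h1 hg]; simp

theorem exists_bialgEquiv_planar (hb : Involutive bar)
    (hf : ∀ s, gen (bar s) = (gen s)⁻¹)
    (h1 : ∀ l : List X, (l.map gen).prod = 1 ↔ reduce bar l = [])
    (Q : Presentation X) (hQ : FreeRel bar Q.u)
    (hQ' : ∀ (B : Type) [Ring B] [StarRing B] [Algebra ℂ B] [StarModule ℂ B] (U : X → X → B),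
      FreeRel bar U → (∀ a b, star (U a b) = U (bar a) (bar b)) → Invariant U (pairVec bar) →
      Invariant U (quadVec bar) → ∀ r ∈ Q.rels, FreeStar.lift U r = 0) :
    ∃ Φ : (planarQuantization (Finset.univ.image gen)).O ≃ₐc[ℂ] Q.O,
      (∀ a, Φ (star a) = star (Φ a)) ∧
      ∀ s t hs ht, Φ ((planarQuantization (Finset.univ.image gen)).u ⟨gen s, hs⟩ ⟨gen t, ht⟩) =
        Q.u s t := by
  have hg := gen_injective hb hf h1
  let e := genEquiv hg
  let P := planarQuantization (Finset.univ.image gen)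
  have hP : ∀ n : {n : ℕ // 1 ≤ n}, Invariant P.u (cycleVector (Finset.univ.image gen) n.1) :=
    (lift_invPresentation_iff P.u _ _).1 fun r hr => by
      rw [show P.u = UnivAlg.u P.rels from rfl, UnivAlg.lift_u_eq]
      exact UnivAlg.mk_rel hr
  have hP' : ∀ n, 1 ≤ n → Invariant (fun i j => P.u (e i) (e j)) (reduceVec bar n) :=
    fun n hn => by have := (hP ⟨n, hn⟩).reindex e; rwa [funext (cycleVector_gen h1 hg n)] at this
  have i2 := hP' 2 (by norm_num)
  rw [reduceVec_two] at i2
  have i4 := quad_of_reduce hb i2 (hP' 4 (by norm_num))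
  have hs := star_of_pair (U := fun i j => P.u (e i) (e j)) hb (sum_right_reindex P e)
    (invariant_pairVec.1 i2)
  have hU := freeRel_of_quad (U := fun i j => P.u (e i) (e j)) hb (sum_right_reindex P e)
    (invariant_pairVec.1 i2) (invariant_quadVec.1 i4)
  obtain ⟨Φ, h2, h3⟩ := exists_bialgEquiv P Q e.symm
    ((lift_invPresentation_iff _ _ _).2 fun n => by
      have := (invariant_reduceVec hb hQ n.1).reindex e.symm
      rwa [cycleVector_gen_symm h1 hg] at this)
    (hQ' _ _ hU hs i2 i4)
  refine ⟨Φ, h2, fun s t hs ht => ?_⟩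
  have := h3 (e s) (e t)
  rwa [e.symm_apply_apply, e.symm_apply_apply] at this

end FreeProducts

/-! ### The two families of examples -/

section Examples

variable (d : ℕ)

theorem swap_involutive : Involutive (Sum.swap : Fin d ⊕ Fin d → Fin d ⊕ Fin d) :=
  Sum.swap_swap

theorem freeGen_swap (s : Fin d ⊕ Fin d) : freeGen d s.swap = (freeGen d s)⁻¹ := by
  rcases s with i | i <;> simp [freeGen]

theorem freeGen_prod (l : List (Fin d ⊕ Fin d)) :
    (l.map (freeGen d)).prod = 1 ↔ reduce Sum.swap l = [] := by
  refine prod_eq_one_iff (swap_involutive d) (freeGen_swap d)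
    (FreeGroup.lift fun i => actPerm (swap_involutive d) (.inl i)) (fun s => ?_) l
  rcases s with i | i
  · simp [freeGen]
  · simp only [freeGen, map_inv, FreeGroup.lift_apply_of]
    exact (actPerm_bar (swap_involutive d) (.inl i)).symm

theorem id_involutive {X : Type*} : Involutive (id : X → X) := fun _ => rfl

theorem z2Gen_inv (i : Fin d) : z2Gen d (id i) = (z2Gen d i)⁻¹ := by
  rw [eq_inv_iff_mul_eq_one, id, z2Gen, ← map_mul, ← ofAdd_add]
  exact map_one _

def z2Lift {G : Type*} [Group G] (f : Fin d → G) (hf : ∀ i, f i * f i = 1) : Z2Free d →* G :=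
  Monoid.CoprodI.lift fun i => AddMonoidHom.toMultiplicativeLeft (ZMod.lift 2
    ⟨zmultiplesHom (Additive G) (Additive.ofMul (f i)), by
      simp only [zmultiplesHom_apply]
      have h2 : ((2 : ℕ) : ℤ) • Additive.ofMul (f i) = Additive.ofMul (f i * f i) :=
        (natCast_zsmul _ 2).trans (two_nsmul _)
      exact h2.trans (congrArg _ (hf i))⟩)

theorem z2Lift_gen {G : Type*} [Group G] (f : Fin d → G) (hf : ∀ i, f i * f i = 1) (i : Fin d) :
    z2Lift d f hf (z2Gen d i) = f i := by
  rw [z2Lift, z2Gen, Monoid.CoprodI.lift_of]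
  change Additive.toMul (ZMod.lift 2 _ 1) = _
  rw [show (1 : ZMod 2) = ((1 : ℤ) : ZMod 2) by simp, ZMod.lift_coe]
  simp

def z2Act : Z2Free d →* Perm {l : List (Fin d) // Reduced id l} :=
  z2Lift d (actPerm id_involutive) fun i => by
    rw [mul_eq_one_iff_eq_inv]; exact actPerm_bar id_involutive i

theorem z2Act_gen (i : Fin d) : z2Act d (z2Gen d i) = actPerm id_involutive i :=
  z2Lift_gen d _ _ i

theorem z2Gen_prod (l : List (Fin d)) :
    (l.map (z2Gen d)).prod = 1 ↔ reduce id l = [] :=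
  prod_eq_one_iff id_involutive (z2Gen_inv d) (z2Act d) (z2Act_gen d) l

theorem twoVector_eq : twoVector d = pairVec Sum.swap := by
  funext t
  simp only [twoVector, basisVec, pairVec, matJ, Matrix.mulVec_single_one]
  rw [sum_eq_single (t 0)]
  · generalize t 0 = a, t 1 = b
    rcases a with a | a <;> rcases b with b | b <;>
      simp [Matrix.col, Matrix.fromBlocks, mone_apply]
  · grind
  · simp

theorem fourVector_eq : fourVector d = quadVec Sum.swap := by
  funext t
  simp only [fourVector, basisVec, quadVec, matJ, Matrix.mulVec_single_one]
  rw [sum_eq_single (t 0)]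
  · generalize t 0 = a, t 1 = b, t 2 = c, t 3 = e
    rcases a with a | a <;> rcases b with b | b <;> rcases e with e | e <;>
      simp [Matrix.col, Matrix.fromBlocks, mone_apply, Pi.single_apply, ← ite_and, and_comm, and_left_comm]
  · grind
  · simp

theorem twisted_invariant (b : Bool) : Invariant (twistedHyperoctahedral d).u
    (n := cond b 4 2) (match b with
      | false => twoVector d
      | true => fourVector d) :=
  (lift_invPresentation_iff (twistedHyperoctahedral d).u _ _).1 (fun r hr => by
    rw [show (twistedHyperoctahedral d).u = UnivAlg.u (twistedHyperoctahedral d).rels from rfl,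
      UnivAlg.lift_u_eq]
    exact UnivAlg.mk_rel hr) b

theorem twisted_freeRel : FreeRel Sum.swap (twistedHyperoctahedral d).u := by
  have h2 : Invariant (twistedHyperoctahedral d).u (twoVector d) := twisted_invariant d false
  have h4 : Invariant (twistedHyperoctahedral d).u (fourVector d) := twisted_invariant d true
  rw [twoVector_eq] at h2
  rw [fourVector_eq] at h4
  exact freeRel_of_quad (swap_involutive d) UnivAlg.sum_right (invariant_pairVec.1 h2)
    (invariant_quadVec.1 h4)

/-- The planar quantization of the free group. -/
theorem planarQuantization_freeGroup :
    ∃ Φ : (planarQuantization (freeGens d)).O ≃ₐc[ℂ] (twistedHyperoctahedral d).O,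
      (∀ a, Φ (star a) = star (Φ a)) ∧ ∀ s t : Fin d ⊕ Fin d,
        Φ ((planarQuantization (freeGens d)).u (freeGenMem d s) (freeGenMem d t)) =
          (twistedHyperoctahedral d).u s t := by
  obtain ⟨Φ, h1, h2⟩ := exists_bialgEquiv_planar (swap_involutive d) (freeGen_swap d)
    (freeGen_prod d) (twistedHyperoctahedral d) (twisted_freeRel d) (by
      intro B _ _ _ _ U _ _ h2 h4
      refine (lift_invPresentation_iff U _ _).2 fun b => ?_
      cases b
      · rw [← twoVector_eq] at h2; exact h2
      · rw [← fourVector_eq] at h4; exact h4)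
  exact ⟨Φ, h1, fun s t => h2 s t _ _⟩

theorem hyper_star (i j : Fin d) :
    star ((𝓗 d).u i j) = (𝓗 d).u i j := by
  have h := UnivAlg.mk_rel (R := (𝓗 d).rels) (HyperRel.selfAdjoint i j)
  rw [map_sub, UnivAlg.mk_star] at h
  exact (sub_eq_zero.1 h).symm

theorem hyper_freeRel : FreeRel id (𝓗 d).u := by
  refine ⟨fun a b => ?_, fun a b => ?_, fun a b c h => ?_, fun a b c h => ?_⟩
  · have := UnivAlg.sum_left (R := (𝓗 d).rels) a b
    simp only [hyper_star] at this
    simpa only [id, eq_comm] using this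
  · have := UnivAlg.sum_right (R := (𝓗 d).rels) a b
    simp only [hyper_star] at this
    simpa only [id, eq_comm] using this
  · have h := UnivAlg.mk_rel (R := (𝓗 d).rels) (HyperRel.row a b c (Ne.symm h)); rwa [map_mul] at h
  · have h := UnivAlg.mk_rel (R := (𝓗 d).rels) (HyperRel.col b a c (Ne.symm h)); rwa [map_mul] at h

/-- The planar quantization of the free product of groups of order two. -/
theorem planarQuantization_z2Free :
    ∃ Φ : (planarQuantization (z2Gens d)).O ≃ₐc[ℂ] (𝓗 d).O,
      (∀ a, Φ (star a) = star (Φ a)) ∧ ∀ s t : Fin d,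
        Φ ((planarQuantization (z2Gens d)).u (z2GenMem d s) (z2GenMem d t)) =
          (𝓗 d).u s t := by
  obtain ⟨Φ, h1, h2⟩ := exists_bialgEquiv_planar id_involutive (z2Gen_inv d)
    (z2Gen_prod d) (𝓗 d) (hyper_freeRel d) (by
      rintro B _ _ _ _ U hU hs - - r hr
      cases hr with
      | selfAdjoint i j =>
        rw [map_sub, FreeStar.lift_star, FreeStar.lift_u, hs, id, id, sub_self]
      | row i j k h => rw [map_mul, FreeStar.lift_u, FreeStar.lift_u]; exact hU.row_zero _ _ _ h.symm
      | col i j k h => rw [map_mul, FreeStar.lift_u, FreeStar.lift_u]; exact hU.col_zero _ _ _ h.symm)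
  exact ⟨Φ, h1, fun s t => h2 s t _ _⟩

end Examples

/-! ### Operators on words and orthogonal projections -/

section Operators

universe w
variable {I : Type w}

theorem op_single (T : Op I) (l i : List I) (k : ℂ) : T (single l k) i = k * T (bv l) i := by
  have : (single l k : 𝓥 I) = k • bv l := by simp
  rw [this, map_smul]
  rfl

theorem op_apply (T : Op I) (v : 𝓥 I) (i : List I) :
    T v i = v.sum fun j c => c * T (bv j) i := by
  induction v using induction_linear with
  | zero => simp
  | add f g hf hg =>
    rw [map_add, fadd_apply, hf, hg, Finsupp.sum_add_index'] <;> simp [add_mul]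
  | single j c => rw [sum_single_index (by simp), op_single]

theorem OpAdj.symm {S T : Op I} (h : OpAdj S T) : OpAdj T S := fun i j => by rw [h, star_star]

theorem OpAdj.ext {S S' T : Op I} (h : OpAdj S T) (h' : OpAdj S' T) : S = S' :=
  op_ext fun l => fext fun i => by rw [h.symm i l, h'.symm i l]

theorem OpAdj.mul {S S' T T' : Op I} (h : OpAdj S S') (h' : OpAdj T T') :
    OpAdj (S * T) (T' * S') := fun i j => by
  classical
  rw [emul_apply, emul_apply, op_apply T', op_apply S]
  rw [Finsupp.sum_of_support_subset (s := (S' (bv j)).support ∪ (T (bv i)).support) _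
      Finset.subset_union_left _ (by simp),
    Finsupp.sum_of_support_subset (s := (S' (bv j)).support ∪ (T (bv i)).support) _
      Finset.subset_union_right _ (by simp), star_sum]
  refine sum_congr rfl fun k _ => ?_
  rw [h, h', star_mul']
  ring

theorem OpAdj.add {S S' T T' : Op I} (h : OpAdj S S') (h' : OpAdj T T') :
    OpAdj (S + T) (S' + T') := fun i j => by simp [h i j, h' i j]

theorem OpAdj.smul {S S' : Op I} (c : ℂ) (h : OpAdj S S') : OpAdj (c • S) (star c • S') :=
  fun i j => by simp [h i j]

theorem OpAdj.zero : OpAdj (0 : Op I) 0 := fun i j => by simp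

/-- The operator `P` is a self-adjoint projection onto `C` that preserves the length of words. -/
structure IsProj (C : Submodule ℂ (𝓥 I)) (P : Op I) : Prop where
  mem : ∀ v, P v ∈ C
  fix : ∀ c ∈ C, P c = c
  adj : OpAdj P P
  length : ∀ x y, x.length ≠ y.length → P (bv y) x = 0

theorem IsProj.comm {C : Submodule ℂ (𝓥 I)} {P : Op I} (h : IsProj C P) {L L' : Op I}
    (hL : ∀ c ∈ C, L c ∈ C) (hL' : ∀ c ∈ C, L' c ∈ C) (a : OpAdj L L') : P * L = L * P := by
  have h1 : P * L * P = L * P := lext fun v => h.fix _ (hL _ (h.mem v))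
  have h2 : P * L' * P = L' * P := lext fun v => h.fix _ (hL' _ (h.mem v))
  have h3 : OpAdj (P * L * P) (P * L' * P) := by
    have := (h.adj.mul a).mul h.adj
    rwa [← mul_assoc] at this
  rw [← h1]
  rw [h2] at h3
  exact (h.adj.mul a).ext h3

end Operators

theorem exists_matrix_proj {W : Type*} [Fintype W] [DecidableEq W] (C : Submodule ℂ (W → ℂ)) :
    ∃ p : Matrix W W ℂ, (∀ v, p.mulVec v ∈ C) ∧ (∀ c ∈ C, p.mulVec c = c) ∧
      pᴴ = p := by
  let e : EuclideanSpace ℂ W ≃ₗ[ℂ] (W → ℂ) := WithLp.linearEquiv 2 ℂ (W → ℂ)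
  let D : Submodule ℂ (EuclideanSpace ℂ W) := C.comap e.toLinearMap
  let P : (W → ℂ) →ₗ[ℂ] (W → ℂ) :=
    e.toLinearMap ∘ₗ D.starProjection.toLinearMap ∘ₗ e.symm.toLinearMap
  have hp : ∀ v, (toMatrix' P).mulVec v = P v := fun v => LinearMap.toMatrix'_mulVec P v
  refine ⟨toMatrix' P, fun v => ?_, fun c hc => ?_, ?_⟩
  · rw [hp]; exact D.starProjection_apply_mem (e.symm v)
  · rw [hp]
    have : D.starProjection (e.symm c) = e.symm c :=
      Submodule.starProjection_eq_self_iff.2 (by simpa [D] using hc)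
    change e (D.starProjection (e.symm c)) = c
    rw [this, e.apply_symm_apply]
  · ext i j
    have h := Submodule.inner_starProjection_left_eq_right D (e.symm (Pi.single j 1))
      (e.symm (Pi.single i 1))
    have e1 : ∀ k : W, e.symm (Pi.single k 1) = EuclideanSpace.single k (1 : ℂ) := fun k => rfl
    rw [e1, e1] at h
    rw [EuclideanSpace.inner_single_right, EuclideanSpace.inner_single_left] at h
    simp only [one_mul, map_one] at h
    exact ((star_star (P (Pi.single j 1) i)).symm.trans (congrArg star h)).symm

section Words

variable {X : Type} [Fintype X]

instance (n : ℕ) : Fintype {l : List X // l.length = n} :=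
  @Fintype.ofFinite _ (List.finite_length_eq X n).to_subtype

theorem exists_isProj (C : Submodule ℂ (𝓥 X))
    (hC : ∀ f ∈ C, ∀ n, f.filter (fun l => l.length = n) ∈ C) : ∃ P, IsProj C P := by
  classical
  let emb : ∀ n, ({l : List X // l.length = n} → ℂ) →ₗ[ℂ] (𝓥 X) := fun n =>
    Fintype.linearCombination ℂ (fun s => bv s.1)
  have emb_def : ∀ n v, emb n v = ∑ s, v s • bv s.1 := fun n v =>
    Fintype.linearCombination_apply ℂ _ v
  have emb_apply : ∀ n v (s : {l : List X // l.length = n}), emb n v s.1 = v s := fun n v s => by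
    rw [emb_def, finsetSum_apply]
    simp only [smul_single, single_apply, mul_one]
    simp [← ext_iff]
  have emb_zero : ∀ n v x, x.length ≠ n → emb n v x = 0 := fun n v x hx => by
    rw [emb_def, finsetSum_apply]
    refine sum_eq_zero fun s _ => ?_
    rw [smul_single, single_apply, if_neg]
    rintro rfl
    exact hx s.2
  have emb_filter : ∀ n (f : 𝓥 X),
      emb n (fun s => f s.1) = f.filter fun l => l.length = n := fun n f => by
    ext x
    by_cases hx : x.length = n
    · rw [filter_apply, if_pos hx]; exact emb_apply n _ ⟨x, hx⟩
    · rw [filter_apply, if_neg hx, emb_zero _ _ _ hx]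
  choose p hp1 hp2 hp3 using fun n => exists_matrix_proj (C.comap (emb n))
  let P : Op X := Finsupp.lift _ ℂ _ fun y => emb y.length fun s => p y.length s ⟨y, rfl⟩
  have P_bv : ∀ y, P (bv y) = emb y.length fun s => p y.length s ⟨y, rfl⟩ := fun y => by simp [P]
  have P_emb : ∀ n v, P (emb n v) = emb n ((p n).mulVec v) := fun n v => by
    have : ∀ s : {l : List X // l.length = n}, P (bv s.1) = emb n fun t => p n t s := by
      rintro ⟨y, rfl⟩
      exact P_bv y
    rw [emb_def, map_sum]
    simp only [map_smul, this]
    simp only [← map_smul, ← map_sum]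
    congr 1
    ext t
    simp [Matrix.mulVec, dotProduct, mul_comm]
  have decomp : ∀ f : 𝓥 X, f = ∑ n ∈ f.support.image List.length,
      f.filter fun l => l.length = n := fun f => by
    ext x
    rw [finsetSum_apply]
    by_cases hx : x ∈ f.support
    · rw [sum_eq_single x.length]
      · rw [filter_apply, if_pos rfl]
      · intro n _ hn; rw [filter_apply, if_neg hn.symm]
      · grind
    · rw [Finsupp.notMem_support_iff.1 hx]
      refine (sum_eq_zero fun n _ => ?_).symm
      rw [filter_apply]
      split_ifs
      · grind
      · rfl
  have hP : ∀ f : 𝓥 X, P f = ∑ n ∈ f.support.image List.length,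
      emb n ((p n).mulVec fun s => f s.1) := fun f => by
    conv_lhs => rw [decomp f]
    rw [map_sum]
    refine sum_congr rfl fun n _ => ?_
    rw [← emb_filter, P_emb]
  refine ⟨P, fun v => ?_, fun c hc => ?_, fun i j => ?_, fun x y h => ?_⟩
  · rw [hP]; exact Submodule.sum_mem _ fun n _ => hp1 n _
  · rw [hP]
    conv_rhs => rw [decomp c]
    refine sum_congr rfl fun n _ => ?_
    rw [hp2, emb_filter]
    rw [mem_comap, emb_filter]
    exact hC c hc n
  · rw [P_bv, P_bv]
    by_cases h : i.length = j.length
    · have h1 := emb_apply j.length (fun s => p j.length s ⟨j, rfl⟩) ⟨i, h⟩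
      have h2 := emb_apply i.length (fun s => p i.length s ⟨i, rfl⟩) ⟨j, h.symm⟩
      rw [h1, h2]
      have h3 : ∀ n (hi : i.length = n) (hj : j.length = n),
          p n ⟨i, hi⟩ ⟨j, hj⟩ = star (p n ⟨j, hj⟩ ⟨i, hi⟩) := fun n hi hj => by
        conv_lhs => rw [← hp3 n]
        rfl
      rw [h3]
      have h4 : ∀ n m (hi : i.length = n) (hj : j.length = n) (hi' : i.length = m)
          (hj' : j.length = m), p n ⟨j, hj⟩ ⟨i, hi⟩ = p m ⟨j, hj'⟩ ⟨i, hi'⟩ := by grind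
      rw [h4]
    · rw [emb_zero _ _ _ h, emb_zero _ _ _ (Ne.symm h), star_zero]
  · rw [P_bv, emb_zero _ _ _ h]

variable [DecidableEq X]

/-- Insertion of `∑ c, e c ⊗ e c` at position `r`. -/
def insertPair (r : ℕ) : Op X := Finsupp.lift _ ℂ _ fun l =>
  if r ≤ l.length then ∑ c, bv (l.take r ++ c :: c :: l.drop r) else 0

/-- Contraction of the letters at the positions `r` and `r + 1`. -/
def contractPair (r : ℕ) : Op X := Finsupp.lift _ ℂ _ fun l =>
  match l.drop r with
  | c :: c' :: b => if c = c' then bv (l.take r ++ b) else 0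
  | _ => 0

/-- Projection onto the words with equal letters at the positions `r` and `r + 1`. -/
def diagPair (r : ℕ) : Op X := Finsupp.lift _ ℂ _ fun l =>
  match l.drop r with
  | c :: c' :: _ => if c = c' then bv l else 0
  | _ => 0

theorem insertPair_bv (a b : List X) :
    insertPair a.length (bv (a ++ b)) = ∑ c, bv (a ++ c :: c :: b) := by simp [insertPair]

theorem insertPair_bv_short {r : ℕ} {l : List X} (h : l.length < r) :
    insertPair r (bv l) = 0 := by simp [insertPair, h]

theorem contractPair_bv (a b : List X) (c c' : X) :
    contractPair a.length (bv (a ++ c :: c' :: b)) = if c = c' then bv (a ++ b) else 0 := by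
  simp [contractPair]

theorem contractPair_bv_short {r : ℕ} {l : List X} (h : l.length < r + 2) :
    contractPair r (bv l) = 0 := by
  have h' : (l.drop r).length < 2 := by rw [length_drop]; omega
  simp only [contractPair, Finsupp.lift_apply, sum_single_index, zero_smul, one_smul]
  match l.drop r, h' with
  | [], _ => rfl
  | [_], _ => rfl

theorem diagPair_bv (a b : List X) (c c' : X) :
    diagPair a.length (bv (a ++ c :: c' :: b)) = if c = c' then bv (a ++ c :: c' :: b) else 0 := by
  simp [diagPair]

theorem diagPair_bv_short {r : ℕ} {l : List X} (h : l.length < r + 2) :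
    diagPair r (bv l) = 0 := by
  have h' : (l.drop r).length < 2 := by rw [length_drop]; omega
  simp only [diagPair, Finsupp.lift_apply, sum_single_index, zero_smul, one_smul]
  match l.drop r, h' with
  | [], _ => rfl
  | [_], _ => rfl

theorem exists_split {r : ℕ} {l : List X} (h : r ≤ l.length) : ∃ a b, a.length = r ∧ l = a ++ b :=
  ⟨l.take r, l.drop r, by simp [h], (take_append_drop r l).symm⟩

theorem exists_split_two {r : ℕ} {l : List X} (h : r + 2 ≤ l.length) :
    ∃ a c c' b, a.length = r ∧ l = a ++ c :: c' :: b := by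
  obtain ⟨a, b, ha, rfl⟩ := exists_split (r := r) (l := l) (by omega)
  match b, h with
  | [], h => simp at h; omega
  | [_], h => simp at h; omega
  | c :: c' :: b, _ => exact ⟨a, c, c', b, ha, rfl⟩

theorem insertPair_adj (r : ℕ) : OpAdj (insertPair r : Op X) (contractPair r) := fun i j => by
  by_cases hj : r + 2 ≤ j.length
  · obtain ⟨a, c, c', b, rfl, rfl⟩ := exists_split_two hj
    rw [contractPair_bv]
    by_cases hi : a.length ≤ i.length
    · obtain ⟨a', b', ha, rfl⟩ := exists_split hi
      have h := insertPair_bv a' b'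
      rw [ha] at h
      rw [h, finsetSum_apply]
      have e : ∀ x, (bv (a' ++ x :: x :: b')) (a ++ c :: c' :: b) =
          if x = c then if c = c' ∧ a ++ b = a' ++ b' then (1 : ℂ) else 0 else 0 := fun x => by
        have : (a' ++ x :: x :: b' = a ++ c :: c' :: b) ↔
            x = c ∧ c = c' ∧ a ++ b = a' ++ b' := by
          constructor
          · intro h
            obtain ⟨rfl, h⟩ := append_inj h ha
            grind
          · rintro ⟨rfl, rfl, h⟩; obtain ⟨rfl, rfl⟩ := append_inj h ha.symm; rfl
        split_ifs <;> simp_all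
      simp only [e]
      by_cases hc : c = c'
      · simp only [hc, if_true, true_and, mem_univ, single_apply]; split_ifs <;> simp
      · simp [hc]
    · rw [insertPair_bv_short (by omega)]
      split_ifs
      · rw [single_apply, if_neg]
        · simp
        · rintro rfl; simp at hi
      · simp
  · rw [contractPair_bv_short (by omega)]
    by_cases hi : r ≤ i.length
    · obtain ⟨a, b, rfl, rfl⟩ := exists_split hi
      rw [insertPair_bv, finsetSum_apply, sum_eq_zero]
      · simp
      · grind
    · rw [insertPair_bv_short (by omega)]; simp

theorem diagPair_adj (r : ℕ) : OpAdj (diagPair r : Op X) (diagPair r) := by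
  have key : ∀ l : List X, ∃ c : ℂ, star c = c ∧ diagPair r (bv l) = c • bv l := fun l => by
    by_cases hj : r + 2 ≤ l.length
    · obtain ⟨a, c, c', b, rfl, rfl⟩ := exists_split_two hj
      rw [diagPair_bv]
      split_ifs
      · exact ⟨1, by simp⟩
      · exact ⟨0, by simp⟩
    · exact ⟨0, by simp [diagPair_bv_short (show l.length < r + 2 by omega)]⟩
  intro i j
  obtain ⟨c, hc, h⟩ := key i
  obtain ⟨c', hc', h'⟩ := key j
  rw [h, h']
  by_cases hij : i = j
  · subst hij
    have : c = c' := by simpa using congrFun (congrArg DFunLike.coe (h.symm.trans h')) i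
    subst this
    simpa using hc.symm
  · simp [hij, Ne.symm hij]

theorem single_swap (l l' : List X) (k : ℂ) :
    k * star ((bv l' : 𝓥 X) l) = single l k l' := by
  by_cases h : l = l'
  · simp [h]
  · simp [h, Ne.symm h]

theorem insertPair_apply (f : 𝓥 X) (a b : List X) (c c' : X) :
    insertPair a.length f (a ++ c :: c' :: b) = if c = c' then f (a ++ b) else 0 := by
  induction f using induction_linear with
  | zero => simp
  | add f g hf hg => rw [map_add, fadd_apply, hf, hg]; split_ifs <;> simp
  | single l k =>
    rw [op_single, (insertPair_adj a.length).symm, contractPair_bv]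
    split_ifs
    · exact single_swap _ _ _
    · simp

theorem contractPair_apply (f : 𝓥 X) (a b : List X) :
    contractPair a.length f (a ++ b) = ∑ c, f (a ++ c :: c :: b) := by
  induction f using induction_linear with
  | zero => simp
  | add f g hf hg => rw [map_add, fadd_apply, hf, hg, ← sum_add_distrib]; rfl
  | single l k =>
    rw [op_single, insertPair_adj a.length, insertPair_bv, finsetSum_apply, star_sum, mul_sum]
    exact sum_congr rfl fun c _ => single_swap _ _ _

theorem diagPair_apply (f : 𝓥 X) (a b : List X) (c c' : X) :
    diagPair a.length f (a ++ c :: c' :: b) = if c = c' then f (a ++ c :: c' :: b) else 0 := by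
  induction f using induction_linear with
  | zero => simp
  | add f g hf hg => rw [map_add, fadd_apply, hf, hg]; split_ifs <;> simp
  | single l k =>
    rw [op_single, diagPair_adj a.length, diagPair_bv]
    split_ifs
    · exact single_swap _ _ _
    · simp

/-- Subspaces of the space of tensors that are closed under insertions, contractions and the
projections onto words with equal neighbouring letters. -/
structure PairClosed (C : Submodule ℂ (𝓥 X)) : Prop where
  unit : bv [] ∈ C
  filter : ∀ f ∈ C, ∀ n, f.filter (fun l => l.length = n) ∈ C
  insert : ∀ r, ∀ f ∈ C, insertPair r f ∈ C
  contract : ∀ r, ∀ f ∈ C, contractPair r f ∈ C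
  diag : ∀ r, ∀ f ∈ C, diagPair r f ∈ C

end Words

/-! ### The Haar functional of the hyperoctahedral quantum group -/

namespace FreeStar

variable {X : Type}

def word (l : List ((X × X) × Bool)) : FreeStar X := (l.map gen).prod

theorem word_append (l l' : List ((X × X) × Bool)) : word (l ++ l') = word l * word l' := by
  simp [word]

theorem word_cons (g : (X × X) × Bool) (l : List ((X × X) × Bool)) :
    word (g :: l) = gen g * word l := by simp [word]

theorem span_word : Submodule.span ℂ (Set.range (word (X := X))) = ⊤ := by
  refine eq_top_iff.2 fun a _ => ?_
  induction a using FreeStar.induction with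
  | h1 c =>
    rw [Algebra.algebraMap_eq_smul_one]
    exact smul_mem _ c (subset_span ⟨[], rfl⟩)
  | h2 g => exact subset_span ⟨[g], by simp [word]⟩
  | h3 a b ha hb =>
    have := Submodule.mul_mem_mul (ha trivial) (hb trivial)
    rw [Submodule.span_mul_span] at this
    refine Submodule.span_mono ?_ this
    rintro _ ⟨_, ⟨l, rfl⟩, _, ⟨l', rfl⟩, rfl⟩
    exact ⟨l ++ l', word_append l l'⟩
  | h4 a b ha hb => exact Submodule.add_mem _ (ha trivial) (hb trivial)

theorem linearMap_ext {M : Type*} [AddCommMonoid M] [Module ℂ M] {f g : FreeStar X →ₗ[ℂ] M}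
    (h : ∀ l, f (word l) = g (word l)) : f = g :=
  LinearMap.ext_on_range span_word h

theorem exists_linear (f : List ((X × X) × Bool) → ℂ) :
    ∃ h : FreeStar X →ₗ[ℂ] ℂ, ∀ l, h (word l) = f l := by
  let φ : FreeStar X →ₐ[ℂ] Module.End ℂ (List ((X × X) × Bool) →₀ ℂ) :=
    FreeAlgebra.lift ℂ fun g => 𝓜 (g :: ·)
  have hφ : ∀ g, φ (gen g) = 𝓜 (g :: ·) := fun g =>
    FreeAlgebra.lift_ι_apply _ _
  have hw : ∀ l, φ (word l) (single [] 1) = single l 1 := fun l => by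
    induction l with
    | nil => simp [word]
    | cons g l ih => rw [word_cons, map_mul, emul_apply, ih, hφ]; simp
  refine ⟨(linearCombination ℂ f) ∘ₗ (LinearMap.applyₗ (single [] 1)) ∘ₗ
    φ.toLinearMap, fun l => ?_⟩
  simp [hw]

end FreeStar

open FreeStar (gen star_gen word word_append word_cons)

theorem UnivAlg.exists_functional {X : Type} [Fintype X] [DecidableEq X] {R : Set (FreeStar X)}
    (h : FreeStar X →ₗ[ℂ] ℂ) (hR : ∀ a b, Rel R a b → ∀ l l',
      h (word l * a * word l') = h (word l * b * word l')) :
    ∃ g : UnivAlg R →ₗ[ℂ] ℂ, ∀ a, g (UnivAlg.mk R a) = h a := by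
  have h1 : ∀ a b, Rel R a b → ∀ x y, h (x * a * y) = h (x * b * y) := fun a b hab x y => by
    have e1 : ∀ l, h ∘ₗ mulLeft ℂ (word l * a) =
        h ∘ₗ mulLeft ℂ (word l * b) := fun l =>
      FreeStar.linearMap_ext fun l' => hR a b hab l l'
    have e2 : h ∘ₗ mulRight ℂ (a * y) = h ∘ₗ mulRight ℂ (b * y) :=
      FreeStar.linearMap_ext fun l => by
        have := DFunLike.congr_fun (e1 l) y
        simpa [mul_assoc] using this
    have := DFunLike.congr_fun e2 x
    simpa [mul_assoc] using this
  have h2 : ∀ a b, RingQuot.Rel (Rel R) a b → ∀ x y, h (x * a * y) = h (x * b * y) := by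
    intro a b hab
    induction hab with
    | of hab => exact h1 _ _ hab
    | add_left _ ih => intro x y; simp only [mul_add, add_mul, map_add, ih]
    | mul_left _ ih =>
      intro x y
      have := ih x
      simpa only [mul_assoc] using this _
    | mul_right _ ih =>
      intro x y
      have := ih
      simpa only [mul_assoc] using this (x * _) y
  have h3 : ∀ a b, UnivAlg.mk R a = UnivAlg.mk R b → h a = h b := fun a b hab => by
    have e : ∀ b : FreeStar X, UnivAlg.mk R b = (⟨Quot.mk _ b⟩ : RingQuot (Rel R)) := fun b => by
      simp [UnivAlg.mk, RingQuot.mkAlgHom_def, RingQuot.mkRingHom_def]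
      rfl
    rw [e, e] at hab
    have q := Quot.eqvGen_exact (congrArg RingQuot.toQuot hab)
    clear hab
    induction q with
    | rel a b hab => simpa using h2 a b hab 1 1
    | refl a => rfl
    | symm _ _ _ ih => exact ih.symm
    | trans _ _ _ _ _ ih1 ih2 => exact ih1.trans ih2
  have hs := fun a => Function.surjInv_eq (UnivAlg.mk_surjective R) a
  exact ⟨{
    toFun := fun a => h (Function.surjInv (UnivAlg.mk_surjective R) a)
    map_add' := fun a b => by rw [← map_add]; exact h3 _ _ (by rw [map_add, hs, hs, hs])
    map_smul' := fun c a => by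
      rw [← map_smul]
      exact h3 _ _ (by rw [map_smul, hs, hs]; rfl) }, fun a => h3 _ _ (hs _)⟩

section Haar

variable {X : Type} [Fintype X] [DecidableEq X] {C : Submodule ℂ (𝓥 X)} {P : Op X}

theorem IsProj.symm_apply (h : IsProj C P) (x y : List X) : P (bv y) x = star (P (bv x) y) :=
  h.adj x y

theorem IsProj.sum_insert (hP : IsProj C P) (hC : PairClosed C) {a a' : List X}
    (h : a.length = a'.length) (b b' : List X) (i j : X) :
    ∑ k, P (bv (a' ++ k :: k :: b')) (a ++ i :: j :: b) =
      if i = j then P (bv (a' ++ b')) (a ++ b) else 0 := by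
  have e := DFunLike.congr_fun (hP.comm (hC.insert a.length) (hC.contract a.length)
    (insertPair_adj _)) (bv (a' ++ b'))
  rw [emul_apply, emul_apply] at e
  have e := DFunLike.congr_fun e (a ++ i :: j :: b)
  rw [insertPair_apply] at e
  rw [h, insertPair_bv, map_sum, finsetSum_apply] at e
  exact e

theorem IsProj.sum_contract (hP : IsProj C P) (hC : PairClosed C) {a a' : List X}
    (h : a.length = a'.length) (b b' : List X) (i j : X) :
    ∑ k, P (bv (a' ++ i :: j :: b')) (a ++ k :: k :: b) =
      if i = j then P (bv (a' ++ b')) (a ++ b) else 0 := by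
  have := congrArg star (hP.sum_insert hC h.symm b' b i j)
  rw [star_sum] at this
  simp only [← hP.symm_apply] at this
  rw [this]
  split_ifs
  · rw [← hP.symm_apply]
  · simp

theorem IsProj.diag_eq_zero (hP : IsProj C P) (hC : PairClosed C) {a a' : List X}
    (h : a.length = a'.length) (b b' : List X) (i : X) {j k : X} (hjk : j ≠ k) :
    P (bv (a' ++ j :: k :: b')) (a ++ i :: i :: b) = 0 := by
  have e := DFunLike.congr_fun (hP.comm (hC.diag a.length) (hC.diag a.length)
    (diagPair_adj _)) (bv (a' ++ j :: k :: b'))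
  rw [emul_apply, emul_apply] at e
  have e := DFunLike.congr_fun e (a ++ i :: i :: b)
  rw [diagPair_apply, if_pos rfl, h, diagPair_bv, if_neg hjk, map_zero] at e
  exact e.symm

theorem IsProj.diag_eq_zero' (hP : IsProj C P) (hC : PairClosed C) {a a' : List X}
    (h : a.length = a'.length) (b b' : List X) (i : X) {j k : X} (hjk : j ≠ k) :
    P (bv (a' ++ i :: i :: b')) (a ++ j :: k :: b) = 0 := by
  rw [hP.symm_apply, hP.diag_eq_zero hC h.symm b' b i hjk, star_zero]

end Haar

theorem exists_haar {d : ℕ} {C : Submodule ℂ (𝓥 (Fin d))} (hC : PairClosed C) :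
    ∃ (P : Op (Fin d)) (h : (𝓗 d).O →ₗ[ℂ] ℂ), IsProj C P ∧
      ∀ x y, h (wordMat (𝓗 d).u x y) = P (bv y) x := by
  obtain ⟨P, hP⟩ := exists_isProj C hC.filter
  obtain ⟨f, hf⟩ := FreeStar.exists_linear (X := Fin d) fun l =>
    P (bv (l.map fun g => g.1.2)) (l.map fun g => g.1.1)
  have key : ∀ g g' l l', f (word l * (gen g * gen g') *
      word l') = P (bv ((l.map fun g => g.1.2) ++ g.1.2 :: g'.1.2 ::
        (l'.map fun g => g.1.2))) ((l.map fun g => g.1.1) ++ g.1.1 :: g'.1.1 ::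
        (l'.map fun g => g.1.1)) := fun g g' l l' => by
    have : word l * (gen g * gen g') * word l' =
        word (l ++ g :: g' :: l') := by
      rw [word_append, word_cons, word_cons]
      simp only [mul_assoc]
    rw [this, hf]
    simp
  have key0 : ∀ l l', f (word l * 1 * word l') =
      P (bv ((l.map fun g => g.1.2) ++ (l'.map fun g => g.1.2)))
        ((l.map fun g => g.1.1) ++ (l'.map fun g => g.1.1)) := fun l l' => by
    rw [mul_one, ← word_append, hf]
    simp
  have len : ∀ l : List ((Fin d × Fin d) × Bool),
      (l.map fun g => g.1.1).length = (l.map fun g => g.1.2).length := fun l => by simp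
  have sum : ∀ i j b b' l l', f (word l * (∑ k, gen ((i, k), b) * gen ((j, k), b')) * word l') =
        f (word l * (if i = j then 1 else 0) * word l') ∧
      f (word l * (∑ k, gen ((k, i), b) * gen ((k, j), b')) * word l') =
        f (word l * (if i = j then 1 else 0) * word l') := fun i j b b' l l' => by
    simp only [mul_sum, sum_mul, map_sum, key]
    rw [hP.sum_insert hC (len l), hP.sum_contract hC (len l)]
    split_ifs
    · rw [key0]; exact ⟨rfl, rfl⟩
    · simp
  have self : ∀ i j b b' l l', f (word l * gen ((i, j), b) *
      word l') = f (word l * gen ((i, j), b') * word l') :=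
    fun i j b b' l l' => by
    have : ∀ b, word l * gen ((i, j), b) * word l' =
        word (l ++ ((i, j), b) :: l') := fun b => by
      rw [word_append, word_cons, mul_assoc]
    rw [this, this, hf, hf]
    simp
  have hu : ∀ i j : Fin d, FreeStar.u i j = gen ((i, j), false) := fun _ _ => rfl
  have good : ∀ a b, Rel (𝓗 d).rels a b → ∀ l l',
      f (word l * a * word l') = f (word l * b * word l') ∧
      f (word l * star a * word l') =
        f (word l * star b * word l') := by
    intro a b hab
    induction hab with
    | unitary_left i j | unitary_right i j =>
      intro l l'
      simp only [hu, star_gen, star_sum, star_mul, apply_ite star, star_one, star_zero,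
        Bool.not_false, Bool.not_true, sum, eq_comm, and_self]
    | of_mem r hr =>
      intro l l'
      cases hr with
      | selfAdjoint i j =>
        simp only [hu, star_gen, star_sub, star_zero, Bool.not_false, Bool.not_true,
          mul_sub, sub_mul, map_sub, mul_zero, zero_mul, map_zero, sub_eq_zero]
        grind
      | row i j k hjk =>
        simp only [hu, star_gen, star_mul, star_zero, key]
        rw [hP.diag_eq_zero hC (len l) _ _ _ hjk, hP.diag_eq_zero hC (len l) _ _ _ hjk.symm]
        simp
      | col i j k hjk =>
        simp only [hu, star_gen, star_mul, star_zero, key]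
        rw [hP.diag_eq_zero' hC (len l) _ _ _ hjk, hP.diag_eq_zero' hC (len l) _ _ _ hjk.symm]
        simp
    | adj a b _ ih =>
      intro l l'
      rw [star_star, star_star]
      exact (ih l l').symm
  obtain ⟨g, hg⟩ := UnivAlg.exists_functional f fun a b hab l l' => (good a b hab l l').1
  refine ⟨P, g, hP, fun x y => ?_⟩
  by_cases hxy : x.length = y.length
  · have e : ∀ l : List (Fin d × Fin d), wordMat (𝓗 d).u (l.map Prod.fst) (l.map Prod.snd) =
        UnivAlg.mk (𝓗 d).rels (word (l.map fun p => (p, false))) := fun l => by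
      induction l with
      | nil => exact (map_one _).symm
      | cons p l ih => simp only [map_cons, wordMat_cons_cons, ih, word_cons, map_mul]; rfl
    obtain ⟨l, rfl, rfl⟩ : ∃ l : List (Fin d × Fin d), l.map Prod.fst = x ∧ l.map Prod.snd = y :=
      ⟨x.zip y, List.map_fst_zip hxy.le, List.map_snd_zip hxy.ge⟩
    rw [e, hg, hf, map_map, map_map]
    rfl
  · rw [wordMat_len _ hxy, map_zero, hP.length _ _ hxy]

/-! ### Fixed vectors -/

section Fixed

def coact {X : Type} {A : Type*} [Ring A] [Algebra ℂ A] (U : X → X → A) (k : List X) :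
    (𝓥 X) →ₗ[ℂ] A :=
  linearCombination ℂ fun t => wordMat U k t

theorem coact_bv {X : Type} {A : Type*} [Ring A] [Algebra ℂ A] (U : X → X → A) (k l : List X) :
    coact U k (bv l) = wordMat U k l := by simp [coact]

variable {X : Type} [Fintype X] [DecidableEq X] {A : Type*} [Ring A] [Algebra ℂ A]

/-- The tensors that are fixed by the tensor powers of `U`. -/
def fixedVectors (U : X → X → A) : Submodule ℂ (𝓥 X) where
  carrier := {f | ∀ k, coact U k f = f k • 1}
  zero_mem' k := by simp
  add_mem' hf hg k := by rw [map_add, hf k, hg k, fadd_apply, add_smul]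
  smul_mem' c f hf k := by rw [map_smul, hf k, fsmul_apply, smul_assoc]

theorem insertPair_apply_short {r : ℕ} (f : 𝓥 X) {k : List X} (h : k.length < r + 2) :
    insertPair r f k = 0 := by
  rw [op_apply]
  refine sum_eq_zero fun y _ => ?_
  dsimp only
  rw [(insertPair_adj r).symm, contractPair_bv_short h]
  simp

theorem contractPair_apply_short {r : ℕ} (f : 𝓥 X) {k : List X} (h : k.length < r) :
    contractPair r f k = 0 := by
  rw [op_apply]
  refine sum_eq_zero fun y _ => ?_
  dsimp only
  rw [insertPair_adj r, insertPair_bv_short h]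
  simp

theorem diagPair_apply_short {r : ℕ} (f : 𝓥 X) {k : List X} (h : k.length < r + 2) :
    diagPair r f k = 0 := by
  rw [op_apply]
  refine sum_eq_zero fun y _ => ?_
  dsimp only
  rw [diagPair_adj r, diagPair_bv_short h]
  simp

theorem linearMap_ext_bv {M : Type*} [AddCommMonoid M] [Module ℂ M]
    {f g : (𝓥 X) →ₗ[ℂ] M} (h : ∀ l, f (bv l) = g (bv l)) : f = g := by
  apply lhom_ext'; intro l; apply ext_ring; exact h l

end Fixed

section FixedClosed

variable {X : Type} [Fintype X] [DecidableEq X] {A : Type*} [Ring A] [Algebra ℂ A]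
  {U : X → X → A}

theorem coact_insertPair (h : FreeRel id U) (a b : List X) (i j : X) (f : 𝓥 X) :
    coact U (a ++ i :: j :: b) (insertPair a.length f) =
      if i = j then coact U (a ++ b) f else 0 := by
  have : (coact U (a ++ i :: j :: b)) ∘ₗ (insertPair a.length) =
      if i = j then coact U (a ++ b) else 0 := linearMap_ext_bv fun l => by
    rw [lcomp_apply]
    have e : (if i = j then coact U (a ++ b) else 0) (bv l) =
        if i = j then wordMat U (a ++ b) l else 0 := by
      split_ifs
      · exact coact_bv _ _ _
      · rfl
    rw [e]
    by_cases hl : a.length ≤ l.length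
    · obtain ⟨a', b', ha, rfl⟩ := exists_split hl
      rw [← ha, insertPair_bv, map_sum]
      simp only [coact_bv, wordMat_append _ _ _ ha.symm, wordMat_cons_cons]
      rw [← mul_sum]
      simp only [← mul_assoc (U i _), ← sum_mul]
      have := h.row i j
      simp only [id] at this
      rw [this]
      by_cases hij : i = j
      · simp [hij]
      · simp [hij, Ne.symm hij]
    · rw [insertPair_bv_short (by omega), map_zero, wordMat_len, ite_self]; simp; omega
  have e := DFunLike.congr_fun this f
  rw [lcomp_apply] at e
  rw [e]
  split_ifs <;> rfl

theorem coact_contractPair (h : FreeRel id U) (a b : List X) (f : 𝓥 X) :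
    coact U (a ++ b) (contractPair a.length f) = ∑ e, coact U (a ++ e :: e :: b) f := by
  have : (coact U (a ++ b)) ∘ₗ (contractPair a.length) =
      ∑ e, coact U (a ++ e :: e :: b) := linearMap_ext_bv fun l => by
    rw [lcomp_apply, lsum_apply]
    simp only [coact_bv]
    by_cases hl : a.length + 2 ≤ l.length
    · obtain ⟨a', c, c', b', ha, rfl⟩ := exists_split_two hl
      rw [← ha, contractPair_bv]
      simp only [wordMat_append _ _ _ ha.symm, wordMat_cons_cons]
      rw [← mul_sum]
      simp only [← mul_assoc (U _ c), ← sum_mul]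
      have := h.col c c'
      simp only [id] at this
      rw [this]
      by_cases hc : c = c'
      · simp [hc, coact_bv, wordMat_append _ _ _ ha.symm]
      · simp [hc, Ne.symm hc]
    · rw [contractPair_bv_short (by omega)]
      refine (sum_eq_zero fun e _ => wordMat_len _ ?_).symm
      simp
      omega
  have e := DFunLike.congr_fun this f
  rwa [lsum_apply] at e

theorem coact_diagPair (h : FreeRel id U) (a b : List X) (i j : X) (f : 𝓥 X) :
    coact U (a ++ i :: j :: b) (diagPair a.length f) =
      if i = j then coact U (a ++ i :: j :: b) f else 0 := by
  have : (coact U (a ++ i :: j :: b)) ∘ₗ (diagPair a.length) =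
      if i = j then coact U (a ++ i :: j :: b) else 0 := linearMap_ext_bv fun l => by
    rw [lcomp_apply]
    have e : (if i = j then coact U (a ++ i :: j :: b) else 0) (bv l) =
        if i = j then wordMat U (a ++ i :: j :: b) l else 0 := by
      split_ifs
      · exact coact_bv _ _ _
      · rfl
    rw [e]
    by_cases hl : a.length + 2 ≤ l.length
    · obtain ⟨a', c, c', b', ha, rfl⟩ := exists_split_two hl
      rw [← ha, diagPair_bv]
      have h1 : i ≠ j → U i c * (U j c * wordMat U b b') = 0 := fun hij => by
        rw [← mul_assoc]
        have := h.col_zero i c j (Ne.symm hij)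
        simp only [id] at this
        rw [this, zero_mul]
      have h2 : c ≠ c' → U i c * (U i c' * wordMat U b b') = 0 := fun hc => by
        rw [← mul_assoc]
        have := h.row_zero i c c' (Ne.symm hc)
        grind
      by_cases hc : c = c'
      · subst hc
        rw [if_pos rfl, coact_bv, wordMat_append _ _ _ ha.symm]
        by_cases hij : i = j
        · simp [hij]
        · simp [h1 hij]
      · rw [if_neg hc, wordMat_append _ _ _ ha.symm]
        by_cases hij : i = j
        · subst hij; simp [h2 hc]
        · simp [hij]
    · rw [diagPair_bv_short (by omega), map_zero, wordMat_len, ite_self]; simp; omega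
  have e := DFunLike.congr_fun this f
  rw [lcomp_apply] at e
  rw [e]
  split_ifs <;> rfl

theorem coact_of_length (k : List X) {f : 𝓥 X} (h : ∀ t ∈ f.support, t.length ≠ k.length) :
    coact U k f = 0 := by
  rw [coact, linearCombination_apply]
  refine sum_eq_zero fun t ht => ?_
  dsimp only
  rw [wordMat_len _ (h t ht).symm, smul_zero]

theorem coact_filter (k : List X) (f : 𝓥 X) (n : ℕ) :
    coact U k (f.filter fun l => l.length = n) = if k.length = n then coact U k f else 0 := by
  split_ifs with hk
  · conv_rhs => rw [← Finsupp.filter_add_filter_not f fun l => l.length = n]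
    rw [map_add, coact_of_length k (f := f.filter fun l => ¬ l.length = n), add_zero]
    intro t ht
    rw [Finsupp.support_filter, mem_filter] at ht
    rw [hk]
    exact ht.2
  · refine coact_of_length k fun t ht => ?_
    rw [Finsupp.support_filter, mem_filter] at ht
    rw [ht.2]
    exact Ne.symm hk

theorem fixedVectors_pairClosed (h : FreeRel id U) : PairClosed (fixedVectors U) where
  unit k := by
    rw [coact_bv]
    cases k with
    | nil => simp
    | cons a k => simp
  filter f hf n k := by
    rw [coact_filter, filter_apply]
    split_ifs
    · exact hf k
    · simp
  insert r f hf k := by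
    by_cases hk : r + 2 ≤ k.length
    · obtain ⟨a, i, j, b, rfl, rfl⟩ := exists_split_two hk
      rw [coact_insertPair h, insertPair_apply, hf]
      split_ifs <;> simp
    · rw [insertPair_apply_short f (by omega), zero_smul]
      rw [coact, linearCombination_apply]
      refine sum_eq_zero fun t _ => ?_
      dsimp only
      by_cases ht : t.length = k.length
      · rw [insertPair_apply_short f (by omega), zero_smul]
      · rw [wordMat_len _ (Ne.symm ht), smul_zero]
  contract r f hf k := by
    by_cases hk : r ≤ k.length
    · obtain ⟨a, b, rfl, rfl⟩ := exists_split hk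
      rw [coact_contractPair h, contractPair_apply, Finset.sum_smul]
      exact sum_congr rfl fun e _ => hf _
    · rw [contractPair_apply_short f (by omega), zero_smul]
      rw [coact, linearCombination_apply]
      refine sum_eq_zero fun t _ => ?_
      dsimp only
      by_cases ht : t.length = k.length
      · rw [contractPair_apply_short f (by omega), zero_smul]
      · rw [wordMat_len _ (Ne.symm ht), smul_zero]
  diag r f hf k := by
    by_cases hk : r + 2 ≤ k.length
    · obtain ⟨a, i, j, b, rfl, rfl⟩ := exists_split_two hk
      rw [coact_diagPair h, diagPair_apply, hf]
      split_ifs <;> simp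
    · rw [diagPair_apply_short f (by omega), zero_smul]
      rw [coact, linearCombination_apply]
      refine sum_eq_zero fun t _ => ?_
      dsimp only
      by_cases ht : t.length = k.length
      · rw [diagPair_apply_short f (by omega), zero_smul]
      · rw [wordMat_len _ (Ne.symm ht), smul_zero]

end FixedClosed

theorem fixedVectors_le {d : ℕ} {C : Submodule ℂ (𝓥 (Fin d))} (hC : PairClosed C) :
    fixedVectors (𝓗 d).u ≤ C := fun f hf => by
  obtain ⟨P, h, hP, hh⟩ := exists_haar hC
  have h1 : h 1 = 1 := by have := hh [] []; rw [hP.fix _ hC.unit] at this; simpa using this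
  have : P f = f := by
    ext x
    have e : h (coact (𝓗 d).u x f) = P f x := by
      rw [coact, linearCombination_apply, Finsupp.sum, map_sum, op_apply]
      refine sum_congr rfl fun y _ => ?_
      rw [map_smul, hh, smul_eq_mul]
    rw [← e, hf x, map_smul, h1, smul_eq_mul, mul_one]
  rw [← this]
  exact hP.mem f

/-! ### Rotation of intertwiners -/

section Rotate

variable {X : Type} [Fintype X] [DecidableEq X]

/-- The tensor corresponding to a matrix between tensor powers. -/
def rotate {n m : ℕ} (T : Matrix (Fin n → X) (Fin m → X) ℂ) : 𝓥 X :=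
  ∑ s, ∑ t, T s t • bv (ofFn s ++ (ofFn t).reverse)

theorem rotate_apply {n m : ℕ} (T : Matrix (Fin n → X) (Fin m → X) ℂ) (s : Fin n → X)
    (t : Fin m → X) : rotate T (ofFn s ++ (ofFn t).reverse) = T s t := by
  rw [rotate, finsetSum_apply, sum_eq_single s]
  · rw [finsetSum_apply, sum_eq_single t]
    · simp
    · intro t' _ h
      rw [fsmul_apply, single_apply, if_neg, smul_zero]
      intro e
      exact h (List.ofFn_injective (List.reverse_injective (List.append_cancel_left e)))
    · simp
  · intro s' _ h
    rw [finsetSum_apply]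
    refine sum_eq_zero fun t' _ => ?_
    rw [fsmul_apply, single_apply, if_neg, smul_zero]
    intro e
    exact h (List.ofFn_injective (append_inj e (by simp)).1)
  · simp

theorem rotate_apply_length {n m : ℕ} (T : Matrix (Fin n → X) (Fin m → X) ℂ) {l : List X}
    (h : l.length ≠ n + m) : rotate T l = 0 := by
  rw [rotate, finsetSum_apply]
  refine sum_eq_zero fun s _ => ?_
  rw [finsetSum_apply]
  refine sum_eq_zero fun t _ => ?_
  rw [fsmul_apply, single_apply, if_neg, smul_zero]
  rintro rfl
  simp at h

theorem exists_ofFn {n m : ℕ} {l : List X} (h : l.length = n + m) :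
    ∃ (s : Fin n → X) (t : Fin m → X), l = ofFn s ++ (ofFn t).reverse := by
  obtain ⟨a, b, ha, rfl⟩ := exists_split (r := n) (l := l) (by omega)
  have hb : b.reverse.length = m := by grind
  subst ha hb
  refine ⟨a.get, b.reverse.get, ?_⟩
  rw [ofFn_get, ofFn_get, List.reverse_reverse]

theorem rotate_eq {n m : ℕ} (T : Matrix (Fin n → X) (Fin m → X) ℂ) {f : 𝓥 X}
    (h : ∀ s t, f (ofFn s ++ (ofFn t).reverse) = T s t)
    (h' : ∀ l, l.length ≠ n + m → f l = 0) : f = rotate T := by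
  ext l
  by_cases hl : l.length = n + m
  · obtain ⟨s, t, rfl⟩ := exists_ofFn hl; rw [h, rotate_apply]
  · rw [h' l hl, rotate_apply_length T hl]

variable {A : Type} [Ring A] [Algebra ℂ A] [StarRing A] {U : X → X → A}

theorem star_wordMat (hs : ∀ i j, star (U i j) = U i j) (x y : List X) :
    star (wordMat U x y) = wordMat U x.reverse y.reverse := by
  induction x generalizing y with
  | nil =>
    cases y with
    | nil => simp
    | cons b y => rw [wordMat_nil_cons, star_zero, wordMat_len]; simp
  | cons a x ih =>
    cases y with
    | nil => rw [wordMat_cons_nil, star_zero, wordMat_len]; simp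
    | cons b y =>
      rw [wordMat_cons_cons, star_mul, ih, hs, List.reverse_cons, List.reverse_cons]
      by_cases h : x.length = y.length
      · rw [wordMat_append _ _ _ (by simpa using h)]; simp
      · rw [wordMat_len _ (by simpa using h), wordMat_len _ (by simpa using h),
          zero_mul]

theorem sum_tpow_star (hl : ∀ i j, ∑ k, U i k * star (U j k) = if i = j then 1 else 0) (n : ℕ)
    (i j : Fin n → X) : ∑ k, tpow U n i k * star (tpow U n j k) = if i = j then 1 else 0 := by
  induction n with
  | zero => simp [tpow_zero, Subsingleton.elim i j]
  | succ n ih =>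
    rw [← (consEquiv fun _ => X).sum_comp, sum_prod_type, sum_comm]
    have e : ∀ (k : Fin n → X) (a : X), tpow U (n + 1) i (consEquiv (fun _ => X) (a, k)) *
        star (tpow U (n + 1) j (consEquiv (fun _ => X) (a, k))) =
        U (i 0) a * (tpow U n (Fin.tail i) k * star (tpow U n (Fin.tail j) k)) *
          star (U (j 0) a) := fun k a => by
      simp only [tpow_succ, consEquiv, coe_fn_mk, Fin.cons_zero, Fin.tail_cons, star_mul, mul_assoc]
    simp only [e]
    rw [sum_comm]
    simp only [← sum_mul, ← mul_sum, ih]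
    have hij : i = j ↔ Fin.tail i = Fin.tail j ∧ i 0 = j 0 := by
      constructor
      · rintro rfl; exact ⟨rfl, rfl⟩
      · rintro ⟨h1, h2⟩; rw [← Fin.cons_self_tail i, ← Fin.cons_self_tail j, h1, h2]
    by_cases h : Fin.tail i = Fin.tail j
    · simp [h, hij, hl]
    · simp [h, hij]

theorem sum_star_tpow (hr : ∀ i j, ∑ k, star (U k i) * U k j = if i = j then 1 else 0) (n : ℕ)
    (i j : Fin n → X) : ∑ k, star (tpow U n k i) * tpow U n k j = if i = j then 1 else 0 := by
  induction n with
  | zero => simp [tpow_zero, Subsingleton.elim i j]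
  | succ n ih =>
    rw [← (consEquiv fun _ => X).sum_comp, sum_prod_type]
    have e : ∀ (a : X) (k : Fin n → X), star (tpow U (n + 1) (consEquiv (fun _ => X) (a, k)) i)
        * tpow U (n + 1) (consEquiv (fun _ => X) (a, k)) j =
        star (tpow U n k (Fin.tail i)) * (star (U a (i 0)) * U a (j 0)) *
          tpow U n k (Fin.tail j) := fun a k => by
      simp only [tpow_succ, consEquiv, coe_fn_mk, Fin.cons_zero, Fin.tail_cons, star_mul, mul_assoc]
    simp only [e]
    rw [sum_comm]
    simp only [← sum_mul, ← mul_sum, hr]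
    have hij : i = j ↔ Fin.tail i = Fin.tail j ∧ i 0 = j 0 := by
      constructor
      · rintro rfl; exact ⟨rfl, rfl⟩
      · rintro ⟨h1, h2⟩; rw [← Fin.cons_self_tail i, ← Fin.cons_self_tail j, h1, h2]
    by_cases h : i 0 = j 0
    · simp [h, hij, ih]
    · simp [h, hij]

theorem mem_intertwiners_iff (hs : ∀ i j, star (U i j) = U i j)
    (hl : ∀ i j, ∑ k, U i k * star (U j k) = if i = j then 1 else 0)
    (hr : ∀ i j, ∑ k, star (U k i) * U k j = if i = j then 1 else 0) {n m : ℕ}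
    (T : Matrix (Fin n → X) (Fin m → X) ℂ) :
    T ∈ intertwiners (tpow U m) (tpow U n) ↔ rotate T ∈ fixedVectors U := by
  have key : ∀ (s : Fin n → X) (t : Fin m → X),
      coact U (ofFn s ++ (ofFn t).reverse) (rotate T) =
        ∑ i, (∑ l, T l i • tpow U n s l) * star (tpow U m t i) := fun s t => by
    rw [rotate, map_sum, sum_congr rfl fun _ _ => map_sum _ _ _, sum_comm]
    refine sum_congr rfl fun i _ => ?_
    rw [sum_mul]
    refine sum_congr rfl fun l _ => ?_
    rw [map_smul, coact_bv, wordMat_append _ _ _ (by simp), wordMat_ofFn, ← star_wordMat hs,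
      wordMat_ofFn, smul_mul_assoc]
  constructor
  · intro h k
    by_cases hk : k.length = n + m
    · obtain ⟨s, t, rfl⟩ := exists_ofFn hk
      rw [key, rotate_apply]
      have h' : ∀ i, (∑ l, T l i • tpow U n s l) * star (tpow U m t i) =
          ∑ j, T s j • (tpow U m j i * star (tpow U m t i)) := fun i => by
        rw [← h s i, sum_mul]
        simp only [smul_mul_assoc]
      simp only [h']
      rw [sum_comm]
      simp only [← Finset.smul_sum, sum_tpow_star hl]
      simp
    · rw [rotate_apply_length T hk, zero_smul]
      refine coact_of_length k fun t ht e => ?_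
      exact Finsupp.mem_support_iff.1 ht (rotate_apply_length T (by rwa [e]))
  · intro h s i
    have h' : ∀ t, ∑ i, (∑ l, T l i • tpow U n s l) * star (tpow U m t i) = T s t • 1 :=
      fun t => by rw [← key, h, rotate_apply]
    have e : ∑ t, (∑ i, (∑ l, T l i • tpow U n s l) * star (tpow U m t i)) * tpow U m t i =
        ∑ l, T l i • tpow U n s l := by
      simp only [sum_mul _ _ (tpow U m _ i), mul_assoc]
      rw [sum_comm]
      simp only [← mul_sum, sum_star_tpow hr]
      simp
    rw [← e]
    simp only [h', smul_mul_assoc, one_mul]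

end Rotate

theorem hyper_mem_intertwiners_iff {d n m : ℕ} (T : Matrix (Fin n → Fin d) (Fin m → Fin d) ℂ) :
    T ∈ intertwiners (tpow (𝓗 d).u m) (tpow (𝓗 d).u n) ↔
      rotate T ∈ fixedVectors (𝓗 d).u :=
  mem_intertwiners_iff (hyper_star d) UnivAlg.sum_left UnivAlg.sum_right T

/-! ### Noncrossing partitions with even blocks -/

section Partitions

/-- The labels of a word are constant on the blocks of a partition of the positions. -/
def ConstOn {X : Type*} (π : Setoid ℕ) (l : List X) : Prop :=
  ∀ a b, a < l.length → b < l.length → π a b → l[a]? = l[b]?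

/-- The restriction of the equivalence relation to the first `n` natural numbers is a noncrossing
partition with even blocks; the latter is expressed by saying that every union of blocks has an even
number of elements. -/
structure NCEven (n : ℕ) (π : Setoid ℕ) : Prop where
  noncrossing : ∀ a b c e, a < b → b < c → c < e → e < n → π a c → π b e → π a b
  even : ∀ S : Finset ℕ, (∀ a ∈ S, a < n) → (∀ a ∈ S, ∀ b < n, π a b → b ∈ S) → Even S.card

def skip (r : ℕ) : ℕ ↪o ℕ := OrderEmbedding.ofStrictMono (fun a => if a < r then a else a + 2)
  fun a b h => by dsimp only; split_ifs <;> omega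

theorem skip_eq (r a : ℕ) : skip r a = if a < r then a else a + 2 := rfl

theorem skip_ne (r a : ℕ) : skip r a ≠ r ∧ skip r a ≠ r + 1 := by rw [skip_eq]; split_ifs <;> omega

theorem skip_lt {r a n : ℕ} (h : a < n) : skip r a < n + 2 := by rw [skip_eq]; split_ifs <;> omega

theorem exists_skip {r a n : ℕ} (hr : r ≤ n) (ha : a < n + 2) (h : a ≠ r) (h' : a ≠ r + 1) :
    ∃ x < n, a = skip r x := by
  by_cases har : a < r
  · exact ⟨a, by omega, by rw [skip_eq, if_pos har]⟩
  · exact ⟨a - 2, by omega, by rw [skip_eq, if_neg (by omega)]; omega⟩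

theorem getElem?_skip {X : Type*} (a b : List X) (c c' : X) (x : ℕ) :
    (a ++ c :: c' :: b)[skip a.length x]? = (a ++ b)[x]? := by
  rw [skip_eq]
  split_ifs with h
  all_goals grind

def merge (π : Setoid ℕ) (r : ℕ) : Setoid ℕ where
  r a b := π a b ∨ (π a r ∨ π a (r + 1)) ∧ (π b r ∨ π b (r + 1))
  iseqv := by
    refine ⟨fun a => .inl (π.refl a), ?_, ?_⟩
    · rintro a b (h | h); exacts [.inl (π.symm h), .inr h.symm]
    · rintro a b c (h | ⟨h1, h2⟩) (h' | ⟨h1', h2'⟩)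
      exacts [.inl (π.trans h h'), .inr ⟨h1'.imp (π.trans h) (π.trans h), h2'⟩,
        .inr ⟨h1, h2.imp (π.trans (π.symm h')) (π.trans (π.symm h'))⟩, .inr ⟨h1, h2'⟩]

theorem merge_iff (π : Setoid ℕ) (r a b : ℕ) :
    merge π r a b ↔ π a b ∨ (π a r ∨ π a (r + 1)) ∧ (π b r ∨ π b (r + 1)) := Iff.rfl

theorem merge_pair (π : Setoid ℕ) (r : ℕ) : merge π r r (r + 1) :=
  .inr ⟨.inl (π.refl r), .inr (π.refl _)⟩

theorem NCEven.merge {n : ℕ} {π : Setoid ℕ} (h : NCEven n π) {r : ℕ} (hr : r + 1 < n) :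
    NCEven n (merge π r) where
  noncrossing a b c e hab hbc hce he hac hbe := by
    have sep : ∀ {s t x y}, s < x → x < t → t < n → y < n → (y < s ∨ t < y) → π s t →
        π x r ∨ π x (r + 1) → π y r ∨ π y (r + 1) → π s x ∨ π s r ∨ π s (r + 1) := by
      intro s t x y h1 h2 h3 h4 h5 hst hx hy
      have key : ∀ {x y}, s < x → x < t → y < n → (y < s ∨ t < y) → π x y → π s x := by
        rintro x y h1 h2 h4 (h5 | h5) hxy
        exacts [π.trans (π.symm (h.noncrossing y s x t h5 h1 h2 h3 (π.symm hxy) hst)) (π.symm hxy),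
          h.noncrossing s x t y h1 h2 h5 h4 hst hxy]
      by_cases hs : s = r ∨ s = r + 1 ∨ t = r ∨ t = r + 1
      · rcases hs with rfl | rfl | rfl | rfl
        exacts [.inr (.inl (π.refl _)), .inr (.inr (π.refl _)), .inr (.inl hst), .inr (.inr hst)]
      by_cases hin : s < r ∧ r + 1 < t
      · exact .inr (hy.imp (fun hy => key hin.1 (by omega) h4 h5 (π.symm hy))
          fun hy => key (by omega) hin.2 h4 h5 (π.symm hy))
      · exact .inl (hx.elim (key h1 h2 (by omega) (by omega)) (key h1 h2 hr (by omega)))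
    rcases hac with hac | ⟨ha, hc⟩ <;> rcases hbe with hbe | ⟨hb, he'⟩
    · exact .inl (h.noncrossing a b c e hab hbc hce he hac hbe)
    · exact (sep hab hbc (by omega) he (.inr hce) hac hb he').imp_right fun h => ⟨h, hb⟩
    · exact .inr ⟨ha, (sep hbc hce he (by omega) (.inl hab) hbe hc ha).elim
        (fun h => hc.imp (π.trans h) (π.trans h)) id⟩
    · exact .inr ⟨ha, hb⟩
  even S h1 h2 := h.even S h1 fun a ha b hb hab => h2 a ha b hb (.inl hab)

theorem NCEven.comap_skip {n r : ℕ} {ρ : Setoid ℕ} (h : NCEven (n + 2) ρ) (hr : r ≤ n)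
    (hp : ρ r (r + 1)) : NCEven n (ρ.comap (skip r)) where
  noncrossing a b c e hab hbc hce he hac hbe :=
    h.noncrossing _ _ _ _ ((skip r).lt_iff_lt.2 hab) ((skip r).lt_iff_lt.2 hbc)
      ((skip r).lt_iff_lt.2 hce) (skip_lt he) hac hbe
  even S h1 h2 := by
    have hS : ∀ a ∈ S.map (skip r).toEmbedding, a ≠ r ∧ a ≠ r + 1 := fun a ha => by
      obtain ⟨x, -, rfl⟩ := Finset.mem_map.1 ha
      exact skip_ne r x
    by_cases hx : ∃ x ∈ S, ρ r (skip r x)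
    · obtain ⟨x, hx, hrx⟩ := hx
      have := h.even (insert r (insert (r + 1) (S.map (skip r).toEmbedding))) ?_ ?_
      · grind
      · intro a ha
        simp only [mem_insert, Finset.mem_map] at ha
        rcases ha with rfl | rfl | ⟨y, hy, rfl⟩
        · omega
        · omega
        · exact skip_lt (h1 y hy)
      · intro a ha b hb hab
        simp only [mem_insert, Finset.mem_map] at ha ⊢
        by_cases hb1 : b = r
        · exact .inl hb1
        by_cases hb2 : b = r + 1
        · exact .inr (.inl hb2)
        obtain ⟨y, hy, rfl⟩ := exists_skip hr hb hb1 hb2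
        refine .inr (.inr ⟨y, ?_, rfl⟩)
        rcases ha with rfl | rfl | ⟨z, hz, rfl⟩
        exacts [h2 x hx y hy (ρ.trans (ρ.symm hrx) hab),
          h2 x hx y hy (ρ.trans (ρ.symm hrx) (ρ.trans hp hab)), h2 z hz y hy hab]
    · have := h.even (S.map (skip r).toEmbedding) ?_ ?_
      · rwa [card_map] at this
      · intro a ha; obtain ⟨y, hy, rfl⟩ := Finset.mem_map.1 ha; exact skip_lt (h1 y hy)
      · intro a ha b hb hab
        obtain ⟨y, hy, rfl⟩ := Finset.mem_map.1 ha
        have hb1 : b ≠ r := by rintro rfl; exact hx ⟨y, hy, ρ.symm hab⟩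
        have hb2 : b ≠ r + 1 := by rintro rfl; exact hx ⟨y, hy, ρ.trans hp (ρ.symm hab)⟩
        obtain ⟨z, hz, rfl⟩ := exists_skip hr hb hb1 hb2
        exact Finset.mem_map_of_mem _ (h2 y hy z hz hab)

theorem NCEven.of_comap_skip {n r : ℕ} {ρ : Setoid ℕ} (h : NCEven n (ρ.comap (skip r)))
    (hr : r ≤ n) (hp : ρ r (r + 1)) (hq : ∀ x, ¬ ρ r (skip r x)) : NCEven (n + 2) ρ where
  noncrossing a b c e hab hbc hce he hac hbe := by
    have key : ∀ x y, x < n + 2 → y < n + 2 → ρ x y → x + 1 < y → x ≠ r ∧ x ≠ r + 1 ∧ y ≠ r ∧ y ≠ r + 1 := by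
      intro x y hx hy hxy hlt
      have e1 : ∀ z < n + 2, ρ r z → z = r ∨ z = r + 1 := by
        intro z hz hrz
        by_contra hh
        rw [not_or] at hh
        obtain ⟨w, -, rfl⟩ := exists_skip hr hz hh.1 hh.2
        exact hq w hrz
      have e2 : (x = r ∨ x = r + 1) → y = r ∨ y = r + 1 := by
        rintro (rfl | rfl)
        exacts [e1 y hy hxy, e1 y hy (ρ.trans hp hxy)]
      have e3 : (y = r ∨ y = r + 1) → x = r ∨ x = r + 1 := by
        rintro (rfl | rfl)
        exacts [e1 x hx (ρ.symm hxy), e1 x hx (ρ.trans hp (ρ.symm hxy))]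
      omega
    obtain ⟨a1, a2, c1, c2⟩ := key a c (by omega) (by omega) hac (by omega)
    obtain ⟨b1, b2, e1, e2⟩ := key b e (by omega) (by omega) hbe (by omega)
    obtain ⟨a, ha, rfl⟩ := exists_skip hr (by omega) a1 a2
    obtain ⟨b, hb, rfl⟩ := exists_skip hr (by omega) b1 b2
    obtain ⟨c, hc, rfl⟩ := exists_skip hr (by omega) c1 c2
    obtain ⟨e, he', rfl⟩ := exists_skip hr (by omega) e1 e2
    rw [(skip r).lt_iff_lt] at hab hbc hce
    exact h.noncrossing a b c e hab hbc hce he' hac hbe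
  even S h1 h2 := by
    have hT := h.even ((Finset.range n).filter fun x => skip r x ∈ S)
      (fun a ha => Finset.mem_range.1 (Finset.mem_filter.1 ha).1)
      (fun a ha b hb hab => Finset.mem_filter.2 ⟨Finset.mem_range.2 hb,
        h2 _ (Finset.mem_filter.1 ha).2 _ (skip_lt hb) hab⟩)
    have hrr : r ∈ S ↔ r + 1 ∈ S :=
      ⟨fun hh => h2 _ hh _ (by omega) hp, fun hh => h2 _ hh _ (by omega) (ρ.symm hp)⟩
    have e1 : (S.erase r).erase (r + 1) =
        ((Finset.range n).filter fun x => skip r x ∈ S).map (skip r).toEmbedding := by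
      ext a
      simp only [Finset.mem_erase, Finset.mem_map, mem_filter, Finset.mem_range]
      constructor
      · rintro ⟨ha1, ha2, ha⟩
        obtain ⟨x, hx, rfl⟩ := exists_skip hr (h1 a ha) ha2 ha1
        exact ⟨x, ⟨hx, ha⟩, rfl⟩
      · rintro ⟨x, ⟨hx, hxS⟩, rfl⟩; exact ⟨(skip_ne r x).2, (skip_ne r x).1, hxS⟩
    have e2 := congrArg Finset.card e1
    rw [card_map] at e2
    rw [← e2] at hT
    by_cases hrS : r ∈ S
    · grind
    · rwa [Finset.erase_eq_of_notMem hrS, Finset.erase_eq_of_notMem (fun hh => hrS (hrr.2 hh))] at hT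

def insertBlock (π : Setoid ℕ) (r : ℕ) : Setoid ℕ where
  r a b := ((a = r ∨ a = r + 1) ∧ (b = r ∨ b = r + 1)) ∨ ∃ x y, a = skip r x ∧ b = skip r y ∧ π x y
  iseqv := by
    refine ⟨fun a => ?_, ?_, ?_⟩
    · by_cases h : a = r ∨ a = r + 1
      · exact .inl ⟨h, h⟩
      · rw [not_or] at h
        obtain ⟨x, -, rfl⟩ := exists_skip (r := r) (a := a) (n := r + a) (by omega) (by omega) h.1 h.2
        exact .inr ⟨x, x, rfl, rfl, π.refl x⟩
    · rintro a b (h | ⟨x, y, rfl, rfl, h⟩); exacts [.inl h.symm, .inr ⟨y, x, rfl, rfl, π.symm h⟩]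
    · rintro a b c (h | ⟨x, y, rfl, rfl, h⟩) (h' | ⟨y', z, e, rfl, h'⟩)
      · exact .inl ⟨h.1, h'.2⟩
      · have := skip_ne r y'; omega
      · have := skip_ne r y; omega
      · obtain rfl := (skip r).injective e; exact .inr ⟨x, z, rfl, rfl, π.trans h h'⟩

theorem insertBlock_comap (π : Setoid ℕ) (r : ℕ) : (insertBlock π r).comap (skip r) = π := by
  ext a b
  change (_ ∨ _) ↔ _
  have h1 := skip_ne r a
  constructor
  · rintro (h | ⟨x, y, hx, hy, h⟩)
    · omega
    · rwa [(skip r).injective hx, (skip r).injective hy]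
  · exact fun h => .inr ⟨a, b, rfl, rfl, h⟩

theorem insertBlock_pair (π : Setoid ℕ) (r : ℕ) : insertBlock π r r (r + 1) :=
  .inl ⟨.inl rfl, .inr rfl⟩

theorem insertBlock_skip (π : Setoid ℕ) (r x : ℕ) : ¬ insertBlock π r r (skip r x) := by
  rintro (h | ⟨y, z, h, -, -⟩)
  · have := skip_ne r x; omega
  · exact (skip_ne r y).1 h.symm

theorem NCEven.insertBlock {n r : ℕ} {π : Setoid ℕ} (h : NCEven n π) (hr : r ≤ n) :
    NCEven (n + 2) (insertBlock π r) :=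
  NCEven.of_comap_skip (by rwa [insertBlock_comap]) hr (insertBlock_pair π r)
    (insertBlock_skip π r)

theorem NCEven.exists_pair {n : ℕ} {π : Setoid ℕ} (h : NCEven n π) (hn : 0 < n) :
    ∃ r, r + 1 < n ∧ π r (r + 1) ∧
      ((∀ x < n, π r x → x = r ∨ x = r + 1) ∨ r + 2 < n ∧ π r (r + 2)) := by
  classical
  have span : ∀ y < n, ∃ a b, a < b ∧ b < n ∧ π y a ∧ π y b ∧ ∀ x < n, π y x → a ≤ x ∧ x ≤ b := by
    intro y hy
    let S := (Finset.range n).filter fun x => π y x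
    have hmem : ∀ x, x ∈ S ↔ x < n ∧ π y x := fun x => by simp [S]
    have hne : S.Nonempty := ⟨y, (hmem y).2 ⟨hy, π.refl y⟩⟩
    have hev := h.even S (fun a ha => ((hmem a).1 ha).1) fun a ha b hb hab =>
      (hmem b).2 ⟨hb, π.trans ((hmem a).1 ha).2 hab⟩
    have h1 := (hmem _).1 (S.min'_mem hne)
    have h2 := (hmem _).1 (S.max'_mem hne)
    refine ⟨S.min' hne, S.max' hne, ?_, h2.1, h1.2, h2.2, fun x hx hyx =>
      ⟨S.min'_le x ((hmem x).2 ⟨hx, hyx⟩), S.le_max' x ((hmem x).2 ⟨hx, hyx⟩)⟩⟩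
    refine S.min'_lt_max'_of_card ?_
    grind
  have main : ∀ k a b, b - a = k → a < b → b < n → π a b →
      (∀ x < n, π a x → a ≤ x ∧ x ≤ b) → ∃ r, r + 1 < n ∧ π r (r + 1) ∧
      ((∀ x < n, π r x → x = r ∨ x = r + 1) ∨ r + 2 < n ∧ π r (r + 2)) := by
    intro k
    induction k using Nat.strong_induction_on with
    | _ k ih =>
      intro a b hk hab hb hπ hx
      by_cases hall : ∀ x, a < x → x < b → π a x
      · by_cases h2 : b = a + 1; all_goals grind
      · push Not at hall
        obtain ⟨x, hax, hxb, hnot⟩ := hall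
        obtain ⟨a', b', hab', hb', hya, hyb, hmm⟩ := span x (by omega)
        have hxx := hmm x (by omega) (π.refl x)
        have h1 : a < a' := by
          rcases lt_trichotomy a a' with h1 | rfl | h1
          · exact h1
          · exact (hnot (π.symm hya)).elim
          · exact (hnot (π.trans (π.symm (h.noncrossing a' a x b h1 hax hxb hb (π.symm hya) hπ))
              (π.symm hya))).elim
        have h2 : b' < b := by
          rcases lt_trichotomy b' b with h2 | rfl | h2
          exacts [h2, (hnot (π.trans hπ (π.symm hyb))).elim,
            (hnot (h.noncrossing a x b b' hax hxb h2 hb' hπ hyb)).elim]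
        exact ih (b' - a') (by omega) a' b' rfl hab' hb' (π.trans (π.symm hya) hyb)
          fun y hy hay => hmm y hy (π.trans hya hay)
  obtain ⟨a, b, hab, hb, h1, h2, h3⟩ := span 0 hn
  exact main _ a b rfl hab hb (π.trans (π.symm h1) h2) fun x hx hax => h3 x hx (π.trans h1 hax)

theorem constOn_iff {X : Type*} {ρ : Setoid ℕ} {a b : List X} (hp : ρ a.length (a.length + 1))
    (c c' : X) : ConstOn ρ (a ++ c :: c' :: b) ↔ c = c' ∧
      ConstOn (ρ.comap (skip a.length)) (a ++ b) ∧
      ∀ x < (a ++ b).length, ρ a.length (skip a.length x) → (a ++ b)[x]? = some c := by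
  have hl : (a ++ c :: c' :: b).length = (a ++ b).length + 2 := by simp; omega
  have hr : a.length ≤ (a ++ b).length := by simp
  have g0 : (a ++ c :: c' :: b)[a.length]? = some c := by simp
  have g1 : (a ++ c :: c' :: b)[a.length + 1]? = some c' := by simp
  constructor
  · intro h
    refine ⟨?_, fun x y hx hy hxy => ?_, fun x hx hxy => ?_⟩
    · have := h _ _ (by omega) (by omega) hp; grind
    · have := h _ _ (by rw [hl]; exact skip_lt hx) (by rw [hl]; exact skip_lt hy) hxy
      rwa [getElem?_skip, getElem?_skip] at this
    · have := h _ _ (by omega) (by rw [hl]; exact skip_lt hx) hxy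
      rw [getElem?_skip, g0] at this
      exact this.symm
  · rintro ⟨rfl, h1, h2⟩ x y hx hy hxy
    rw [hl] at hx hy
    have key : ∀ x, x < (a ++ b).length + 2 → (ρ a.length x ∧ (a ++ c :: c :: b)[x]? = some c) ∨
        ∃ z < (a ++ b).length, x = skip a.length z := by
      intro x hx
      by_cases hx1 : x = a.length
      · subst hx1; exact .inl ⟨ρ.refl _, g0⟩
      by_cases hx2 : x = a.length + 1
      · subst hx2; exact .inl ⟨hp, g1⟩
      exact .inr (exists_skip hr hx hx1 hx2)
    rcases key x hx with ⟨e1, e2⟩ | ⟨z, hz, rfl⟩ <;> rcases key y hy with ⟨e3, e4⟩ | ⟨w, hw, rfl⟩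
    · rw [e2, e4]
    · rw [e2, getElem?_skip, h2 w hw (ρ.trans e1 hxy)]
    · rw [e4, getElem?_skip, h2 z hz (ρ.trans e3 (ρ.symm hxy))]
    · rw [getElem?_skip, getElem?_skip]; exact h1 z w hz hw hxy

theorem constOn_merge {X : Type*} {π : Setoid ℕ} {r : ℕ} {l : List X} (hr : r + 1 < l.length) :
    ConstOn (merge π r) l ↔ ConstOn π l ∧ l[r]? = l[r + 1]? := by
  constructor
  · intro h
    exact ⟨fun a b ha hb hab => h a b ha hb (.inl hab), h _ _ (by omega) hr (merge_pair π r)⟩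
  · rintro ⟨h1, h2⟩ a b ha hb (h | ⟨h3, h4⟩)
    · exact h1 a b ha hb h
    · have key : ∀ x < l.length, π x r ∨ π x (r + 1) → l[x]? = l[r]? := by
        rintro x hx (h | h)
        · exact h1 x r hx (by omega) h
        · rw [h2]; exact h1 x _ hx hr h
      rw [key a ha h3, key b hb h4]

variable {X : Type} [Fintype X] [DecidableEq X]

open Classical in
/-- The sum of the words of length `n` that are constant on the blocks of a partition. -/
def partVec (n : ℕ) (π : Setoid ℕ) : 𝓥 X :=
  Finsupp.ofSupportFinite (fun l => if l.length = n ∧ ConstOn π l then 1 else 0)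
    ((List.finite_length_eq X n).subset fun l hl => by
      by_contra h
      exact hl (if_neg fun hh => h hh.1))

open Classical in
theorem partVec_apply (n : ℕ) (π : Setoid ℕ) (l : List X) :
    partVec n π l = if l.length = n ∧ ConstOn π l then 1 else 0 := rfl

variable (X) in
def ncSpan : Submodule ℂ (𝓥 X) :=
  Submodule.span ℂ {f | ∃ n π, NCEven n π ∧ f = partVec n π}

theorem partVec_mem {n : ℕ} {π : Setoid ℕ} (h : NCEven n π) : partVec n π ∈ ncSpan X :=
  subset_span ⟨n, π, h, rfl⟩

theorem insertPair_partVec {n r : ℕ} (hr : r ≤ n) {ρ : Setoid ℕ} (hp : ρ r (r + 1))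
    (hq : ∀ x < n, ¬ ρ r (skip r x)) :
    insertPair r (partVec n (ρ.comap (skip r)) : 𝓥 X) = partVec (n + 2) ρ := by
  classical
  ext l
  by_cases hl : r + 2 ≤ l.length
  · obtain ⟨a, c, c', b, rfl, rfl⟩ := exists_split_two hl
    rw [insertPair_apply, partVec_apply, partVec_apply, ← ite_and]
    refine if_congr ?_ rfl rfl
    rw [constOn_iff hp]
    have e : (a ++ c :: c' :: b).length = n + 2 ↔ (a ++ b).length = n := by simp; omega
    rw [e]
    constructor
    all_goals grind
  · rw [insertPair_apply_short _ (by omega), partVec_apply, if_neg]; omega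

theorem diagPair_partVec {n r : ℕ} (hr : r + 1 < n) (π : Setoid ℕ) :
    diagPair r (partVec n π : 𝓥 X) = partVec n (merge π r) := by
  classical
  ext l
  by_cases hl : r + 2 ≤ l.length
  · obtain ⟨a, c, c', b, rfl, rfl⟩ := exists_split_two hl
    rw [diagPair_apply, partVec_apply, partVec_apply, ← ite_and]
    refine if_congr ?_ rfl rfl
    rw [constOn_merge (by simp)]
    grind
  · rw [diagPair_apply_short _ (by omega), partVec_apply, if_neg]; omega

theorem contractPair_partVec {n r : ℕ} (hr : r ≤ n) (π : Setoid ℕ) :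
    ∃ k : ℂ, contractPair r (partVec (n + 2) π : 𝓥 X) =
      k • partVec n ((merge π r).comap (skip r)) := by
  classical
  have key : ∀ a b : List X, a.length = r → contractPair r (partVec (n + 2) π) (a ++ b) =
      if (a ++ b).length = n ∧ ConstOn ((merge π r).comap (skip r)) (a ++ b) then
        ∑ c : X, if ∀ x < (a ++ b).length, merge π r r (skip r x) →
          (a ++ b)[x]? = some c then (1 : ℂ) else 0
      else 0 := fun a b ha => by
    subst ha
    rw [contractPair_apply]
    have e0 : ∀ c, (partVec (n + 2) π : 𝓥 X) (a ++ c :: c :: b) =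
        if (a ++ b).length = n ∧ ConstOn ((merge π a.length).comap (skip a.length)) (a ++ b) then
        (if ∀ x < (a ++ b).length, merge π a.length a.length (skip a.length x) →
          (a ++ b)[x]? = some c then (1 : ℂ) else 0) else 0 := fun c => by
      rw [partVec_apply, ← ite_and]
      refine if_congr ?_ rfl rfl
      have e : (a ++ c :: c :: b).length = n + 2 ↔ (a ++ b).length = n := by simp; omega
      have := constOn_iff (merge_pair π a.length) (a := a) (b := b) c c
      rw [constOn_merge (by simp)] at this
      grind
    rw [sum_congr rfl fun c _ => e0 c]
    split_ifs <;> simp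
  by_cases hx : ∃ x < n, merge π r r (skip r x)
  · obtain ⟨x, hx, hrx⟩ := hx
    refine ⟨1, ?_⟩
    ext l
    rw [one_smul]
    by_cases hl : r ≤ l.length
    · obtain ⟨a, b, ha, rfl⟩ := exists_split hl
      rw [key a b ha, partVec_apply]
      refine ite_congr rfl (fun h => ?_) (fun _ => rfl)
      have hxl : x < (a ++ b).length := by omega
      rw [sum_eq_single ((a ++ b)[x])]
      · rw [if_pos]
        intro y hy hry
        rw [← List.getElem?_eq_getElem hxl]
        exact h.2 y x hy hxl ((merge π r).trans ((merge π r).symm hry) hrx)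
      · grind
      · simp
    · rw [contractPair_apply_short _ (by omega), partVec_apply, if_neg]; omega
  · refine ⟨Fintype.card X, ?_⟩
    ext l
    by_cases hl : r ≤ l.length
    · obtain ⟨a, b, ha, rfl⟩ := exists_split hl
      rw [key a b ha, fsmul_apply, partVec_apply, smul_eq_mul, mul_ite, mul_one, mul_zero]
      refine ite_congr rfl (fun h => ?_) (fun _ => rfl)
      rw [sum_congr rfl fun c _ => if_pos fun y hy hry =>
        (hx ⟨y, by omega, hry⟩).elim]
      simp
    · rw [contractPair_apply_short _ (by omega), fsmul_apply, partVec_apply, if_neg]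
      · simp
      · omega

theorem partVec_zero (π : Setoid ℕ) : (partVec 0 π : 𝓥 X) = bv [] := by
  classical
  ext l
  rw [partVec_apply, single_apply]
  refine if_congr ⟨by grind, ?_⟩ rfl rfl
  rintro rfl
  exact ⟨rfl, fun a b ha => by simp at ha⟩

theorem ncSpan_pairClosed : PairClosed (ncSpan X) := by
  have of_gen : ∀ T : Op X, (∀ n π, NCEven n π → T (partVec n π) ∈ ncSpan X) →
      ∀ f ∈ ncSpan X, T f ∈ ncSpan X := fun T h f hf => by
    have : ncSpan X ≤ (ncSpan X).comap T := Submodule.span_le.2 (by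
      rintro _ ⟨n, π, hπ, rfl⟩; exact h n π hπ)
    exact this hf
  refine ⟨?_, fun f hf n => ?_, fun r => of_gen _ ?_, fun r => of_gen _ ?_, fun r => of_gen _ ?_⟩
  · rw [← partVec_zero ⊥]
    refine partVec_mem ⟨by omega, fun S hS _ => ?_⟩
    rw [Finset.eq_empty_of_forall_notMem fun a ha => (hS a ha).not_ge (Nat.zero_le a)]
    simp
  · induction hf using span_induction with
    | mem f hf =>
      obtain ⟨m, π, hπ, rfl⟩ := hf
      have : (partVec m π : 𝓥 X).filter (fun l => l.length = n) =
          if m = n then partVec m π else 0 := by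
        ext l
        rw [filter_apply, apply_ite (fun f : 𝓥 X => f l), partVec_apply]
        by_cases h1 : l.length = n
        all_goals grind
      rw [this]
      split_ifs
      exacts [partVec_mem hπ, Submodule.zero_mem _]
    | zero => simp [Finsupp.filter_zero]
    | add f g _ _ hf hg => rw [Finsupp.filter_add]; exact Submodule.add_mem _ hf hg
    | smul c f _ hf => rw [Finsupp.filter_smul]; exact smul_mem _ c hf
  · intro n π hπ
    by_cases hr : r ≤ n
    · have := insertPair_partVec (X := X) hr (insertBlock_pair π r) fun x _ => insertBlock_skip π r x
      rw [insertBlock_comap] at this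
      rw [this]
      exact partVec_mem (hπ.insertBlock hr)
    · have : insertPair r (partVec n π : 𝓥 X) = 0 := by
        ext l
        by_cases hl : r + 2 ≤ l.length
        · obtain ⟨a, c, c', b, rfl, rfl⟩ := exists_split_two hl
          rw [insertPair_apply, partVec_apply, if_neg (c := _ ∧ _) (fun hh => by grind)]
          simp
        · rw [insertPair_apply_short _ (by omega)]; rfl
      rw [this]
      exact Submodule.zero_mem _
  · intro n π hπ
    by_cases hr : r + 2 ≤ n
    · obtain ⟨m, rfl⟩ := Nat.exists_eq_add_of_le' (show 2 ≤ n by omega)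
      obtain ⟨k, hk⟩ := contractPair_partVec (X := X) (show r ≤ m by omega) π
      rw [hk]
      exact smul_mem _ k (partVec_mem ((hπ.merge (by omega)).comap_skip (by omega)
        (merge_pair π r)))
    · have : contractPair r (partVec n π : 𝓥 X) = 0 := by
        ext l
        by_cases hl : r ≤ l.length
        · obtain ⟨a, b, rfl, rfl⟩ := exists_split hl
          rw [contractPair_apply]
          refine sum_eq_zero fun c _ => ?_
          rw [partVec_apply, if_neg (c := _ ∧ _) (fun hh => by grind)]
        · rw [contractPair_apply_short _ (by omega)]; rfl
      rw [this]
      exact Submodule.zero_mem _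
  · intro n π hπ
    by_cases hr : r + 2 ≤ n
    · rw [diagPair_partVec (by omega)]; exact partVec_mem (hπ.merge (by omega))
    · have : diagPair r (partVec n π : 𝓥 X) = 0 := by
        ext l
        by_cases hl : r + 2 ≤ l.length
        · obtain ⟨a, c, c', b, rfl, rfl⟩ := exists_split_two hl
          rw [diagPair_apply, partVec_apply, if_neg (c := _ ∧ _) (fun hh => by grind)]
          simp
        · rw [diagPair_apply_short _ (by omega)]; rfl
      rw [this]
      exact Submodule.zero_mem _

theorem partVec_mem_of_pairClosed {C : Submodule ℂ (𝓥 X)} (hC : PairClosed C) (n : ℕ)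
    {π : Setoid ℕ} (h : NCEven n π) : partVec n π ∈ C := by
  classical
  induction n using Nat.strong_induction_on generalizing π with
  | _ n ih =>
    rcases Nat.eq_zero_or_pos n with rfl | hn
    · rw [partVec_zero]; exact hC.unit
    · obtain ⟨r, hr, hp, hx⟩ := h.exists_pair hn
      obtain ⟨m, rfl⟩ := Nat.exists_eq_add_of_le' (show 2 ≤ n by omega)
      have hm := hC.insert r _ (ih m (by omega) (h.comap_skip (by omega) hp))
      rcases hx with hx | ⟨hr2, hp2⟩
      · rwa [insertPair_partVec (by omega) hp] at hm
        intro x hxm hrx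
        have := hx _ (skip_lt hxm) hrx
        have := skip_ne r x
        omega
      · convert hC.diag (r + 1) _ hm using 1
        ext l
        by_cases hl : r + 3 ≤ l.length
        · obtain ⟨a, c, c', b, rfl, rfl⟩ := exists_split_two (show r + 2 ≤ l.length by omega)
          obtain ⟨e, b, rfl⟩ := exists_cons_of_ne_nil (l := b) (by rintro rfl; simp at hl)
          have h1 := diagPair_apply (insertPair a.length
            (partVec m (π.comap (skip a.length)))) (a ++ [c]) b c' e
          rw [length_append, List.length_singleton] at h1
          rw [show a ++ c :: c' :: e :: b = a ++ [c] ++ c' :: e :: b by simp, h1,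
            show a ++ [c] ++ c' :: e :: b = a ++ c :: c' :: e :: b by simp, insertPair_apply,
            partVec_apply, partVec_apply, ← ite_and, ← ite_and]
          refine if_congr ?_ rfl rfl
          rw [constOn_iff hp]
          have hl' : (a ++ c :: c' :: e :: b).length = m + 2 ↔ (a ++ e :: b).length = m := by grind
          have g : (a ++ e :: b)[a.length]? = some e := by simp
          have hsk : skip a.length a.length = a.length + 2 := by simp [skip_eq]
          rw [hl']
          constructor
          · grind
          · rintro ⟨⟨rfl, rfl⟩, hl2, h2⟩
            refine ⟨hl2, rfl, h2, fun x hx hrx => ?_⟩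
            rw [← g]
            refine h2 x a.length hx (by simp) ?_
            change π _ _
            rw [hsk]
            exact π.trans (π.symm hrx) hp2
        · rw [diagPair_apply_short _ (by omega), partVec_apply, if_neg (by omega)]

theorem fixedVectors_eq_ncSpan (d : ℕ) :
    fixedVectors (𝓗 d).u = ncSpan (Fin d) :=
  le_antisymm (fixedVectors_le ncSpan_pairClosed) (Submodule.span_le.2 (by
    rintro _ ⟨n, π, hπ, rfl⟩
    exact partVec_mem_of_pairClosed (fixedVectors_pairClosed (hyper_freeRel d)) n hπ))

end Partitions

section PartitionMatrix

variable {n m : ℕ}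

theorem circlePos_lt (a : Fin n ⊕ Fin m) : circlePos a < n + m := by
  rcases a with a | a <;> simp only [circlePos] <;> omega

theorem circlePos_injective : Inj (circlePos (n := n) (m := m)) := by
  rintro (a | a) (b | b) h <;> simp only [circlePos] at h
  · exact congrArg _ (Fin.ext h)
  · omega
  · omega
  · exact congrArg _ (Fin.ext (by omega))

theorem exists_circlePos {x : ℕ} (h : x < n + m) : ∃ a : Fin n ⊕ Fin m, circlePos a = x := by
  by_cases hx : x < n
  · exact ⟨.inl ⟨x, hx⟩, rfl⟩
  · exact ⟨.inr ⟨m - 1 - (x - n), by omega⟩, by simp only [circlePos]; omega⟩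

theorem getElem?_circlePos {X : Type*} (s : Fin n → X) (t : Fin m → X) (a : Fin n ⊕ Fin m) :
    (ofFn s ++ (ofFn t).reverse)[circlePos a]? = some (Sum.elim s t a) := by
  rcases a with a | a
  · rw [List.getElem?_append_left (by simp [circlePos])]; simp [circlePos]
  · rw [List.getElem?_append_right (by simp [circlePos])]
    rw [List.getElem?_reverse (by simp [circlePos]; omega)]
    simp only [circlePos, length_ofFn]
    rw [show m - 1 - (n + (m - 1 - (a : ℕ)) - n) = a by omega]
    simp

theorem even_card_of_blocks {α : Type*} [Fintype α] (p : Setoid α)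
    (h : ∀ a, Even (Nat.card {b // p a b})) (S : Finset α)
    (hS : ∀ a ∈ S, ∀ b, p a b → b ∈ S) : Even S.card := by
  classical
  induction S using Finset.strongInduction with
  | H S ih =>
    rcases S.eq_empty_or_nonempty with rfl | ⟨a, ha⟩
    · simp
    · have h1 : (S.filter fun b => p a b).card = Nat.card {b // p a b} := by
        rw [Nat.card_eq_fintype_card, Fintype.card_subtype]
        congr 1
        ext b
        simp only [mem_filter, mem_univ, true_and]
        exact ⟨fun hb => hb.2, fun hb => ⟨hS a ha b hb, hb⟩⟩
      have h2 := ih (S.filter fun b => ¬ p a b)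
        (Finset.filter_ssubset.2 ⟨a, ha, fun hh => hh (p.refl a)⟩) (by
          intro b hb c hbc
          rw [mem_filter] at hb ⊢
          exact ⟨hS b hb.1 c hbc, fun hac => hb.2 (p.trans hac (p.symm hbc))⟩)
      rw [← Finset.card_filter_add_card_filter_not (fun b => p a b), h1]
      exact (h a).add h2

theorem ncEven_iff (π : Setoid ℕ) :
    NCEven (n + m) π ↔ IsNoncrossingEven (π.comap (circlePos (n := n) (m := m))) := by
  classical
  constructor
  · intro h
    refine ⟨fun a b c e hab hbc hce hac hbe =>
      h.noncrossing _ _ _ _ hab hbc hce (circlePos_lt e) hac hbe, fun a => ?_⟩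
    have := h.even ((Finset.univ.filter fun b : Fin n ⊕ Fin m =>
      π (circlePos a) (circlePos b)).image circlePos) ?_ ?_
    · rw [Finset.card_image_of_injective _ circlePos_injective] at this
      rw [Nat.card_eq_fintype_card, Fintype.card_subtype]
      exact this
    · intro x hx; obtain ⟨b, -, rfl⟩ := Finset.mem_image.1 hx; exact circlePos_lt b
    · intro x hx y hy hxy
      obtain ⟨b, hb, rfl⟩ := Finset.mem_image.1 hx
      obtain ⟨c, rfl⟩ := exists_circlePos hy
      refine mem_image_of_mem _ (Finset.mem_filter.2 ⟨mem_univ _, ?_⟩)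
      exact π.trans (Finset.mem_filter.1 hb).2 hxy
  · intro h
    refine ⟨fun a b c e hab hbc hce he hac hbe => ?_, fun S h1 h2 => ?_⟩
    · obtain ⟨a, rfl⟩ := exists_circlePos (n := n) (m := m) (x := a) (by omega)
      obtain ⟨b, rfl⟩ := exists_circlePos (n := n) (m := m) (x := b) (by omega)
      obtain ⟨c, rfl⟩ := exists_circlePos (n := n) (m := m) (x := c) (by omega)
      obtain ⟨e, rfl⟩ := exists_circlePos (n := n) (m := m) (x := e) (by omega)
      exact h.noncrossing a b c e hab hbc hce hac hbe
    · have := even_card_of_blocks _ h.even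
        (Finset.univ.filter fun a : Fin n ⊕ Fin m => circlePos a ∈ S) (by
          intro a ha b hab
          rw [mem_filter] at ha ⊢
          exact ⟨mem_univ _, h2 _ ha.2 _ (circlePos_lt b) hab⟩)
      rw [← Finset.card_image_of_injective _ circlePos_injective] at this
      convert this using 2
      ext x
      simp only [Finset.mem_image, mem_filter, mem_univ, true_and]
      constructor
      · intro hx
        obtain ⟨a, rfl⟩ := exists_circlePos (n := n) (m := m) (h1 x hx)
        exact ⟨a, hx, rfl⟩
      · rintro ⟨a, ha, rfl⟩; exact ha

theorem exists_comap_circlePos (p : Setoid (Fin n ⊕ Fin m)) :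
    ∃ π : Setoid ℕ, p = π.comap circlePos := by
  refine ⟨⟨fun x y => x = y ∨ ∃ a b, circlePos a = x ∧ circlePos b = y ∧ p a b,
    fun x => .inl rfl, ?_, ?_⟩, ?_⟩
  · rintro x y (rfl | ⟨a, b, rfl, rfl, h⟩)
    exacts [.inl rfl, .inr ⟨b, a, rfl, rfl, p.symm h⟩]
  · rintro x y z (rfl | ⟨a, b, rfl, rfl, h⟩) (h' | ⟨b', c, e, rfl, h'⟩)
    · exact .inl h'
    · exact .inr ⟨b', c, e, rfl, h'⟩
    · exact .inr ⟨a, b, rfl, h', h⟩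
    · rw [circlePos_injective e] at h'; exact .inr ⟨a, c, rfl, rfl, p.trans h h'⟩
  · ext a b
    change _ ↔ (_ ∨ _)
    constructor
    · exact fun h => .inr ⟨a, b, rfl, rfl, h⟩
    · rintro (h | ⟨a', b', h1, h2, h⟩)
      · rw [circlePos_injective h]
      · rwa [circlePos_injective h1, circlePos_injective h2] at h

theorem partVec_rotate {d : ℕ} (π : Setoid ℕ) (s : Fin n → Fin d) (t : Fin m → Fin d) :
    partVec (n + m) π (ofFn s ++ (ofFn t).reverse) =
      partitionMatrix d (π.comap circlePos) s t := by
  classical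
  rw [partVec_apply]
  refine if_congr ?_ rfl rfl
  have hl : (ofFn s ++ (ofFn t).reverse).length = n + m := by simp
  constructor
  · rintro ⟨-, h⟩ a b hab
    have := h _ _ (by rw [hl]; exact circlePos_lt a) (by rw [hl]; exact circlePos_lt b) hab
    rw [getElem?_circlePos, getElem?_circlePos] at this
    exact some_injective _ this
  · refine fun h => ⟨hl, fun x y hx hy hxy => ?_⟩
    rw [hl] at hx hy
    obtain ⟨a, rfl⟩ := exists_circlePos hx
    obtain ⟨b, rfl⟩ := exists_circlePos hy
    rw [getElem?_circlePos, getElem?_circlePos, h a b hxy]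

/-- The intertwiners between tensor powers of the fundamental representation of `H⁺(d)`. -/
theorem intertwiners_eq_span (d n m : ℕ) :
    intertwiners (tpow (𝓗 d).u m) (tpow (𝓗 d).u n) =
      Submodule.span ℂ {T | ∃ p : Setoid (Fin n ⊕ Fin m), IsNoncrossingEven p ∧
        T = partitionMatrix d p} := by
  apply le_antisymm
  · intro T hT
    rw [hyper_mem_intertwiners_iff, fixedVectors_eq_ncSpan] at hT
    let unrot : (𝓥 (Fin d)) →ₗ[ℂ] Matrix (Fin n → Fin d) (Fin m → Fin d) ℂ :=
      { toFun := fun f s t => f (ofFn s ++ (ofFn t).reverse)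
        map_add' := fun _ _ => rfl
        map_smul' := fun _ _ => rfl }
    have hle : ncSpan (Fin d) ≤ (Submodule.span ℂ {T | ∃ p : Setoid (Fin n ⊕ Fin m),
        IsNoncrossingEven p ∧ T = partitionMatrix d p}).comap unrot := Submodule.span_le.2 (by
      rintro _ ⟨k, π, hπ, rfl⟩
      by_cases hk : k = n + m
      · subst hk; exact subset_span ⟨_, (ncEven_iff π).1 hπ, by ext s t; exact partVec_rotate π s t⟩
      · have : unrot (partVec k π) = 0 := by
          ext s t
          change partVec k π _ = 0
          rw [partVec_apply, if_neg]
          rintro ⟨h, -⟩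
          simp at h
          exact hk h.symm
        rw [SetLike.mem_coe, mem_comap, this]
        exact Submodule.zero_mem _)
    have h2 := hle hT
    have : unrot (rotate T) = T := by ext s t; exact rotate_apply T s t
    rwa [mem_comap, this] at h2
  · refine Submodule.span_le.2 ?_
    rintro _ ⟨p, hp, rfl⟩
    obtain ⟨π, rfl⟩ := exists_comap_circlePos p
    rw [SetLike.mem_coe, hyper_mem_intertwiners_iff, fixedVectors_eq_ncSpan,
      ← rotate_eq (n := n) (m := m) _ (partVec_rotate π)]
    · exact partVec_mem ((ncEven_iff π).2 hp)
    · intro l hl; classical rw [partVec_apply, if_neg]; exact fun h => hl h.1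

end PartitionMatrix

/-! ### Regular trees -/

section Words

variable (d : ℕ)

def redWord (g : Z2Free d) : List (Fin d) := (z2Act d g ⟨[], List.isChain_nil⟩).1

theorem reduced_redWord (g : Z2Free d) : Reduced id (redWord d g) := (z2Act d g _).2

theorem redWord_mul_gen (i : Fin d) (g : Z2Free d) :
    redWord d (z2Gen d i * g) = act id i (redWord d g) := by rw [redWord, map_mul, z2Act_gen]; rfl

theorem redWord_prod (l : List (Fin d)) : redWord d (l.map (z2Gen d)).prod = reduce id l := by
  induction l with
  | nil => simp [redWord, reduce]
  | cons i l ih => rw [map_cons, prod_cons, redWord_mul_gen, ih, reduce_cons]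

theorem redWord_one : redWord d 1 = [] := redWord_prod d []

theorem exists_word (g : Z2Free d) : ∃ l : List (Fin d), (l.map (z2Gen d)).prod = g := by
  induction g using Monoid.CoprodI.induction_on with
  | one => exact ⟨[], rfl⟩
  | of i m =>
    have : m = 1 ∨ m = Multiplicative.ofAdd 1 := by revert m; decide
    rcases this with rfl | rfl
    · exact ⟨[], by simp⟩
    · exact ⟨[i], by simp [z2Gen]⟩
  | mul x y hx hy =>
    obtain ⟨l, rfl⟩ := hx
    obtain ⟨l', rfl⟩ := hy
    exact ⟨l ++ l', by simp⟩

theorem prod_redWord (g : Z2Free d) : ((redWord d g).map (z2Gen d)).prod = g := by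
  obtain ⟨l, rfl⟩ := exists_word d g
  rw [redWord_prod]
  exact prod_reduce (z2Gen_inv d) l

theorem redWord_of_reduced {l : List (Fin d)} (h : Reduced id l) :
    redWord d (l.map (z2Gen d)).prod = l := by rw [redWord_prod, reduce_of_reduced h]

theorem redWord_injective : Inj (redWord d) := fun g h e => by
  rw [← prod_redWord d g, e, prod_redWord]

end Words

section Tree

variable {I : Type*} {Pi : SimpleGraph I} {d : ℕ}

theorem exists_parent (hT : Pi.IsTree) {o v : I} (h : v ≠ o) :
    ∃ p, Pi.Adj v p ∧ Pi.dist o p < Pi.dist o v := by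
  obtain ⟨w, hw⟩ := hT.1.exists_walk_length_eq_dist v o
  cases w with
  | nil => exact absurd rfl h
  | @cons _ p _ ha w =>
    refine ⟨p, ha, ?_⟩
    rw [SimpleGraph.dist_comm, SimpleGraph.dist_comm (u := o), ← hw, SimpleGraph.Walk.length_cons]
    exact Nat.lt_succ_of_le (SimpleGraph.dist_le w)

theorem parent_unique (hT : Pi.IsTree) {o v p q : I} (hp : Pi.Adj v p) (hq : Pi.Adj v q)
    (h : Pi.dist o p < Pi.dist o v) (h' : Pi.dist o q < Pi.dist o v) : p = q := by
  have key : ∀ p, Pi.Adj v p → Pi.dist o p < Pi.dist o v →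
      ∃ w : Pi.Walk v o, w.IsPath ∧ w.snd = p := by
    intro p hp h
    obtain ⟨w, hw⟩ := hT.1.exists_walk_length_eq_dist p o
    refine ⟨.cons hp w, SimpleGraph.Walk.isPath_of_length_eq_dist _ ?_, by simp⟩
    rw [SimpleGraph.Walk.length_cons, hw, SimpleGraph.dist_comm, SimpleGraph.dist_comm (u := v)]
    have := hT.dist_eq_dist_add_one_of_adj o hp
    omega
  obtain ⟨w, hw, rfl⟩ := key p hp h
  obtain ⟨w', hw', rfl⟩ := key q hq h'
  have := (hT.2.subsingleton_path v o).elim ⟨w, hw⟩ ⟨w', hw'⟩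
  rw [Subtype.mk.injEq] at this
  rw [this]

def parent (hT : Pi.IsTree) {o v : I} (h : v ≠ o) : I := (exists_parent hT h).choose

open Classical in
def numbering (hT : Pi.IsTree) (e : ∀ v, Fin d ≃ Pi.neighborSet v) (o v : I) :
    Fin d ≃ Pi.neighborSet v :=
  if h : v = o then e v else
    (Equiv.swap ((e v).symm ⟨parent hT h, (exists_parent hT h).choose_spec.1⟩)
      ((numbering hT e o (parent hT h)).symm
        ⟨v, (exists_parent hT h).choose_spec.1.symm⟩)).trans (e v)
termination_by Pi.dist o v
decreasing_by exact (exists_parent hT h).choose_spec.2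

theorem numbering_parent (hT : Pi.IsTree) (e : ∀ v, Fin d ≃ Pi.neighborSet v) {o v : I}
    (h : v ≠ o) : (numbering hT e o v
      ((numbering hT e o (parent hT h)).symm ⟨v, (exists_parent hT h).choose_spec.1.symm⟩)).1 =
    parent hT h := by
  rw [numbering, dif_neg h, Equiv.trans_apply, Equiv.swap_apply_right, Equiv.apply_symm_apply]

theorem numbering_symm (hT : Pi.IsTree) (e : ∀ v, Fin d ≃ Pi.neighborSet v) (o v : I)
    (s : Fin d) : (numbering hT e o (numbering hT e o v s).1 s).1 = v := by
  have key : ∀ {v w : I} (hv : v ≠ o) (hw : w = parent hT hv) (s : Fin d),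
      (numbering hT e o v s).1 = w ↔ (numbering hT e o w s).1 = v := by
    rintro v _ hv rfl s
    have h := numbering_parent hT e hv
    constructor
    · intro h1
      have h2 := (numbering hT e o v).injective (sext (h1.trans h.symm))
      rw [h2, Equiv.apply_symm_apply]
    · intro h1
      rw [← h]
      congr 2
      rw [Equiv.eq_symm_apply]
      exact sext h1
  obtain ⟨w, hw⟩ : ∃ w, (numbering hT e o v s).1 = w := ⟨_, rfl⟩
  have ha : Pi.Adj v w := hw ▸ (numbering hT e o v s).2
  rw [hw]
  have h2 := hT.dist_ne_of_adj o ha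
  rcases lt_or_gt_of_ne h2 with h2 | h2
  · have hwo : w ≠ o := by rintro rfl; simp at h2
    refine (key hwo ?_ s).2 hw
    exact parent_unique hT ha.symm (exists_parent hT hwo).choose_spec.1 h2
      (exists_parent hT hwo).choose_spec.2
  · have hvo : v ≠ o := by rintro rfl; simp at h2
    refine (key hvo ?_ s).1 hw
    exact parent_unique hT ha (exists_parent hT hvo).choose_spec.1 h2
      (exists_parent hT hvo).choose_spec.2

theorem exists_colouring [Pi.LocallyFinite] (hT : Pi.IsTree) (hR : Pi.IsRegularOfDegree d) :
    ∃ σ : Fin d → I → I, (∀ s v, σ s (σ s v) = v) ∧ (∀ s t v, σ s v = σ t v → s = t) ∧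
      ∀ v w, Pi.Adj v w ↔ ∃ s, σ s v = w := by
  classical
  obtain ⟨o⟩ := hT.1.nonempty
  have e : ∀ v, Fin d ≃ Pi.neighborSet v := fun v =>
    (finCongr ((Pi.card_neighborSet_eq_degree v).trans (hR v)).symm).trans
      (Fintype.equivFin _).symm
  refine ⟨fun s v => (numbering hT e o v s).1, fun s v => numbering_symm hT e o v s,
    fun s t v h => (numbering hT e o v).injective (sext h), fun v w => ⟨fun h => ?_, ?_⟩⟩
  · exact ⟨(numbering hT e o v).symm ⟨w, h⟩, by simp⟩
  · rintro ⟨s, rfl⟩; exact (numbering hT e o v s).2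

theorem foldr_ne_self (hT : Pi.IsTree) {σ : Fin d → I → I} (h1 : ∀ s v, σ s (σ s v) = v)
    (h2 : ∀ s t v, σ s v = σ t v → s = t) (h3 : ∀ v w, Pi.Adj v w ↔ ∃ s, σ s v = w)
    {l : List (Fin d)} (hl : Reduced id l) (hne : l ≠ []) (v : I) : l.foldr σ v ≠ v := by
  have adj : ∀ s v, Pi.Adj (σ s v) v := fun s v => ((h3 v _).2 ⟨s, rfl⟩).symm
  let walk : ∀ l : List (Fin d), Pi.Walk (l.foldr σ v) v := fun l =>
    List.rec .nil (fun s l w => .cons (adj s (l.foldr σ v)) w) l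
  have hw : ∀ s l, walk (s :: l) = .cons (adj s (l.foldr σ v)) (walk l) := fun _ _ => rfl
  have hchain : ∀ l, Reduced id l → List.IsChain (· ≠ ·) (walk l).edges := by
    intro l hl
    induction l with
    | nil => exact List.isChain_nil
    | cons s l ih =>
      change List.IsChain (· ≠ ·) (s(σ s (l.foldr σ v), l.foldr σ v) :: (walk l).edges)
      cases l with
      | nil => exact List.isChain_singleton _
      | cons t l =>
        have hl' := List.isChain_cons_cons.1 hl
        have ih' := ih hl'.2
        change List.IsChain (· ≠ ·) (s(σ t (l.foldr σ v), l.foldr σ v) :: (walk l).edges) at ih'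
        change List.IsChain (· ≠ ·) (_ :: s(σ t (l.foldr σ v), l.foldr σ v) :: (walk l).edges)
        refine List.isChain_cons_cons.2 ⟨?_, ih'⟩
        rw [List.foldr_cons, Ne, Sym2.eq_iff]
        rintro (⟨h, -⟩ | ⟨h, -⟩)
        · exact (adj s _).ne h
        · grind
  intro h
  have hp := (hT.2.isPath_iff_isChain (walk l)).2 (hchain l hl)
  have h0 : ∀ {u} (w : Pi.Walk u v), u = v → w.IsPath → w.length = 0 := by
    rintro _ w rfl hw
    rw [SimpleGraph.Walk.isPath_iff_nil] at hw
    grind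
  have := h0 _ h hp
  cases l with
  | nil => exact hne rfl
  | cons s l =>
    change (walk l).length + 1 = 0 at this
    omega

/-- The vertices of a regular tree as a torsor over the free product of groups of order two. -/
theorem exists_displacement [Pi.LocallyFinite] (hT : Pi.IsTree) (hR : Pi.IsRegularOfDegree d) :
    ∃ δ : I → I → Z2Free d, (∀ i j k, δ i j * δ j k = δ i k) ∧
      (∀ i j, Pi.Adj i j ↔ ∃ s, δ i j = z2Gen d s) ∧ (∀ i g, ∃ j, δ i j = g) ∧
      ∀ i j, δ i j = 1 → i = j := by
  obtain ⟨σ, h1, h2, h3⟩ := exists_colouring hT hR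
  let τ : Fin d → Perm I := fun s => ⟨σ s, σ s, h1 s, h1 s⟩
  let ρ : Z2Free d →* Perm I := z2Lift d τ fun s => Equiv.ext fun v => h1 s v
  have hρ : ∀ s v, ρ (z2Gen d s) v = σ s v := fun s v => by
    change z2Lift d τ _ _ v = _
    rw [z2Lift_gen]; rfl
  have hρl : ∀ (l : List (Fin d)) v, ρ (l.map (z2Gen d)).prod v = l.foldr σ v := by
    intro l v
    induction l with
    | nil => simp
    | cons s l ih => rw [map_cons, prod_cons, map_mul, Equiv.Perm.mul_apply, ih, hρ]; rfl
  have free : ∀ g v, ρ g v = v → g = 1 := by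
    intro g v h
    rw [← prod_redWord d g, hρl] at h
    rw [← prod_redWord d g]
    by_contra hne
    exact foldr_ne_self hT h1 h2 h3 (reduced_redWord d g)
      (fun h0 => hne (by rw [h0]; rfl)) v h
  have trans : ∀ i j, ∃ g, ρ g j = i := by
    intro i j
    obtain ⟨w⟩ := hT.1.preconnected i j
    induction w with
    | nil => exact ⟨1, by simp⟩
    | cons h w ih =>
      obtain ⟨g, hg⟩ := ih
      obtain ⟨s, hs⟩ := (h3 _ _).1 h.symm
      exact ⟨z2Gen d s * g, by rw [map_mul, Equiv.Perm.mul_apply, hg, hρ, hs]⟩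
  choose δ hδ using trans
  have uniq : ∀ i j g, ρ g j = i → δ i j = g := by
    intro i j g h
    have : g⁻¹ * δ i j = 1 := free _ j (by
      rw [map_mul, Equiv.Perm.mul_apply, hδ, map_inv, ← h]; exact (ρ g).symm_apply_apply j)
    exact (inv_mul_eq_one.1 this).symm
  refine ⟨δ, fun i j k => (uniq _ _ _ ?_).symm, fun i j => ⟨fun h => ?_, ?_⟩, fun i g => ?_,
    fun i j h => ?_⟩
  · rw [map_mul, Equiv.Perm.mul_apply, hδ, hδ]
  · grind
  · grind
  · exact ⟨ρ g⁻¹ i, uniq _ _ _ (by rw [map_inv]; exact (ρ g).apply_symm_apply i)⟩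
  · have := hδ i j; rw [h, map_one] at this; exact this.symm

end Tree

/-! ### The matrix indexed by the free product -/

section GroupMat

variable {d : ℕ} {A : Type*} [Ring A] {U : Fin d → Fin d → A}

/-- The matrix with rows and columns indexed by the free product of groups of order two, which acts
on reduced words. -/
def groupMat (U : Fin d → Fin d → A) (g h : Z2Free d) : A := wordMat U (redWord d g) (redWord d h)

theorem groupMat_swap (g h : Z2Free d) : groupMat (fun a b => U b a) g h = groupMat U h g :=
  wordMat_swap U _ _

theorem redWord_eq_nil {g : Z2Free d} : redWord d g = [] ↔ g = 1 := by
  rw [← redWord_one d, (redWord_injective d).eq_iff]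

theorem groupMat_one_left (h : Z2Free d) : groupMat U 1 h = if h = 1 then 1 else 0 := by
  rw [groupMat, redWord_one]
  split_ifs with h1
  · rw [redWord_eq_nil.2 h1]; rfl
  · obtain ⟨a, l, e⟩ := exists_cons_of_ne_nil (fun h0 => h1 (redWord_eq_nil.1 h0)); rw [e]; rfl

theorem redWord_gen (i : Fin d) : redWord d (z2Gen d i) = [i] := by
  have := redWord_of_reduced d (l := [i]) (List.isChain_singleton _)
  simpa using this

theorem groupMat_gen (i j : Fin d) : groupMat U (z2Gen d i) (z2Gen d j) = U i j := by
  simp [groupMat, redWord_gen]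

theorem groupMat_of_length {g h : Z2Free d} (hgh : (redWord d g).length ≠ (redWord d h).length) :
    groupMat U g h = 0 := wordMat_len U hgh

variable (d) in
theorem finite_sphere (n : ℕ) : {g : Z2Free d | (redWord d g).length = n}.Finite :=
  Set.Finite.preimage (redWord_injective d).injOn (List.finite_length_eq (Fin d) n)

theorem finite_groupMat_row (g : Z2Free d) : {h | groupMat U g h ≠ 0}.Finite :=
  (finite_sphere d (redWord d g).length).subset fun h hh => by
    by_contra h'
    exact hh (groupMat_of_length (Ne.symm h'))

theorem finite_groupMat_col (h : Z2Free d) : {g | groupMat U g h ≠ 0}.Finite := by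
  simpa only [groupMat_swap] using finite_groupMat_row (U := fun a b => U b a) h

theorem groupMat_gen_mul (hU : FreeRel id U) (i : Fin d) (g k : Z2Free d) :
    groupMat U (z2Gen d i * g) k = ∑ j, U i j * groupMat U g (z2Gen d j * k) := by
  simp only [groupMat, redWord_mul_gen]
  exact wordMat_act_left id_involutive hU i (reduced_redWord d g) (reduced_redWord d k)

theorem groupMat_mul (hU : FreeRel id U) (g g' k : Z2Free d) :
    groupMat U (g * g') k = ∑ᶠ l, groupMat U g l * groupMat U g' (l⁻¹ * k) := by
  have key : ∀ (w : List (Fin d)) (k : Z2Free d), groupMat U ((w.map (z2Gen d)).prod * g') k =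
      ∑ᶠ l, groupMat U (w.map (z2Gen d)).prod l * groupMat U g' (l⁻¹ * k) := by
    intro w
    induction w with
    | nil =>
      intro k
      rw [finsum_eq_single _ 1 fun l hl => by simp [groupMat_one_left, hl]]
      simp [groupMat_one_left]
    | cons i w ih =>
      intro k
      set h := (w.map (z2Gen d)).prod
      have e : ((i :: w).map (z2Gen d)).prod = z2Gen d i * h := by simp [h]
      simp only [e, mul_assoc, groupMat_gen_mul hU i, ih, sum_mul]
      rw [finsum_sum_comm]
      · refine sum_congr rfl fun j _ => ?_
        rw [← finsum_comp_equiv (Equiv.mulLeft (z2Gen d j)⁻¹), mul_finsum']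
        · refine finsum_congr fun l => ?_
          have : (z2Gen d j)⁻¹ = z2Gen d j := (z2Gen_inv d j).symm
          dsimp only [Equiv.coe_mulLeft]
          have h2 : z2Gen d j * z2Gen d j = 1 := by rw [mul_eq_one_iff_eq_inv, this]
          rw [mul_inv_rev, inv_inv, this, mul_assoc, ← mul_assoc (z2Gen d j) (z2Gen d j), h2, one_mul]
        · refine (((finite_groupMat_row (U := U) h)).preimage
            (Equiv.mulLeft (z2Gen d j)⁻¹).injective.injOn).subset fun l hl => ?_
          exact left_ne_zero_of_mul hl
      · intro j _
        refine (((finite_groupMat_row (U := U) h)).preimage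
            (Equiv.mulLeft (z2Gen d j)).injective.injOn).subset fun l hl => ?_
        exact left_ne_zero_of_mul (right_ne_zero_of_mul hl)
  have := key (redWord d g) k
  rwa [prod_redWord] at this

theorem finite_wordMat_row {Y : Type} {V : Y → Y → A} (hV : ∀ g, {h | V g h ≠ 0}.Finite)
    (x : List Y) : {y | wordMat V x y ≠ 0}.Finite := by
  induction x with
  | nil =>
    refine (Set.finite_singleton []).subset fun y hy => ?_
    cases y with
    | nil => rfl
    | cons b y => exact absurd rfl hy
  | cons a x ih =>
    refine (Set.Finite.image2 List.cons (hV a) ih).subset fun y hy => ?_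
    cases y with
    | nil => exact absurd rfl hy
    | cons b y => exact ⟨b, left_ne_zero_of_mul hy, y, right_ne_zero_of_mul hy, rfl⟩

theorem finite_wordMat_col {Y : Type} [DecidableEq Y] {V : Y → Y → A} (hV : ∀ h, {g | V g h ≠ 0}.Finite)
    (y : List Y) : {x | wordMat V x y ≠ 0}.Finite := by
  have := finite_wordMat_row (V := fun a b => V b a) hV y
  simpa only [wordMat_swap] using this

/-- Multiplicative displacements between the vertices of a regular tree. -/
structure Displacement {I : Type*} (Pi : SimpleGraph I) (d : ℕ) where
  δ : I → I → Z2Free d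
  move : I → Z2Free d → I
  mul : ∀ i j k, δ i j * δ j k = δ i k
  adj : ∀ i j, Pi.Adj i j ↔ ∃ s, δ i j = z2Gen d s
  δ_move : ∀ i g, δ i (move i g) = g
  move_δ : ∀ i j, move i (δ i j) = j

theorem nonempty_displacement {I : Type*} {Pi : SimpleGraph I} [Pi.LocallyFinite]
    (hT : Pi.IsTree) (hR : Pi.IsRegularOfDegree d) : Nonempty (Displacement Pi d) := by
  obtain ⟨δ, h1, h2, h3, h4⟩ := exists_displacement hT hR
  choose move hm using h3
  refine ⟨δ, move, h1, h2, hm, fun i j => (h4 _ _ ?_).symm⟩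
  have e1 : δ i i = 1 := by simpa using h1 i i i
  have e2 : δ j i * δ i j = 1 := by rw [h1]; simpa using h1 j j j
  rw [← h1 j i, hm, e2]

namespace Displacement

variable {I : Type*} {Pi : SimpleGraph I} (D : Displacement Pi d)

theorem self (i : I) : D.δ i i = 1 := by simpa using D.mul i i i

theorem eq_one_iff {i j : I} : D.δ i j = 1 ↔ i = j :=
  ⟨fun h => by rw [← D.move_δ i i, D.self, ← h, D.move_δ], by rintro rfl; exact D.self i⟩

theorem symm (i j : I) : D.δ j i = (D.δ i j)⁻¹ := by rw [eq_inv_iff_mul_eq_one, D.mul, D.self]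

def equiv (i : I) : I ≃ Z2Free d where
  toFun := D.δ i
  invFun := D.move i
  left_inv := D.move_δ i
  right_inv := D.δ_move i

def steps : List I → 𝓦 d
  | a :: b :: l => D.δ a b :: steps (b :: l)
  | _ => []

def path : I → 𝓦 d → List I
  | a, [] => [a]
  | a, g :: G => a :: path (D.move a g) G

@[simp] theorem steps_nil : D.steps [] = [] := rfl
@[simp] theorem steps_singleton (a : I) : D.steps [a] = [] := rfl
@[simp] theorem steps_cons_cons (a b : I) (l : List I) :
    D.steps (a :: b :: l) = D.δ a b :: D.steps (b :: l) := rfl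

theorem path_eq_cons (a : I) (G : 𝓦 d) : ∃ l, D.path a G = a :: l := by
  cases G with
  | nil => exact ⟨[], rfl⟩
  | cons g G => exact ⟨_, rfl⟩

theorem steps_path (a : I) (G : 𝓦 d) : D.steps (D.path a G) = G := by
  induction G generalizing a with
  | nil => rfl
  | cons g G ih =>
    have := ih (D.move a g)
    rw [path]
    obtain ⟨l, hl⟩ := D.path_eq_cons (D.move a g) G
    rw [hl, steps_cons_cons, ← hl, this, D.δ_move]

theorem path_steps (a : I) (l : List I) : D.path a (D.steps (a :: l)) = a :: l := by
  induction l generalizing a with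
  | nil => rfl
  | cons b l ih => rw [steps_cons_cons, path, D.move_δ, ih]

theorem length_path (a : I) (G : 𝓦 d) : (D.path a G).length = G.length + 1 := by
  induction G generalizing a with
  | nil => rfl
  | cons g G ih => rw [path, length_cons, ih, length_cons]

theorem length_steps (a : I) (l : List I) : (D.steps (a :: l)).length = l.length := by
  have := D.length_path a (D.steps (a :: l))
  rw [path_steps, length_cons] at this
  omega

theorem steps_append (p : List I) (c : I) (q : List I) :
    D.steps (p ++ c :: q) = D.steps (p ++ [c]) ++ D.steps (c :: q) := by
  induction p with
  | nil => rfl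
  | cons a p ih =>
    cases p with
    | nil => rfl
    | cons b p => simpa using ih

theorem prod_steps (p : List I) (a b : I) (h : p.head? = some a) (h' : p.getLast? = some b) :
    (D.steps p).prod = D.δ a b := by
  induction p generalizing a with
  | nil => simp at h
  | cons c p ih =>
    obtain rfl : c = a := by simpa using h
    cases p with
    | nil =>
      obtain rfl : c = b := by simpa using h'
      simp [D.self]
    | cons e p => rw [steps_cons_cons, prod_cons, ih e rfl (by simpa using h'), D.mul]

def chainMat (U : Fin d → Fin d → A) (L L' : List I) : A :=
  wordMat (groupMat U) (D.steps L) (D.steps L')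

theorem chainMat_swap (L L' : List I) :
    D.chainMat (fun a b => U b a) L L' = D.chainMat U L' L := by
  rw [chainMat, chainMat, ← wordMat_swap (groupMat U)]
  congr 1
  funext a b
  exact groupMat_swap a b

theorem chainMat_append {p p' : List I} (c c' : I) (q q' : List I) (h : p.length = p'.length) :
    D.chainMat U (p ++ c :: q) (p' ++ c' :: q') =
      D.chainMat U (p ++ [c]) (p' ++ [c']) * D.chainMat U (c :: q) (c' :: q') := by
  unfold chainMat
  rw [D.steps_append p c q, D.steps_append p' c' q', wordMat_append]
  cases p with
  | nil => cases p' with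
    | nil => rfl
    | cons => simp at h
  | cons a p => cases p' with
    | nil => simp at h
    | cons a' p' =>
      rw [cons_append, cons_append, length_steps, length_steps]
      simpa using h

@[simp] theorem chainMat_cons_cons (a b a' b' : I) (l l' : List I) :
    D.chainMat U (a :: b :: l) (a' :: b' :: l') =
      groupMat U (D.δ a b) (D.δ a' b') * D.chainMat U (b :: l) (b' :: l') := rfl

@[simp] theorem chainMat_singleton (a a' : I) : D.chainMat U [a] [a'] = 1 := rfl

theorem chainMat_of_length {a a' : I} {l l' : List I} (h : l.length ≠ l'.length) :
    D.chainMat U (a :: l) (a' :: l') = 0 :=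
  wordMat_len _ (by rwa [length_steps, length_steps])

theorem groupMat_insert (hU : FreeRel id U) (c e c' e' k : I) :
    groupMat U (D.δ c e) (D.δ c' e') =
      ∑ᶠ k', groupMat U (D.δ c k) (D.δ c' k') * groupMat U (D.δ k e) (D.δ k' e') := by
  rw [← D.mul c k e, groupMat_mul hU, ← finsum_comp_equiv (D.equiv c')]
  refine finsum_congr fun k' => ?_
  change groupMat U (D.δ c k) (D.δ c' k') * groupMat U (D.δ k e) ((D.δ c' k')⁻¹ * D.δ c' e') = _
  rw [← D.symm, D.mul]

theorem groupMat_insert_right (hU : FreeRel id U) (c e c' e' k' : I) :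
    groupMat U (D.δ c e) (D.δ c' e') =
      ∑ᶠ k, groupMat U (D.δ c k) (D.δ c' k') * groupMat U (D.δ k e) (D.δ k' e') := by
  simpa only [groupMat_swap] using D.groupMat_insert hU.swap c' e' c e k'

theorem finite_insert (c c' k : I) : {k' | groupMat U (D.δ c k) (D.δ c' k') ≠ 0}.Finite :=
  (finite_groupMat_row (U := U) (D.δ c k)).preimage (D.equiv c').injective.injOn

theorem finite_chain (a : I) (L' : List I) : {l | D.chainMat U (a :: l) L' ≠ 0}.Finite := by
  refine ((finite_wordMat_col (V := groupMat U) finite_groupMat_col (D.steps L')).preimage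
    (f := fun l => D.steps (a :: l)) ?_)
  intro l _ l' _ h
  have := congrArg (D.path a) h
  simpa [path_steps] using this

theorem finite_chain_right (b : I) (L' : List I) :
    {l | D.chainMat U (l ++ [b]) L' ≠ 0}.Finite := by
  refine ((finite_wordMat_col (V := groupMat U) finite_groupMat_col (D.steps L')).preimage
    (f := fun l => D.steps (l ++ [b])) ?_)
  have key : ∀ l : List I, D.path (D.move b (D.steps (l ++ [b])).prod⁻¹) (D.steps (l ++ [b])) =
      l ++ [b] := by
    intro l
    obtain ⟨a, q, hq⟩ := exists_cons_of_ne_nil (l := l ++ [b]) (by simp)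
    have h1 : (D.steps (l ++ [b])).prod = D.δ a b :=
      D.prod_steps _ _ _ (by rw [hq]; rfl) (by simp)
    rw [h1, ← D.symm, D.move_δ, hq, path_steps]
  intro l _ l' _ h
  have h1 := key l
  have h2 := key l'
  simp only at h
  rw [h] at h1
  exact List.append_cancel_right (h1.symm.trans h2)

end Displacement

end GroupMat

/-! ### Homomorphisms from compositions and tensor products -/

section Homs

open BiLabeledGraph

universe u₁

variable {J : Type u₁}

/-- Maps from the vertices of a bi-labeled graph that send edges to related pairs. -/
def Homs (K : 𝓑) (R : J → J → Prop) : Type u₁ :=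
  {φ : K.V → J // ∀ v w, K.adj v w → R (φ v) (φ w)}

def Homs.xs {K : 𝓑} {R : J → J → Prop} (φ : Homs K R) : List J := K.x.map φ.1

def Homs.ys {K : 𝓑} {R : J → J → Prop} (φ : Homs K R) : List J := K.y.map φ.1

/-- The set `S` with the maps `x` and `y` is a model of the homomorphisms together with their values
on labels. -/
def IsModel (K : 𝓑) (R : J → J → Prop) {S : Type*} (x y : S → List J) : Prop :=
  ∃ e : Homs K R ≃ S, ∀ φ, x (e φ) = φ.xs ∧ y (e φ) = φ.ys

variable {K K' K₀ : 𝓑} {R : J → J → Prop} {S S' T : Type*} {x y : S → List J}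
  {x' y' : S' → List J}

theorem isModel (K : 𝓑) (R : J → J → Prop) :
    IsModel K R (Homs.xs (K := K) (R := R)) Homs.ys := ⟨Equiv.refl _, fun _ => ⟨rfl, rfl⟩⟩

theorem IsModel.map (h : IsModel K R x y) {z w : T → List J} (f : S → T)
    (hf : Function.Bijective f) (hz : ∀ s, z (f s) = x s) (hw : ∀ s, w (f s) = y s) :
    IsModel K R z w := by
  obtain ⟨e, he⟩ := h
  exact ⟨e.trans (Equiv.ofBijective f hf), fun φ => ⟨(hz _).trans (he φ).1, (hw _).trans (he φ).2⟩⟩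

theorem IsModel.length_x (h : IsModel K R x y) (s : S) : (x s).length = K.x.length := by
  obtain ⟨e, he⟩ := h
  obtain ⟨φ, rfl⟩ := e.surjective s
  rw [(he φ).1, Homs.xs, length_map]

theorem IsModel.length_y (h : IsModel K R x y) (s : S) : (y s).length = K.y.length := by
  obtain ⟨e, he⟩ := h
  obtain ⟨φ, rfl⟩ := e.surjective s
  rw [(he φ).2, Homs.ys, length_map]

theorem IsModel.transpose (h : IsModel K R x y) : IsModel K.transpose R y x := by
  obtain ⟨e, he⟩ := h
  exact ⟨e, fun φ => (he φ).symm⟩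

theorem IsModel.comp (h : K.y.length = K'.x.length) (hK : IsModel K R x y)
    (hK' : IsModel K' R x' y') : IsModel (K.comp K') R
      (S := {p : S × S' // y p.1 = x' p.2}) (fun p => x p.1.1) (fun p => y' p.1.2) := by
  obtain ⟨e, he⟩ := hK
  obtain ⟨e', he'⟩ := hK'
  let E : Homs (K.comp K') R ≃ {p : Homs K R × Homs K' R // p.1.ys = p.2.xs} :=
    { toFun := fun φ => ⟨(⟨fun v => φ.1 (cl K K' v), fun _ _ hvw => φ.2 _ _ (adj_cl hvw)⟩,
        ⟨fun v => φ.1 (cr K K' v), fun _ _ hvw => φ.2 _ _ (adj_cr hvw)⟩), comp_agree h φ.1⟩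
      invFun := fun ψ => ⟨Quot.lift (Sum.elim ψ.1.1.1 ψ.1.2.1) (by
          rintro _ _ ⟨p, hp, rfl, rfl⟩
          exact (zip_map_eq _ _ _ _ h).2 ψ.2 p hp), by
        rintro _ _ ⟨v, w, ⟨hvw⟩ | ⟨hvw⟩, rfl, rfl⟩
        · exact ψ.1.1.2 _ _ hvw
        · exact ψ.1.2.2 _ _ hvw⟩
      left_inv := fun φ => by
        apply sext
        funext v
        induction v using Quot.ind with
        | mk v => rcases v with v | v <;> rfl
      right_inv := fun ψ => rfl }
  refine ⟨E.trans ((e.prodCongr e').subtypeEquiv fun p => ?_), fun φ => ⟨?_, ?_⟩⟩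
  · change p.1.ys = p.2.xs ↔ y (e p.1) = x' (e' p.2); rw [(he _).2, (he' _).1]
  exacts [((he _).1).trans (comp_x_map K K' φ.1).symm, ((he' _).2).trans (comp_y_map K K' φ.1).symm]

theorem IsModel.tensor (hK : IsModel K R x y) (hK' : IsModel K' R x' y') :
    IsModel (K.tensor K') R (S := S × S') (fun p => x p.1 ++ x' p.2)
      (fun p => y p.1 ++ y' p.2) := by
  obtain ⟨e, he⟩ := hK
  obtain ⟨e', he'⟩ := hK'
  let E : Homs (K.tensor K') R ≃ Homs K R × Homs K' R :=
    { toFun := fun φ => (⟨fun v => φ.1 (tl K K' v), fun _ _ hvw => φ.2 _ _ (adj_tl hvw)⟩,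
        ⟨fun v => φ.1 (tr K K' v), fun _ _ hvw => φ.2 _ _ (adj_tr hvw)⟩)
      invFun := fun ψ => ⟨Sum.elim ψ.1.1 ψ.2.1, by
        rintro _ _ (⟨hvw⟩ | ⟨hvw⟩)
        · exact ψ.1.2 _ _ hvw
        · exact ψ.2.2 _ _ hvw⟩
      left_inv := fun φ => by apply sext; funext v; rcases v with v | v <;> rfl
      right_inv := fun ψ => rfl }
  refine ⟨E.trans (e.prodCongr e'), fun φ => ⟨?_, ?_⟩⟩
  exacts [(congrArg₂ (· ++ ·) (he _).1 (he' _).1).trans (tensor_x_map K K' φ.1).symm,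
    (congrArg₂ (· ++ ·) (he _).2 (he' _).2).trans (tensor_y_map K K' φ.1).symm]

def strands (p : ℕ) : 𝓑 where
  V := Fin p
  adj _ _ := False
  symm _ _ h := h
  x := List.finRange p
  y := List.finRange p

theorem isModel_strands (p : ℕ) (R : J → J → Prop) : IsModel (strands p) R
    (S := {l : List J // l.length = p}) Subtype.val Subtype.val := by
  let E : Homs (strands p) R ≃ {l : List J // l.length = p} :=
    { toFun := fun φ => ⟨ofFn φ.1, length_ofFn⟩
      invFun := fun l => ⟨fun v => l.1.get (Fin.cast l.2.symm v), fun _ _ h => h.elim⟩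
      left_inv := fun φ => by apply sext; funext v; exact List.get_ofFn _ _
      right_inv := fun l => by obtain ⟨l, rfl⟩ := l; exact sext (ofFn_get l) }
  exact ⟨E, fun φ => ⟨List.ofFn_eq_map, List.ofFn_eq_map⟩⟩

/-- A bi-labeled graph with `p` strands to the left and `q` strands to the right. -/
def padded (p : ℕ) (K : 𝓑) (q : ℕ) : 𝓑 :=
  ((strands p).tensor K).tensor (strands q)

theorem IsModel.padded (h : IsModel K R x y) (p q : ℕ) : IsModel (padded p K q) R
    (S := ({l : List J // l.length = p} × S) × {l : List J // l.length = q})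
    (fun z => (z.1.1.1 ++ x z.1.2) ++ z.2.1) (fun z => (z.1.1.1 ++ y z.1.2) ++ z.2.1) :=
  ((isModel_strands p R).tensor h).tensor (isModel_strands q R)

theorem padded_x_length (p : ℕ) (K : 𝓑) (q : ℕ) :
    (padded p K q).x.length = p + K.x.length + q := by
  rw [padded, tensor_x_length, tensor_x_length]; simp [strands]

theorem padded_y_length (p : ℕ) (K : 𝓑) (q : ℕ) :
    (padded p K q).y.length = p + K.y.length + q := by
  rw [padded, tensor_y_length, tensor_y_length]; simp [strands]

/-- The homomorphisms from two bi-labeled graphs have the same values on labels, with the same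
multiplicities. -/
def HomEquiv (K K' : 𝓑) (R : J → J → Prop) : Prop :=
  IsModel K' R (Homs.xs (K := K) (R := R)) Homs.ys

theorem IsModel.homEquiv (hK : IsModel K R x y) (hK' : IsModel K' R x y) : HomEquiv K K' R := by
  obtain ⟨e, he⟩ := hK
  obtain ⟨e', he'⟩ := hK'
  refine ⟨e'.trans e.symm, fun φ => ?_⟩
  grind

theorem homEquiv_of_isIso (h : K.IsIso K') (R : J → J → Prop) : HomEquiv K K' R := by
  obtain ⟨e, h1, h2, h3⟩ := h
  let E : Homs K' R ≃ Homs K R :=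
    { toFun := fun φ => ⟨fun v => φ.1 (e v), fun v w hvw => φ.2 _ _ ((h1 v w).1 hvw)⟩
      invFun := fun φ => ⟨fun v => φ.1 (e.symm v), fun v w hvw => φ.2 _ _ ((h1 _ _).2 (by grind))⟩
      left_inv := fun φ => sext (funext fun v => congrArg φ.1 (e.apply_symm_apply v))
      right_inv := fun φ => sext (funext fun v => congrArg φ.1 (e.symm_apply_apply v)) }
  refine ⟨E, fun φ => ⟨?_, ?_⟩⟩
  · rw [Homs.xs, Homs.xs, ← h2, map_map]; rfl
  · rw [Homs.ys, Homs.ys, ← h3, map_map]; rfl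

theorem HomEquiv.lengths (h : HomEquiv K K' R) (φ : Homs K R) :
    K.x.length = K'.x.length ∧ K.y.length = K'.y.length :=
  ⟨(isModel K R).length_x φ ▸ IsModel.length_x h φ,
    (isModel K R).length_y φ ▸ IsModel.length_y h φ⟩

theorem HomEquiv.comp_padded (h : HomEquiv K K' R) (hl : K.x.length = K'.x.length) {p q : ℕ}
    (h0 : K₀.y.length = p + K.x.length + q) :
    HomEquiv (K₀.comp (padded p K q)) (K₀.comp (padded p K' q)) R :=
  ((isModel K₀ R).comp (by rw [padded_x_length, h0])
    ((isModel K R).padded p q)).homEquiv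
    ((isModel K₀ R).comp (by rw [padded_x_length, h0, hl]) (IsModel.padded h p q))

theorem isModel_M (n m : ℕ) (R : J → J → Prop) : IsModel (M n m) R
    (fun c : J => replicate n c) (fun c => replicate m c) :=
  ⟨{ toFun := fun φ => φ.1 (), invFun := fun c => ⟨fun _ => c, fun _ _ h => h.elim⟩,
     left_inv := fun φ => rfl, right_inv := fun c => rfl }, fun φ =>
    ⟨(map_replicate (f := φ.1)).symm, (map_replicate (f := φ.1)).symm⟩⟩

theorem exists_eq_append_cons {p q : ℕ} {l : List J} (hl : l.length = p + 1 + q) :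
    ∃ (l₁ : List J) (c : J) (l₂ : List J), l = l₁ ++ c :: l₂ ∧ l₁.length = p ∧ l₂.length = q := by
  obtain ⟨c, l₂, h2⟩ := List.exists_cons_of_length_eq_add_one (l := l.drop p) (n := q)
    (by rw [length_drop]; omega)
  refine ⟨l.take p, c, l₂, by rw [← h2, take_append_drop], by rw [length_take]; omega, ?_⟩
  have := congrArg List.length h2
  grind

theorem homEquiv_comp_padded_one {p q : ℕ} (h0 : K₀.y.length = p + 1 + q) (R : J → J → Prop) :
    HomEquiv K₀ (K₀.comp (padded p (M 1 1) q)) R := by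
  have h1 : IsModel (M 1 1) R (fun c => [c]) (fun c => [c]) := isModel_M 1 1 R
  refine ((isModel K₀ R).comp (by rw [padded_x_length, h0]; rfl) (h1.padded p q)).map
    (fun z => z.1.1) ⟨?_, ?_⟩ (fun z => rfl) (fun z => z.2)
  · rintro ⟨⟨φ, ⟨l, c⟩, r⟩, h⟩ ⟨⟨φ', ⟨l', c'⟩, r'⟩, h'⟩ (rfl : φ = φ')
    have e := h.symm.trans h'
    obtain ⟨e1, e2⟩ := append_inj' e (r.2.trans r'.2.symm)
    obtain ⟨e3, e4⟩ := append_inj' e1 rfl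
    grind
  · intro φ
    obtain ⟨l, c, r, hr, hl, hr'⟩ :=
      exists_eq_append_cons (((isModel K₀ R).length_y φ).trans h0)
    exact ⟨⟨(φ, (⟨l, hl⟩, c), ⟨r, hr'⟩), by simpa using hr⟩, rfl⟩

theorem homEquiv_comp_padded_comp {p q : ℕ} (h0 : K₀.y.length = p + K.x.length + q)
    (h : K.y.length = K'.x.length) (R : J → J → Prop) :
    HomEquiv ((K₀.comp (padded p K q)).comp (padded p K' q)) (K₀.comp (padded p (K.comp K') q))
      R := by
  have hy := (isModel K R).length_y
  have hx' := (isModel K' R).length_x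
  have m1 := (isModel K₀ R).comp (by rw [padded_x_length, h0, comp_x_length])
    (((isModel K R).comp h (isModel K' R)).padded p q)
  have m2 := ((isModel K₀ R).comp (by rw [padded_x_length, h0])
    ((isModel K R).padded p q)).comp (by rw [comp_y_length, padded_y_length, padded_x_length, h])
    ((isModel K' R).padded p q)
  refine m2.homEquiv (m1.map (fun z => ⟨(⟨(z.1.1, (z.1.2.1.1, z.1.2.1.2.1.1), z.1.2.2), z.2⟩,
    (z.1.2.1.1, z.1.2.1.2.1.2), z.1.2.2), by grind⟩) ⟨?_, ?_⟩ (fun z => rfl) (fun z => rfl))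
  · rintro ⟨⟨φ, ⟨l, ψ, hψ⟩, r⟩, h⟩ ⟨⟨φ', ⟨l', ψ', hψ'⟩, r'⟩, h'⟩ e; grind
  · rintro ⟨⟨⟨⟨φ, ⟨l, ψ⟩, r⟩, hφ⟩, ⟨l', ψ'⟩, r'⟩, e⟩
    obtain ⟨e1, e2⟩ := append_inj' e (r.2.trans r'.2.symm)
    obtain ⟨e3, e4⟩ := append_inj e1 (l.2.trans l'.2.symm)
    obtain rfl : l = l' := sext e3
    obtain rfl : r = r' := sext e2
    exact ⟨⟨(φ, (l, ⟨(ψ, ψ'), e4⟩), r), hφ⟩, rfl⟩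

theorem homEquiv_comp_padded_tensor {p q : ℕ}
    (h0 : K₀.y.length = p + (K.x.length + K'.x.length) + q) (R : J → J → Prop) :
    HomEquiv ((K₀.comp (padded p K (K'.x.length + q))).comp (padded (p + K.y.length) K' q))
      (K₀.comp (padded p (K.tensor K') q)) R := by
  have hy := (isModel K R).length_y
  have hx' := (isModel K' R).length_x
  have m1 := (isModel K₀ R).comp (by rw [padded_x_length, h0, tensor_x_length])
    (((isModel K R).tensor (isModel K' R)).padded p q)
  have m2 := ((isModel K₀ R).comp (by rw [padded_x_length, h0]; omega)
    ((isModel K R).padded p (K'.x.length + q))).comp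
    (by rw [comp_y_length, padded_y_length, padded_x_length]; omega)
    ((isModel K' R).padded (p + K.y.length) q)
  refine m2.homEquiv (m1.map (fun z => ⟨(⟨(z.1.1, (z.1.2.1.1, z.1.2.1.2.1),
      ⟨z.1.2.1.2.2.xs ++ z.1.2.2.1, by rw [length_append, hx', z.1.2.2.2]⟩), by
        rw [z.2]; simp only [append_assoc]⟩,
    (⟨z.1.2.1.1.1 ++ z.1.2.1.2.1.ys, by rw [length_append, hy, z.1.2.1.1.2]⟩,
      z.1.2.1.2.2), z.1.2.2), by simp only [append_assoc]⟩) ⟨?_, ?_⟩ (fun z => rfl)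
      (fun z => by simp only [append_assoc]))
  · rintro ⟨⟨φ, ⟨l, ψ⟩, r⟩, h⟩ ⟨⟨φ', ⟨l', ψ'⟩, r'⟩, h'⟩ e; grind
  · rintro ⟨⟨⟨⟨φ, ⟨l, ψ⟩, r⟩, hφ⟩, ⟨l', ψ'⟩, r'⟩, e⟩
    rw [append_assoc (l'.1)] at e
    obtain ⟨e1, e2⟩ := append_inj e (by rw [length_append, l.2, hy, l'.2])
    refine ⟨⟨(φ, (l, (ψ, ψ')), r'), ?_⟩, ?_⟩
    all_goals grind

theorem homEquiv_transpose_comp (h : K.y.length = K'.x.length) (R : J → J → Prop) :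
    HomEquiv (K'.transpose.comp K.transpose) (K.comp K').transpose R := by
  refine ((isModel K' R).transpose.comp h.symm (isModel K R).transpose).homEquiv
    (((isModel K R).comp h (isModel K' R)).transpose.map
      (fun z => ⟨(z.1.2, z.1.1), z.2.symm⟩) ⟨?_, ?_⟩ (fun z => rfl) (fun z => rfl))
  · rintro ⟨⟨φ, ψ⟩, h⟩ ⟨⟨φ', ψ'⟩, h'⟩ e; grind
  · rintro ⟨⟨φ, ψ⟩, h⟩; exact ⟨⟨(ψ, φ), h.symm⟩, rfl⟩

theorem homEquiv_strands_comp {n : ℕ} (h : K.x.length = n) (R : J → J → Prop) :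
    HomEquiv ((strands n).comp (padded 0 K 0)) K R := by
  refine IsModel.homEquiv ((isModel_strands n R).comp
    (by rw [padded_x_length, h]; simp [strands]) ((isModel K R).padded 0 0))
    ((isModel K R).map (fun φ => ⟨(⟨φ.xs, by rw [Homs.xs, length_map, h]⟩,
      (⟨[], rfl⟩, φ), ⟨[], rfl⟩), by simp⟩) ⟨?_, ?_⟩ (fun φ => rfl) (fun φ => by simp))
  · intro φ ψ e; grind
  · rintro ⟨⟨l, ⟨⟨l', h1⟩, φ⟩, ⟨r', h2⟩⟩, e⟩; grind

end Homs

/-! ### Planar bi-labeled graphs and the matrix of the free product -/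

section FinsumAux

variable {α β M : Type*} [AddCommMonoid M]

open Classical in
theorem finsum_subtype (p : α → Prop) (f : α → M) :
    ∑ᶠ a : {a // p a}, f a.1 = ∑ᶠ a, if p a then f a else 0 := by
  refine Eq.trans (finsum_subtype_eq_finsum_cond (f := f) p) ?_
  refine finsum_congr fun a => ?_
  by_cases h : p a <;> simp [h]

theorem finsum_of_injective {g : α → β} (hg : Inj g) {f : β → M}
    (hf : ∀ b, (∀ a, g a ≠ b) → f b = 0) : ∑ᶠ b, f b = ∑ᶠ a, f (g a) := by
  rw [← finsum_mem_range hg]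
  refine finsum_congr fun b => ?_
  by_cases h : b ∈ Set.range g
  · simp [h]
  · rw [hf b fun a ha => h ⟨a, ha⟩]; simp

theorem finsum_finsum_comm {f : α → β → M} (hf : {p : α × β | f p.1 p.2 ≠ 0}.Finite) :
    ∑ᶠ a, ∑ᶠ b, f a b = ∑ᶠ b, ∑ᶠ a, f a b := by
  have h1 := finsum_curry (fun p : α × β => f p.1 p.2) hf
  have h2 := finsum_curry (fun p : β × α => f p.2 p.1)
    (hf.preimage (f := Prod.swap) Prod.swap_injective.injOn)
  rw [← h1, ← h2]
  exact (finsum_comp_equiv (Equiv.prodComm β α) (f := fun p : α × β => f p.1 p.2)).symm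

end FinsumAux

section Balanced

open BiLabeledGraph

theorem IsModel.finsum {J : Type*} {K : 𝓑} {R : J → J → Prop} {S : Type*}
    {x y : S → List J} (h : IsModel K R x y) {M : Type*} [AddCommMonoid M]
    (F : List J → List J → M) :
    ∑ᶠ φ : Homs K R, F φ.xs φ.ys = ∑ᶠ s, F (x s) (y s) := by
  obtain ⟨e, he⟩ := h
  rw [← finsum_comp_equiv e]
  grind

/-- A bi-labeled graph is anchored if each of its components contains a label. -/
def Anchored (K : 𝓑) : Prop :=
  ∀ φ ψ : Homs K 𝓔, (∀ P ∈ φ.xs ++ φ.ys, ¬ P) →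
    (∀ P ∈ ψ.xs ++ ψ.ys, ¬ P) → φ = ψ

theorem IsModel.anchored_iff {K : 𝓑} {S : Type*} {x y : S → List Prop}
    (h : IsModel K Eq x y) : Anchored K ↔ ∀ s t : S, (∀ P ∈ x s ++ y s, ¬ P) →
      (∀ P ∈ x t ++ y t, ¬ P) → s = t := by
  obtain ⟨e, he⟩ := h
  constructor
  · intro hK s t hs ht
    obtain ⟨φ, rfl⟩ := e.surjective s
    obtain ⟨ψ, rfl⟩ := e.surjective t
    rw [(he _).1, (he _).2] at hs ht
    rw [hK φ ψ hs ht]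
  · intro hS φ ψ hφ hψ; rw [← (he _).1, ← (he _).2] at hφ hψ; exact e.injective (hS _ _ hφ hψ)

variable {K K' K₀ : 𝓑}

def falseHom (K : 𝓑) : Homs K 𝓔 := ⟨fun _ => False, fun _ _ _ => rfl⟩

theorem eq_replicate_false {l : List Prop} (h : ∀ P ∈ l, ¬ P) : l = replicate l.length False :=
  List.eq_replicate_iff.2 ⟨rfl, fun P hP => eq_false (h P hP)⟩

theorem not_of_mem_replicate (n : ℕ) : ∀ P ∈ replicate n False, ¬ P := fun _ hP =>
  eq_of_mem_replicate hP ▸ id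

theorem falseHom_ys (K : 𝓑) : (falseHom K).ys = replicate K.y.length False :=
  map_const'

theorem falseHom_xs (K : 𝓑) : (falseHom K).xs = replicate K.x.length False :=
  map_const'

theorem Anchored.of_comp (hl : K.y.length = K'.x.length) (h : Anchored (K.comp K')) :
    Anchored K ∧ Anchored K' := by
  have h' := ((isModel K Eq).comp hl (isModel K' Eq)).anchored_iff.1 h
  have ey : ∀ φ : Homs K 𝓔, (∀ P ∈ φ.xs ++ φ.ys, ¬ P) →
      φ.ys = (falseHom K').xs := fun φ hφ => by
    rw [eq_replicate_false (l := φ.ys) fun P hP => hφ P (List.mem_append_right _ hP),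
      falseHom_xs, ← hl, (isModel K _).length_y]
  have ex : ∀ φ : Homs K' 𝓔, (∀ P ∈ φ.xs ++ φ.ys, ¬ P) →
      (falseHom K).ys = φ.xs := fun φ hφ => by
    rw [eq_replicate_false (l := φ.xs) fun P hP => hφ P (List.mem_append_left _ hP),
      falseHom_ys, hl, (isModel K' _).length_x]
  refine ⟨fun φ ψ hφ hψ => ?_, fun φ ψ hφ hψ => ?_⟩
  · have fY : ∀ P ∈ (falseHom K').ys, ¬ P := falseHom_ys K' ▸ not_of_mem_replicate _
    have := h' ⟨(φ, falseHom K'), ey φ hφ⟩ ⟨(ψ, falseHom K'), ey ψ hψ⟩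
      (List.forall_mem_append.2 ⟨(List.forall_mem_append.1 hφ).1, fY⟩)
      (List.forall_mem_append.2 ⟨(List.forall_mem_append.1 hψ).1, fY⟩)
    simpa using this
  · have fX : ∀ P ∈ (falseHom K).xs, ¬ P := falseHom_xs K ▸ not_of_mem_replicate _
    have := h' ⟨(falseHom K, φ), ex φ hφ⟩ ⟨(falseHom K, ψ), ex ψ hψ⟩
      (List.forall_mem_append.2 ⟨fX, (List.forall_mem_append.1 hφ).2⟩)
      (List.forall_mem_append.2 ⟨fX, (List.forall_mem_append.1 hψ).2⟩)
    simpa using this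

theorem Anchored.of_padded {p q : ℕ} (h : Anchored (padded p K q)) : Anchored K := by
  have h' := ((isModel K Eq).padded p q).anchored_iff.1 h
  intro φ ψ hφ hψ
  have key : ∀ φ : Homs K 𝓔, (∀ P ∈ φ.xs ++ φ.ys, ¬ P) →
      ∀ P ∈ ((replicate p False ++ φ.xs) ++ replicate q False) ++
        ((replicate p False ++ φ.ys) ++ replicate q False), ¬ P := by
    intro φ hφ
    simp only [List.forall_mem_append] at hφ ⊢
    have r := not_of_mem_replicate
    exact ⟨⟨⟨r p, hφ.1⟩, r q⟩, ⟨r p, hφ.2⟩, r q⟩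
  have := h' ((⟨_, List.length_replicate⟩, φ), ⟨_, List.length_replicate⟩)
    ((⟨_, List.length_replicate⟩, ψ), ⟨_, List.length_replicate⟩) (key φ hφ) (key ψ hψ)
  simpa using this

universe w

variable {I : Type w} {Pi : SimpleGraph I}

theorem finite_homs [Pi.LocallyFinite] (L : List K.V)
    (hL : ∀ φ ψ : Homs K 𝓔, (∀ v ∈ L, ¬ φ.1 v) → (∀ v ∈ L, ¬ ψ.1 v) →
      φ = ψ) (P : Set (Homs K Pi.Adj)) (hP : ((fun φ => L.map φ.1) '' P).Finite) : P.Finite := by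
  have adj : ∀ v w, K.adj v w → ((fun φ : Homs K Pi.Adj => φ.1 v) '' P).Finite →
      ((fun φ : Homs K Pi.Adj => φ.1 w) '' P).Finite := by
    intro v w hvw h
    refine (h.biUnion fun i _ => (toFinite (Pi.neighborSet i))).subset ?_
    rintro _ ⟨φ, hφ, rfl⟩
    exact Set.mem_biUnion (Set.mem_image_of_mem _ hφ) (φ.2 v w hvw)
  let f : Homs K 𝓔 :=
    ⟨fun v => ¬ ((fun φ : Homs K Pi.Adj => φ.1 v) '' P).Finite, fun v w hvw =>
      propext (not_congr ⟨adj v w hvw, adj w v (K.symm _ _ hvw)⟩)⟩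
  have hf : f = falseHom K := hL _ _ (fun v hv => by
    change ¬ ¬ _
    rw [not_not]
    obtain ⟨k, hk, rfl⟩ := List.mem_iff_getElem.1 hv
    refine Set.Finite.of_finite_image (f := some) ((hP.image fun l => l[k]?).subset ?_)
      (some_injective I).injOn
    grind) (fun v _ => id)
  have hfin : ∀ v, ((fun φ : Homs K Pi.Adj => φ.1 v) '' P).Finite := fun v => by
    have := congrFun (congrArg Subtype.val hf) v
    by_contra h
    exact this.mp h
  refine Set.Finite.of_finite_image (f := Subtype.val) ((Set.Finite.pi' hfin).subset ?_)
    Subtype.val_injective.injOn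
  rintro _ ⟨φ, hφ, rfl⟩ v
  exact ⟨φ, hφ, rfl⟩

theorem Anchored.finite [Pi.LocallyFinite] (hK : Anchored K) {F F' : Set (List I)} (hF : F.Finite)
    (hF' : F'.Finite) : {φ : Homs K Pi.Adj | φ.xs ∈ F ∧ φ.ys ∈ F'}.Finite := by
  refine finite_homs (K.x ++ K.y) (fun φ ψ hφ hψ => hK φ ψ ?_ ?_) _
    ((hF.image2 (· ++ ·) hF').subset ?_)
  · rw [Homs.xs, Homs.ys, ← map_append]; exact List.forall_mem_map.2 hφ
  · rw [Homs.xs, Homs.ys, ← map_append]; exact List.forall_mem_map.2 hψ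
  · rintro _ ⟨φ, hφ, rfl⟩; exact ⟨φ.xs, hφ.1, φ.ys, hφ.2, List.map_append.symm⟩

variable {d : ℕ} (D : Displacement Pi d) {A : Type*} [Ring A] (U : Fin d → Fin d → A)

def Displacement.wMat (a : I) (l : List I) (b a' : I) (l' : List I) (b' : I) : A :=
  D.chainMat U (a :: (l ++ [b])) (a' :: (l' ++ [b']))

variable {U}

theorem Displacement.wMat_swap (a : I) (l : List I) (b a' : I) (l' : List I) (b' : I) :
    D.wMat (fun s t => U t s) a l b a' l' b' = D.wMat U a' l' b' a l b := D.chainMat_swap _ _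

theorem Displacement.wMat_of_length {a : I} {l : List I} {b a' : I} {l' : List I} {b' : I}
    (h : l.length ≠ l'.length) : D.wMat U a l b a' l' b' = 0 :=
  D.chainMat_of_length (by simpa using h)

theorem Displacement.finite_wMat (a b a' b' : I) (l' : List I) :
    {l | D.wMat U a l b a' l' b' ≠ 0}.Finite :=
  (D.finite_chain a (a' :: (l' ++ [b']))).preimage
    (f := fun l => l ++ [b]) (List.append_left_injective [b]).injOn

theorem Displacement.finite_wMat_right (a b a' b' : I) (l : List I) :
    {l' | D.wMat U a l b a' l' b' ≠ 0}.Finite := by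
  have := D.finite_wMat (U := fun s t => U t s) a' b' a b l
  simpa only [D.wMat_swap (U := U)] using this

variable (U)

open Classical in
/-- The matrices of homomorphism counts of `K` and of its transpose are exchanged by the matrix of
the free product, with arbitrary ends to the left and to the right. -/
def Balanced (K : 𝓑) : Prop :=
  Anchored K → ∀ a b a' b' i j, ∑ᶠ φ : Homs K Pi.Adj,
      (if φ.xs = i then D.wMat U a φ.ys b a' j b' else 0) =
    ∑ᶠ φ : Homs K Pi.Adj, if φ.ys = j then D.wMat U a i b a' φ.xs b' else 0

variable {D U}

theorem Balanced.of_homEquiv (h : HomEquiv K K' Pi.Adj)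
    (h' : HomEquiv K K' 𝓔) (hK : Balanced D U K) : Balanced D U K' := by
  classical
  intro hA a b a' b' i j
  have hA' : Anchored K := (IsModel.anchored_iff h').1 hA
  have := hK hA' a b a' b' i j
  rw [IsModel.finsum h fun x y => if x = i then D.wMat U a y b a' j b' else 0,
    IsModel.finsum h fun x y => if y = j then D.wMat U a i b a' x b' else 0]
  exact this

theorem balanced_of_swap (h : Balanced D (fun s t => U t s) K) : Balanced D U K.transpose := by
  intro hA a b a' b' i j
  have hA' : Anchored K := fun φ ψ hφ hψ => hA φ ψ
    (fun P hP => hφ P (List.mem_append.2 (List.mem_append.1 hP).symm))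
    (fun P hP => hψ P (List.mem_append.2 (List.mem_append.1 hP).symm))
  have := h hA' a' b' a b j i
  simp only [D.wMat_swap (U := U)] at this
  exact this.symm

theorem Balanced.finite_left [Pi.LocallyFinite] (hK : Anchored K) (a b a' b' : I) (i j : List I) :
    {φ : Homs K Pi.Adj | φ.xs = i ∧ D.wMat U a φ.ys b a' j b' ≠ 0}.Finite :=
  hK.finite (Set.finite_singleton i) (D.finite_wMat a b a' b' j)

theorem Balanced.finite_right [Pi.LocallyFinite] (hK : Anchored K) (a b a' b' : I) (i j : List I) :
    {φ : Homs K Pi.Adj | φ.ys = j ∧ D.wMat U a i b a' φ.xs b' ≠ 0}.Finite :=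
  (hK.finite (D.finite_wMat_right (U := U) a b a' b' i) (Set.finite_singleton j)).subset
    fun _ h => ⟨h.2, h.1⟩

open Classical in
theorem Balanced.comp [Pi.LocallyFinite] (hl : K.y.length = K'.x.length) (hK : Balanced D U K)
    (hK' : Balanced D U K') (hfin : Anchored (K.comp K') → ∀ a b a' b' i j,
      {p : Homs K Pi.Adj × Homs K' Pi.Adj | p.1.xs = i ∧ p.2.ys = j ∧
        D.wMat U a p.1.ys b a' p.2.xs b' ≠ 0}.Finite) : Balanced D U (K.comp K') := by
  intro hA a b a' b' i j
  obtain ⟨hA1, hA2⟩ := hA.of_comp hl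
  have m := (isModel K Pi.Adj).comp hl (isModel K' Pi.Adj)
  obtain ⟨e, he⟩ := id m
  have inj : Inj fun φ : Homs (K.comp K') Pi.Adj => (e φ).1 :=
    Subtype.val_injective.comp e.injective
  have fin1 : {p : Homs K Pi.Adj × Homs K' Pi.Adj | p.1.ys = p.2.xs ∧ p.1.xs = i ∧
      D.wMat U a p.2.ys b a' j b' ≠ 0}.Finite := by
    refine ((Balanced.finite_left (D := D) (U := U) hA a b a' b' i j).image
      fun φ => (e φ).1).subset ?_
    rintro p ⟨h1, h2, h3⟩
    refine ⟨e.symm ⟨p, h1⟩, ?_, by simp⟩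
    grind
  have fin2 : {p : Homs K Pi.Adj × Homs K' Pi.Adj | p.1.ys = p.2.xs ∧ p.2.ys = j ∧
      D.wMat U a i b a' p.1.xs b' ≠ 0}.Finite := by
    refine ((Balanced.finite_right (D := D) (U := U) hA a b a' b' i j).image
      fun φ => (e φ).1).subset ?_
    rintro p ⟨h1, h2, h3⟩
    refine ⟨e.symm ⟨p, h1⟩, ?_, by simp⟩
    grind
  rw [m.finsum fun x y => if x = i then D.wMat U a y b a' j b' else 0,
    m.finsum fun x y => if y = j then D.wMat U a i b a' x b' else 0,
    finsum_subtype (fun p : Homs K Pi.Adj × Homs K' Pi.Adj => p.1.ys = p.2.xs)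
      (fun p => if p.1.xs = i then D.wMat U a p.2.ys b a' j b' else 0),
    finsum_subtype (fun p : Homs K Pi.Adj × Homs K' Pi.Adj => p.1.ys = p.2.xs)
      (fun p => if p.2.ys = j then D.wMat U a i b a' p.1.xs b' else 0),
    finsum_curry _ (fin1.subset fun p hp => ?_), finsum_curry _ (fin2.subset fun p hp => ?_)]
  · have e1 : ∀ φ : Homs K Pi.Adj, ∑ᶠ ψ : Homs K' Pi.Adj, (if φ.ys = ψ.xs then
        (if φ.xs = i then D.wMat U a ψ.ys b a' j b' else 0) else 0) =
        ∑ᶠ ψ : Homs K' Pi.Adj, if φ.xs = i ∧ ψ.ys = j then D.wMat U a φ.ys b a' ψ.xs b'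
          else 0 := by
      intro φ
      by_cases h : φ.xs = i
      · have := hK' hA2 a b a' b' φ.ys j; grind
      · simp [h]
    have e2 : ∀ ψ : Homs K' Pi.Adj, ∑ᶠ φ : Homs K Pi.Adj, (if φ.ys = ψ.xs then
        (if ψ.ys = j then D.wMat U a i b a' φ.xs b' else 0) else 0) =
        ∑ᶠ φ : Homs K Pi.Adj, if φ.xs = i ∧ ψ.ys = j then D.wMat U a φ.ys b a' ψ.xs b'
          else 0 := by
      intro ψ
      by_cases h : ψ.ys = j
      · have := hK hA1 a b a' b' i ψ.xs; simp only [h, if_true, and_true, this]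
      · simp [h]
    have e3 := (finsum_congr e1).trans (Eq.trans ?_ (finsum_finsum_comm (f := fun
      (φ : Homs K Pi.Adj) (ψ : Homs K' Pi.Adj) => if φ.ys = ψ.xs then
        (if ψ.ys = j then D.wMat U a i b a' φ.xs b' else 0) else 0) ?_).symm)
    · convert e3
    · rw [finsum_congr e2, finsum_finsum_comm]
      refine (hfin hA a b a' b' i j).subset fun p hp => ?_
      simp only [mem_ofPred_eq, ne_eq, ite_eq_right_iff, not_forall] at hp
      exact ⟨hp.1.1, hp.1.2, hp.2⟩
    · grind
  all_goals
    simp only [mem_support, ne_eq, ite_eq_right_iff, not_forall] at hp; exact ⟨hp.1, hp.2.1, hp.2.2⟩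

open Classical in
theorem balanced_of_lengths (h : Anchored K → ∀ a b a' b' i j, i.length = K.x.length →
    j.length = K.y.length → ∑ᶠ φ : Homs K Pi.Adj,
      (if φ.xs = i then D.wMat U a φ.ys b a' j b' else 0) =
    ∑ᶠ φ : Homs K Pi.Adj, if φ.ys = j then D.wMat U a i b a' φ.xs b' else 0) :
    Balanced D U K := by
  intro hA a b a' b' i j
  have hx := (isModel K Pi.Adj).length_x
  have hy := (isModel K Pi.Adj).length_y
  by_cases hi : i.length = K.x.length
  · by_cases hj : j.length = K.y.length
    · exact h hA a b a' b' i j hi hj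
    · rw [finsum_congr (g := fun _ => (0 : A)) fun φ => ?_,
        finsum_congr (f := fun φ : Homs K Pi.Adj => if φ.ys = j then _ else _)
          (g := fun _ => (0 : A)) fun φ => ?_]
      · rw [if_neg]; rintro rfl; exact hj (hy φ)
      · rw [D.wMat_of_length (by rw [hy]; exact Ne.symm hj), ite_self]
  · rw [finsum_congr (g := fun _ => (0 : A)) fun φ => ?_,
        finsum_congr (f := fun φ : Homs K Pi.Adj => if φ.ys = j then _ else _)
          (g := fun _ => (0 : A)) fun φ => ?_]
    · rw [D.wMat_of_length (by rw [hx]; exact hi), ite_self]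
    · rw [if_neg]; rintro rfl; exact hi (hx φ)

theorem Displacement.exists_wMat_pad {l l' r r' : List I} (hl : l.length = l'.length)
    (hr : r.length = r'.length) (a b a' b' : I) : ∃ (P S : A) (a₁ b₁ a₁' b₁' : I), ∀ y y',
      D.wMat U a (l ++ y ++ r) b a' (l' ++ y' ++ r') b' =
        P * D.wMat U a₁ y b₁ a₁' y' b₁' * S := by
  obtain ⟨s, a₁, hs⟩ := (eq_nil_or_concat' (a :: l)).resolve_left (by simp)
  obtain ⟨s', a₁', hs'⟩ := (eq_nil_or_concat' (a' :: l')).resolve_left (by simp)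
  obtain ⟨b₁, t, ht⟩ := exists_cons_of_ne_nil (l := r ++ [b]) (by simp)
  obtain ⟨b₁', t', ht'⟩ := exists_cons_of_ne_nil (l := r' ++ [b']) (by simp)
  have hss : s.length = s'.length := by
    have h1 := congrArg List.length hs
    have h2 := congrArg List.length hs'
    simp at h1 h2; omega
  have htt : t.length = t'.length := by
    have h1 := congrArg List.length ht
    have h2 := congrArg List.length ht'
    simp at h1 h2; omega
  have e : ∀ {a l r b s a₁ b₁ t} (_ : a :: l = s ++ [a₁]) (_ : r ++ [b] = b₁ :: t) (y : List I),
      a :: ((l ++ y ++ r) ++ [b]) = s ++ a₁ :: (y ++ b₁ :: t) := by grind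
  refine ⟨D.chainMat U (s ++ [a₁]) (s' ++ [a₁']), D.chainMat U (b₁ :: t) (b₁' :: t'), a₁, b₁, a₁',
    b₁', fun y y' => ?_⟩
  rw [Displacement.wMat, e hs ht, e hs' ht', D.chainMat_append _ _ _ _ hss]
  by_cases hy : y.length = y'.length
  · have := D.chainMat_append (U := U) (p := a₁ :: y) (p' := a₁' :: y') b₁ b₁' t t' (by simp [hy])
    rw [cons_append, cons_append] at this
    rw [this, Displacement.wMat, mul_assoc]; rfl
  · rw [D.chainMat_of_length (by simp [htt]; exact hy), D.wMat_of_length hy, mul_zero, zero_mul]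

open Classical in
theorem Balanced.padded [Pi.LocallyFinite] (hK : Balanced D U K) (p q : ℕ) :
    Balanced D U (padded p K q) := by
  refine balanced_of_lengths fun hA a b a' b' i j hi hj => ?_
  have hA' := hA.of_padded
  rw [padded_x_length] at hi
  rw [padded_y_length] at hj
  have split : ∀ {k : ℕ} {l : List I}, l.length = p + k + q →
      ∃ l₁ l₂ l₃ : List I, l = l₁ ++ l₂ ++ l₃ ∧ l₁.length = p ∧ l₂.length = k ∧
        l₃.length = q := by
    intro k l hl
    refine ⟨l.take p, (l.drop p).take k, (l.drop p).drop k, ?_, ?_, ?_, ?_⟩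
    · rw [append_assoc, take_append_drop, take_append_drop]
    · rw [length_take]; omega
    · rw [length_take, length_drop]; omega
    · rw [length_drop, length_drop]; omega
  obtain ⟨l₁, i₁, r₁, rfl, hl1, hi1, hr1⟩ := split hi
  obtain ⟨l₂, j₂, r₂, rfl, hl2, hj2, hr2⟩ := split hj
  obtain ⟨P, S, a₁, b₁, a₁', b₁', h⟩ := D.exists_wMat_pad (U := U) (hl1.trans hl2.symm)
    (hr1.trans hr2.symm) a b a' b'
  have m := (isModel K Pi.Adj).padded p q
  rw [m.finsum fun x y => if x = l₁ ++ i₁ ++ r₁ then D.wMat U a y b a' (l₂ ++ j₂ ++ r₂) b' else 0,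
    m.finsum fun x y => if y = l₂ ++ j₂ ++ r₂ then D.wMat U a (l₁ ++ i₁ ++ r₁) b a' x b' else 0,
    finsum_of_injective (g := fun φ : Homs K Pi.Adj => ((⟨l₁, hl1⟩, φ), ⟨r₁, hr1⟩)),
    finsum_of_injective (g := fun φ : Homs K Pi.Adj => ((⟨l₂, hl2⟩, φ), ⟨r₂, hr2⟩))]
  · simp only [h, List.append_cancel_right_eq, List.append_cancel_left_eq]
    have := hK hA' a₁ b₁ a₁' b₁' i₁ j₂
    have e1 : ∀ (c : Prop) [Decidable c] (x : A), (if c then P * x * S else 0) =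
        P * (if c then x else 0) * S := fun c _ x => by split_ifs <;> simp
    simp only [e1]
    rw [← finsum_mul', ← mul_finsum', ← finsum_mul', ← mul_finsum', this]
    · refine (Balanced.finite_right (D := D) (U := U) hA' a₁ b₁ a₁' b₁' i₁ j₂).subset fun φ hφ => ?_
      simpa using hφ
    · refine (Balanced.finite_right (D := D) (U := U) hA' a₁ b₁ a₁' b₁' i₁ j₂).subset fun φ hφ => ?_
      simpa using right_ne_zero_of_mul hφ
    · refine (Balanced.finite_left (D := D) (U := U) hA' a₁ b₁ a₁' b₁' i₁ j₂).subset fun φ hφ => ?_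
      simpa using hφ
    · refine (Balanced.finite_left (D := D) (U := U) hA' a₁ b₁ a₁' b₁' i₁ j₂).subset fun φ hφ => ?_
      simpa using right_ne_zero_of_mul hφ
  · intro φ ψ e; simpa using e
  · rintro ⟨⟨⟨l, hl⟩, φ⟩, ⟨r, hr⟩⟩ hne
    rw [if_neg]
    intro e
    obtain ⟨e1, rfl⟩ := append_inj' e (hr.trans hr2.symm)
    obtain ⟨rfl, -⟩ := append_inj e1 (hl.trans hl2.symm)
    exact hne φ rfl
  · intro φ ψ e; simpa using e
  · rintro ⟨⟨⟨l, hl⟩, φ⟩, ⟨r, hr⟩⟩ hne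
    rw [if_neg]
    intro e
    obtain ⟨e1, rfl⟩ := append_inj' e (hr.trans hr1.symm)
    obtain ⟨rfl, -⟩ := append_inj e1 (hl.trans hl1.symm)
    exact hne φ rfl

end Balanced

section PlanarBalanced

open BiLabeledGraph

theorem isModel_edge {J : Type*} (R : J → J → Prop) : IsModel edge R
    (S := {p : J × J // R p.1 p.2 ∧ R p.2 p.1}) (fun p => [p.1.1]) (fun p => [p.1.2]) := by
  refine ⟨⟨fun φ => ⟨(φ.1 false, φ.1 true), φ.2 _ _ Bool.false_ne_true,
    φ.2 _ _ Bool.false_ne_true.symm⟩, fun p => ⟨fun b => cond b p.1.2 p.1.1, ?_⟩, fun φ => ?_,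
    fun p => rfl⟩, fun φ => ⟨rfl, rfl⟩⟩
  · rintro (_ | _) (_ | _) h
    exacts [absurd rfl h, p.2.1, p.2.2, absurd rfl h]
  · apply sext
    funext b
    cases b <;> rfl

universe w

variable {I : Type w} {Pi : SimpleGraph I} {d : ℕ} {D : Displacement Pi d} {A : Type*} [Ring A]
  {U : Fin d → Fin d → A} {K K' K₀ : 𝓑}

theorem Displacement.groupMat_self (i i' : I) : groupMat U (D.δ i i) (D.δ i' i') = 1 := by
  rw [D.self, D.self, groupMat_one_left, if_pos rfl]

theorem balanced_M_one_zero (hU : FreeRel id U) : Balanced D U (M 1 0) := by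
  classical
  refine balanced_of_lengths fun _ a b a' b' i j hi hj => ?_
  obtain ⟨v, rfl⟩ := List.length_eq_one_iff.1 hi
  obtain rfl := List.length_eq_zero_iff.1 hj
  have m := isModel_M 1 0 Pi.Adj
  rw [m.finsum fun x y => if x = [v] then D.wMat U a y b a' [] b' else 0,
    m.finsum fun x y => if y = [] then D.wMat U a [v] b a' x b' else 0,
    finsum_eq_single _ v fun c hc => by simp [hc]]
  simpa [Displacement.wMat] using D.groupMat_insert hU a b a' b' v

theorem balanced_M_one_two : Balanced D U (M 1 2) := by
  classical
  refine balanced_of_lengths fun _ a b a' b' i j hi hj => ?_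
  obtain ⟨v, rfl⟩ := List.length_eq_one_iff.1 hi
  obtain ⟨c₁, c₂, rfl⟩ := List.length_eq_two.1 hj
  have m := isModel_M 1 2 Pi.Adj
  rw [m.finsum fun x y => if x = [v] then D.wMat U a y b a' [c₁, c₂] b' else 0,
    m.finsum fun x y => if y = [c₁, c₂] then D.wMat U a [v] b a' x b' else 0,
    finsum_eq_single _ v fun c hc => by grind]
  by_cases h : c₁ = c₂
  · subst h
    rw [finsum_eq_single _ c₁ fun c hc => by simp [replicate_succ, hc]]
    simp [Displacement.wMat, replicate_succ, D.groupMat_self]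
  · rw [finsum_congr (g := fun _ => (0 : A)) fun c => ?_, finsum_zero]
    · simp [Displacement.wMat, replicate_succ, D.self, groupMat_one_left, D.eq_one_iff, h]
    · grind

theorem Displacement.adj_iff_length {i j : I} : Pi.Adj i j ↔ (redWord d (D.δ i j)).length = 1 := by
  rw [D.adj]
  constructor
  · rintro ⟨s, hs⟩; rw [hs, redWord_gen]; rfl
  · intro h
    obtain ⟨s, hs⟩ := List.length_eq_one_iff.1 h
    refine ⟨s, redWord_injective d ?_⟩
    rw [hs, redWord_gen]

theorem Displacement.adj_iff_of_ne_zero {i j i' j' : I}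
    (h : groupMat U (D.δ i j) (D.δ i' j') ≠ 0) : Pi.Adj i j ↔ Pi.Adj i' j' := by
  rw [D.adj_iff_length, D.adj_iff_length]
  by_contra h'
  refine h (groupMat_of_length fun e => h' ?_)
  rw [e]

theorem balanced_edge [Pi.LocallyFinite] (hU : FreeRel id U) : Balanced D U edge := by
  classical
  refine balanced_of_lengths fun _ a b a' b' i j hi hj => ?_
  obtain ⟨v, rfl⟩ := List.length_eq_one_iff.1 hi
  obtain ⟨w, rfl⟩ := List.length_eq_one_iff.1 hj
  have m := isModel_edge Pi.Adj
  rw [m.finsum fun x y => if x = [v] then D.wMat U a y b a' [w] b' else 0,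
    m.finsum fun x y => if y = [w] then D.wMat U a [v] b a' x b' else 0,
    finsum_subtype (fun p : I × I => Pi.Adj p.1 p.2 ∧ Pi.Adj p.2 p.1)
      (fun p => if [p.1] = [v] then D.wMat U a [p.2] b a' [w] b' else 0),
    finsum_subtype (fun p : I × I => Pi.Adj p.1 p.2 ∧ Pi.Adj p.2 p.1)
      (fun p => if [p.2] = [w] then D.wMat U a [v] b a' [p.1] b' else 0),
    finsum_of_injective (g := fun c => (v, c)) (fun _ _ h => congrArg Prod.snd h),
    finsum_of_injective (g := fun c => (c, w)) (fun _ _ h => congrArg Prod.fst h)]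
  · let f : I → I → A := fun c k => if Pi.Adj v c ∧ Pi.Adj k w then
      groupMat U (D.δ a v) (D.δ a' k) * groupMat U (D.δ v c) (D.δ k w) *
        groupMat U (D.δ c b) (D.δ w b') else 0
    have e1 : ∀ c, (if Pi.Adj v c then
        groupMat U (D.δ a c) (D.δ a' w) * groupMat U (D.δ c b) (D.δ w b') else 0) =
        ∑ᶠ k, f c k := by
      intro c
      by_cases h : Pi.Adj v c
      · rw [if_pos h, D.groupMat_insert hU a c a' w v, finsum_mul']
        · refine finsum_congr fun k => ?_
          simp only [f, h, true_and]
          split_ifs with h'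
          · rfl
          · by_cases h0 : groupMat U (D.δ v c) (D.δ k w) = 0
            · simp [h0]
            · exact absurd ((D.adj_iff_of_ne_zero h0).1 h) h'
        · exact (D.finite_insert (U := U) a a' v).subset fun k hk => left_ne_zero_of_mul hk
      · simp [f, h]
    have e2 : ∀ k, (if Pi.Adj k w then
        groupMat U (D.δ a v) (D.δ a' k) * groupMat U (D.δ v b) (D.δ k b') else 0) =
        ∑ᶠ c, f c k := by
      intro k
      by_cases h : Pi.Adj k w
      · rw [if_pos h, D.groupMat_insert_right hU v b k b' w, mul_finsum']
        · refine finsum_congr fun c => ?_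
          simp only [f, h, and_true, ← mul_assoc]
          split_ifs with h'
          · rfl
          · by_cases h0 : groupMat U (D.δ v c) (D.δ k w) = 0
            · simp [h0]
            · exact absurd ((D.adj_iff_of_ne_zero h0).2 h) h'
        · exact (D.finite_insert (U := fun s t => U t s) k v w).subset fun c hc => by
            simp only [mem_ofPred_eq, groupMat_swap (U := U)]
            exact left_ne_zero_of_mul hc
      · simp [f, h]
    have e3 := (finsum_congr e1).trans ((finsum_finsum_comm ?_).trans (finsum_congr e2).symm)
    · simpa [Displacement.wMat, Pi.adj_comm v, Pi.adj_comm w] using e3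
    · refine ((toFinite (Pi.neighborSet v)).prod
        (D.finite_insert (U := U) a a' v)).subset fun p hp => ?_
      simp only [mem_ofPred_eq, f, ne_eq, ite_eq_right_iff, not_forall] at hp
      exact ⟨hp.1.1, left_ne_zero_of_mul (left_ne_zero_of_mul hp.2)⟩
  · rintro ⟨x, y⟩ h; grind
  · rintro ⟨x, y⟩ h; grind

theorem balanced_comp_padded [Pi.LocallyFinite] {p q : ℕ} (h0 : K₀.y.length = p + K.x.length + q)
    (hK₀ : Balanced D U K₀) (hK : Balanced D U K)
    (hf : ∀ j, {φ : Homs K Pi.Adj | φ.ys = j}.Finite) : Balanced D U (K₀.comp (padded p K q)) := by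
  have hl : K₀.y.length = (padded p K q).x.length := by rw [padded_x_length, h0]
  refine Balanced.comp hl hK₀ (hK.padded p q) fun hA a b a' b' i j => ?_
  have hfin : {ψ : Homs (padded p K q) Pi.Adj | ψ.ys = j}.Finite := by
    obtain ⟨e, he⟩ := (isModel K Pi.Adj).padded p q
    by_cases hne : ∃ ψ : Homs (padded p K q) Pi.Adj, ψ.ys = j
    · obtain ⟨ψ, hψ⟩ := hne
      refine ((hf (e ψ).1.2.ys).image fun φ => e.symm (((e ψ).1.1, φ), (e ψ).2)).subset ?_
      intro χ hχ
      have h1 := ((he ψ).2.trans hψ).trans ((he χ).2.trans hχ).symm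
      obtain ⟨h2, h3⟩ := append_inj' h1 ((e ψ).2.2.trans (e χ).2.2.symm)
      obtain ⟨h4, h5⟩ := append_inj h2 ((e ψ).1.1.2.trans (e χ).1.1.2.symm)
      grind
    · grind
  refine (hfin.biUnion fun ψ _ => (Balanced.finite_left (D := D) (U := U)
    (hA.of_comp hl).1 a b a' b' i ψ.xs).image fun φ => (φ, ψ)).subset ?_
  rintro ⟨φ, ψ⟩ ⟨h1, h2, h3⟩
  exact Set.mem_biUnion h2 ⟨φ, ⟨h1, h3⟩, rfl⟩

theorem take_drop_map {J : Type*} {R : J → J → Prop} {φ : Homs K R} {l₁ l₂ : List J} {c : J}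
    {p : ℕ} (h : φ.ys = l₁ ++ c :: l₂) (hp : l₁.length = p) :
    (K.y.take p).map φ.1 = l₁ ∧ (K.y.drop (p + 1)).map φ.1 = l₂ := by
  rw [map_take, map_drop]
  change φ.ys.take p = l₁ ∧ φ.ys.drop (p + 1) = l₂
  rw [h, take_left' hp, ← List.drop_drop, drop_left' hp]
  exact ⟨rfl, rfl⟩

theorem balanced_comp_padded_M_one_zero [Pi.LocallyFinite] (hU : FreeRel id U) {p q : ℕ}
    (h0 : K₀.y.length = p + 1 + q) (hK₀ : Balanced D U K₀) :
    Balanced D U (K₀.comp (padded p (M 1 0) q)) := by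
  have hl : K₀.y.length = (padded p (M 1 0) q).x.length := by rw [padded_x_length, h0]; rfl
  refine Balanced.comp hl hK₀ ((balanced_M_one_zero hU).padded p q) fun hA a b a' b' i j => ?_
  have hy := (isModel K₀ Pi.Adj).length_y
  have hy' := (isModel K₀ 𝓔).length_y
  have hA' := ((isModel K₀ Eq).comp hl ((isModel_M 1 0 Eq).padded p q)).anchored_iff.1 hA
  have hfin : {φ : Homs K₀ Pi.Adj | φ.xs = i ∧ ∃ ψ : Homs (padded p (M 1 0) q) Pi.Adj,
      ψ.ys = j ∧ D.wMat U a φ.ys b a' ψ.xs b' ≠ 0}.Finite := by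
    refine finite_homs (K₀.x ++ (K₀.y.take p ++ K₀.y.drop (p + 1))) (fun φ ψ hφ hψ => ?_) _
      (((Set.finite_singleton i).image2 (· ++ ·)
        ((D.finite_chain (U := U) a (a' :: j.take p)).image2 (· ++ ·)
          (D.finite_chain_right (U := U) b (j.drop p ++ [b'])))).subset ?_)
    · have key : ∀ φ : Homs K₀ 𝓔,
          (∀ v ∈ K₀.x ++ (K₀.y.take p ++ K₀.y.drop (p + 1)), ¬ φ.1 v) →
          ∃ z : {z : Homs K₀ 𝓔 × (({l : List Prop // l.length = p} × Prop) ×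
            {l : List Prop // l.length = q}) //
              z.1.ys = (z.2.1.1.1 ++ replicate 1 z.2.1.2) ++ z.2.2.1},
            z.1.1 = φ ∧ ∀ P ∈ z.1.1.xs ++ ((z.1.2.1.1.1 ++ replicate 0 z.1.2.1.2) ++
              z.1.2.2.1), ¬ P := by
        intro φ hφ
        obtain ⟨l₁, c, l₂, h1, h2, h3⟩ := exists_eq_append_cons ((hy' φ).trans h0)
        refine ⟨⟨(φ, (⟨l₁, h2⟩, c), ⟨l₂, h3⟩), by simpa using h1⟩, rfl, ?_⟩
        simp only [List.replicate_zero, append_nil]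
        rw [← (take_drop_map h1 h2).1, ← (take_drop_map h1 h2).2, Homs.xs, ← map_append, ← map_append]
        exact List.forall_mem_map.2 hφ
      obtain ⟨z, rfl, hz⟩ := key φ hφ
      obtain ⟨z', rfl, hz'⟩ := key ψ hψ
      rw [hA' z z' hz hz']
    · rintro _ ⟨φ, ⟨h1, ψ, h2, h3⟩, rfl⟩
      obtain ⟨e, he⟩ := (isModel_M 1 0 Pi.Adj).padded p q
      obtain ⟨l₁, c, l₂, h4, h5, h6⟩ := exists_eq_append_cons ((hy φ).trans h0)
      have h7 := (he ψ).1
      have h8 := (he ψ).2.trans h2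
      generalize e ψ = z at h7 h8
      obtain ⟨⟨⟨l, hl⟩, c'⟩, ⟨r, hr⟩⟩ := z
      simp only [List.replicate_zero, append_nil, List.replicate_one] at h7 h8
      have e1 : j.take p = l := by rw [← h8, take_left' hl]
      have e2 : j.drop p = r := by rw [← h8, drop_left' hl]
      have h9 : D.wMat U a φ.ys b a' ψ.xs b' = D.chainMat U ((a :: l₁) ++ [c]) ((a' :: l) ++ [c']) *
          D.chainMat U (c :: (l₂ ++ [b])) (c' :: (r ++ [b'])) := by
        rw [← D.chainMat_append _ _ _ _ (by simp [h5, hl]), Displacement.wMat, h4, ← h7]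
        simp
      rw [h9] at h3
      refine ⟨i, rfl, l₁ ++ l₂, ⟨l₁, ?_, l₂, ?_, rfl⟩, ?_⟩
      · have := left_ne_zero_of_mul h3
        rw [mem_ofPred_eq, e1]
        obtain ⟨s, a₁, hs⟩ := (eq_nil_or_concat' (a :: l₁)).resolve_left (by simp)
        obtain ⟨s', a₁', hs'⟩ := (eq_nil_or_concat' (a' :: l)).resolve_left (by simp)
        have hss : s.length = s'.length := by
          have h1 := congrArg List.length hs
          have h2 := congrArg List.length hs'
          simp at h1 h2; omega
        rw [hs, hs', append_assoc, append_assoc] at this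
        erw [D.chainMat_append _ _ _ _ hss] at this
        grind
      · have := right_ne_zero_of_mul h3
        rw [mem_ofPred_eq, e2]
        obtain ⟨b₁, t, ht⟩ := exists_cons_of_ne_nil (l := l₂ ++ [b]) (by simp)
        obtain ⟨b₁', t', ht'⟩ := exists_cons_of_ne_nil (l := r ++ [b']) (by simp)
        rw [ht, ht', D.chainMat_cons_cons] at this
        grind
      · simp only [map_append, take_drop_map h4 h5]
        rw [← h1]; rfl
  refine (hfin.biUnion fun φ _ => (Balanced.finite_right (D := D) (U := U)
    (hA.of_comp hl).2 a b a' b' φ.ys j).image fun ψ => (φ, ψ)).subset ?_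
  rintro ⟨φ, ψ⟩ ⟨h1, h2, h3⟩
  exact Set.mem_biUnion (show φ ∈ _ from ⟨h1, ψ, h2, h3⟩) ⟨ψ, ⟨h2, h3⟩, rfl⟩

variable (D U) in
def PadBalanced (K : 𝓑) : Prop := ∀ (K₀ : 𝓑) (p q : ℕ),
  K₀.y.length = p + K.x.length + q → Balanced D U K₀ → Balanced D U (K₀.comp (padded p K q))

theorem PadBalanced.of_homEquiv (h : HomEquiv K K' Pi.Adj)
    (h' : HomEquiv K K' 𝓔) (hK : PadBalanced D U K) :
    PadBalanced D U K' := by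
  intro K₀ p q h0 hK₀
  have hl := (h'.lengths (falseHom K)).1
  rw [← hl] at h0
  exact (hK K₀ p q h0 hK₀).of_homEquiv (h.comp_padded hl h0) (h'.comp_padded hl h0)

theorem PadBalanced.comp (h : K.y.length = K'.x.length) (hK : PadBalanced D U K)
    (hK' : PadBalanced D U K') : PadBalanced D U (K.comp K') := by
  intro K₀ p q h0 hK₀
  rw [comp_x_length] at h0
  exact (hK' _ p q (by rw [comp_y_length, padded_y_length, h]) (hK K₀ p q h0 hK₀)).of_homEquiv
    (homEquiv_comp_padded_comp h0 h _) (homEquiv_comp_padded_comp h0 h _)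

theorem PadBalanced.tensor (hK : PadBalanced D U K) (hK' : PadBalanced D U K') :
    PadBalanced D U (K.tensor K') := by
  intro K₀ p q h0 hK₀
  rw [tensor_x_length] at h0
  exact (hK' _ (p + K.y.length) q (by rw [comp_y_length, padded_y_length]; omega)
    (hK K₀ p (K'.x.length + q) (by omega) hK₀)).of_homEquiv
    (homEquiv_comp_padded_tensor h0 _) (homEquiv_comp_padded_tensor h0 _)

theorem isIso_transpose (h : K.IsIso K') : K.transpose.IsIso K'.transpose := by
  obtain ⟨e, h1, h2, h3⟩ := h
  exact ⟨e, h1, h3, h2⟩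

theorem FreeRel.swap_id (hU : FreeRel id U) : FreeRel id fun s t => U t s := hU.swap

theorem isIso_M_comp {n k m : ℕ} (hk : k ≠ 0) : ((M n k).comp (M k m)).IsIso (M n m) := by
  obtain ⟨k, rfl⟩ := Nat.exists_eq_succ_of_ne_zero hk
  have hg : cl (M n (k + 1)) (M (k + 1) m) () = cr _ _ () := Quot.sound ⟨((), ()), by
    change ((), ()) ∈ (replicate (k + 1) ()).zip (replicate (k + 1) ())
    simp [replicate_succ], rfl, rfl⟩
  refine ⟨⟨fun _ => (), fun _ => cl _ _ (), fun v => ?_, fun _ => rfl⟩, fun v w => ?_, ?_, ?_⟩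
  · rcases comp_cases v with ⟨w, rfl⟩ | ⟨w, rfl⟩
    · rfl
    · exact hg
  · refine ⟨?_, fun h => h.elim⟩; rintro ⟨_, _, ⟨h⟩ | ⟨h⟩, -, -⟩ <;> exact h
  · exact (comp_x_map _ _ _).trans (map_const' .. |>.trans (by simp [M]))
  · exact (comp_y_map _ _ _).trans (map_const' .. |>.trans (by simp [M]))

theorem padBalanced_of_planar [Pi.LocallyFinite] (hU : FreeRel id U) (hK : K ∈ planarGraphs) :
    PadBalanced D U K := by
  have hf : ∀ (n m : ℕ) (j : List I), {φ : Homs (M n (m + 1)) Pi.Adj | φ.ys = j}.Finite := by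
    intro n m j
    refine Set.Subsingleton.finite fun φ hφ ψ hψ => ?_
    have h1 := hφ.trans hψ.symm
    have h2 : φ.1 () = ψ.1 () := by
      have := congrArg List.head? h1
      simpa [Homs.ys, M, replicate_succ] using this
    exact sext (funext fun _ => h2)
  have hfe : ∀ j, {φ : Homs edge Pi.Adj | φ.ys = j}.Finite := by
    intro j
    obtain ⟨e, he⟩ := isModel_edge Pi.Adj
    by_cases hc : ∃ c, j = [c]
    · obtain ⟨c, rfl⟩ := hc
      refine ((toFinite (Pi.neighborSet c)).image fun v => (v, c)).preimage
        (f := fun φ => (e φ).1) (fun φ _ ψ _ h => e.injective (sext h)) |>.subset ?_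
      intro φ hφ
      have h1 : (e φ).1.2 = c := List.singleton_injective ((he φ).2.trans hφ)
      exact ⟨(e φ).1.1, h1 ▸ (e φ).2.2, by rw [← h1]⟩
    · grind
  have of {K : 𝓑} (hK : Balanced D U K)
      (hf : ∀ j, {φ : Homs K Pi.Adj | φ.ys = j}.Finite) : PadBalanced D U K :=
    fun K₀ p q h0 hK₀ => balanced_comp_padded h0 hK₀ hK hf
  have one : PadBalanced D U (M 1 1) := fun K₀ p q h0 hK₀ => hK₀.of_homEquiv
    (homEquiv_comp_padded_one h0 _) (homEquiv_comp_padded_one h0 _)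
  have cap : PadBalanced D U (M 1 0) := fun K₀ p q h0 => balanced_comp_padded_M_one_zero hU h0
  have cap' : PadBalanced D U (M 0 1) := of (balanced_of_swap (balanced_M_one_zero hU.swap_id)) (hf 0 0)
  have fork : PadBalanced D U (M 1 2) := of balanced_M_one_two (hf 1 1)
  have fork' : PadBalanced D U (M 2 1) := of (balanced_of_swap balanced_M_one_two) (hf 2 0)
  have edge' : PadBalanced D U edge := of (balanced_edge hU) hfe
  have edge'' : PadBalanced D U edge.transpose := by
    have : edge.IsIso edge.transpose := ⟨⟨not, not, Bool.not_not, Bool.not_not⟩, fun v w => by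
      exact (not_congr (Bool.not_inj_iff (x := v) (y := w))).symm, rfl, rfl⟩
    exact edge'.of_homEquiv (homEquiv_of_isIso this _) (homEquiv_of_isIso this _)
  have iso : ∀ {K K' : 𝓑}, K.IsIso K' → PadBalanced D U K → PadBalanced D U K' :=
    fun h hK => hK.of_homEquiv (homEquiv_of_isIso h _) (homEquiv_of_isIso h _)
  refine (hK {K | PadBalanced D U K ∧ PadBalanced D U K.transpose} ⟨⟨?_, ?_, ?_, ?_, ?_, ?_⟩,
    ⟨cap, cap'⟩, ⟨fork, fork'⟩, edge', edge''⟩).1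
  · exact fun K K' h e => ⟨iso e h.1, iso (isIso_transpose e) h.2⟩
  · exact ⟨one, one⟩
  · exact ⟨iso (isIso_M_comp one_ne_zero) (fork'.comp rfl cap),
      iso (isIso_M_comp one_ne_zero) (cap'.comp rfl fork)⟩
  · exact fun K K' h h' e => ⟨h.1.comp e h'.1, (h'.2.comp e.symm h.2).of_homEquiv
      (homEquiv_transpose_comp e _) (homEquiv_transpose_comp e _)⟩
  exacts [fun K K' h h' => ⟨h.1.tensor h'.1, h.2.tensor h'.2⟩, fun K h => ⟨h.2, h.1⟩]

theorem balanced_strands (n : ℕ) : Balanced D U (strands n) := by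
  classical
  refine balanced_of_lengths fun _ a b a' b' i j hi hj => ?_
  have hi' : i.length = n := hi.trans (by simp [strands])
  have hj' : j.length = n := hj.trans (by simp [strands])
  have m := isModel_strands n Pi.Adj
  rw [m.finsum fun x y => if x = i then D.wMat U a y b a' j b' else 0,
    m.finsum fun x y => if y = j then D.wMat U a i b a' x b' else 0,
    finsum_eq_single _ ⟨i, hi'⟩ fun l hl => if_neg fun e => hl (sext e),
    finsum_eq_single _ ⟨j, hj'⟩ fun l hl => if_neg fun e => hl (sext e), if_pos rfl,
    if_pos rfl]

theorem balanced_of_planar [Pi.LocallyFinite] (hU : FreeRel id U) (hK : K ∈ planarGraphs) :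
    Balanced D U K :=
  (padBalanced_of_planar hU hK (strands K.x.length) 0 0 (by simp [strands])
    (balanced_strands _)).of_homEquiv (homEquiv_strands_comp rfl _) (homEquiv_strands_comp rfl _)

theorem Displacement.wMat_ends {a b a' b' : I} {l l' : List I} (h1 : l.head? = some a)
    (h2 : l.getLast? = some b) (h3 : l'.head? = some a') (h4 : l'.getLast? = some b') :
    D.wMat U a l b a' l' b' = D.chainMat U l l' := by
  by_cases hl : l.length = l'.length
  · obtain ⟨t, rfl⟩ := List.head?_eq_some_iff.1 h1
    obtain ⟨t', rfl⟩ := List.head?_eq_some_iff.1 h3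
    obtain ⟨s, hs⟩ := List.getLast?_eq_some_iff.1 h2
    obtain ⟨s', hs'⟩ := List.getLast?_eq_some_iff.1 h4
    rw [Displacement.wMat, cons_append, cons_append, D.chainMat_cons_cons,
      D.groupMat_self, one_mul, ← cons_append, ← cons_append, hs, hs', append_assoc,
      append_assoc]
    rw [hs, hs', length_append, length_append] at hl
    erw [D.chainMat_append _ _ _ _ (Nat.add_right_cancel hl)]
    change _ * D.chainMat U [b, b] [b', b'] = _
    rw [D.chainMat_cons_cons, D.groupMat_self, one_mul, D.chainMat_singleton, mul_one]
  · rw [D.wMat_of_length hl]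
    cases l with
    | nil => simp at h1
    | cons c t => cases l' with
      | nil => simp at h3
      | cons c' t' => rw [D.chainMat_of_length (by simpa using hl)]

open Classical in
theorem sum_chainMat [Pi.LocallyFinite] (hU : FreeRel id U) {n m : ℕ} (hK : IsL n m K)
    {i j : List I} (hi : i.length = n + 1) (hj : j.length = m + 1) :
    ∑ᶠ φ : Homs K Pi.Adj, (if φ.xs = i then D.chainMat U φ.ys j else 0) =
      ∑ᶠ φ : Homs K Pi.Adj, if φ.ys = j then D.chainMat U i φ.xs else 0 := by
  have hA : Anchored K := by
    have key : ∀ φ : Homs K 𝓔, (∀ P ∈ φ.xs ++ φ.ys, ¬ P) → ∀ v, ¬ φ.1 v := by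
      intro φ hφ v hv
      obtain ⟨v₀, xs, hx⟩ := List.exists_cons_of_length_eq_add_one hK.length_x
      refine hφ (φ.1 v₀) ?_ (IsConnected_const hK.connected φ.1
        (fun a b hab => by rw [φ.2 a b hab]) v v₀ hv)
      simp [Homs.xs, hx]
    intro φ ψ hφ hψ
    apply sext
    funext v
    grind
  obtain ⟨a, i, rfl⟩ := List.exists_cons_of_length_eq_add_one hi
  obtain ⟨a', j, rfl⟩ := List.exists_cons_of_length_eq_add_one hj
  obtain ⟨b, hb⟩ := Option.isSome_iff_exists.1 (show (a :: i).getLast?.isSome by simp)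
  obtain ⟨b', hb'⟩ := Option.isSome_iff_exists.1 (show (a' :: j).getLast?.isSome by simp)
  have hh : ∀ φ : Homs K Pi.Adj, φ.xs.head? = φ.ys.head? ∧ φ.xs.getLast? = φ.ys.getLast? := by
    intro φ
    simp only [Homs.xs, Homs.ys, List.head?_map, List.getLast?_map, hK.head, hK.last, and_self]
  have := balanced_of_planar (D := D) hU hK.planar hA a b a' b' (a :: i) (a' :: j)
  refine Eq.trans (finsum_congr fun φ => ?_) (this.trans (finsum_congr fun φ => ?_))
  · by_cases h : φ.xs = a :: i
    · rw [if_pos h, if_pos h, D.wMat_ends _ _ rfl hb']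
      · rw [← (hh φ).1, h]; rfl
      · rw [← (hh φ).2, h, hb]
    · rw [if_neg h, if_neg h]
  · by_cases h : φ.ys = a' :: j
    · rw [if_pos h, if_pos h, D.wMat_ends rfl hb]
      · rw [(hh φ).1, h]; rfl
      · rw [(hh φ).2, h, hb']
    · rw [if_neg h, if_neg h]

end PlanarBalanced

section Based

abbrev LinOp (α β : Type*) : Type _ := (α →₀ ℂ) →ₗ[ℂ] (β →₀ ℂ)

abbrev ev {α : Type*} (a : α) : α →₀ ℂ := single a 1

variable {α β γ α' β' : Type*} {A : Type*} [Ring A] [StarRing A] [Algebra ℂ A] [StarModule ℂ A]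

@[elab_as_elim]
theorem ev_induction {p : (α →₀ ℂ) → Prop} (x : α →₀ ℂ) (zero : p 0)
    (add : ∀ x y, p x → p y → p (x + y)) (single : ∀ a (c : ℂ), p (c • ev a)) : p x :=
  induction_linear x zero add fun a c => by simpa using single a c

theorem linOp_ext {M : Type*} [AddCommMonoid M] [Module ℂ M] {f g : (α →₀ ℂ) →ₗ[ℂ] M}
    (h : ∀ a, f (ev a) = g (ev a)) : f = g := by apply lhom_ext'; intro l; apply ext_ring; exact h l

/-- The sesquilinear map with values in `A` given by a matrix over `A`. -/
def form (V : α → α → A) (x y : α →₀ ℂ) : A :=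
  star (linearCombination ℂ (fun k => star (linearCombination ℂ (V k) y)) x)

variable {V : α → α → A} {W : β → β → A} {X : γ → γ → A} {V' : α' → α' → A} {W' : β' → β' → A}

theorem form_ev_left (a : α) (y : α →₀ ℂ) : form V (ev a) y = linearCombination ℂ (V a) y := by
  simp [form]

@[simp] theorem form_ev (a b : α) : form V (ev a) (ev b) = V a b := by simp [form_ev_left]

theorem form_add_left (x x' y : α →₀ ℂ) : form V (x + x') y = form V x y + form V x' y := by
  simp [form]

theorem form_smul_left (c : ℂ) (x y : α →₀ ℂ) : form V (c • x) y = star c • form V x y := by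
  simp [form]

@[simp] theorem form_zero_left (y : α →₀ ℂ) : form V 0 y = 0 := by simp [form]

theorem form_add_right (x y y' : α →₀ ℂ) : form V x (y + y') = form V x y + form V x y' := by
  induction x using ev_induction with
  | zero => simp
  | add x x' h h' => rw [form_add_left, h, h', form_add_left, form_add_left]; abel
  | single a c =>
    simp only [form_smul_left, form_ev_left, map_add, smul_add]

theorem form_smul_right (c : ℂ) (x y : α →₀ ℂ) : form V x (c • y) = c • form V x y := by
  induction x using induction_linear with
  | zero => simp
  | add x x' h h' => rw [form_add_left, h, h', form_add_left, smul_add]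
  | single a b =>
    rw [← mul_one b, ← smul_eq_mul, ← smul_single]
    simp only [form_smul_left, form_ev_left, map_smul, smul_comm c]

@[simp] theorem form_zero_right (x : α →₀ ℂ) : form V x 0 = 0 := by
  simpa using form_smul_right (V := V) 0 x 0

theorem form_ext {S : LinOp α β} {T : LinOp β α}
    (h : ∀ a b, form V (T (ev b)) (ev a) = form W (ev b) (S (ev a))) (x : β →₀ ℂ) (y : α →₀ ℂ) :
    form V (T x) y = form W x (S y) := by
  induction x using ev_induction with
  | zero => simp
  | add x x' h h' => rw [map_add, form_add_left, form_add_left, h, h']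
  | single b c =>
    rw [map_smul, form_smul_left, form_smul_left]
    congr 1
    induction y using ev_induction with
    | zero => simp
    | add x x' h h' => rw [map_add, form_add_right, form_add_right, h, h']
    | single a c =>
      rw [map_smul, form_smul_right, form_smul_right, h]

open Classical in
def idMat (a b : α) : ℂ := if a = b then 1 else 0

theorem form_idMat_left (a : α) (y : α →₀ ℂ) : form idMat (ev a) y = y a := by
  classical
  rw [form_ev_left, linearCombination_apply]
  simp [idMat]
  exact fun h => h.symm

theorem form_idMat_symm (x y : α →₀ ℂ) : form idMat x y = star (form idMat y x) := by
  have h1 : ∀ (a : α) x, form idMat x (ev a) = star (x a) := by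
    intro a x
    induction x using ev_induction with
    | zero => simp
    | add x x' h h' => rw [form_add_left, h, h', fadd_apply, star_add]
    | single b c =>
      rw [form_smul_left]
      by_cases h : b = a
      · subst h; simp [idMat]
      · simp [idMat, h]
  induction y using ev_induction with
  | zero => simp
  | add x x' h h' => rw [form_add_right, h, h', form_add_left, star_add]
  | single b c =>
    rw [form_smul_right, form_smul_left, h1, form_idMat_left]
    simp

/-- The linear map `S` and its adjoint `T` intertwine the matrices `V` and `W`. -/
structure Eqv (V : α → α → A) (W : β → β → A) (S : LinOp α β) (T : LinOp β α) : Prop where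
  adj : ∀ x y, form idMat (T x) y = form idMat x (S y)
  left : ∀ x y, form V (T x) y = form W x (S y)
  right : ∀ x y, form W (S x) y = form V x (T y)

namespace Eqv

variable {S S₁ : LinOp α β} {T T₁ : LinOp β α} {S' : LinOp β γ} {T' : LinOp γ β}

theorem of_basis (h1 : ∀ a b, T (ev b) a = star (S (ev a) b))
    (h2 : ∀ a b, form V (T (ev b)) (ev a) = form W (ev b) (S (ev a)))
    (h3 : ∀ b a, form W (S (ev a)) (ev b) = form V (ev a) (T (ev b))) : Eqv V W S T :=
  ⟨form_ext fun a b => by rw [form_idMat_symm, form_idMat_left, form_idMat_left, h1, star_star],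
    form_ext h2, form_ext h3⟩

theorem adj_apply (h : Eqv V W S T) (a : α) (b : β) : T (ev b) a = star (S (ev a) b) := by
  rw [← form_idMat_left b, ← h.adj, form_idMat_symm, form_idMat_left, star_star]

theorem symm (h : Eqv V W S T) : Eqv W V T S :=
  ⟨fun x y => by rw [form_idMat_symm, ← h.adj, form_idMat_symm, star_star], h.right, h.left⟩

theorem comp (h' : Eqv W X S' T') (h : Eqv V W S T) : Eqv V X (S' ∘ₗ S) (T ∘ₗ T') :=
  ⟨fun x y => by simp [h.adj, h'.adj], fun x y => by simp [h.left, h'.left],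
    fun x y => by simp [h.right, h'.right]⟩

theorem zero : Eqv V W 0 0 := ⟨fun x y => by simp, fun x y => by simp, fun x y => by simp⟩

theorem add (h : Eqv V W S T) (h₁ : Eqv V W S₁ T₁) : Eqv V W (S + S₁) (T + T₁) :=
  ⟨fun x y => by simp [h.adj, h₁.adj, form_add_left, form_add_right],
    fun x y => by simp [h.left, h₁.left, form_add_left, form_add_right],
    fun x y => by simp [h.right, h₁.right, form_add_left, form_add_right]⟩

theorem sum {ι : Type*} (s : Finset ι) {S : ι → LinOp α β} {T : ι → LinOp β α}
    (h : ∀ i, Eqv V W (S i) (T i)) : Eqv V W (∑ i ∈ s, S i) (∑ i ∈ s, T i) := by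
  classical
  induction s using Finset.induction_on with
  | empty => exact zero
  | insert a s ha ih => rw [sum_insert ha, sum_insert ha]; exact (h a).add ih

theorem unique (h : Eqv V W S T) (h' : Eqv V W S T₁) : T = T₁ :=
  linOp_ext fun b => fext fun a => by rw [h.adj_apply, h'.adj_apply]

theorem of_injective {f : α → β} (hf : Inj f) (h : ∀ a a', V a a' = W (f a) (f a'))
    (h1 : ∀ a b, b ∉ Set.range f → W (f a) b = 0) (h2 : ∀ a b, b ∉ Set.range f → W b (f a) = 0) :
    Eqv V W (𝓜 f) (lcomapDomain f hf) := by
  classical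
  have hT : ∀ b, b ∉ Set.range f → (lcomapDomain f hf : LinOp β α) (ev b) = 0 := by
    intro b hb
    ext a
    change single b (1 : ℂ) (f a) = 0
    exact single_eq_of_ne fun e => hb ⟨a, e⟩
  have hT' : ∀ a, (lcomapDomain f hf : LinOp β α) (ev (f a)) = ev a := by
    intro a
    ext a'
    simp [single_apply, hf.eq_iff]
  refine of_basis (fun a b => ?_) (fun a b => ?_) fun b a => ?_
  · change single b (1 : ℂ) (f a) = _
    simp [single_apply, eq_comm]
  all_goals
    rw [lmapDomain_apply, mapDomain_single]
    by_cases hb : b ∈ Set.range f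
    · obtain ⟨a', rfl⟩ := hb; rw [hT', form_ev, form_ev, h]
    · rw [hT b hb]; simp [h1 _ _ hb, h2 _ _ hb]

end Eqv

def tens : (α →₀ ℂ) →ₗ[ℂ] (β →₀ ℂ) →ₗ[ℂ] (α × β →₀ ℂ) :=
  (TensorProduct.mk ℂ _ _).compr₂ (finsuppTensorFinsupp' ℂ α β).toLinearMap

theorem tens_apply (x : α →₀ ℂ) (y : β →₀ ℂ) (p : α × β) : tens x y p = x p.1 * y p.2 :=
  finsuppTensorFinsupp'_apply_apply ℂ _ _ x y p.1 p.2

theorem tens_ev (a : α) (b : β) : tens (ev a) (ev b) = ev (a, b) := by simp [tens]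

def tmap (S : LinOp α β) (T : LinOp α' β') : LinOp (α × α') (β × β') :=
  (finsuppTensorFinsupp' ℂ β β').toLinearMap ∘ₗ TensorProduct.map S T ∘ₗ
    (finsuppTensorFinsupp' ℂ α α').symm.toLinearMap

theorem tmap_tens (S : LinOp α β) (T : LinOp α' β') (x : α →₀ ℂ) (y : α' →₀ ℂ) :
    tmap S T (tens x y) = tens (S x) (T y) := by simp [tmap, tens]

theorem tmap_ev (S : LinOp α β) (T : LinOp α' β') (p : α × α') :
    tmap S T (ev p) = tens (S (ev p.1)) (T (ev p.2)) := by rw [← tmap_tens, tens_ev]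

theorem tmap_comp (S : LinOp α β) (T : LinOp α' β') {γ' : Type*} (S' : LinOp β γ)
    (T' : LinOp β' γ') : tmap S' T' ∘ₗ tmap S T = tmap (S' ∘ₗ S) (T' ∘ₗ T) :=
  linOp_ext fun p => by rw [lcomp_apply, tmap_ev, tmap_tens, tmap_ev]; rfl

theorem tmap_id : tmap (lid : LinOp α α) (lid : LinOp β β) = lid :=
  linOp_ext fun p => by rw [tmap_ev]; exact tens_ev _ _

def prodMat (V : α → α → A) (W : β → β → A) (p q : α × β) : A := V p.1 q.1 * W p.2 q.2

theorem form_tens (x x' : α →₀ ℂ) (y y' : β →₀ ℂ) :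
    form (prodMat V W) (tens x y) (tens x' y') = form V x x' * form W y y' := by
  induction x using ev_induction with
  | zero => simp
  | add x₁ x₂ h h' => rw [map_add, ladd_apply, form_add_left, h, h', form_add_left, add_mul]
  | single a c =>
  rw [map_smul, lsmul_apply, form_smul_left, form_smul_left, smul_mul_assoc]
  congr 1
  induction y using ev_induction with
  | zero => simp
  | add x₁ x₂ h h' => rw [map_add, form_add_left, h, h', form_add_left, mul_add]
  | single b c =>
  rw [map_smul, form_smul_left, form_smul_left, mul_smul_comm]
  congr 1
  induction x' using ev_induction with
  | zero => simp
  | add x₁ x₂ h h' =>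
    rw [map_add, ladd_apply, form_add_right, h, h', form_add_right, add_mul]
  | single a' c =>
  rw [map_smul, lsmul_apply, form_smul_right, form_smul_right, smul_mul_assoc]
  congr 1
  induction y' using ev_induction with
  | zero => simp
  | add x₁ x₂ h h' => rw [map_add, form_add_right, h, h', form_add_right, mul_add]
  | single b' c =>
  rw [map_smul, form_smul_right, form_smul_right, mul_smul_comm]
  rw [tens_ev, tens_ev, form_ev, form_ev, form_ev, prodMat]

theorem Eqv.tmap {S : LinOp α β} {T : LinOp β α} {S' : LinOp α' β'} {T' : LinOp β' α'}
    (h : Eqv V W S T) (h' : Eqv V' W' S' T') :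
    Eqv (prodMat V V') (prodMat W W') (tmap S S') (tmap T T') := by
  refine of_basis (fun a b => ?_) (fun a b => ?_) fun b a => ?_
  · rw [tmap_ev, tmap_ev, tens_apply, tens_apply, h.adj_apply, h'.adj_apply, star_mul']
  · rw [tmap_ev, tmap_ev, ← tens_ev a.1, ← tens_ev b.1, form_tens, form_tens, h.left, h'.left]
  · rw [tmap_ev, tmap_ev, ← tens_ev a.1, ← tens_ev b.1, form_tens, form_tens, h.right, h'.right]

def mtx (S : LinOp α β) : Matrix β α ℂ := fun b a => S (ev a) b

def ofMtx [Finite β] (M : Matrix β α ℂ) : LinOp α β :=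
  Finsupp.lift _ ℂ _ fun a => Finsupp.equivFunOnFinite.symm fun b => M b a

@[simp] theorem mtx_ofMtx [Finite β] (M : Matrix β α ℂ) : mtx (ofMtx M) = M := by
  funext b a
  simp [mtx, ofMtx]

theorem mtx_injective : Inj (mtx : LinOp α β → Matrix β α ℂ) := fun _ _ h =>
  linOp_ext fun a => fext fun b => congrFun (congrFun h b) a

theorem mtx_comp [Fintype β] (S : LinOp β γ) (T : LinOp α β) : mtx (S ∘ₗ T) = mtx S * mtx T := by
  funext c a
  change S (T (ev a)) c = _
  have : T (ev a) = ∑ b, T (ev a) b • ev b := by classical ext b; simp [single_apply]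
  rw [this, map_sum, finsetSum_apply]
  exact sum_congr rfl fun b _ => by rw [map_smul, fsmul_apply, mul_comm]; rfl

theorem mtx_id [DecidableEq α] : mtx (lid : LinOp α α) = 1 := by
  funext b a
  simp [mtx, mone_apply, single_apply, eq_comm]

theorem mtx_tmap (S : LinOp α β) (T : LinOp α' β') : mtx (tmap S T) = (mtx S).kronecker (mtx T) := by
  funext b a
  rw [mtx, tmap_ev, tens_apply]; rfl

theorem mtx_lmapDomain {α β : Type} [DecidableEq β] (e : α ≃ β) :
    mtx (𝓜 e) = permMat e := by
  funext b a
  simp [mtx, permMat, mapDomain_single, single_apply, eq_comm]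

theorem Eqv.mtx_conjTranspose {S : LinOp α β} {T : LinOp β α} (h : Eqv V W S T) :
    mtx T = (mtx S)ᴴ := by funext a b; exact h.adj_apply a b

theorem form_ev_right [Fintype α] (x : α →₀ ℂ) (b : α) :
    form V x (ev b) = ∑ a, star (x a) • V a b := by
  rw [form, linearCombination_apply, Finsupp.sum_fintype _ _ (by simp)]
  simp

theorem form_ev_left' [Fintype α] (y : α →₀ ℂ) (a : α) :
    form V (ev a) y = ∑ b, y b • V a b := by
  rw [form_ev_left, linearCombination_apply, Finsupp.sum_fintype _ _ (by simp)]

theorem Eqv.mtx_mem {α β A : Type} [Ring A] [StarRing A] [Algebra ℂ A] [StarModule ℂ A] [Fintype α]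
    [Fintype β] {V : α → α → A} {W : β → β → A} {S : LinOp α β} {T : LinOp β α}
    (h : Eqv V W S T) : mtx S ∈ intertwiners V W := fun b a => by
  have := h.left (ev b) (ev a)
  rw [form_ev_right, form_ev_left'] at this
  refine Eq.trans (sum_congr rfl fun c _ => ?_) this
  rw [h.adj_apply, star_star]; rfl

theorem URep.eqv {A : Type} [Ring A] [StarRing A] [Bialgebra ℂ A] [StarModule ℂ A] {X Y : URep A}
    {M : Matrix Y.ι X.ι ℂ} (hM : M ∈ intertwiners X.U Y.U) :
    Eqv X.U Y.U (ofMtx M) (ofMtx M.conjTranspose) := by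
  have key : ∀ {X Y : URep A} {M : Matrix Y.ι X.ι ℂ}, M ∈ intertwiners X.U Y.U → ∀ a b,
      form X.U (ofMtx M.conjTranspose (ev b)) (ev a) = form Y.U (ev b) (ofMtx M (ev a)) := by
    intro X Y M hM a b
    rw [form_ev_right, form_ev_left']
    simpa [ofMtx] using hM b a
  have hM' : M.conjTranspose ∈ intertwiners Y.U X.U := by
    let u : Matrix X.ι X.ι A := Matrix.of X.U
    let v : Matrix Y.ι Y.ι A := Matrix.of Y.U
    let m : Matrix Y.ι X.ι A := M.map (algebraMap ℂ A)
    have h1 : m * u = v * m := by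
      ext b a
      have := hM b a
      simpa [m, u, v, mmul_apply, Algebra.smul_def, Algebra.commutes] using this
    have hu : u * uᴴ = 1 := by
      ext i j; simpa [u, mmul_apply, mone_apply] using X.unitary_left i j
    have hv : vᴴ * v = 1 := by
      ext i j; simpa [v, mmul_apply, mone_apply] using Y.unitary_right i j
    have h2 : vᴴ * m = m * uᴴ := by
      calc _ = vᴴ * (m * u) * uᴴ := by
            rw [mmul_assoc, mmul_assoc, hu, mmul_one]
        _ = _ := by rw [h1, ← mmul_assoc, hv, Matrix.one_mul]
    have h3 := congrArg Matrix.conjTranspose h2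
    intro a b
    have := congrFun (congrFun h3 a) b
    simpa [m, u, v, mmul_apply, Algebra.smul_def, Algebra.commutes,
      ← algebraMap_star_comm] using this
  refine Eqv.of_basis (fun a b => ?_) (key hM) fun b a => ?_
  · simp [ofMtx]
  · have := key hM' b a; rwa [Matrix.conjTranspose_conjTranspose] at this

end Based

section Bar

open BiLabeledGraph

universe w

variable {I : Type w} {Pi : SimpleGraph I} {d : ℕ} (D : Displacement Pi d)
  {A : Type*} [Ring A] [StarRing A] [Algebra ℂ A] [StarModule ℂ A]

theorem IsL.transpose {n m : ℕ} {K : 𝓑} (hK : IsL n m K) : IsL m n K.transpose where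
  planar := planarGraphs_isGraphCategory.transpose_mem _ hK.planar
  connected := hK.connected
  length_x := hK.length_y
  length_y := hK.length_x
  head := hK.head.symm
  last := hK.last.symm

variable [Pi.LocallyFinite]

open Classical in
theorem form_homMat_right {n m : ℕ} {K : 𝓑} (hK : IsL n m K) (V : List I → List I → A)
    (i j : List I) : form V (bv i) (homMat Pi K (bv j)) =
      ∑ᶠ φ : Homs K Pi.Adj, if φ.ys = j then V i φ.xs else 0 := by
  have := finite_fib Pi hK j
  let e : Fib Pi K j ≃ {φ : Homs K Pi.Adj // φ.ys = j} :=
    ⟨fun φ => ⟨⟨φ.1, φ.2.1⟩, φ.2.2⟩, fun φ => ⟨φ.1.1, φ.1.2, φ.2⟩, fun _ => rfl, fun _ => rfl⟩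
  let f : (𝓥 I) →+ A := ⟨⟨fun y => form V (bv i) y, form_zero_right _⟩, form_add_right _⟩
  rw [homMat_bv]
  refine (f.map_finsum (toFinite _)).trans (Eq.trans ?_
    ((finsum_subtype (fun φ : Homs K Pi.Adj => φ.ys = j) fun φ => V i φ.xs).trans
      (finsum_congr fun φ => by congr)))
  rw [← finsum_comp_equiv e]
  exact finsum_congr fun φ => form_ev _ _

open Classical in
theorem form_homMat_left {n m : ℕ} {K : 𝓑} (hK : IsL n m K) (V : List I → List I → A)
    (i j : List I) : form V (homMat Pi K (bv j)) (bv i) =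
      ∑ᶠ φ : Homs K Pi.Adj, if φ.ys = j then V φ.xs i else 0 := by
  have := finite_fib Pi hK j
  let e : Fib Pi K j ≃ {φ : Homs K Pi.Adj // φ.ys = j} :=
    ⟨fun φ => ⟨⟨φ.1, φ.2.1⟩, φ.2.2⟩, fun φ => ⟨φ.1.1, φ.1.2, φ.2⟩, fun _ => rfl, fun _ => rfl⟩
  let f : (𝓥 I) →+ A := ⟨⟨fun y => form V y (bv i), form_zero_left _⟩,
    fun x y => form_add_left x y _⟩
  rw [homMat_bv]
  refine (f.map_finsum (toFinite _)).trans (Eq.trans ?_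
    ((finsum_subtype (fun φ : Homs K Pi.Adj => φ.ys = j) fun φ => V φ.xs i).trans
      (finsum_congr fun φ => by congr)))
  rw [← finsum_comp_equiv e]
  exact finsum_congr fun φ => form_ev _ _

theorem homMat_transpose_adj {n m : ℕ} {K : 𝓑} (hK : IsL n m K) :
    OpAdj (homMat Pi K) (homMat Pi K.transpose) := fun i j => by
  classical
  rw [← form_idMat_left j, ← form_idMat_left i, ← form_idMat_symm, form_homMat_right hK.transpose,
    form_homMat_left hK]
  refine finsum_congr fun φ => ?_
  change (if Homs.xs (K := K) φ = j then idMat i (Homs.ys (K := K) φ) else 0) = _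
  by_cases h1 : Homs.xs (K := K) φ = j
  · by_cases h2 : Homs.ys (K := K) φ = i
    · rw [if_pos h1, if_pos h2, h1, h2]; simp [idMat]
    · rw [if_pos h1, if_neg h2, idMat, if_neg (Ne.symm h2)]
  · rw [if_neg h1]
    split_ifs
    · rw [idMat, if_neg h1]
    · rfl

/-- The adjoint of an operator in `Mor n m` and the compatibility of both with the matrices of the
quantum symmetries. -/
structure MorAdj (n m : ℕ) (T T' : Op I) : Prop where
  mem : T ∈ Mor Pi n m
  mem' : T' ∈ Mor Pi m n
  adj : OpAdj T T'
  left : ∀ (A : Type) [Ring A] [StarRing A] [Algebra ℂ A] [StarModule ℂ A] (U : Fin d → Fin d → A),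
    FreeRel id U → ∀ i j : List I, i.length = n + 1 → j.length = m + 1 →
      form (D.chainMat U) (T' (bv i)) (bv j) = form (D.chainMat U) (bv i) (T (bv j))
  right : ∀ (A : Type) [Ring A] [StarRing A] [Algebra ℂ A] [StarModule ℂ A] (U : Fin d → Fin d → A),
    FreeRel id U → ∀ i j : List I, i.length = n + 1 → j.length = m + 1 →
      form (D.chainMat U) (T (bv j)) (bv i) = form (D.chainMat U) (bv j) (T' (bv i))

theorem exists_morAdj {n m : ℕ} {T : Op I} (hT : T ∈ Mor Pi n m) : ∃ T', MorAdj D n m T T' := by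
  induction hT using span_induction with
  | mem T h =>
    obtain ⟨K, hK, rfl⟩ := h
    have key : ∀ {n m : ℕ} {K : 𝓑} (_ : IsL n m K) (A : Type) [Ring A] [StarRing A]
        [Algebra ℂ A] [StarModule ℂ A] (U : Fin d → Fin d → A), FreeRel id U → ∀ i j : List I,
        i.length = n + 1 → j.length = m + 1 →
        form (D.chainMat U) (homMat Pi K.transpose (bv i)) (bv j) =
          form (D.chainMat U) (bv i) (homMat Pi K (bv j)) := by
      intro n m K hK A _ _ _ _ U hU i j hi hj
      rw [form_homMat_left hK.transpose, form_homMat_right hK, ← sum_chainMat hU hK hi hj]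
      rfl
    exact ⟨homMat Pi K.transpose, subset_span ⟨_, hK, rfl⟩,
      subset_span ⟨_, hK.transpose, rfl⟩, homMat_transpose_adj hK, key hK,
      fun A _ _ _ _ U hU i j hi hj => key hK.transpose A U hU j i hj hi⟩
  | zero => exact ⟨0, zero_mem _, zero_mem _, OpAdj.zero, fun A _ _ _ _ U hU i j hi hj => by simp,
      fun A _ _ _ _ U hU i j hi hj => by simp⟩
  | add T S _ _ h h' =>
    obtain ⟨T', h⟩ := h
    obtain ⟨S', h'⟩ := h'
    refine ⟨T' + S', add_mem h.mem h'.mem, add_mem h.mem' h'.mem', h.adj.add h'.adj, ?_, ?_⟩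
    · intro A _ _ _ _ U hU i j hi hj
      rw [ladd_apply, ladd_apply, form_add_left, form_add_right,
        h.left A U hU i j hi hj, h'.left A U hU i j hi hj]
    · intro A _ _ _ _ U hU i j hi hj
      rw [ladd_apply, ladd_apply, form_add_left, form_add_right,
        h.right A U hU i j hi hj, h'.right A U hU i j hi hj]
  | smul c T _ h =>
    obtain ⟨T', h⟩ := h
    refine ⟨star c • T', smul_mem _ c h.mem, smul_mem _ _ h.mem', h.adj.smul c,
      ?_, ?_⟩
    · intro A _ _ _ _ U hU i j hi hj
      rw [lsmul_apply, lsmul_apply, form_smul_left, form_smul_right, star_star,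
        h.left A U hU i j hi hj]
    · intro A _ _ _ _ U hU i j hi hj
      rw [lsmul_apply, lsmul_apply, form_smul_left, form_smul_right, h.right A U hU i j hi hj]

theorem mor_adj_mem {n m : ℕ} {T T' : Op I} (hT : T ∈ Mor Pi n m) (h : OpAdj T T') :
    MorAdj D n m T T' := by obtain ⟨T'', h'⟩ := exists_morAdj D hT; rwa [h.symm.ext h'.adj.symm]

theorem freeRel_idMat (d : ℕ) : FreeRel id (idMat : Fin d → Fin d → ℂ) := by
  classical
  constructor <;> simp [idMat] <;> aesop

theorem wordMat_idMat {X : Type*} (x y : List X) : wordMat (idMat : X → X → ℂ) x y = idMat x y := by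
  classical
  induction x generalizing y with
  | nil => cases y <;> simp [idMat]
  | cons a x ih =>
    cases y with
    | nil => simp [idMat]
    | cons b y =>
      rw [wordMat_cons_cons, ih]
      by_cases h1 : a = b <;> by_cases h2 : x = y <;> simp [idMat, h1, h2]

theorem groupMat_idMat : groupMat (idMat : Fin d → Fin d → ℂ) = idMat := by
  funext g h
  rw [groupMat, wordMat_idMat]
  by_cases h1 : g = h
  · simp [idMat, h1]
  · rw [idMat, idMat, if_neg h1, if_neg fun e => h1 (redWord_injective d e)]

theorem Displacement.path_injective (o : I) : Inj (D.path o) := fun G H h => by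
  rw [← D.steps_path o G, h, D.steps_path]

theorem Displacement.exists_path {o : I} {l : List I} (h : l.head? = some o) : ∃ G, D.path o G = l := by
  cases l with
  | nil => simp at h
  | cons a l =>
    obtain rfl : a = o := by simpa using h
    exact ⟨_, D.path_steps a l⟩

theorem Displacement.head?_path (o : I) (G : 𝓦 d) : (D.path o G).head? = some o := by
  obtain ⟨l, hl⟩ := D.path_eq_cons o G
  rw [hl]; rfl

theorem bim_apply_path {n m : ℕ} {T : Op I} (hT : T ∈ Bim n m) (o : I) (G : 𝓦 d) :
    T (bv (D.path o G)) ∈ supported ℂ ℂ (Set.range (D.path o)) := by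
  by_cases h : (D.path o G).length = m + 1
  · refine Finsupp.supported_mono (fun l hl => ?_) (hT.1 _ h)
    exact D.exists_path (hl.2.1.trans (D.head?_path o G))
  · rw [hT.2 _ h]; exact zero_mem _

theorem mor_translate {n m : ℕ} {T : Op I} (hT : T ∈ Mor Pi n m) (v v' : I)
    (G H : 𝓦 d) :
    T (bv (D.path v G)) (D.path v H) = T (bv (D.path v' G)) (D.path v' H) := by
  have hB := mor_le_bim Pi _ _ hT
  by_cases hG : G.length = m
  · by_cases hH : H.length = n
    · obtain ⟨T', h⟩ := exists_morAdj D hT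
      have h1 := h.left ℂ idMat (freeRel_idMat d) (D.path v H) (D.path v' G)
        (by rw [D.length_path, hH]) (by rw [D.length_path, hG])
      have key : ∀ (x : 𝓥 I) (v : I) (G : 𝓦 d),
          x ∈ supported ℂ ℂ (Set.range (D.path v)) → ∀ v',
          form (D.chainMat idMat) (bv (D.path v' G)) x = x (D.path v G) := by
        intro x v G hx v'
        rw [form_ev_left]
        refine eq_of_supported hx _ (lapply (D.path v G)) ?_
        rintro _ ⟨H, rfl⟩
        rw [← form_ev_left, form_ev, Displacement.chainMat, D.steps_path, D.steps_path,
          groupMat_idMat, wordMat_idMat, Finsupp.lapply_apply, ← form_idMat_left, form_ev]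
        by_cases h : G = H
        · simp [idMat, h]
        · rw [idMat, idMat, if_neg h, if_neg fun e => h (D.path_injective v e)]
      have h2 : form (D.chainMat idMat) (T' (bv (D.path v H))) (bv (D.path v' G)) =
          star (form (D.chainMat idMat) (bv (D.path v' G)) (T' (bv (D.path v H)))) := by
        have hs : (D.chainMat idMat : List I → List I → ℂ) = fun L L' => idMat (D.steps L) (D.steps L') := by
          funext L L'
          rw [Displacement.chainMat, groupMat_idMat, wordMat_idMat]
        rw [hs]
        have : ∀ x y : 𝓥 I, form (fun L L' => (idMat (D.steps L) (D.steps L') : ℂ)) x y =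
            form idMat (mapDomain D.steps x) (mapDomain D.steps y) := by
          intro x y
          simp [form, Finsupp.linearCombination_mapDomain, comp_def]
        rw [this, this, form_idMat_symm]
      rw [h2, key _ v G (bim_apply_path D (mor_le_bim Pi _ _ h.mem') v H),
        key _ v' H (bim_apply_path D hB v' G), h.adj, star_star] at h1
      exact h1
    · rw [bim_apply_eq_zero hB (by rw [D.length_path]; omega),
        bim_apply_eq_zero hB (by rw [D.length_path]; omega)]
  · rw [hB.2 _ (by rw [D.length_path]; omega), hB.2 _ (by rw [D.length_path]; omega)]; rfl

theorem Displacement.zeroCellEquiv {Pi : SimpleGraph I} [Pi.LocallyFinite] (D : Displacement Pi d) (i j : I) : ZeroCellEquiv Pi i j := fun T hT =>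
  mor_translate D hT i j [] []

variable (o : I)

/-- The operator on tuples of displacements induced by a translation invariant operator. -/
def bar : Op I →ₗ[ℂ] Op (Z2Free d) :=
  (llcomp ℂ _ _ _ (lcomapDomain (D.path o) (D.path_injective o))).comp
    ((lcomp ℂ _ (𝓜 (D.path o))))

theorem bar_apply (T : Op I) (G H : 𝓦 d) :
    bar D o T (bv G) H = T (bv (D.path o G)) (D.path o H) := by
  change (T (𝓜 (D.path o) (bv G))) (D.path o H) = _
  rw [lmapDomain_apply, mapDomain_single]

theorem lmapDomain_bar {n m : ℕ} {T : Op I} (hT : T ∈ Bim n m) (x : 𝓦 d →₀ ℂ) :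
    𝓜 (D.path o) (bar D o T x) = T (𝓜 (D.path o) x) := by
  have : (𝓜 (D.path o)).comp (bar D o T) =
      T.comp (𝓜 (D.path o)) := by
    refine linOp_ext fun G => ?_
    rw [lcomp_apply, lcomp_apply, lmapDomain_apply _ _ _ (ev G), mapDomain_single]
    have h := (mem_supported _ _).1 (bim_apply_path D hT o G)
    refine Eq.trans ?_ (Finsupp.mapDomain_comapDomain _ (D.path_injective o) _ h)
    refine congrArg (mapDomain (D.path o)) (fext fun H => ?_)
    rw [bar_apply]; rfl
  exact lcongr_fun this x

theorem bar_mul {n k m : ℕ} {S T : Op I} (_hS : S ∈ Bim n k) (hT : T ∈ Bim k m) :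
    bar D o (S * T) = bar D o S * bar D o T := by
  refine op_ext fun G => fext fun H => ?_
  have h := lmapDomain_bar D o hT (bv G)
  rw [lmapDomain_apply _ _ _ (bv G), mapDomain_single] at h
  rw [bar_apply, emul_apply, ← h]; rfl

theorem bar_adj {T T' : Op I} (h : OpAdj T T') : OpAdj (bar D o T) (bar D o T') := fun G H => by
  rw [bar_apply, bar_apply, h]

theorem bar_apply_of_length {n m : ℕ} {T : Op I} (hT : T ∈ Bim n m) {G : 𝓦 d}
    (h : G.length ≠ m) : bar D o T (bv G) = 0 :=
  fext fun H => by rw [bar_apply, hT.2 _ (by rw [D.length_path]; omega)]; rfl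

theorem bar_apply_of_length' {n m : ℕ} {T : Op I} (hT : T ∈ Bim n m) {G H : 𝓦 d}
    (h : H.length ≠ n) : bar D o T (bv G) H = 0 := by
  rw [bar_apply, bim_apply_eq_zero hT (by rw [D.length_path]; omega)]

theorem bar_injective {n m : ℕ} {T T' : Op I} (hT : T ∈ Mor Pi n m) (hT' : T' ∈ Mor Pi n m)
    (h : bar D o T = bar D o T') : T = T' := by
  have hB := mor_le_bim Pi _ _ hT
  have hB' := mor_le_bim Pi _ _ hT'
  refine op_ext fun j => fext fun i => ?_
  cases j with
  | nil => rw [hB.2 _ (by simp), hB'.2 _ (by simp)]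
  | cons v l =>
    rw [← D.path_steps v l]
    generalize D.steps (v :: l) = G
    by_cases hi : i ∈ Set.range (D.path v)
    · obtain ⟨H, rfl⟩ := hi
      rw [mor_translate D hT v o, mor_translate D hT' v o, ← bar_apply, ← bar_apply, h]
    · have h0 : ∀ {T : Op I}, T ∈ Bim n m → T (bv (D.path v G)) i = 0 := fun hT => by
        by_contra h0
        exact hi ((mem_supported _ _).1 (bim_apply_path D hT v G)
          (Finsupp.mem_support_iff.2 h0))
      rw [h0 hB, h0 hB']

theorem form_lmapDomain {α β : Type*} {f : α → β} {V : α → α → A} {W : β → β → A}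
    (h : ∀ a b, V a b = W (f a) (f b)) (x y : α →₀ ℂ) :
    form W (𝓜 f x) (𝓜 f y) = form V x y := by
  simp only [form, lmapDomain_apply, Finsupp.linearCombination_mapDomain, comp_def]
  have : ∀ k, (fun l => W (f k) (f l)) = V k := fun k => funext fun l => (h k l).symm
  simp only [this]

abbrev tupleMat (U : Fin d → Fin d → A) (G H : 𝓦 d) : A := wordMat (groupMat U) G H

theorem eqv_bar {A : Type} [Ring A] [StarRing A] [Algebra ℂ A] [StarModule ℂ A]
    {U : Fin d → Fin d → A} (hU : FreeRel id U) {n m : ℕ} {T T' : Op I} (hT : T ∈ Mor Pi n m)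
    (h : OpAdj T T') : Eqv (tupleMat U) (tupleMat U) (bar D o T) (bar D o T') := by
  have h' := mor_adj_mem D hT h
  have hB := mor_le_bim Pi _ _ hT
  have hB' := mor_le_bim Pi _ _ h'.mem'
  have ht : ∀ G H, tupleMat U G H = D.chainMat U (D.path o G) (D.path o H) := fun G H => by
    rw [Displacement.chainMat, D.steps_path, D.steps_path]
  have zero : ∀ {n m : ℕ} {T : Op I} (hT : T ∈ Bim n m) (G H : 𝓦 d), H.length ≠ n →
      form (tupleMat U) (bv H) (bar D o T (bv G)) = 0 ∧
      form (tupleMat U) (bar D o T (bv G)) (bv H) = 0 := by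
    intro n m T hT G H hH
    have hs : bar D o T (bv G) ∈ supported ℂ ℂ {H | H.length = n} := by
      rw [mem_supported]
      intro H' h'
      by_contra h0
      exact Finsupp.mem_support_iff.1 h' (bar_apply_of_length' D o hT h0)
    constructor
    · rw [form_ev_left]
      refine eq_of_supported hs _ 0 fun K hK => ?_
      rw [← form_ev_left, form_ev]
      exact wordMat_len _ fun e => hH (e.trans hK)
    · rw [form, star_eq_zero]
      refine eq_of_supported hs _ 0 fun K hK => ?_
      rw [Finsupp.linearCombination_single, ← form_ev_left, form_ev]
      rw [tupleMat, wordMat_len _ fun e => hH (e.symm.trans hK)]; simp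
  have hp : ∀ G, 𝓜 (D.path o) (bv G) = bv (D.path o G) := fun G => by
    rw [lmapDomain_apply, mapDomain_single]
  refine Eqv.of_basis (fun G H => bar_adj D o h G H) (fun G H => ?_) fun H G => ?_
  · by_cases hG : G.length = m
    · by_cases hH : H.length = n
      · rw [← form_lmapDomain ht, ← form_lmapDomain ht, lmapDomain_bar D o hB',
          lmapDomain_bar D o hB, hp, hp]
        exact h'.left A U hU _ _ (by rw [D.length_path, hH]) (by rw [D.length_path, hG])
      · rw [(zero hB G H hH).1, bar_apply_of_length D o hB' hH, form_zero_left]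
    · rw [(zero hB' H G hG).2, bar_apply_of_length D o hB hG, form_zero_right]
  · by_cases hG : G.length = m
    · by_cases hH : H.length = n
      · rw [← form_lmapDomain ht, ← form_lmapDomain ht, lmapDomain_bar D o hB',
          lmapDomain_bar D o hB, hp, hp]
        exact h'.right A U hU _ _ (by rw [D.length_path, hH]) (by rw [D.length_path, hG])
      · rw [(zero hB G H hH).2, bar_apply_of_length D o hB' hH, form_zero_right]
    · rw [(zero hB' H G hG).1, bar_apply_of_length D o hB hG, form_zero_left]

theorem finite_bar {n m : ℕ} {T : Op I} (hT : T ∈ Mor Pi n m) :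
    {G | bar D o T (bv G) ≠ 0}.Finite := by
  induction hT using span_induction with
  | mem T h =>
    obtain ⟨K, hK, rfl⟩ := h
    obtain ⟨v₀, ys, hy⟩ := List.exists_cons_of_length_eq_add_one hK.length_y
    have h1 : {φ : Homs K Pi.Adj | φ.1 v₀ = o}.Finite := by
      have key : ∀ φ : Homs K 𝓔, (∀ v ∈ [v₀], ¬ φ.1 v) → ∀ v, ¬ φ.1 v :=
        fun φ hφ v hv => hφ v₀ (by simp) (IsConnected_const hK.connected φ.1
          (fun a b hab => by rw [φ.2 a b hab]) v v₀ hv)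
      refine finite_homs [v₀] (fun φ ψ hφ hψ => sext (funext fun v => propext
        ⟨fun h => (key φ hφ v h).elim, fun h => (key ψ hψ v h).elim⟩)) _
        ((Set.finite_singleton [o]).subset ?_)
      rintro _ ⟨φ, hφ, rfl⟩
      simpa using hφ
    refine (h1.image fun φ => D.steps φ.ys).subset fun G hG => ?_
    by_contra h0
    refine hG (fext fun H => ?_)
    have : IsEmpty (Fib Pi K (D.path o G)) := ⟨fun φ => h0 ⟨⟨φ.1, φ.2.1⟩, ?_, ?_⟩⟩
    · rw [bar_apply, homMat_bv, finsum_of_isEmpty]; rfl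
    · have h2 := congrArg List.head? φ.2.2
      have h3 : K.y.head? = some v₀ := by rw [hy]; rfl
      rw [D.head?_path, List.head?_map, h3] at h2
      exact Option.some.inj h2
    · change D.steps (K.y.map φ.1) = G; rw [φ.2.2, D.steps_path]
  | zero => simp
  | add T S _ _ h h' =>
    refine (h.union h').subset fun G hG => ?_
    by_contra h0
    simp only [Set.mem_union, mem_ofPred_eq, not_or, not_not] at h0
    exact hG (by rw [map_add, ladd_apply, h0.1, h0.2, add_zero])
  | smul c T _ h =>
    refine h.subset fun G hG h0 => hG ?_
    rw [map_smul, lsmul_apply, h0, smul_zero]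

end Bar

section Concat

variable {α : Type*} {A : Type*} [Ring A] [StarRing A] [Algebra ℂ A] [StarModule ℂ A]

def catL (n : ℕ) : LinOp (List α × List α) (List α) :=
  Finsupp.lift _ ℂ _ fun p => if p.1.length = n then bv (p.1 ++ p.2) else 0

def splitL (n : ℕ) : LinOp (List α) (List α × List α) :=
  Finsupp.lift _ ℂ _ fun l => if n ≤ l.length then ev (l.take n, l.drop n) else 0

theorem catL_ev (n : ℕ) (p : List α × List α) :
    catL n (ev p) = if p.1.length = n then bv (p.1 ++ p.2) else 0 := by simp [catL]

theorem splitL_ev (n : ℕ) (l : List α) :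
    splitL n (ev l) = if n ≤ l.length then ev (l.take n, l.drop n) else 0 := by simp [splitL]

theorem catL_splitL (n : ℕ) (l : List α) :
    catL n (splitL n (bv l)) = if n ≤ l.length then bv l else 0 := by
  rw [splitL_ev]
  split_ifs with h
  · rw [catL_ev, if_pos (by simpa using h), take_append_drop]
  · simp

theorem splitL_catL (n : ℕ) (p : List α × List α) :
    splitL n (catL n (ev p)) = if p.1.length = n then ev p else 0 := by
  rw [catL_ev]
  split_ifs with h
  · rw [splitL_ev, if_pos (by simp [h]), take_left' h, drop_left' h]
  · simp

theorem catL_apply (n : ℕ) (f : List α × List α →₀ ℂ) (l : List α) :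
    catL n f l = if n ≤ l.length then f (l.take n, l.drop n) else 0 := by
  induction f using ev_induction with
  | zero => simp
  | add f g h h' => rw [map_add, fadd_apply, h, h']; split_ifs <;> simp
  | single p c =>
    rw [map_smul, fsmul_apply, catL_ev]
    by_cases h : p.1.length = n
    · rw [if_pos h]
      by_cases h' : p.1 ++ p.2 = l
      · subst h'
        rw [Finsupp.single_eq_same, if_pos (by simp [h]), take_left' h, drop_left' h]
        simp
      · rw [single_eq_of_ne (Ne.symm h')]
        split_ifs
        · rw [fsmul_apply, single_eq_of_ne]; rintro rfl; exact h' (take_append_drop _ _)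
        · simp
    · rw [if_neg h]
      split_ifs with h'
      · rw [fsmul_apply, single_eq_of_ne]
        · simp
        · grind
      · simp

theorem eqv_catL (U : α → α → A) (n : ℕ) :
    Eqv (prodMat (wordMat U) (wordMat U)) (wordMat U) (catL n) (splitL n) := by
  classical
  have h1 : ∀ (p : List α × List α) (l : List α), p.1.length = n → n ≤ l.length →
      wordMat U l (p.1 ++ p.2) = wordMat U (l.take n) p.1 * wordMat U (l.drop n) p.2 ∧
      wordMat U (p.1 ++ p.2) l = wordMat U p.1 (l.take n) * wordMat U p.2 (l.drop n) := by
    intro p l hp hl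
    have h : (l.take n).length = p.1.length := by simp [hp, hl]
    rw [← wordMat_append _ _ _ h, ← wordMat_append _ _ _ h.symm, take_append_drop]
    exact ⟨rfl, rfl⟩
  refine Eqv.of_basis (fun p l => ?_) (fun p l => ?_) fun l p => ?_
  · rw [splitL_ev, catL_apply]
    split_ifs
    · rw [single_apply]
      by_cases h : p = (l.take n, l.drop n)
      · simp [h]
      · simp [h, Ne.symm h]
    · simp
  all_goals
    rw [catL_ev, splitL_ev]
    by_cases hp : p.1.length = n <;> by_cases hl : n ≤ l.length
    · simp only [if_pos hp, if_pos hl, form_ev, prodMat, h1 p l hp hl]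
    · rw [if_pos hp, if_neg hl, form_ev, wordMat_len]
      · simp
      · simp [hp]; omega
    · have h : (l.take n).length ≠ p.1.length := by simp [hl]; omega
      simp only [if_neg hp, if_pos hl, form_ev, prodMat, wordMat_len U h,
        wordMat_len U h.symm, form_zero_left, form_zero_right, zero_mul]
    · simp [hp, hl]

theorem catL_assoc (n m : ℕ) (x y z : List α →₀ ℂ) :
    catL (n + m) (tens (catL n (tens x y)) z) = catL n (tens x (catL m (tens y z))) := by
  ext l
  simp only [catL_apply, tens_apply, length_take, length_drop, List.drop_drop]
  by_cases h : n + m ≤ l.length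
  · grind
  · grind

theorem catL_zero (y : List α →₀ ℂ) : catL 0 (tens (bv []) y) = y := by
  ext l
  simp [catL_apply, tens_apply]

theorem catL_nil {n : ℕ} {x : List α →₀ ℂ} (hx : ∀ l, l.length ≠ n → x l = 0) :
    catL n (tens x (bv [])) = x := by
  ext l
  rw [catL_apply, tens_apply]
  by_cases h : l.length = n
  · grind
  · rw [hx l h]
    split_ifs with h'
    · rw [single_eq_of_ne, mul_zero]
      intro e
      have := congrArg List.length e
      simp at this
      omega
    · rfl

end Concat

section BarTen

universe w

variable {I : Type w} {Pi : SimpleGraph I} {d : ℕ} (D : Displacement Pi d) [Pi.LocallyFinite] (o : I)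

theorem Displacement.exists_path_append (o : I) (G : 𝓦 d) : ∃ v,
    (D.path o G).getLast? = some v ∧ ∀ H, (D.path o (G ++ H)).take (G.length + 1) = D.path o G ∧
      (D.path o (G ++ H)).drop G.length = D.path v H := by
  induction G generalizing o with
  | nil =>
    refine ⟨o, rfl, fun H => ⟨?_, rfl⟩⟩
    obtain ⟨l, hl⟩ := D.path_eq_cons o H
    simp [hl, Displacement.path]
  | cons g G ih =>
    obtain ⟨v, h1, h2⟩ := ih (D.move o g)
    refine ⟨v, ?_, fun H => ⟨?_, ?_⟩⟩
    · obtain ⟨l, hl⟩ := D.path_eq_cons (D.move o g) G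
      rw [Displacement.path, hl, List.getLast?_cons_cons, ← hl, h1]
    · rw [cons_append, Displacement.path, length_cons, List.take_succ_cons, (h2 H).1]; rfl
    · rw [cons_append, Displacement.path, length_cons, List.drop_succ_cons, (h2 H).2]

theorem bar_ten {n m n' m' : ℕ} {T S : Op I} (hT : T ∈ Mor Pi n m) (hS : S ∈ Mor Pi n' m') :
    bar D o (ten m T S) ∘ₗ catL m = catL n ∘ₗ tmap (bar D o T) (bar D o S) := by
  have hB := mor_le_bim Pi _ _ hT
  have hB' := mor_le_bim Pi _ _ hS
  have hB'' := bim_ten hB hB'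
  refine linOp_ext fun p => fext fun K => ?_
  obtain ⟨G, G'⟩ := p
  rw [lcomp_apply, lcomp_apply, tmap_ev, catL_apply, tens_apply, catL_ev]
  by_cases hG : G.length = m
  · rw [if_pos hG]
    by_cases hG' : G'.length = m'
    · rw [bar_apply, ten_apply hB hB' _ _ (by rw [D.length_path]; simp [hG, hG'])]
      obtain ⟨v, hv, h⟩ := D.exists_path_append o G
      rw [hG] at h
      rw [(h G').1, (h G').2]
      by_cases hK : n ≤ K.length
      · obtain ⟨v', hv', h'⟩ := D.exists_path_append o (K.take n)
        have hl : (K.take n).length = n := by simp [hK]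
        have h' := h' (K.drop n)
        rw [hl, take_append_drop] at h'
        rw [if_pos hK, h'.1, h'.2, bar_apply]
        by_cases h0 : T (bv (D.path o G)) (D.path o (K.take n)) = 0
        · rw [h0, zero_mul, zero_mul]
        · have := ((mem_supported _ _).1 (hB.1 (D.path o G) (by rw [D.length_path, hG]))
            (Finsupp.mem_support_iff.2 h0)).2.2
          rw [hv, hv'] at this
          obtain rfl := Option.some.inj this
          rw [mor_translate D hS v' o, bar_apply]
      · rw [if_neg hK, bim_apply_eq_zero hB, zero_mul]; rw [length_take, D.length_path]; omega
    · rw [bar_apply_of_length D o hB'' (by simp [hG]; omega), bar_apply_of_length D o hB' hG']; simp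
  · rw [if_neg hG, bar_apply_of_length D o hB hG]; simp

end BarTen

section Constructions

variable {A : Type} [Ring A] [StarRing A] [Bialgebra ℂ A]

theorem sum_subtype_eq_sum {ι M : Type*} [Fintype ι] [AddCommMonoid M] (s : ι → Prop) [DecidablePred s] (f : ι → M)
    (h : ∀ k, ¬ s k → f k = 0) : ∑ k : {k // s k}, f k = ∑ k, f k := by
  rw [← Finset.sum_subtype (Finset.univ.filter s) (by simp) f, Finset.sum_filter_of_ne]
  grind

namespace URep

def pow (X : URep A) : ℕ → URep A
  | 0 => unit
  | n + 1 => tensor X (pow X n)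

def powList (X : URep A) : ∀ n, (X.pow n).ι → List X.ι
  | 0, _ => []
  | n + 1, p => Prod.fst p :: powList X n (Prod.snd p)

theorem pow_U (X : URep A) (n : ℕ) (a b : (X.pow n).ι) :
    (X.pow n).U a b = wordMat X.U (X.powList n a) (X.powList n b) := by
  induction n with
  | zero => rfl
  | succ n ih => exact congrArg (X.U _ _ * ·) (ih a.2 b.2)

theorem length_powList (X : URep A) (n : ℕ) (a : (X.pow n).ι) : (X.powList n a).length = n := by
  induction n with
  | zero => rfl
  | succ n ih => exact congrArg (· + 1) (ih a.2)

theorem powList_injective (X : URep A) (n : ℕ) : Inj (X.powList n) := by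
  induction n with
  | zero => exact fun _ _ _ => rfl
  | succ n ih =>
    intro a b h
    obtain ⟨h1, h2⟩ := List.cons.inj h
    exact Prod.ext h1 (ih h2)

theorem exists_powList (X : URep A) (l : List X.ι) : ∃ a, X.powList l.length a = l := by
  induction l with
  | nil => exact ⟨(), rfl⟩
  | cons i l ih =>
    obtain ⟨a, ha⟩ := ih
    exact ⟨(i, a), congrArg (i :: ·) ha⟩

def restrict (X : URep A) (s : X.ι → Prop) [DecidablePred s]
    (h : ∀ i j, s i → ¬ s j → X.U i j = 0 ∧ X.U j i = 0) : URep A where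
  ι := {i // s i}
  U i j := X.U i j
  unitary_left i j := by
    rw [sum_subtype_eq_sum s (fun k => X.U i k * star (X.U j k))
      fun k hk => by rw [(h i k i.2 hk).1, zero_mul], X.unitary_left]
    simp [ext_iff]
  unitary_right i j := by
    rw [sum_subtype_eq_sum s (fun k => star (X.U k i) * X.U k j)
      fun k hk => by rw [(h j k j.2 hk).2, mul_zero], X.unitary_right]
    simp [ext_iff]
  comul_U i j := by
    rw [sum_subtype_eq_sum s (fun k => X.U i k ⊗ₜ[ℂ] X.U k j)
      fun k hk => by rw [(h i k i.2 hk).1, zero_tmul], X.comul_U]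

def sigmaMat {κ : Type} [DecidableEq κ] (R : κ → URep A) (p q : Σ k, (R k).ι) : A :=
  if h : p.1 = q.1 then (R q.1).U (h ▸ p.2) q.2 else 0

section

variable {κ : Type} [Fintype κ] [DecidableEq κ] (R : κ → URep A)

theorem sigmaMat_self (k : κ) (i j : (R k).ι) : sigmaMat R ⟨k, i⟩ ⟨k, j⟩ = (R k).U i j := by
  simp [sigmaMat]

theorem sigmaMat_of_ne {k l : κ} (h : k ≠ l) (i : (R k).ι) (j : (R l).ι) :
    sigmaMat R ⟨k, i⟩ ⟨l, j⟩ = 0 := by simp [sigmaMat, h]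

def sigma : URep A where
  ι := Σ k, (R k).ι
  U := sigmaMat R
  unitary_left := fun ⟨k, i⟩ ⟨l, j⟩ => by
    rw [sum_sigma, sum_eq_single k]
    · by_cases h : k = l
      · subst h; simpa [sigmaMat_self] using (R k).unitary_left i j
      · simp [sigmaMat_of_ne R (Ne.symm h), h]
    · exact fun m _ hm => sum_eq_zero fun c _ => by rw [sigmaMat_of_ne R (Ne.symm hm), zero_mul]
    · simp
  unitary_right := fun ⟨k, i⟩ ⟨l, j⟩ => by
    rw [sum_sigma, sum_eq_single k]
    · by_cases h : k = l
      · subst h; simpa [sigmaMat_self] using (R k).unitary_right i j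
      · simp [sigmaMat_of_ne R h, h]
    · exact fun m _ hm => sum_eq_zero fun c _ => by rw [sigmaMat_of_ne R hm, star_zero, zero_mul]
    · simp
  comul_U := fun ⟨k, i⟩ ⟨l, j⟩ => by
    rw [sum_sigma, sum_eq_single k]
    · by_cases h : k = l
      · subst h; simpa [sigmaMat_self] using (R k).comul_U i j
      · simp [sigmaMat_of_ne R h]
    · exact fun m _ hm => sum_eq_zero fun c _ => by rw [sigmaMat_of_ne R (Ne.symm hm), zero_tmul]
    · simp

def sigmaIncl (k : κ) (i : (R k).ι) : (sigma R).ι := ⟨k, i⟩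

theorem sigmaIncl_injective (k : κ) : Inj (sigmaIncl R k) := fun _ _ h =>
  sigma_mk_injective (β := fun k => (R k).ι) h

theorem eqv_sigma [StarModule ℂ A] (k : κ) : Eqv (R k).U (sigma R).U
    (𝓜 (sigmaIncl R k))
    (lcomapDomain (sigmaIncl R k) (sigmaIncl_injective R k)) := by
  refine Eqv.of_injective (sigmaIncl_injective R k) (fun a b => (sigmaMat_self R k a b).symm) ?_ ?_
  all_goals
    rintro a ⟨l, b⟩ hb
    have : k ≠ l := by rintro rfl; exact hb ⟨b, rfl⟩
  exacts [sigmaMat_of_ne R this _ _, sigmaMat_of_ne R this.symm _ _]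

end

def subMat {B : Type} [Ring B] [Algebra ℂ B] {ι κ : Type} [Fintype ι] (v : Matrix ι κ ℂ)
    (u : Matrix ι ι B) : Matrix κ κ B :=
  vᴴ.map (algebraMap ℂ B) * u * v.map (algebraMap ℂ B)

section

variable {B : Type} [Ring B] [Algebra ℂ B] {ι κ : Type} [Fintype ι] [Fintype κ] [DecidableEq κ]
  {v : Matrix ι κ ℂ}

theorem subMat_one [DecidableEq ι] (hv : vᴴ * v = 1) : subMat v (1 : Matrix ι ι B) = 1 := by
  rw [subMat, mmul_one, ← mmap_mul, hv]
  simp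

theorem map_mul_subMat (hv : vᴴ * v = 1) {u : Matrix ι ι B}
    (hu : (v * vᴴ).map (algebraMap ℂ B) * u =
      u * (v * vᴴ).map (algebraMap ℂ B)) :
    v.map (algebraMap ℂ B) * subMat v u = u * v.map (algebraMap ℂ B) := by
  rw [subMat, ← mmul_assoc, ← mmul_assoc, ← mmap_mul, hu, mmul_assoc,
    ← mmap_mul, mmul_assoc, hv, mmul_one]

theorem subMat_mul (hv : vᴴ * v = 1) {u w : Matrix ι ι B}
    (hw : (v * vᴴ).map (algebraMap ℂ B) * w =
      w * (v * vᴴ).map (algebraMap ℂ B)) :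
    subMat v u * subMat v w = subMat v (u * w) := by
  conv_lhs => rw [subMat, mmul_assoc, map_mul_subMat hv hw]
  simp only [subMat, mmul_assoc]

theorem subMat_map {B' : Type} [Ring B'] [Algebra ℂ B'] (f : B →ₐ[ℂ] B') (u : Matrix ι ι B) :
    (subMat v u).map f = subMat v (u.map f) := by
  have h : ∀ {α β : Type} (w : Matrix α β ℂ), (w.map (algebraMap ℂ B)).map f =
      w.map (algebraMap ℂ B') := fun w => by ext i j; simp
  rw [subMat, mmap_mul, mmap_mul, h, h, subMat]

theorem subMat_conjTranspose [StarRing B] [StarModule ℂ B] (u : Matrix ι ι B) :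
    (subMat v u)ᴴ = subMat v uᴴ := by
  have h : ∀ {α β : Type} (w : Matrix α β ℂ), (w.map (algebraMap ℂ B))ᴴ =
      wᴴ.map (algebraMap ℂ B) := fun w => by ext i j; exact (algebraMap_star_comm _).symm
  rw [subMat, Matrix.conjTranspose_mul, Matrix.conjTranspose_mul, h, h,
    Matrix.conjTranspose_conjTranspose, subMat, mmul_assoc]

theorem intertwiners_iff_map_mul {ι κ : Type} [Fintype ι] [Fintype κ] {U : ι → ι → B}
    {V : κ → κ → B} {T : Matrix κ ι ℂ} : T ∈ intertwiners U V ↔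
      T.map (algebraMap ℂ B) * Matrix.of U = Matrix.of V * T.map (algebraMap ℂ B) := by
  rw [← Matrix.ext_iff]
  simp only [mmul_apply, Matrix.map_apply, Matrix.of_apply, ← Algebra.commutes]
  simp only [← Algebra.smul_def]
  rfl

end

theorem unitary_mul (X : URep A) : Matrix.of X.U * (Matrix.of X.U)ᴴ = 1 := by
  ext i j
  simpa [mmul_apply, mone_apply] using X.unitary_left i j

theorem mul_unitary (X : URep A) : (Matrix.of X.U)ᴴ * Matrix.of X.U = 1 := by
  ext i j
  simpa [mmul_apply, mone_apply] using X.unitary_right i j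

theorem map_comul (X : URep A) : (Matrix.of X.U).map (Bialgebra.comulAlgHom ℂ A) =
    (Matrix.of X.U).map (includeLeft : A →ₐ[ℂ] A ⊗[ℂ] A) *
      (Matrix.of X.U).map (includeRight : A →ₐ[ℂ] A ⊗[ℂ] A) := by
  ext i j
  simpa [mmul_apply] using X.comul_U i j

def sub [StarModule ℂ A] (X : URep A) {κ : Type} [Fintype κ] [DecidableEq κ] (v : Matrix X.ι κ ℂ)
    (hv : vᴴ * v = 1) (hX : v * vᴴ ∈ intertwiners X.U X.U) : URep A where
  ι := κ
  U := subMat v (Matrix.of X.U)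
  unitary_left i j := by
    have h := intertwiners_iff_map_mul.1 (Eqv.mtx_mem (URep.eqv hX).symm)
    rw [mtx_ofMtx, Matrix.conjTranspose_mul, Matrix.conjTranspose_conjTranspose] at h
    have h' : (v * vᴴ).map (algebraMap ℂ A) * (Matrix.of X.U)ᴴ =
        (Matrix.of X.U)ᴴ * (v * vᴴ).map (algebraMap ℂ A) := by
      rw [← Matrix.one_mul (_ * _), ← X.mul_unitary, mmul_assoc, ← mmul_assoc _ _
        (Matrix.conjTranspose _), ← h, mmul_assoc, X.unitary_mul, mmul_one]
    have := congrFun (congrFun (subMat_mul hv (u := Matrix.of X.U) h') i) j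
    rw [X.unitary_mul, subMat_one hv, ← subMat_conjTranspose] at this
    simpa [mmul_apply, mone_apply] using this
  unitary_right i j := by
    have := congrFun (congrFun (subMat_mul hv (u := (Matrix.of X.U)ᴴ)
      (intertwiners_iff_map_mul.1 hX)) i) j
    rw [X.mul_unitary, subMat_one hv, ← subMat_conjTranspose] at this
    simpa [mmul_apply, mone_apply] using this
  comul_U i j := by
    have h : (v * vᴴ).map (algebraMap ℂ (A ⊗[ℂ] A)) *
        (Matrix.of X.U).map (includeRight : A →ₐ[ℂ] A ⊗[ℂ] A) =
        (Matrix.of X.U).map (includeRight : A →ₐ[ℂ] A ⊗[ℂ] A) *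
          (v * vᴴ).map (algebraMap ℂ (A ⊗[ℂ] A)) := by
      have := congrArg (fun M => M.map (includeRight : A →ₐ[ℂ] A ⊗[ℂ] A))
        (intertwiners_iff_map_mul.1 hX)
      have e : ((v * vᴴ).map (algebraMap ℂ A)).map
          (includeRight : A →ₐ[ℂ] A ⊗[ℂ] A) =
            (v * vᴴ).map (algebraMap ℂ (A ⊗[ℂ] A)) := by
        ext i j
        exact AlgHom.commutes (includeRight : A →ₐ[ℂ] A ⊗[ℂ] A) _
      rwa [mmap_mul (M := Matrix.of X.U), mmap_mul (L := Matrix.of X.U), e] at this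
    have := congrFun (congrFun (subMat_mul hv (u := (Matrix.of X.U).map
      (includeLeft : A →ₐ[ℂ] A ⊗[ℂ] A)) h) i) j
    rw [← X.map_comul, ← subMat_map, ← subMat_map, ← subMat_map] at this
    simpa [mmul_apply] using this.symm

theorem sub_mem [StarModule ℂ A] (X : URep A) {κ : Type} [Fintype κ] [DecidableEq κ] (v : Matrix X.ι κ ℂ)
    (hv : vᴴ * v = 1) (hX : v * vᴴ ∈ intertwiners X.U X.U) :
    v ∈ intertwiners (X.sub v hv hX).U X.U :=
  intertwiners_iff_map_mul.2 (map_mul_subMat hv (intertwiners_iff_map_mul.1 hX))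

end URep

theorem exists_isometry {ι : Type} [Fintype ι] [DecidableEq ι] {p : Matrix ι ι ℂ} (hp : p.IsHermitian)
    (hpp : p * p = p) : ∃ (κ : Type) (_ : Fintype κ) (_ : DecidableEq κ) (v : Matrix ι κ ℂ),
      vᴴ * v = 1 ∧ v * vᴴ = p := by
  let u : Matrix ι ι ℂ := hp.eigenvectorUnitary
  let D : Matrix ι ι ℂ := Matrix.diagonal (RCLike.ofReal ∘ hp.eigenvalues)
  have hu : uᴴ * u = 1 := Unitary.coe_star_mul_self hp.eigenvectorUnitary
  have hs : p = u * D * uᴴ := hp.spectral_theorem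
  have hD : D = uᴴ * p * u := by grind
  have hDD : D * D = D := by grind
  have hD' : ∀ i, D i i = 0 ∨ D i i = 1 := fun i => by
    have := congrFun (congrFun hDD i) i
    rw [Matrix.diagonal_mul_diagonal, diagonal_apply_eq] at this
    rw [show D i i = _ from diagonal_apply_eq _ i] at this ⊢
    grind
  refine ⟨{i // D i i = 1}, inferInstance, inferInstance, Matrix.of fun a i => u a i, ?_, ?_⟩
  · ext i j; have := congrFun (congrFun hu i) j; simpa [mmul_apply, mone_apply, ext_iff] using this
  · rw [hs]
    ext a b
    refine Eq.trans (sum_congr rfl fun i _ => ?_) (sum_subtype_eq_sum (fun i => D i i = 1)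
      (fun i => (u * D) a i * uᴴ i b) fun k hk => ?_)
    · rw [Matrix.mul_diagonal]
      have h : (RCLike.ofReal ∘ hp.eigenvalues) i.1 = (1 : ℂ) :=
        (diagonal_apply_eq _ i.1).symm.trans i.2
      rw [h, mul_one]; rfl
    · rw [Matrix.mul_diagonal]
      have h : (RCLike.ofReal ∘ hp.eigenvalues) k = (0 : ℂ) :=
        (diagonal_apply_eq _ k).symm.trans ((hD' k).resolve_right hk)
      rw [h, mul_zero, zero_mul]

end Constructions

section Words

variable {d : ℕ}

theorem wordMat_of_reduced {A : Type*} [Ring A] {U : Fin d → Fin d → A} (hU : FreeRel id U) {x z : List (Fin d)}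
    (hx : Reduced id x) (hz : ¬ Reduced id z) : wordMat U x z = 0 := by
  induction z generalizing x with
  | nil => exact absurd List.isChain_nil hz
  | cons a z ih =>
    obtain _ | ⟨b, x⟩ := x
    · rfl
    rw [wordMat_cons_cons]
    by_cases h : Reduced id z
    · obtain _ | ⟨a', z⟩ := z
      · grind
      obtain _ | ⟨b', x⟩ := x
      · exact mul_zero _
      have h1 : a' = a := by grind
      subst h1
      rw [wordMat_cons_cons, ← mul_assoc]
      have h2 := hU.col_zero b a' b' (List.isChain_cons_cons.1 hx).1
      grind
    · rw [ih (x := x) hx.tail h, mul_zero]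

end Words

section Realizations

variable {d : ℕ}

theorem forall_mem_of_wordMat_ne_zero {X : Type*} {A : Type*} [DecidableEq X] [Ring A] {U : X → X → A} (P : X → Prop)
    (hU : ∀ g h, P g → ¬ P h → U g h = 0) {x y : List X} (hx : ∀ g ∈ x, P g) (h : wordMat U x y ≠ 0) :
    ∀ g ∈ y, P g := by
  induction x generalizing y with
  | nil => cases y <;> simp_all [wordMat]
  | cons a x ih =>
    cases y with
    | nil => simp
    | cons b y =>
      rw [wordMat_cons_cons] at h
      grind

abbrev redMat (d : ℕ) : Z2Free d → Z2Free d → (𝓗 d).O := groupMat (𝓗 d).u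

open Classical in
def sphereRep (d n : ℕ) : URep (𝓗 d).O :=
  ((𝓗 d).fund.pow n).restrict
    (fun a => Reduced id ((𝓗 d).fund.powList n a)) fun i j hi hj => by
      rw [URep.pow_U, URep.pow_U]
      refine ⟨wordMat_of_reduced (hyper_freeRel d) hi hj, ?_⟩
      rw [← wordMat_swap]
      exact wordMat_of_reduced (hyper_freeRel d).swap hi hj

def ballRep (d N : ℕ) : URep (𝓗 d).O :=
  URep.sigma fun k : Fin (N + 1) => sphereRep d k

def ballGroup (d N : ℕ) (p : (ballRep d N).ι) : Z2Free d :=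
  (((𝓗 d).fund.powList p.1 p.2.1).map (z2Gen d)).prod

theorem redWord_ballGroup {N : ℕ} (p : (ballRep d N).ι) :
    redWord d (ballGroup d N p) = (𝓗 d).fund.powList p.1 p.2.1 :=
  redWord_of_reduced d p.2.2

theorem length_redWord_ballGroup {N : ℕ} (p : (ballRep d N).ι) :
    (redWord d (ballGroup d N p)).length = p.1 := by
  rw [redWord_ballGroup]
  exact URep.length_powList _ _ _

theorem ballRep_U {N : ℕ} (p q : (ballRep d N).ι) :
    (ballRep d N).U p q = redMat d (ballGroup d N p) (ballGroup d N q) := by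
  by_cases h : p.1 = q.1
  · rw [redMat, groupMat, redWord_ballGroup, redWord_ballGroup]
    obtain ⟨k, p⟩ := p
    obtain ⟨l, q⟩ := q
    obtain rfl : k = l := h
    exact (URep.sigmaMat_self (fun k : Fin (N + 1) => sphereRep d k) k p q).trans
      (URep.pow_U _ _ _ _)
  · rw [redMat, groupMat_of_length (by
      rw [length_redWord_ballGroup, length_redWord_ballGroup]; exact fun h' => h (Fin.ext h'))]
    exact URep.sigmaMat_of_ne _ h _ _

theorem ballGroup_injective (N : ℕ) : Inj (ballGroup d N) := by
  intro p q h
  have h1 := length_redWord_ballGroup p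
  have h2 := redWord_ballGroup p
  rw [h, length_redWord_ballGroup] at h1
  rw [h, redWord_ballGroup] at h2
  obtain ⟨k, p⟩ := p
  obtain ⟨l, q⟩ := q
  obtain rfl : l = k := Fin.ext h1
  have h3 : p = q := sext (URep.powList_injective _ _ h2.symm)
  rw [h3]

theorem exists_ballGroup {N : ℕ} {g : Z2Free d} (hg : (redWord d g).length ≤ N) :
    ∃ p, ballGroup d N p = g := by
  obtain ⟨a, ha⟩ := (𝓗 d).fund.exists_powList (redWord d g)
  refine ⟨⟨⟨(redWord d g).length, Nat.lt_succ_of_le hg⟩, ⟨a, ?_⟩⟩, ?_⟩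
  · change Reduced id _; exact (congrArg (Reduced id) ha).mpr (reduced_redWord d g)
  · change (List.map (z2Gen d) ((𝓗 d).fund.powList _ a)).prod = g; rw [ha, prod_redWord]

theorem length_redWord_ballGroup_le {N : ℕ} (p : (ballRep d N).ι) :
    (redWord d (ballGroup d N p)).length ≤ N := by
  rw [length_redWord_ballGroup]; exact Nat.lt_succ_iff.1 p.1.2

theorem exists_tupleRep {s : Set (𝓦 d)} (hs : s.Finite) {n : ℕ}
    (hn : ∀ l ∈ s, l.length = n) :
    ∃ (R : URep (𝓗 d).O) (f : R.ι → 𝓦 d), Inj f ∧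
      (∀ a a', R.U a a' = wordMat (redMat d) (f a) (f a')) ∧
      (∀ a b, b ∉ Set.range f → wordMat (redMat d) (f a) b = 0) ∧
      (∀ a b, b ∉ Set.range f → wordMat (redMat d) b (f a) = 0) ∧ s ⊆ Set.range f ∧ ∀ a, (f a).length = n := by
  obtain ⟨N, hN⟩ : ∃ N, ∀ l ∈ s, ∀ g ∈ l, (redWord d g).length ≤ N := by
    obtain ⟨N, hN⟩ := (hs.image fun l => (l.map fun g => (redWord d g).length).sum).bddAbove
    exact ⟨N, fun l hl g hg => (List.single_le_sum (fun _ _ => Nat.zero_le _) _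
      (List.mem_map_of_mem hg)).trans (hN ⟨l, hl, rfl⟩)⟩
  let f : ((ballRep d N).pow n).ι → 𝓦 d := fun a =>
    ((ballRep d N).powList n a).map (ballGroup d N)
  have hf : ∀ l : 𝓦 d, l.length = n → (∀ g ∈ l, (redWord d g).length ≤ N) →
      l ∈ Set.range f := by
    intro l hl h
    obtain ⟨q, rfl⟩ : ∃ q, List.map (ballGroup d N) q = l := by
      clear hl
      induction l with
      | nil => exact ⟨[], rfl⟩
      | cons g l ih =>
        rw [List.forall_mem_cons] at h
        obtain ⟨q, rfl⟩ := ih h.2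
        obtain ⟨p, rfl⟩ := exists_ballGroup h.1
        exact ⟨p :: q, rfl⟩
    obtain ⟨a, ha⟩ := (ballRep d N).exists_powList q
    grind
  have hw : ∀ x y : List (ballRep d N).ι, wordMat (ballRep d N).U x y =
      wordMat (redMat d) (x.map (ballGroup d N)) (y.map (ballGroup d N)) := by
    intro x y
    induction x generalizing y with
    | nil => cases y <;> rfl
    | cons a x ih => cases y with
      | nil => rfl
      | cons b y => simp [ih, ballRep_U]
  have hle : ∀ a, ∀ g ∈ f a, (redWord d g).length ≤ N := by
    intro a g hg
    obtain ⟨p, -, rfl⟩ := List.mem_map.1 hg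
    exact length_redWord_ballGroup_le p
  have key : ∀ V : Z2Free d → Z2Free d → (𝓗 d).O,
      (∀ g h, (redWord d g).length ≠ (redWord d h).length → V g h = 0) → ∀ a b, b ∉ Set.range f →
        wordMat V (f a) b = 0 := by
    intro V hV a b hb
    by_contra h
    refine hb (hf b ?_ (forall_mem_of_wordMat_ne_zero (fun g => (redWord d g).length ≤ N)
      (fun g h hg hh => hV g h fun e => hh (e ▸ hg)) (hle a) h))
    by_contra hn
    refine h (wordMat_len _ ?_)
    rw [length_map, URep.length_powList]
    exact Ne.symm hn
  refine ⟨(ballRep d N).pow n, f, fun a b h => URep.powList_injective _ _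
    (List.map_injective_iff.2 (ballGroup_injective N) h), fun a a' => ?_, key _ fun g h hgh =>
    groupMat_of_length hgh, fun a b hb => ?_, fun l hl => hf l (hn l hl) (hN l hl),
    fun a => (length_map _).trans (URep.length_powList _ _ _)⟩
  · rw [URep.pow_U]; exact hw _ _
  · rw [← wordMat_swap]; exact key _ (fun g h hgh => groupMat_of_length hgh.symm) a b hb

theorem exists_rep_of_proj {p : LinOp (𝓦 d) (𝓦 d)}
    (hp : Eqv (wordMat (redMat d)) (wordMat (redMat d)) p p) (hpp : p ∘ₗ p = p) {n : ℕ}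
    (hfin : {G | p (ev G) ≠ 0}.Finite) (hlen : ∀ G, G.length ≠ n → p (ev G) = 0) :
    ∃ (Z : URep (𝓗 d).O) (w : LinOp Z.ι (𝓦 d))
      (w' : LinOp (𝓦 d) Z.ι), Eqv Z.U (wordMat (redMat d)) w w' ∧
        w' ∘ₗ w = lid ∧ w ∘ₗ w' = p := by
  obtain ⟨R, f, hf, hU, h1, h2, hs, -⟩ := exists_tupleRep hfin (n := n) fun l hl =>
    by_contra fun h => hl (hlen l h)
  set s : LinOp R.ι (𝓦 d) := 𝓜 f
  set s' : LinOp (𝓦 d) R.ι := lcomapDomain f hf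
  have hss : Eqv R.U (wordMat (redMat d)) s s' := Eqv.of_injective hf hU h1 h2
  have hs1 : ∀ a, s' (ev (f a)) = ev a := fun a => by
    classical
    ext a'
    change single (f a) (1 : ℂ) (f a') = _
    simp [single_apply, hf.eq_iff]
  have hs2 : s' ∘ₗ s = lid := linOp_ext fun a => by
    rw [lcomp_apply, lmapDomain_apply, mapDomain_single, hs1]; rfl
  have hp1 : p ∘ₗ s ∘ₗ s' = p := linOp_ext fun l => by
    by_cases hl : l ∈ Set.range f
    · obtain ⟨a, rfl⟩ := hl
      rw [lcomp_apply, lcomp_apply, hs1, lmapDomain_apply, mapDomain_single]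
    · have h0 : s' (ev l) = 0 := by
        ext a
        exact single_eq_of_ne fun e => hl ⟨a, e⟩
      rw [lcomp_apply, lcomp_apply, h0, map_zero, map_zero]
      grind
  have hp2 : (s ∘ₗ s') ∘ₗ p = p := by
    have := (hss.comp hss.symm)
    have h := hp.comp this
    rw [hp1] at h
    exact (hp.unique h).symm
  have hP := hss.symm.comp (hp.comp hss)
  set P := s' ∘ₗ p ∘ₗ s
  have hPP : P ∘ₗ P = P := by
    calc P ∘ₗ P = s' ∘ₗ p ∘ₗ ((s ∘ₗ s') ∘ₗ p) ∘ₗ s := rfl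
      _ = s' ∘ₗ (p ∘ₗ p) ∘ₗ s := by rw [hp2]; rfl
      _ = P := by rw [hpp]
  obtain ⟨κ, _, _, v, hv, hvp⟩ := exists_isometry (p := mtx P) (Eq.symm hP.mtx_conjTranspose)
    (by rw [← mtx_comp, hPP])
  have hX : v * vᴴ ∈ intertwiners R.U R.U := hvp ▸ hP.mtx_mem
  have hv2 := URep.eqv (R.sub_mem v hv hX)
  refine ⟨R.sub v hv hX, s ∘ₗ ofMtx v, ofMtx vᴴ ∘ₗ s', hss.comp hv2, ?_, ?_⟩
  · change ofMtx vᴴ ∘ₗ (s' ∘ₗ s) ∘ₗ ofMtx v = _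
    rw [hs2, id_comp]
    apply mtx_injective
    rw [mtx_comp, mtx_ofMtx, mtx_ofMtx]
    exact hv.trans mtx_id.symm
  · have : ofMtx v ∘ₗ ofMtx vᴴ = P := by
      apply mtx_injective
      rw [← hvp]
      exact (mtx_comp (β := κ) _ _).trans (by rw [mtx_ofMtx, mtx_ofMtx])
    calc _ = s ∘ₗ (ofMtx v ∘ₗ ofMtx vᴴ) ∘ₗ s' := rfl
      _ = ((s ∘ₗ s') ∘ₗ p) ∘ₗ (s ∘ₗ s') := by rw [this]; rfl
      _ = p := by rw [hp2, hp1]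

universe w

variable {I : Type w} {Pi : SimpleGraph I} (D : Displacement Pi d) [Pi.LocallyFinite] (o : I)

/-- A representation on an orthogonal direct sum of ranges of projections. -/
structure Realization (X : PlanarObj Pi) where
  Z : URep (𝓗 d).O
  w : X.ι → LinOp Z.ι (𝓦 d)
  w' : X.ι → LinOp (𝓦 d) Z.ι
  eqv : ∀ i, Eqv Z.U (wordMat (redMat d)) (w i) (w' i)
  sum : ∑ i, w' i ∘ₗ w i = lid
  proj : ∀ i, w i ∘ₗ w' i = bar D o (X.p i)
  orth : ∀ i j, i ≠ j → w i ∘ₗ w' j = 0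

theorem nonempty_realization (X : PlanarObj Pi) : Nonempty (Realization D o X) := by
  have h : ∀ i, ∃ (Z : URep (𝓗 d).O) (w : LinOp Z.ι (𝓦 d))
      (w' : LinOp (𝓦 d) Z.ι), Eqv Z.U (wordMat (redMat d)) w w' ∧
        w' ∘ₗ w = lid ∧ w ∘ₗ w' = bar D o (X.p i) := fun i => by
    have hB := mor_le_bim Pi _ _ (X.mem i)
    refine exists_rep_of_proj (eqv_bar D o (hyper_freeRel d) (X.mem i) (X.selfAdj i)) ?_
      (finite_bar D o (X.mem i)) fun G hG => bar_apply_of_length D o hB hG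
    change bar D o (X.p i) * bar D o (X.p i) = _
    rw [← bar_mul D o hB hB, X.idem]
  choose Z w w' h1 h2 h3 using h
  have hc : ∀ i j, (lcomapDomain (URep.sigmaIncl Z i) (URep.sigmaIncl_injective Z i)) ∘ₗ
      𝓜 (URep.sigmaIncl Z j) =
        if h : i = j then h ▸ lid else (0 : LinOp (Z j).ι (Z i).ι) := by
    intro i j
    refine linOp_ext fun a => fext fun b => ?_
    rw [lcomp_apply, lmapDomain_apply, mapDomain_single]
    split_ifs with h
    · subst h; classical simp [single_apply, (URep.sigmaIncl_injective Z i).eq_iff]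
    · exact single_eq_of_ne fun e => h (congrArg Sigma.fst e)
  refine ⟨⟨URep.sigma Z, fun i => w i ∘ₗ lcomapDomain _ (URep.sigmaIncl_injective Z i),
    fun i => 𝓜 (URep.sigmaIncl Z i) ∘ₗ w' i,
    fun i => (h1 i).comp (URep.eqv_sigma Z i).symm, ?_, fun i => ?_, fun i j hij => ?_⟩⟩
  · have : ∀ i, (𝓜 (URep.sigmaIncl Z i) ∘ₗ w' i) ∘ₗ w i ∘ₗ
        lcomapDomain _ (URep.sigmaIncl_injective Z i) =
        𝓜 (URep.sigmaIncl Z i) ∘ₗ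
          lcomapDomain _ (URep.sigmaIncl_injective Z i) := fun i => by
      rw [comp_assoc, ← comp_assoc _ (w i), h2, id_comp]
    simp only [this]
    refine linOp_ext fun p => ?_
    obtain ⟨k, a⟩ := p
    change (∑ i, 𝓜 (URep.sigmaIncl Z i) ∘ₗ
      lcomapDomain _ (URep.sigmaIncl_injective Z i)) (ev (URep.sigmaIncl Z k a)) =
        ev (URep.sigmaIncl Z k a)
    have e : (ev (URep.sigmaIncl Z k a) : (URep.sigma Z).ι →₀ ℂ) =
        𝓜 (URep.sigmaIncl Z k) (ev a) := by rw [lmapDomain_apply, mapDomain_single]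
    rw [e, lsum_apply, sum_eq_single k]
    · have := lcongr_fun (hc k k) (ev a)
      rw [dif_pos rfl, lcomp_apply] at this
      rw [lcomp_apply, this]; rfl
    · intro i _ hi
      have := lcongr_fun (hc i k) (ev a)
      rw [dif_neg hi, lcomp_apply] at this
      rw [lcomp_apply, this, LinearMap.zero_apply, map_zero]
    · simp
  · have := hc i i
    rw [dif_pos rfl] at this
    rw [comp_assoc, ← comp_assoc (w' i), this, id_comp, h3]
  · have := hc i j
    rw [dif_neg hij] at this
    rw [comp_assoc, ← comp_assoc (w' j), this, zero_comp, comp_zero]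

end Realizations

section Maps

universe w

variable {d : ℕ} {I : Type w} {Pi : SimpleGraph I} {D : Displacement Pi d} [Pi.LocallyFinite] {o : I}

theorem comp_finset_sum {α β γ κ : Type*} (u : Finset κ) (S : LinOp β γ) (T : κ → LinOp α β) :
    S ∘ₗ ∑ k ∈ u, T k = ∑ k ∈ u, S ∘ₗ T k :=
  map_sum (llcomp ℂ _ _ _ S) T u

theorem finset_sum_comp {α β γ κ : Type*} (u : Finset κ) (S : κ → LinOp β γ) (T : LinOp α β) :
    (∑ k ∈ u, S k) ∘ₗ T = ∑ k ∈ u, S k ∘ₗ T :=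
  map_sum (lcomp ℂ _ T) S u

theorem tmap_sum {α β α' β' κ κ' : Type*} [Fintype κ] [Fintype κ'] (S : κ → LinOp α β)
    (T : κ' → LinOp α' β') : tmap (∑ i, S i) (∑ j, T j) = ∑ p : κ × κ', tmap (S p.1) (T p.2) :=
  linOp_ext fun p => by simp only [tmap_ev, lsum_apply, map_sum, sum_prod_type]; exact sum_comm

theorem tmap_zero_left {α β α' β' : Type*} (T : LinOp α' β') : tmap (0 : LinOp α β) T = 0 :=
  linOp_ext fun p => by simp [tmap_ev]

theorem tmap_zero_right {α β α' β' : Type*} (T : LinOp α' β') : tmap T (0 : LinOp α β) = 0 :=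
  linOp_ext fun p => by simp [tmap_ev]

theorem splitL_catL_tens {α : Type*} {n : ℕ} {x y : List α →₀ ℂ} (hx : ∀ l, l.length ≠ n → x l = 0) :
    splitL n (catL n (tens x y)) = tens x y := by
  rw [← x.sum_single, Finsupp.sum, map_sum, lsum_apply, map_sum, map_sum]
  refine sum_congr rfl fun l hl => ?_
  have hl' : l.length = n := by_contra fun h => Finsupp.mem_support_iff.1 hl (hx l h)
  rw [← mul_one (x l), ← smul_eq_mul, ← smul_single, map_smul, lsmul_apply, map_smul, map_smul]
  congr 1
  induction y using ev_induction with
  | zero => simp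
  | add y y' h h' => rw [map_add, map_add, map_add, h, h']
  | single a c =>
    rw [map_smul, map_smul, map_smul, tens_ev, splitL_catL, if_pos hl']

namespace Realization

variable {X Y Z W : PlanarObj Pi} (r : Realization D o X) (s : Realization D o Y)
  (t : Realization D o Z) (u : Realization D o W)

theorem bar_w (i : X.ι) : bar D o (X.p i) ∘ₗ r.w i = r.w i := by
  calc _ = r.w i ∘ₗ r.w' i ∘ₗ r.w i := by rw [← r.proj]; rfl
    _ = r.w i ∘ₗ ∑ k, r.w' k ∘ₗ r.w k := by
      rw [comp_finset_sum, sum_eq_single i]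
      · exact fun k _ hk => by rw [← comp_assoc, r.orth i k (Ne.symm hk), zero_comp]
      · simp
    _ = r.w i := by rw [r.sum, LinearMap.comp_id]

theorem w_apply_of_length (i : X.ι) (x : r.Z.ι →₀ ℂ) {l : 𝓦 d} (h : l.length ≠ X.n i) :
    r.w i x l = 0 := by
  rw [← r.bar_w i, lcomp_apply]
  induction r.w i x using ev_induction with
  | zero => simp
  | add x x' h h' => rw [map_add, fadd_apply, h, h', add_zero]
  | single a c =>
    rw [map_smul, fsmul_apply, bar_apply_of_length' D o (mor_le_bim Pi _ _ (X.mem i)) h, smul_zero]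

theorem ext_left {α : Type*} {S T : LinOp α r.Z.ι} (h : ∀ i, r.w i ∘ₗ S = r.w i ∘ₗ T) : S = T := by
  have : ∀ S : LinOp α r.Z.ι, S = ∑ i, r.w' i ∘ₗ r.w i ∘ₗ S := fun S => by
    conv_lhs => rw [← id_comp S, ← r.sum, finset_sum_comp]
    rfl
  rw [this S, this T]
  simp only [h]

theorem ext_right {α : Type*} {S T : LinOp r.Z.ι α} (h : ∀ i, S ∘ₗ r.w' i = T ∘ₗ r.w' i) : S = T := by
  have : ∀ S : LinOp r.Z.ι α, S = ∑ i, (S ∘ₗ r.w' i) ∘ₗ r.w i := fun S => by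
    conv_lhs => rw [← LinearMap.comp_id S, ← r.sum, comp_finset_sum]
    rfl
  rw [this S, this T]
  simp only [h]

def lin (T : Y.ι → X.ι → Op I) : LinOp r.Z.ι s.Z.ι := ∑ j, ∑ i, s.w' j ∘ₗ bar D o (T j i) ∘ₗ r.w i

variable {r s t u}

theorem w_lin {T : Y.ι → X.ι → Op I} (hT : T ∈ PlanarObj.homs X Y) (j : Y.ι) :
    s.w j ∘ₗ r.lin s T = ∑ i, bar D o (T j i) ∘ₗ r.w i := by
  rw [lin, comp_finset_sum, sum_eq_single j]
  · rw [comp_finset_sum]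
    refine sum_congr rfl fun i _ => ?_
    rw [← comp_assoc, s.proj]
    change (bar D o (Y.p j) * bar D o (T j i)) ∘ₗ _ = _
    rw [← bar_mul D o (mor_le_bim Pi _ _ (Y.mem j)) (mor_le_bim Pi _ _ (hT j i).1), (hT j i).2.1]
  · intro k _ hk
    rw [comp_finset_sum]
    exact sum_eq_zero fun i _ => by rw [← comp_assoc, s.orth j k (Ne.symm hk), zero_comp]
  · simp

theorem w_lin_w' {T : Y.ι → X.ι → Op I} (hT : T ∈ PlanarObj.homs X Y) (j : Y.ι) (i : X.ι) :
    s.w j ∘ₗ r.lin s T ∘ₗ r.w' i = bar D o (T j i) := by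
  rw [← comp_assoc, w_lin hT, finset_sum_comp, sum_eq_single i]
  · rw [comp_assoc, r.proj]
    change bar D o (T j i) * bar D o (X.p i) = _
    rw [← bar_mul D o (mor_le_bim Pi _ _ (hT j i).1) (mor_le_bim Pi _ _ (X.mem i)), (hT j i).2.2]
  · exact fun k _ hk => by rw [comp_assoc, r.orth k i hk, comp_zero]
  · simp

theorem lin_comp {S : Z.ι → Y.ι → Op I} {T : Y.ι → X.ι → Op I} (hS : S ∈ PlanarObj.homs Y Z)
    (hT : T ∈ PlanarObj.homs X Y) :
    r.lin t (PlanarObj.compMat S T) = s.lin t S ∘ₗ r.lin s T := by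
  refine t.ext_left fun k => ?_
  rw [w_lin (PlanarObj.compMat_mem hS hT), ← comp_assoc, w_lin hS]
  simp only [comp_assoc, w_lin hT, comp_finset_sum, PlanarObj.compMat, map_sum, finset_sum_comp]
  rw [sum_comm]
  refine sum_congr rfl fun j _ => sum_congr rfl fun i _ => ?_
  rw [bar_mul D o (mor_le_bim Pi _ _ (hS k j).1) (mor_le_bim Pi _ _ (hT j i).1)]
  rfl

theorem w_lin_perm (e : X.ι ≃ Y.ι) (hn : ∀ i, Y.n (e i) = X.n i) (hp : ∀ i, Y.p (e i) = X.p i)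
    (i : X.ι) : s.w (e i) ∘ₗ r.lin s (PlanarObj.perm e) = r.w i := by
  rw [w_lin (PlanarObj.perm_mem e hn hp), sum_eq_single i]
  · rw [PlanarObj.perm, if_pos rfl, r.bar_w]
  · intro k _ hk
    rw [PlanarObj.perm, if_neg (fun h => hk (e.injective h).symm), map_zero, zero_comp]
  · simp

theorem lin_id : r.lin r (PlanarObj.perm (Equiv.refl X.ι)) = lid :=
  r.ext_left fun i => w_lin_perm (Equiv.refl X.ι) (fun _ => rfl) (fun _ => rfl) i

theorem eqv_lin {T : Y.ι → X.ι → Op I} {T' : X.ι → Y.ι → Op I} (hT : T ∈ PlanarObj.homs X Y)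
    (h : ∀ i j, OpAdj (T j i) (T' i j)) : Eqv r.Z.U s.Z.U (r.lin s T) (s.lin r T') := by
  rw [lin, lin, sum_comm (s := (univ : Finset X.ι))]
  refine Eqv.sum _ fun j => Eqv.sum _ fun i => ?_
  exact (s.eqv j).symm.comp ((eqv_bar D o (hyper_freeRel d) (hT j i).1 (h i j)).comp (r.eqv i))

theorem lin_mem {T : Y.ι → X.ι → Op I} (hT : T ∈ PlanarObj.homs X Y) :
    mtx (r.lin s T) ∈ intertwiners r.Z.U s.Z.U := by
  choose T' hT' using fun j i => exists_morAdj D (hT j i).1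
  exact (eqv_lin (T' := fun i j => T' j i) hT fun i j => (hT' j i).adj).mtx_mem

variable (r s) (v : Realization D o (X.tensor Y))

def mu : LinOp (r.Z.ι × s.Z.ι) v.Z.ι :=
  ∑ p : (X.tensor Y).ι, v.w' p ∘ₗ catL (X.n p.1) ∘ₗ tmap (r.w p.1) (s.w p.2)

def muInv : LinOp v.Z.ι (r.Z.ι × s.Z.ι) :=
  ∑ p : (X.tensor Y).ι, (tmap (r.w' p.1) (s.w' p.2) ∘ₗ splitL (X.n p.1)) ∘ₗ v.w p

theorem eqv_mu : Eqv (prodMat r.Z.U s.Z.U) v.Z.U (mu r s v) (muInv r s v) :=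
  Eqv.sum _ fun p => (v.eqv p).symm.comp
    ((eqv_catL (redMat d) (X.n p.1)).comp ((r.eqv p.1).tmap (s.eqv p.2)))

theorem bar_catL (p : (X.tensor Y).ι) : bar D o ((X.tensor Y).p p) ∘ₗ catL (X.n p.1) =
    catL (X.n p.1) ∘ₗ tmap (bar D o (X.p p.1)) (bar D o (Y.p p.2)) :=
  bar_ten D o (X.mem p.1) (Y.mem p.2)

theorem w_mu (p : (X.tensor Y).ι) :
    v.w p ∘ₗ mu r s v = catL (X.n p.1) ∘ₗ tmap (r.w p.1) (s.w p.2) := by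
  rw [mu, comp_finset_sum, sum_eq_single p]
  · rw [← comp_assoc, v.proj, ← comp_assoc, bar_catL, comp_assoc,
      tmap_comp, r.bar_w, s.bar_w]
  · intro q _ hq; rw [← comp_assoc, v.orth p q (Ne.symm hq), zero_comp]
  · simp

theorem muInv_w' (p : (X.tensor Y).ι) :
    muInv r s v ∘ₗ v.w' p = tmap (r.w' p.1) (s.w' p.2) ∘ₗ splitL (X.n p.1) := by
  have h1 := (v.eqv p).comp (eqv_mu r s v)
  have h2 := (eqv_catL (redMat d) (X.n p.1)).comp ((r.eqv p.1).tmap (s.eqv p.2))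
  rw [w_mu] at h1
  exact h1.unique h2

theorem splitL_catL_w (p : (X.tensor Y).ι) :
    splitL (X.n p.1) ∘ₗ catL (X.n p.1) ∘ₗ tmap (r.w p.1) (s.w p.2) = tmap (r.w p.1) (s.w p.2) :=
  linOp_ext fun q => by
    rw [lcomp_apply, lcomp_apply, tmap_ev]
    exact splitL_catL_tens fun l hl => r.w_apply_of_length _ _ hl

theorem muInv_mu : muInv r s v ∘ₗ mu r s v = lid := by
  rw [muInv, finset_sum_comp]
  simp only [comp_assoc, w_mu, splitL_catL_w, tmap_comp]
  have := tmap_sum (fun i => r.w' i ∘ₗ r.w i) (fun j => s.w' j ∘ₗ s.w j)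
  rw [r.sum, s.sum, tmap_id] at this
  exact this.symm

theorem mu_muInv : mu r s v ∘ₗ muInv r s v = lid := by
  refine v.ext_left fun p => v.ext_right fun q => ?_
  rw [LinearMap.comp_id, ← comp_assoc, w_mu, comp_assoc, muInv_w',
    comp_assoc, ← comp_assoc (splitL _), tmap_comp]
  by_cases h : p = q
  · subst h
    rw [v.proj, r.proj, s.proj, ← comp_assoc, ← bar_catL]
    refine linOp_ext fun l => ?_
    rw [lcomp_apply, lcomp_apply, catL_splitL]
    split_ifs with hl
    · rfl
    · rw [map_zero]
      refine (bar_apply_of_length D o (mor_le_bim Pi _ _ ((X.tensor Y).mem p)) fun e => hl ?_).symm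
      rw [e]
      exact Nat.le_add_right _ _
  · rw [v.orth p q h]
    by_cases h1 : p.1 = q.1
    · rw [s.orth p.2 q.2 fun h2 => h (Prod.ext h1 h2), tmap_zero_right, zero_comp,
        comp_zero]
    · rw [r.orth p.1 q.1 h1, tmap_zero_left, zero_comp, comp_zero]

theorem mu_natural {X' Y' : PlanarObj Pi} (r' : Realization D o X') (s' : Realization D o Y')
    (v' : Realization D o (X'.tensor Y')) {T : X'.ι → X.ι → Op I} {S : Y'.ι → Y.ι → Op I}
    (hT : T ∈ PlanarObj.homs X X') (hS : S ∈ PlanarObj.homs Y Y') :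
    mu r' s' v' ∘ₗ tmap (r.lin r' T) (s.lin s' S) =
      v.lin v' (PlanarObj.tenMat (X := X) (Y := X') (X' := Y) (Y' := Y') T S) ∘ₗ mu r s v := by
  refine v'.ext_left fun p => ?_
  rw [← comp_assoc, w_mu, comp_assoc, tmap_comp, w_lin hT, w_lin hS,
    ← comp_assoc, w_lin (PlanarObj.tenMat_mem hT hS), finset_sum_comp, tmap_sum,
    comp_finset_sum]
  refine sum_congr rfl fun q _ => ?_
  have h := bar_ten D o (hT p.1 q.1).1 (hS p.2 q.2).1
  have h' := w_mu r s v q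
  calc _ = (catL (X'.n p.1) ∘ₗ tmap (bar D o (T p.1 q.1)) (bar D o (S p.2 q.2))) ∘ₗ
        tmap (r.w q.1) (s.w q.2) := by rw [comp_assoc, tmap_comp]
    _ = bar D o (ten (X.n q.1) (T p.1 q.1) (S p.2 q.2)) ∘ₗ catL (X.n q.1) ∘ₗ
        tmap (r.w q.1) (s.w q.2) := by rw [← h, comp_assoc]
    _ = _ := by rw [← h']; rfl

def nilL (d : ℕ) : LinOp Unit (𝓦 d) := 𝓜 fun _ => []

def nilL' (d : ℕ) : LinOp (𝓦 d) Unit :=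
  lcomapDomain (fun _ => []) fun _ _ _ => rfl

theorem nilL_ev : nilL d (ev ()) = bv [] := by rw [nilL, lmapDomain_apply, mapDomain_single]

theorem nilL'_ev (l : 𝓦 d) : nilL' d (ev l) = if l = [] then ev () else 0 := by
  ext
  change single l (1 : ℂ) [] = _
  split_ifs with h
  · simp [h]
  · grind

theorem eqv_nilL : Eqv (URep.unit (A := (𝓗 d).O)).U (wordMat (redMat d)) (nilL d) (nilL' d) :=
  Eqv.of_injective (fun _ _ _ => rfl) (fun _ _ => rfl)
    (fun a b hb => by
      cases b
      · exact absurd ⟨(), rfl⟩ hb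
      · rfl)
    fun a b hb => by
      cases b
      · exact absurd ⟨(), rfl⟩ hb
      · rfl

theorem nilL'_nilL : nilL' d ∘ₗ nilL d = lid :=
  linOp_ext fun a => by rw [lcomp_apply, nilL_ev, nilL'_ev]; rfl

theorem bar_unitOp : bar D o unitOp = nilL d ∘ₗ nilL' d :=
  linOp_ext fun l => by
    rw [lcomp_apply, nilL'_ev]
    split_ifs with h
    · subst h
      rw [nilL_ev]
      ext H
      classical
      rw [bar_apply, unitOp_bv, if_pos (by rw [D.length_path]; rfl), single_apply, single_apply]
      simp [(D.path_injective o).eq_iff]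
    · rw [map_zero]
      exact bar_apply_of_length D o (n := 0) (m := 0) unitOp_mem_bim (by simpa using h)

variable (v0 : Realization D o (PlanarObj.unit : PlanarObj Pi))

theorem w_unit : v0.w () ∘ₗ v0.w' () ∘ₗ nilL d = nilL d := by
  refine (congrArg (· ∘ₗ nilL d) (v0.proj ())).trans ?_
  change bar D o unitOp ∘ₗ _ = _
  rw [bar_unitOp, comp_assoc, nilL'_nilL, LinearMap.comp_id]

theorem unit_inv : (nilL' d ∘ₗ v0.w ()) ∘ₗ v0.w' () ∘ₗ nilL d = lid := by
  rw [comp_assoc, w_unit, nilL'_nilL]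

theorem inv_unit : (v0.w' () ∘ₗ nilL d) ∘ₗ nilL' d ∘ₗ v0.w () = lid := by
  refine v0.ext_left fun i => ?_
  obtain rfl : i = () := rfl
  have := v0.bar_w ()
  change bar D o unitOp ∘ₗ _ = _ at this
  rw [bar_unitOp] at this
  calc _ = (v0.w () ∘ₗ v0.w' () ∘ₗ nilL d) ∘ₗ nilL' d ∘ₗ v0.w () := rfl
    _ = _ := by rw [w_unit, ← comp_assoc, this, LinearMap.comp_id]

end Realization

end Maps

section Equivalence

namespace URep

variable {A : Type} [Ring A] [StarRing A] [Bialgebra ℂ A]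

open scoped MonoidalCategory

theorem ofMtx_mtx {α β : Type*} [Finite β] (S : LinOp α β) : ofMtx (mtx S) = S :=
  mtx_injective (mtx_ofMtx _)

def toLin {X Y : URep A} (f : X ⟶ Y) : LinOp X.ι Y.ι := ofMtx (mat f)

def homOf {X Y : URep A} (S : LinOp X.ι Y.ι) (h : mtx S ∈ intertwiners X.U Y.U) : X ⟶ Y := ⟨mtx S, h⟩

theorem mtx_toLin {X Y : URep A} (f : X ⟶ Y) : mtx (toLin f) = mat f := mtx_ofMtx _

theorem toLin_homOf {X Y : URep A} (S : LinOp X.ι Y.ι) (h : mtx S ∈ intertwiners X.U Y.U) :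
    toLin (homOf S h) = S := ofMtx_mtx S

theorem toLin_ext {X Y : URep A} {f g : X ⟶ Y} (h : toLin f = toLin g) : f = g :=
  hom_ext (by rw [← mtx_toLin, h, mtx_toLin])

theorem toLin_comp {X Y Z : URep A} (f : X ⟶ Y) (g : Y ⟶ Z) : toLin (f ≫ g) = toLin g ∘ₗ toLin f :=
  mtx_injective (by rw [mtx_comp, mtx_toLin, mtx_toLin, mtx_toLin]; rfl)

theorem toLin_id (X : URep A) : toLin (𝟙 X) = lid :=
  mtx_injective (by rw [mtx_id, mtx_toLin]; rfl)

theorem toLin_tensorHom {X Y X' Y' : URep A} (f : X ⟶ Y) (g : X' ⟶ Y') :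
    toLin (f ⊗ₘ g) = tmap (toLin f) (toLin g) :=
  mtx_injective (by
    refine Eq.trans ?_ (mtx_tmap _ _).symm
    rw [mtx_toLin, mtx_toLin, mtx_toLin]; rfl)

theorem toLin_whiskerRight {X Y : URep A} (f : X ⟶ Y) (Z : URep A) :
    toLin (f ▷ Z) = tmap (toLin f) lid := by rw [← toLin_id, ← toLin_tensorHom]; rfl

theorem toLin_whiskerLeft (Z : URep A) {X Y : URep A} (f : X ⟶ Y) :
    toLin (Z ◁ f) = tmap lid (toLin f) := by rw [← toLin_id, ← toLin_tensorHom]; rfl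

theorem toLin_permMat {X Y : URep A} (e : X.ι ≃ Y.ι) (f : X ⟶ Y) (hf : mat f = permMat e) :
    toLin f = 𝓜 e :=
  mtx_injective (by rw [mtx_toLin, hf, mtx_lmapDomain])

def isoOf [StarModule ℂ A] (X Y : URep A) (S : LinOp X.ι Y.ι) (T : LinOp Y.ι X.ι) (h : Eqv X.U Y.U S T)
    (h1 : T ∘ₗ S = lid) (h2 : S ∘ₗ T = lid) : X ≅ Y where
  hom := homOf S h.mtx_mem
  inv := homOf T h.symm.mtx_mem
  hom_inv_id := toLin_ext (by rw [toLin_comp, toLin_homOf, toLin_homOf, toLin_id, h1])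
  inv_hom_id := toLin_ext (by rw [toLin_comp, toLin_homOf, toLin_homOf, toLin_id, h2])

theorem isoOf_adj [StarModule ℂ A] {X Y : URep A} {S : LinOp X.ι Y.ι} {T : LinOp Y.ι X.ι}
    (h : Eqv X.U Y.U S T) (h1 : T ∘ₗ S = lid) (h2 : S ∘ₗ T = lid) :
    IsAdj (isoOf X Y S T h h1 h2).hom (isoOf X Y S T h h1 h2).inv := h.mtx_conjTranspose

end URep

universe w

variable {d : ℕ} {I : Type w} {Pi : SimpleGraph I} (D : Displacement Pi d) [Pi.LocallyFinite] (o : I)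

open Realization URep

open scoped MonoidalCategory

def realization (X : PlanarObj Pi) : Realization D o X := Classical.choice (nonempty_realization D o X)

local notation "𝓡" => realization D o

/-- The functor from planar bi-labeled graphs to representations. -/
def realize : PlanarObj Pi ⥤ URep (𝓗 d).O where
  obj X := (𝓡 X).Z
  map {X Y} f := homOf ((𝓡 X).lin (𝓡 Y) (PlanarObj.mat f))
    (lin_mem (PlanarObj.mat_mem f))
  map_id X := toLin_ext (by rw [toLin_homOf, toLin_id, PlanarObj.mat_id, lin_id])
  map_comp f g := toLin_ext (by
    rw [toLin_homOf, toLin_comp, toLin_homOf, toLin_homOf, PlanarObj.mat_comp,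
      lin_comp (PlanarObj.mat_mem g) (PlanarObj.mat_mem f)])

theorem toLin_realize {X Y : PlanarObj Pi} (f : X ⟶ Y) : toLin ((realize D o).map f) =
    (𝓡 X).lin (𝓡 Y) (PlanarObj.mat f) := toLin_homOf _ _

def realizeMu (X Y : PlanarObj Pi) :
    (realize D o).obj X ⊗ (realize D o).obj Y ≅ (realize D o).obj (X ⊗ Y) :=
  isoOf ((𝓡 X).Z.tensor (𝓡 Y).Z) (𝓡 (X.tensor Y)).Z
    _ _ (eqv_mu (𝓡 X) (𝓡 Y) _) (muInv_mu _ _ _) (mu_muInv _ _ _)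

def realizeUnit : 𝟙_ (URep (𝓗 d).O) ≅ (realize D o).obj (𝟙_ (PlanarObj Pi)) :=
  isoOf URep.unit (𝓡 PlanarObj.unit).Z _ _
    (((𝓡 PlanarObj.unit).eqv ()).symm.comp eqv_nilL) (unit_inv _) (inv_unit _)

theorem toLin_realizeMu (X Y : PlanarObj Pi) : toLin (realizeMu D o X Y).hom =
    mu (𝓡 X) (𝓡 Y) (𝓡 (X.tensor Y)) := toLin_homOf _ _

theorem toLin_realizeUnit : toLin (realizeUnit D o).hom =
    (𝓡 PlanarObj.unit).w' () ∘ₗ nilL d := toLin_homOf _ _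

theorem realize_natural {X Y X' Y' : PlanarObj Pi} (f : X ⟶ X') (g : Y ⟶ Y') :
    ((realize D o).map f ⊗ₘ (realize D o).map g) ≫ (realizeMu D o X' Y').hom =
      (realizeMu D o X Y).hom ≫ (realize D o).map (f ⊗ₘ g) := toLin_ext (by
  rw [toLin_comp, toLin_comp, toLin_tensorHom, toLin_realizeMu, toLin_realizeMu, toLin_realize, toLin_realize, toLin_realize]
  exact mu_natural _ _ _ _ _ _ (PlanarObj.mat_mem f) (PlanarObj.mat_mem g))

def realizeCore : (realize D o).CoreMonoidal where
  εIso := realizeUnit D o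
  μIso := realizeMu D o
  μIso_hom_natural_left f Z := by
    have := realize_natural D o f (𝟙 Z)
    rwa [CategoryTheory.Functor.map_id, MonoidalCategory.tensorHom_id, MonoidalCategory.tensorHom_id] at this
  μIso_hom_natural_right Z f := by
    have := realize_natural D o (𝟙 Z) f
    rwa [CategoryTheory.Functor.map_id, MonoidalCategory.id_tensorHom, MonoidalCategory.id_tensorHom] at this
  associativity X Y Z := toLin_ext (by
    rw [toLin_comp, toLin_comp, toLin_comp, toLin_comp, toLin_whiskerRight, toLin_whiskerLeft, toLin_realizeMu,
      toLin_realizeMu, toLin_realizeMu, toLin_realizeMu, toLin_realize,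
      toLin_permMat _ _ (URep.mat_associator _ _ _)]
    refine (𝓡 (X.tensor (Y.tensor Z))).ext_left fun p => ?_
    obtain ⟨i, j, k⟩ := p
    have h1 := w_lin_perm (r := 𝓡 ((X.tensor Y).tensor Z))
      (s := 𝓡 (X.tensor (Y.tensor Z))) (PlanarObj.assocE X Y Z)
      (fun _ => (add_assoc _ _ _).symm) (PlanarObj.assoc_p X Y Z) ((i, j), k)
    have h2 := w_mu (𝓡 (X.tensor Y)) (𝓡 Z)
      (𝓡 ((X.tensor Y).tensor Z)) ((i, j), k)
    have h3 := w_mu (𝓡 X) (𝓡 (Y.tensor Z))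
      (𝓡 (X.tensor (Y.tensor Z))) (i, j, k)
    have h4 := w_mu (𝓡 X) (𝓡 Y) (𝓡 (X.tensor Y)) (i, j)
    have h5 := w_mu (𝓡 Y) (𝓡 Z) (𝓡 (Y.tensor Z)) (j, k)
    refine linOp_ext fun q => ?_
    obtain ⟨⟨a, b⟩, c⟩ := q
    have h1' := fun x => lcongr_fun h1 x
    have h2' := fun x => lcongr_fun h2 x
    have h3' := fun x => lcongr_fun h3 x
    have h4' := fun x => lcongr_fun h4 x
    have h5' := fun x => lcongr_fun h5 x
    refine (h1' _).trans ((h2' _).trans (Eq.trans ?_ (h3' _).symm))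
    have e1 : 𝓜 (Equiv.prodAssoc (𝓡 X).Z.ι (𝓡 Y).Z.ι
        (𝓡 Z).Z.ι) (ev ((a, b), c)) = ev (a, b, c) := by
      rw [lmapDomain_apply, mapDomain_single]; rfl
    refine Eq.trans ?_ (congrArg (fun x => catL (X.n i) (tmap ((𝓡 X).w i)
      ((𝓡 (Y.tensor Z)).w (j, k)) (tmap lid
        (mu (𝓡 Y) (𝓡 Z) (𝓡 (Y.tensor Z))) x))) e1).symm
    change catL (X.n i + Y.n j) (tmap ((𝓡 (X.tensor Y)).w (i, j))
      ((𝓡 Z).w k) (tmap (mu (𝓡 X) (𝓡 Y)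
        (𝓡 (X.tensor Y))) lid (ev ((a, b), c)))) = _
    refine Eq.trans (congrArg (fun x => catL (X.n i + Y.n j)
      (tmap ((𝓡 (X.tensor Y)).w (i, j)) ((𝓡 Z).w k) x)) (tmap_ev _ _ _)) ?_
    refine Eq.trans ?_ (congrArg (fun x => catL (X.n i) (tmap ((𝓡 X).w i)
      ((𝓡 (Y.tensor Z)).w (j, k)) x)) (tmap_ev _ _ _)).symm
    rw [tmap_tens, tmap_tens]
    have h4a := h4' (ev (a, b))
    have h5a := h5' (ev (b, c))
    rw [lcomp_apply, lcomp_apply, tmap_ev] at h4a h5a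
    refine Eq.trans (congrArg (fun x => catL (X.n i + Y.n j) (tens x
      ((𝓡 Z).w k (ev c)))) h4a) ?_
    exact (catL_assoc _ _ _ _ _).trans (congrArg (fun x => catL (X.n i) (tens
      ((𝓡 X).w i (ev a)) x)) h5a).symm)
  left_unitality X := toLin_ext (by
    rw [toLin_comp, toLin_comp, toLin_whiskerRight, toLin_realizeMu, toLin_realizeUnit, toLin_realize,
      toLin_permMat _ _ (URep.mat_leftUnitor _)]
    refine (𝓡 X).ext_left fun i => linOp_ext fun q => ?_
    obtain ⟨⟨⟩, a⟩ := q
    have h1 := w_lin_perm (r := 𝓡 (PlanarObj.unit.tensor X))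
      (s := 𝓡 X) (PlanarObj.leftE X) (fun _ => (zero_add _).symm)
      (fun i => (unit_ten (mor_le_bim Pi _ _ (X.mem i.2))).symm) ((), i)
    have h2 := w_mu (𝓡 PlanarObj.unit) (𝓡 X)
      (𝓡 (PlanarObj.unit.tensor X)) ((), i)
    refine Eq.trans ?_ ((lcongr_fun h1 _).trans (lcongr_fun h2 _)).symm
    have h3 := lcongr_fun (w_unit (𝓡 PlanarObj.unit)) (ev ())
    change (𝓡 X).w i (𝓜 (Equiv.punitProd _) (ev ((), a))) =
      catL 0 (tmap ((𝓡 PlanarObj.unit).w ()) ((𝓡 X).w i)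
        (tmap ((𝓡 PlanarObj.unit).w' () ∘ₗ nilL d) lid (ev ((), a))))
    rw [tmap_ev, tmap_tens, lmapDomain_apply, mapDomain_single]
    rw [nilL_ev] at h3
    refine ((congrArg (fun x => catL 0 (tens x ((𝓡 X).w i (ev a)))) h3).trans
      (catL_zero _)).symm)
  right_unitality X := toLin_ext (by
    rw [toLin_comp, toLin_comp, toLin_whiskerLeft, toLin_realizeMu, toLin_realizeUnit, toLin_realize,
      toLin_permMat _ _ (URep.mat_rightUnitor _)]
    refine (𝓡 X).ext_left fun i => linOp_ext fun q => ?_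
    obtain ⟨a, ⟨⟩⟩ := q
    have h1 := w_lin_perm (r := 𝓡 (X.tensor PlanarObj.unit))
      (s := 𝓡 X) (PlanarObj.rightE X) (fun _ => rfl)
      (fun i => (ten_unit (mor_le_bim Pi _ _ (X.mem i.1))).symm) (i, ())
    have h2 := w_mu (𝓡 X) (𝓡 PlanarObj.unit)
      (𝓡 (X.tensor PlanarObj.unit)) (i, ())
    refine Eq.trans ?_ ((lcongr_fun h1 _).trans (lcongr_fun h2 _)).symm
    have h3 := lcongr_fun (w_unit (𝓡 PlanarObj.unit)) (ev ())
    change (𝓡 X).w i (𝓜 (Equiv.prodPUnit _) (ev (a, ()))) =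
      catL (X.n i) (tmap ((𝓡 X).w i) ((𝓡 PlanarObj.unit).w ())
        (tmap lid ((𝓡 PlanarObj.unit).w' () ∘ₗ nilL d) (ev (a, ()))))
    rw [tmap_ev, tmap_tens, lmapDomain_apply, mapDomain_single]
    rw [nilL_ev] at h3
    refine ((congrArg (fun x => catL (X.n i) (tens ((𝓡 X).w i (ev a)) x)) h3).trans
      (catL_nil fun l hl => (𝓡 X).w_apply_of_length i _ hl)).symm)

instance realize_faithful : (realize D o).Faithful where
  map_injective {X Y f g} h := PlanarObj.hom_ext (by
    have h' := congrArg toLin h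
    rw [toLin_realize, toLin_realize] at h'
    funext j i
    refine bar_injective D o (PlanarObj.mat_mem f j i).1 (PlanarObj.mat_mem g j i).1 ?_
    rw [← w_lin_w' (r := 𝓡 X) (s := 𝓡 Y) (PlanarObj.mat_mem f), h', w_lin_w' (PlanarObj.mat_mem g)])

theorem realize_additive : (realize D o).Additive where
  map_add {X Y f g} := toLin_ext (by
    have h : ∀ f g : (realize D o).obj X ⟶ (realize D o).obj Y, toLin (f + g) = toLin f + toLin g :=
      fun f g => mtx_injective (by rw [mtx_toLin]; ext i j; simp [mtx, toLin, ofMtx]; rfl)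
    rw [h, toLin_realize, toLin_realize, toLin_realize]
    have : ∀ j i, PlanarObj.mat (f + g) j i = PlanarObj.mat f j i + PlanarObj.mat g j i :=
      fun _ _ => rfl
    simp only [lin, this, map_add, LinearMap.add_comp, LinearMap.comp_add, sum_add_distrib]
    rfl)

theorem realize_linear : (realize D o).Linear ℂ where
  map_smul {X Y} f c := toLin_ext (by
    have h : ∀ f : (realize D o).obj X ⟶ (realize D o).obj Y, toLin (c • f) = c • toLin f :=
      fun f => mtx_injective (by rw [mtx_toLin]; ext i j; simp [mtx, toLin, ofMtx]; rfl)
    rw [h, toLin_realize, toLin_realize]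
    have : ∀ j i, PlanarObj.mat (c • f) j i = c • PlanarObj.mat f j i := fun _ _ => rfl
    simp only [lin, this, map_smul, LinearMap.smul_comp, LinearMap.comp_smul, ← Finset.smul_sum]
    rfl)

theorem realize_adj {X Y : PlanarObj Pi} (f : X ⟶ Y) (g : Y ⟶ X) (h : PlanarObj.IsAdj f g) :
    URep.IsAdj ((realize D o).map f) ((realize D o).map g) :=
  (eqv_lin (PlanarObj.mat_mem f) h).mtx_conjTranspose

theorem realizeMu_adj (X Y : PlanarObj Pi) :
    URep.IsAdj (realizeMu D o X Y).hom (realizeMu D o X Y).inv :=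
  (eqv_mu _ _ _).mtx_conjTranspose

theorem realizeUnit_adj : URep.IsAdj (realizeUnit D o).hom (realizeUnit D o).inv :=
  (((𝓡 PlanarObj.unit).eqv ()).symm.comp eqv_nilL).mtx_conjTranspose

end Equivalence

section SmallGraphs

universe w

open BiLabeledGraph

variable {I : Type w} (Pi : SimpleGraph I)

theorem homMat_of_isModel {K : 𝓑} {S : Type*} {x y : S → List I}
    (h : IsModel K Pi.Adj x y) (l : List I) :
    homMat Pi K (bv l) = ∑ᶠ s : {s // y s = l}, bv (x s.1) := by
  obtain ⟨e, he⟩ := h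
  let E : Fib Pi K l ≃ {s // y s = l} :=
    { toFun := fun φ => ⟨e ⟨φ.1, φ.2.1⟩, (he _).2.trans φ.2.2⟩
      invFun := fun s => ⟨(e.symm s.1).1, (e.symm s.1).2, by
        have := (he (e.symm s.1)).2
        rw [e.apply_symm_apply, s.2] at this
        exact this.symm⟩
      left_inv := fun φ => sext
        (congrArg (fun ψ : Homs K Pi.Adj => ψ.1) (e.symm_apply_apply ⟨φ.1, φ.2.1⟩))
      right_inv := fun s => sext (e.apply_symm_apply _) }
  rw [homMat_bv, ← finsum_comp_equiv E]
  exact finsum_congr fun φ => congrArg bv (he ⟨φ.1, φ.2.1⟩).1.symm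

theorem isConnected_of_isModel {K : 𝓑} (hx : K.x ≠ [])
    (h : ∀ φ ψ : Homs K Iff, φ.xs.head? = ψ.xs.head? → φ = ψ) : K.IsConnected := by
  obtain ⟨v₀, l, hl⟩ := exists_cons_of_ne_nil hx
  refine isConnected_of ⟨v₀⟩ fun f hf v w hv => ?_
  have := h ⟨f, hf⟩ ⟨fun _ => f v₀, fun _ _ _ => Iff.rfl⟩ (by simp [Homs.xs, hl])
  have h1 : ∀ u, f u = f v₀ := fun u => congrFun (congrArg Subtype.val this) u
  rwa [h1 w, ← h1 v]

theorem M01_mem : M 0 1 ∈ planarGraphs :=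
  planarGraphs_isGraphCategory.transpose_mem (M 1 0) fun _ hD => hD.2.1

theorem M21_mem : M 2 1 ∈ planarGraphs :=
  planarGraphs_isGraphCategory.transpose_mem (M 1 2) M12_mem

def pathGraph : 𝓑 :=
  (((M 1 2).tensor (M 1 1)).comp (((M 1 1).tensor edge).tensor (M 1 1))).comp
    ((M 1 1).tensor (M 2 1))

theorem isModel_pathGraph {J : Type*} (R : J → J → Prop) : IsModel pathGraph R
    (S := {p : J × J // R p.1 p.2 ∧ R p.2 p.1}) (fun p => [p.1.1, p.1.2]) fun p => [p.1.1, p.1.2] := by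
  have h1 := (isModel_M 1 2 R).tensor (isModel_M 1 1 R)
  have h2 := ((isModel_M 1 1 R).tensor (isModel_edge R)).tensor (isModel_M 1 1 R)
  have h3 := (isModel_M 1 1 R).tensor (isModel_M 2 1 R)
  refine ((h1.comp rfl h2).comp rfl h3).map (fun z => z.1.1.1.2.1.2) ⟨?_, ?_⟩ ?_ ?_
  · rintro ⟨⟨⟨⟨⟨a, b⟩, ⟨c, e⟩, f⟩, h⟩, ⟨g, k⟩⟩, h'⟩ ⟨⟨⟨⟨⟨a', b'⟩, ⟨c', e'⟩, f'⟩, t⟩, ⟨g', k'⟩⟩, t'⟩ (rfl : e = e')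
    simp [replicate] at h h' t t'
    grind
  · rintro ⟨⟨a, b⟩, hab⟩
    exact ⟨⟨(⟨((a, b), ((a, ⟨(a, b), hab⟩), b)), by simp⟩, (a, b)), by simp⟩, rfl⟩
  · rintro ⟨⟨⟨⟨⟨a, b⟩, ⟨c, e⟩, f⟩, h⟩, ⟨g, k⟩⟩, h'⟩; simp [replicate] at h h' ⊢; grind
  · rintro ⟨⟨⟨⟨⟨a, b⟩, ⟨c, e⟩, f⟩, h⟩, ⟨g, k⟩⟩, h'⟩; simp [replicate] at h h' ⊢; grind

theorem isL_pathGraph : IsL 1 1 pathGraph where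
  planar := by
    have hc := planarGraphs_isGraphCategory
    exact hc.comp_mem _ _ (hc.comp_mem _ _ (hc.tensor_mem _ _ M12_mem hc.one_mem)
      (hc.tensor_mem _ _ (hc.tensor_mem _ _ hc.one_mem fun _ hD => hD.2.2.2) hc.one_mem) rfl)
      (hc.tensor_mem _ _ hc.one_mem M21_mem) rfl
  connected := by
    refine isConnected_of_isModel (by simp [pathGraph, comp, BiLabeledGraph.tensor, M]) fun φ ψ h => ?_
    obtain ⟨e, he⟩ := isModel_pathGraph Iff
    rw [← (he φ).1, ← (he ψ).1] at h
    have h1 : (e φ).1.1 = (e ψ).1.1 := by simpa using h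
    have h2 := propext (e φ).2.1
    have h3 := propext (e ψ).2.1
    exact e.injective (sext (Prod.ext h1 (by rw [← h2, ← h3, h1])))
  length_x := rfl
  length_y := rfl
  head := by
    obtain ⟨e, he⟩ := isModel_pathGraph (J := pathGraph.V) fun _ _ => True
    have := he ⟨id, fun _ _ _ => trivial⟩
    have h1 : pathGraph.x = pathGraph.y := by
      have := this.1.symm.trans this.2
      simpa [Homs.xs, Homs.ys] using this
    rw [h1]
  last := by
    obtain ⟨e, he⟩ := isModel_pathGraph (J := pathGraph.V) fun _ _ => True
    have := he ⟨id, fun _ _ _ => trivial⟩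
    have h1 : pathGraph.x = pathGraph.y := by
      have := this.1.symm.trans this.2
      simpa [Homs.xs, Homs.ys] using this
    rw [h1]

open Classical in
theorem homMat_pathGraph (a b : I) :
    homMat Pi pathGraph (bv [a, b]) = if Pi.Adj a b then bv [a, b] else 0 := by
  rw [homMat_of_isModel Pi (isModel_pathGraph Pi.Adj)]
  split_ifs with h
  · rw [finsum_eq_single _ ⟨⟨(a, b), h, h.symm⟩, rfl⟩]
    rintro ⟨⟨⟨c, e⟩, h1⟩, h2⟩ hne
    simp at h2
    obtain ⟨rfl, rfl⟩ := h2
    exact absurd rfl hne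
  · have : IsEmpty {s : {p : I × I // Pi.Adj p.1 p.2 ∧ Pi.Adj p.2 p.1} // [s.1.1, s.1.2] = [a, b]} := by
      refine ⟨?_⟩
      rintro ⟨⟨⟨c, e⟩, h1⟩, h2⟩
      simp at h2
      obtain ⟨rfl, rfl⟩ := h2
      exact h h1.1
    exact finsum_of_isEmpty _

theorem isL_M21 : IsL 1 0 (M 2 1) where
  planar := M21_mem
  connected := ⟨⟨()⟩, fun _ _ => .refl⟩
  length_x := rfl
  length_y := rfl
  head := rfl
  last := rfl

theorem homMat_M21 (a : I) : homMat Pi (M 2 1) (bv [a]) = bv [a, a] := by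
  rw [homMat_of_isModel Pi (isModel_M 2 1 Pi.Adj), finsum_eq_single _ ⟨a, rfl⟩]
  · rfl
  · rintro ⟨c, h⟩ hne; simp at h; exact absurd (sext h) hne

/-- The graph that removes a label. -/
def forgetGraph : 𝓑 := ((M 1 1).tensor (M 0 1)).tensor (M 1 1)

theorem isModel_forgetGraph {J : Type*} (R : J → J → Prop) : IsModel forgetGraph R
    (S := (J × J) × J) (fun p => [p.1.1, p.2]) fun p => [p.1.1, p.1.2, p.2] :=
  ((isModel_M 1 1 R).tensor (isModel_M 0 1 R)).tensor (isModel_M 1 1 R)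

theorem homMat_forgetGraph (a b c : I) : homMat Pi forgetGraph (bv [a, b, c]) = bv [a, c] := by
  rw [homMat_of_isModel Pi (isModel_forgetGraph Pi.Adj), finsum_eq_single _ ⟨((a, b), c), rfl⟩]
  rintro ⟨⟨⟨a', b'⟩, c'⟩, h⟩ hne
  simp at h
  obtain ⟨rfl, rfl, rfl⟩ := h
  exact absurd rfl hne

theorem homMat_of_length {K : 𝓑} {l : List I} (h : l.length ≠ K.y.length) :
    homMat Pi K (bv l) = 0 := by
  have : IsEmpty (Fib Pi K l) := ⟨fun φ => h (length_of_fib Pi φ)⟩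
  rw [homMat_bv, finsum_of_isEmpty]

theorem finite_fib_forgetGraph (l : List I) : Finite (Fib Pi forgetGraph l) := by
  have h : ∀ n m, ∀ l, m ≠ 0 → Finite (Fib Pi (M n m) l) := fun n m l hm => by
    refine @Finite.of_subsingleton _ ⟨fun φ ψ => sext (funext fun v => ?_)⟩
    have := (map_replicate (f := φ.1)).symm.trans
      ((φ.2.2.trans ψ.2.2.symm).trans (map_replicate (f := ψ.1)))
    exact (List.replicate_inj.1 this).2.resolve_left hm
  exact finite_fib_tensor Pi (finite_fib_tensor Pi (fun l => h 1 1 l one_ne_zero)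
    fun l => h 0 1 l one_ne_zero) (fun l => h 1 1 l one_ne_zero) l

theorem IsL.forget {m : ℕ} {K : 𝓑} (hK : IsL 2 m K) : IsL 1 m (forgetGraph.comp K) := by
  have hl : forgetGraph.y.length = K.x.length := hK.length_x.symm
  obtain ⟨⟨e, he⟩⟩ : Nonempty {e : K.V × K.V × K.V // K.x = [e.1, e.2.1, e.2.2]} := by
    have := hK.length_x
    match h : K.x, this with
    | [a, b, c], _ => exact ⟨(a, b, c), rfl⟩
  have key : ∀ {J : Type} (f : (forgetGraph.comp K).V → J),
      [f (cl _ _ (tl _ _ (tl _ _ ()))), f (cl _ _ (tl _ _ (tr _ _ ()))), f (cl _ _ (tr _ _ ()))] =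
        [f (cr _ _ e.1), f (cr _ _ e.2.1), f (cr _ _ e.2.2)] := by
    intro J f
    have := comp_agree hl f
    rw [he] at this
    exact this
  refine ⟨planarGraphs_isGraphCategory.comp_mem _ _
    (planarGraphs_isGraphCategory.tensor_mem _ _ (planarGraphs_isGraphCategory.tensor_mem _ _
      planarGraphs_isGraphCategory.one_mem M01_mem) planarGraphs_isGraphCategory.one_mem)
    hK.planar hl, isConnected_of ⟨cr _ _ e.1⟩ ?_, rfl, ?_, ?_, ?_⟩
  · intro f hf
    have h2 : ∀ v w : K.V, f (cr forgetGraph K v) = f (cr forgetGraph K w) := fun v w =>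
      propext ⟨IsConnected_const hK.connected _ (fun v w h => hf _ _ (adj_cr h)) v w,
        IsConnected_const hK.connected _ (fun v w h => hf _ _ (adj_cr h)) w v⟩
    have h3 : ∀ v, f v = f (cr forgetGraph K e.1) := by
      have h := key f
      simp only [List.cons.injEq, and_true] at h
      intro v
      rcases comp_cases v with ⟨u, rfl⟩ | ⟨u, rfl⟩
      · rcases u with (⟨⟩ | ⟨⟩) | ⟨⟩
        exacts [h.1, h.2.1.trans (h2 _ _), h.2.2.trans (h2 _ _)]
      · exact h2 _ _
    intro v w hv
    rwa [h3 w, ← h3 v]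
  · exact (length_map _).trans hK.length_y
  all_goals
    have h := key id
    simp only [List.cons.injEq, id] at h
  · have h1 : (K.y.map (cr forgetGraph K)).head? = some (cr forgetGraph K e.1) := by
      rw [List.head?_map, ← hK.head, he]; rfl
    exact (congrArg some h.1).trans h1.symm
  · have h1 : (K.y.map (cr forgetGraph K)).getLast? = some (cr forgetGraph K e.2.2) := by
      rw [List.getLast?_map, ← hK.last, he]; rfl
    exact (congrArg some h.2.2.1).trans h1.symm

theorem forget_mul_mem [Pi.LocallyFinite] {m : ℕ} {T : Op I} (hT : T ∈ Mor Pi 2 m) :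
    homMat Pi forgetGraph * T ∈ Mor Pi 1 m := by
  induction hT using span_induction with
  | mem T h =>
    obtain ⟨K, hK, rfl⟩ := h
    rw [← homMat_comp Pi (K := forgetGraph) (K' := K) hK.length_x.symm (finite_fib_forgetGraph Pi) (finite_fib Pi hK)]
    exact subset_span ⟨_, hK.forget, rfl⟩
  | zero => rw [mul_zero]; exact Submodule.zero_mem _
  | add T T' _ _ h h' => rw [mul_add]; exact Submodule.add_mem _ h h'
  | smul c T _ h => rw [mul_smul_comm]; exact smul_mem _ c h

end SmallGraphs

section Blocks

variable {X : Type} [Fintype X] [DecidableEq X]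

def lenProj (n : ℕ) : Op X := Finsupp.lift _ ℂ _ fun w => if w.length = n then bv w else 0

theorem lenProj_bv (n : ℕ) (w : List X) :
    lenProj n (bv w) = if w.length = n then bv w else 0 := by simp [lenProj]

theorem lenProj_apply (n : ℕ) (f : 𝓥 X) (w : List X) :
    lenProj n f w = if w.length = n then f w else 0 := by
  induction f using ev_induction with
  | zero => simp
  | add f g h h' => rw [map_add, fadd_apply, h, h']; split_ifs <;> simp
  | single a c =>
    rw [map_smul, lenProj_bv]
    by_cases h : a = w
    · subst h; split_ifs <;> simp
    · split_ifs <;> simp [single_eq_of_ne (Ne.symm h)]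

def blockTen {α β : Type*} (m n : ℕ) (S T : LinOp (List α) (List β)) : LinOp (List α) (List β) :=
  catL n ∘ₗ tmap S T ∘ₗ splitL m

theorem blockTen_bv {α β : Type*} {m : ℕ} (n : ℕ) (S T : LinOp (List α) (List β)) {a : List α}
    (b : List α) (h : a.length = m) :
    blockTen m n S T (bv (a ++ b)) = catL n (tens (S (bv a)) (T (bv b))) := by
  rw [blockTen, lcomp_apply, lcomp_apply, splitL_ev, if_pos (by simp [h]),
    take_left' h, drop_left' h, tmap_ev]

theorem blockTen_bv_short {α β : Type*} {m : ℕ} (n : ℕ) (S T : LinOp (List α) (List β)) {l : List α}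
    (h : l.length < m) : blockTen m n S T (bv l) = 0 := by
  rw [blockTen, lcomp_apply, lcomp_apply, splitL_ev, if_neg (by omega), map_zero, map_zero]

theorem catL_tens_bv {α : Type*} {n : ℕ} {a : List α} (b : List α) (h : a.length = n) :
    catL n (tens (bv a) (bv b)) = bv (a ++ b) := by rw [tens_ev, catL_ev, if_pos h]

theorem blockTen_ext {α β : Type*} {m n : ℕ} {S T : LinOp (List α) (List β)}
    {R : LinOp (List α) (List β)} (h : ∀ a b, a.length = m →
      R (bv (a ++ b)) = catL n (tens (S (bv a)) (T (bv b)))) (h' : ∀ l, l.length < m → R (bv l) = 0) :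
    R = blockTen m n S T :=
  linOp_ext fun l => by
    by_cases hl : l.length < m
    · rw [blockTen_bv_short n S T hl, h' l hl]
    · have ha : (l.take m).length = m := by rw [length_take]; omega
      rw [← take_append_drop m l, blockTen_bv n S T _ ha, h _ _ ha]

theorem shift_mul_lenProj {F : ℕ → Op X} {m n : ℕ} (hF : ∀ a p b : List X, p.length = m →
      F a.length (bv (a ++ (p ++ b))) = catL a.length (tens (bv a) (catL n (tens (F 0 (bv p)) (bv b)))))
    (r s : ℕ) : F r * lenProj (r + (m + s)) =
      blockTen r r (lenProj r) (blockTen m n (F 0 * lenProj m) (lenProj s)) := by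
  refine blockTen_ext (fun a b ha => ?_) fun l hl => ?_
  · subst ha
    rw [emul_apply, lenProj_bv, lenProj_bv, if_pos rfl]
    by_cases hb : b.length < m
    · rw [blockTen_bv_short _ _ _ hb, if_neg (by simp; omega), map_zero, map_zero, map_zero]
    · obtain ⟨p, b, hp, rfl⟩ := exists_split (not_lt.1 hb)
      rw [blockTen_bv _ _ _ _ hp, emul_apply, lenProj_bv, lenProj_bv, if_pos hp]
      by_cases hs : b.length = s
      · rw [if_pos (by simp [hp, hs]), if_pos hs, hF _ _ _ hp]
      · rw [if_neg (by simp [hp, hs]), if_neg hs]; simp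
  · rw [emul_apply, lenProj_bv, if_neg (by omega), map_zero]

theorem insertPair_mul_lenProj (r s : ℕ) : (insertPair r * lenProj (r + (0 + s)) : Op X) =
    blockTen r r (lenProj r) (blockTen 0 2 (insertPair 0 * lenProj 0) (lenProj s)) :=
  shift_mul_lenProj (fun a p b hp => by
    obtain rfl := List.length_eq_zero_iff.1 hp
    have h := insertPair_bv ([] : List X) []
    rw [length_nil, nil_append] at h
    rw [insertPair_bv, h]
    simp [catL_tens_bv]) r s

theorem contractPair_mul_lenProj (r s : ℕ) : (contractPair r * lenProj (r + (2 + s)) : Op X) =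
    blockTen r r (lenProj r) (blockTen 2 0 (contractPair 0 * lenProj 2) (lenProj s)) :=
  shift_mul_lenProj (fun a p b hp => by
    obtain ⟨c, c', rfl⟩ := List.length_eq_two.1 hp
    have h := contractPair_bv ([] : List X) [] c c'
    rw [length_nil, nil_append] at h
    refine (contractPair_bv a b c c').trans ?_
    rw [h]
    split_ifs <;> simp [catL_tens_bv]) r s

theorem diagPair_mul_lenProj (r s : ℕ) : (diagPair r * lenProj (r + (2 + s)) : Op X) =
    blockTen r r (lenProj r) (blockTen 2 2 (diagPair 0 * lenProj 2) (lenProj s)) :=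
  shift_mul_lenProj (fun a p b hp => by
    obtain ⟨c, c', rfl⟩ := List.length_eq_two.1 hp
    have h := diagPair_bv ([] : List X) [] c c'
    rw [length_nil, nil_append] at h
    refine (diagPair_bv a b c c').trans ?_
    rw [h]
    split_ifs <;> simp [catL_tens_bv]) r s

theorem lenProj_add (n m : ℕ) : (lenProj (n + m) : Op X) = blockTen n n (lenProj n) (lenProj m) := by
  refine blockTen_ext (fun a b ha => ?_) fun l hl => ?_
  · rw [lenProj_bv, lenProj_bv, lenProj_bv, if_pos ha]
    by_cases hb : b.length = m
    · rw [if_pos (by simp [ha, hb]), if_pos hb, catL_tens_bv _ ha]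
    · rw [if_neg (by simp [ha, hb]), if_neg hb]; simp
  · rw [lenProj_bv, if_neg (by omega)]

end Blocks

section Letters

variable (d : ℕ)

theorem map_z2Gen_injective : Inj (List.map (z2Gen d)) :=
  List.map_injective_iff.2 fun i j h => by
    have := congrArg (redWord d) h
    simpa [redWord_gen] using this

def genL : LinOp (List (Fin d)) (𝓦 d) := 𝓜 (List.map (z2Gen d))

def genL' : LinOp (𝓦 d) (List (Fin d)) :=
  lcomapDomain (List.map (z2Gen d)) (map_z2Gen_injective d)

variable {d}

@[simp] theorem genL_bv (w : List (Fin d)) : genL d (bv w) = bv (w.map (z2Gen d)) := by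
  rw [genL, lmapDomain_apply, mapDomain_single]

theorem genL'_apply (f : 𝓦 d →₀ ℂ) (w : List (Fin d)) : genL' d f w = f (w.map (z2Gen d)) := rfl

theorem genL_apply (f : 𝓥 (Fin d)) (w : List (Fin d)) : genL d f (w.map (z2Gen d)) = f w :=
  mapDomain_apply (map_z2Gen_injective d) f w

theorem genL'_genL : genL' d ∘ₗ genL d = lid := lext fun f => fext (genL_apply f)

@[simp] theorem genL'_bv (w : List (Fin d)) : genL' d (bv (w.map (z2Gen d))) = bv w := by
  rw [← genL_bv]; exact lcongr_fun genL'_genL _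

theorem genL'_of_not_mem {G : 𝓦 d} (h : ∀ w : List (Fin d), w.map (z2Gen d) ≠ G) :
    genL' d (bv G) = 0 :=
  fext fun w => by classical rw [genL'_apply, single_eq_of_ne (h w)]; rfl

theorem splitL_genL' (m : ℕ) : splitL m ∘ₗ genL' d = tmap (genL' d) (genL' d) ∘ₗ splitL m :=
  linOp_ext fun G => by
    rw [lcomp_apply, lcomp_apply]
    by_cases h : ∃ w : List (Fin d), w.map (z2Gen d) = G
    · obtain ⟨w, rfl⟩ := h
      rw [genL'_bv, splitL_ev, splitL_ev, length_map]
      split_ifs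
      · rw [tmap_ev, ← map_take, ← map_drop, genL'_bv, genL'_bv, tens_ev]
      · simp
    · push Not at h
      rw [genL'_of_not_mem h, map_zero, splitL_ev]
      split_ifs
      · rw [tmap_ev]
        by_cases h1 : ∃ w : List (Fin d), w.map (z2Gen d) = G.take m
        · obtain ⟨w, hw⟩ := h1
          rw [genL'_of_not_mem (G := G.drop m) fun w' h' => h (w ++ w') (by
            rw [map_append, hw, h', take_append_drop]), map_zero]
        · push Not at h1; rw [genL'_of_not_mem h1, map_zero, LinearMap.zero_apply]
      · simp

theorem genL_catL (n : ℕ) : genL d ∘ₗ catL n = catL n ∘ₗ tmap (genL d) (genL d) :=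
  linOp_ext fun p => by
    rw [lcomp_apply, lcomp_apply, tmap_ev, genL_bv, genL_bv, tens_ev, catL_ev,
      catL_ev, length_map, ← map_append]
    split_ifs <;> simp

theorem genL_blockTen {α : Type*} (m n : ℕ) (S T : LinOp (List α) (List (Fin d))) :
    genL d ∘ₗ blockTen m n S T = blockTen m n (genL d ∘ₗ S) (genL d ∘ₗ T) := by
  rw [blockTen, blockTen, ← comp_assoc, genL_catL, comp_assoc, ← comp_assoc (splitL m), tmap_comp]

theorem blockTen_genL' {α : Type*} (m n : ℕ) (S T : LinOp (List (Fin d)) (List α)) :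
    blockTen m n (S ∘ₗ genL' d) (T ∘ₗ genL' d) = blockTen m n S T ∘ₗ genL' d := by
  simp only [blockTen, ← tmap_comp, comp_assoc, splitL_genL']

/-- Operators on words in the generators as operators on tuples of group elements. -/
def push : Op (Fin d) →ₗ[ℂ] Op (Z2Free d) :=
  llcomp ℂ _ _ _ (genL d) ∘ₗ lcomp ℂ _ (genL' d)

theorem push_eq (T : Op (Fin d)) : push T = genL d ∘ₗ T ∘ₗ genL' d := rfl

theorem push_mul (S T : Op (Fin d)) : push (S * T) = push S * push T := by
  change _ = (genL d ∘ₗ S ∘ₗ genL' d) ∘ₗ genL d ∘ₗ T ∘ₗ genL' d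
  rw [comp_assoc, comp_assoc, ← comp_assoc _ (genL d), genL'_genL, id_comp]; rfl

theorem push_blockTen (m n : ℕ) (S T : Op (Fin d)) :
    push (blockTen m n S T) = blockTen m n (push S) (push T) := by
  rw [push_eq, push_eq, push_eq, ← genL_blockTen, blockTen_genL']

end Letters

section MorBar

universe w

variable {I : Type w} {Pi : SimpleGraph I} {d : ℕ} (D : Displacement Pi d) [Pi.LocallyFinite] (o : I)

/-- The space `Mor n m` as operators on tuples of group elements. -/
def morBar (n m : ℕ) : Submodule ℂ (Op (Z2Free d)) := (Mor Pi n m).map (bar D o)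

variable {D o} {n m k n' m' : ℕ} {S T T' : Op (Z2Free d)}

theorem morBar_mul (hS : S ∈ morBar D o n k) (hT : T ∈ morBar D o k m) : S * T ∈ morBar D o n m := by
  obtain ⟨S, hS, rfl⟩ := hS
  obtain ⟨T, hT, rfl⟩ := hT
  exact ⟨S * T, mor_mul Pi hS hT, bar_mul D o (mor_le_bim Pi _ _ hS) (mor_le_bim Pi _ _ hT)⟩

theorem exists_morBar_adj (hT : T ∈ morBar D o n m) : ∃ T' ∈ morBar D o m n, OpAdj T T' := by
  obtain ⟨T, hT, rfl⟩ := hT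
  obtain ⟨T', h⟩ := exists_morAdj D hT
  exact ⟨_, ⟨T', h.mem', rfl⟩, bar_adj D o h.adj⟩

theorem morBar_of_adj (hT : T ∈ morBar D o n m) (h : OpAdj T T') : T' ∈ morBar D o m n := by
  obtain ⟨T'', h1, h2⟩ := exists_morBar_adj hT
  rwa [h.symm.ext h2.symm]

theorem morBar_bv (hT : T ∈ morBar D o n m) {G : 𝓦 d} (h : G.length ≠ m) : T (bv G) = 0 := by
  obtain ⟨T, hT, rfl⟩ := hT
  exact bar_apply_of_length D o (mor_le_bim Pi _ _ hT) h

theorem morBar_blockTen (hS : S ∈ morBar D o n m) (hT : T ∈ morBar D o n' m') :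
    blockTen m n S T ∈ morBar D o (n + n') (m + m') := by
  obtain ⟨S, hS, rfl⟩ := hS
  obtain ⟨T, hT, rfl⟩ := hT
  refine ⟨ten m S T, mor_ten Pi hS hT, ?_⟩
  rw [blockTen, ← comp_assoc, ← bar_ten D o hS hT, comp_assoc]
  refine linOp_ext fun l => ?_
  rw [lcomp_apply, lcomp_apply, catL_splitL]
  split_ifs with h
  · rfl
  · rw [map_zero, bar_apply_of_length D o (mor_le_bim Pi _ _ (mor_ten Pi hS hT)) (by omega)]

theorem morBar_ext (hS : S ∈ morBar D o n m) (hT : ∀ G, G.length ≠ m → T (bv G) = 0)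
    (h : ∀ G, G.length = m → S (bv G) = T (bv G)) : S = T :=
  linOp_ext fun G => by
    by_cases hG : G.length = m
    · exact h G hG
    · rw [hT G hG]; exact morBar_bv hS hG

end MorBar

section Generators

universe w

variable {I : Type w} {Pi : SimpleGraph I} {d : ℕ} {D : Displacement Pi d} [Pi.LocallyFinite] {o : I}

theorem bar_bv {T : Op I} {G H : 𝓦 d} (h : T (bv (D.path o G)) = bv (D.path o H)) :
    bar D o T (bv G) = bv H :=
  fext fun K => by
    classical
    rw [bar_apply, h]
    simp [single_apply, (D.path_injective o).eq_iff]

theorem lenProj_adj {X : Type} [Fintype X] [DecidableEq X] (n : ℕ) : OpAdj (lenProj n : Op X) (lenProj n) := fun i j => by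
  rw [lenProj_apply, lenProj_apply, single_apply, single_apply]
  by_cases h : i = j
  · subst h; split_ifs <;> simp
  · simp [h, Ne.symm h]

theorem push_bv (T : Op (Fin d)) (w : List (Fin d)) : push T (bv (w.map (z2Gen d))) = genL d (T (bv w)) := by
  rw [push_eq, lcomp_apply, lcomp_apply, genL'_bv]

theorem push_adj {T T' : Op (Fin d)} (h : OpAdj T T') : OpAdj (push T) (push T') := fun i j => by
  have h0 : ∀ {T : Op (Fin d)} {i}, (∀ w : List (Fin d), w.map (z2Gen d) ≠ i) → push T (bv i) = 0 := fun hi => by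
    rw [push_eq, lcomp_apply, lcomp_apply, genL'_of_not_mem hi, map_zero, map_zero]
  have h1 : ∀ {x} {i}, (∀ w : List (Fin d), w.map (z2Gen d) ≠ i) → genL d x i = 0 := fun hi =>
    Finsupp.mapDomain_of_notMem_range _ _ fun ⟨w, hw⟩ => hi w hw
  by_cases hi : ∃ w : List (Fin d), w.map (z2Gen d) = i
  · obtain ⟨v, rfl⟩ := hi
    by_cases hj : ∃ w : List (Fin d), w.map (z2Gen d) = j
    · obtain ⟨w, rfl⟩ := hj; rw [push_bv, push_bv, genL_apply, genL_apply, h]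
    · push Not at hj; rw [h0 hj, push_eq, lcomp_apply, h1 hj]; simp
  · push Not at hi; rw [h0 hi, push_eq, lcomp_apply, h1 hi]; simp

theorem morBar_apply {n m : ℕ} {T : Op (Z2Free d)} (hT : T ∈ morBar D o n m) {G H : 𝓦 d}
    (h : H.length ≠ n) : T (bv G) H = 0 := by
  obtain ⟨T', hT', ha⟩ := exists_morBar_adj hT
  rw [ha.symm, morBar_bv hT' h]; simp

theorem genL'_length {T : LinOp (List (Fin d)) (𝓦 d)} {m : ℕ} (hT : ∀ w, w.length ≠ m → T (bv w) = 0)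
    (G : 𝓦 d) (hG : G.length ≠ m) : (T ∘ₗ genL' d) (bv G) = 0 := by
  rw [lcomp_apply]
  by_cases h : ∃ w : List (Fin d), w.map (z2Gen d) = G
  · obtain ⟨w, rfl⟩ := h; rw [genL'_bv, hT _ (by simpa using hG)]
  · push Not at h; rw [genL'_of_not_mem h, map_zero]

theorem bar_pathGraph : bar D o (homMat Pi pathGraph) = push (lenProj 1) := by
  classical
  have hm : bar D o (homMat Pi pathGraph) ∈ morBar D o 1 1 :=
    ⟨_, subset_span ⟨_, isL_pathGraph, rfl⟩, rfl⟩
  refine morBar_ext hm (genL'_length (T := genL d ∘ₗ lenProj 1) fun w hw => ?_) fun G hG => ?_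
  · rw [lcomp_apply, lenProj_bv, if_neg hw, map_zero]
  · obtain ⟨g, rfl⟩ := List.length_eq_one_iff.1 hG
    have hp : D.path o [g] = [o, D.move o g] := rfl
    have hmat := homMat_pathGraph Pi o (D.move o g)
    by_cases h : Pi.Adj o (D.move o g)
    · obtain ⟨s, hs⟩ := (D.adj _ _).1 h
      rw [D.δ_move] at hs
      subst hs
      rw [bar_bv (H := [z2Gen d s]) (by rw [hp, hmat, if_pos h])]
      refine Eq.trans ?_ (push_bv (lenProj 1) [s]).symm
      rw [lenProj_bv]; simp
    · have h0 : ∀ w : List (Fin d), w.map (z2Gen d) ≠ [g] := fun w hw => h ((D.adj _ _).2 (by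
        obtain ⟨s, rfl⟩ := List.length_eq_one_iff.1 ((length_map _).symm.trans (congrArg List.length hw))
        exact ⟨s, by rw [D.δ_move]; exact (List.cons.inj hw).1.symm⟩))
      refine Eq.trans ?_ (congrArg (genL d ∘ₗ lenProj 1) (genL'_of_not_mem h0)).symm
      rw [map_zero]
      ext H
      rw [bar_apply, hp, hmat, if_neg h]; rfl

theorem push_lenProj_one : push (lenProj 1) ∈ morBar D o 1 1 :=
  bar_pathGraph (D := D) (o := o) ▸ ⟨_, subset_span ⟨_, isL_pathGraph, rfl⟩, rfl⟩

theorem push_lenProj_zero : push (lenProj 0) ∈ morBar D o 0 0 := by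
  have hm : bar D o unitOp ∈ morBar D o 0 0 := ⟨_, unitOp_mem Pi, rfl⟩
  convert hm
  refine (morBar_ext hm (genL'_length (T := genL d ∘ₗ lenProj 0) fun w hw => ?_) fun G hG => ?_).symm
  · rw [lcomp_apply, lenProj_bv, if_neg hw, map_zero]
  · obtain rfl := List.length_eq_zero_iff.1 hG
    rw [bar_bv (H := []) (by rw [unitOp_bv]; rfl)]
    refine Eq.trans ?_ (push_bv (lenProj 0) []).symm
    rw [lenProj_bv]; simp

theorem push_lenProj (n : ℕ) : push (lenProj n) ∈ morBar D o n n := by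
  induction n with
  | zero => exact push_lenProj_zero
  | succ n ih =>
    rw [lenProj_add, push_blockTen]
    exact morBar_blockTen ih push_lenProj_one

theorem forget_mem {m : ℕ} {T : Op (Z2Free d)} (hT : T ∈ morBar D o 2 m) :
    bar D o (homMat Pi forgetGraph) * T ∈ morBar D o 1 m := by
  obtain ⟨T, hT, rfl⟩ := hT
  refine ⟨_, forget_mul_mem Pi hT, lext fun x => ?_⟩
  exact (congrArg (fun y : 𝓥 I => (lcomapDomain (D.path o)
    (D.path_injective o) : LinOp (List I) (𝓦 d)) (homMat Pi forgetGraph y)) (lmapDomain_bar D o (mor_le_bim Pi _ _ hT) x)).symm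

theorem bar_forget (g h : Z2Free d) : bar D o (homMat Pi forgetGraph) (bv [g, h]) = bv [g * h] :=
  bar_bv ((homMat_forgetGraph Pi _ _ _).trans (by
    rw [show D.path o [g * h] = [o, D.move o (g * h)] from rfl]
    have := D.move_δ o (D.move (D.move o g) h)
    rw [← D.mul o (D.move o g), D.δ_move, D.δ_move] at this
    rw [this]))

def wordProd (d k : ℕ) : LinOp (List (Fin d)) (𝓦 d) :=
  𝓜 (fun w => [(w.map (z2Gen d)).prod]) ∘ₗ lenProj k

theorem wordProd_bv (k : ℕ) (w : List (Fin d)) :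
    wordProd d k (bv w) = if w.length = k then bv [(w.map (z2Gen d)).prod] else 0 := by
  rw [wordProd, lcomp_apply, lenProj_bv]
  split_ifs
  · rw [lmapDomain_apply, mapDomain_single]
  · exact map_zero _

theorem wordProd_mem (k : ℕ) : wordProd d k ∘ₗ genL' d ∈ morBar D o 1 k := by
  induction k with
  | zero =>
    have hm : bar D o (homMat Pi (BiLabeledGraph.M 2 1)) ∈ morBar D o 1 0 :=
      ⟨_, subset_span ⟨_, isL_M21, rfl⟩, rfl⟩
    convert hm
    refine (morBar_ext hm (genL'_length fun w hw => ?_) fun G hG => ?_).symm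
    · rw [wordProd_bv, if_neg hw]
    · obtain rfl := List.length_eq_zero_iff.1 hG
      rw [bar_bv (H := [1]) ((homMat_M21 Pi o).trans (by
        rw [show D.path o [1] = [o, D.move o 1] from rfl]
        have := D.move_δ o o
        rw [D.self] at this
        rw [this])), lcomp_apply]
      refine Eq.trans ?_ (congrArg (wordProd d 0) (genL'_bv [])).symm
      rw [wordProd_bv]; rfl
  | succ k ih =>
    have h0 : push (lenProj 1) ∈ morBar D o 1 1 := push_lenProj_one
    have h1 := morBar_blockTen h0 ih
    have h := forget_mem h1
    rw [Nat.add_comm] at h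
    convert h using 1
    change _ = bar D o (homMat Pi forgetGraph) ∘ₗ _
    rw [push_eq, ← comp_assoc, blockTen_genL', ← comp_assoc]
    refine congrArg (· ∘ₗ genL' d) ?_
    refine linOp_ext fun w => ?_
    rw [lcomp_apply, wordProd_bv]
    cases w with
    | nil => rw [blockTen_bv_short _ _ _ (by simp)]; simp
    | cons a w =>
      have h3 := blockTen_bv (m := 1) 1 (genL d ∘ₗ lenProj 1) (wordProd d k) (a := [a]) w rfl
      rw [show a :: w = [a] ++ w from rfl, h3, lcomp_apply, lenProj_bv,
        if_pos (c := [a].length = 1) rfl, genL_bv, wordProd_bv]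
      by_cases hw : w.length = k
      · rw [if_pos (by simp [hw]), if_pos hw, List.map_singleton, catL_tens_bv (n := 1) _ rfl]
        exact (bar_forget _ _).symm
      · rw [if_neg (by simpa using hw), if_neg hw]; simp

end Generators

section WordMor

universe w

variable {I : Type w} {Pi : SimpleGraph I} {d : ℕ} (D : Displacement Pi d) [Pi.LocallyFinite] (o : I)

/-- The operators on words in the generators that belong to the path category. -/
def wordMor (n m : ℕ) : Submodule ℂ (Op (Fin d)) := (morBar D o n m).comap push

variable {D o} {n m k n' m' : ℕ} {S T T' : Op (Fin d)}

theorem lenProj_mem (n : ℕ) : lenProj n ∈ wordMor D o n n := push_lenProj n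

theorem wordMor_mul (hS : S ∈ wordMor D o n k) (hT : T ∈ wordMor D o k m) : S * T ∈ wordMor D o n m := by
  change push (S * T) ∈ morBar D o n m
  rw [push_mul]
  exact morBar_mul hS hT

theorem wordMor_blockTen (hS : S ∈ wordMor D o n m) (hT : T ∈ wordMor D o n' m') :
    blockTen m n S T ∈ wordMor D o (n + n') (m + m') := by
  change push _ ∈ morBar D o (n + n') (m + m')
  rw [push_blockTen]
  exact morBar_blockTen hS hT

theorem wordMor_adj (hT : T ∈ wordMor D o n m) (h : OpAdj T T') : T' ∈ wordMor D o m n :=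
  morBar_of_adj hT (push_adj h)

theorem pull_mem {T : Op (Z2Free d)} (hT : T ∈ morBar D o n m) :
    lenProj n * (genL' d ∘ₗ T ∘ₗ genL d) * lenProj m ∈ wordMor D o n m := by
  have h : push (lenProj n * (genL' d ∘ₗ T ∘ₗ genL d) * lenProj m) =
    push (lenProj n) * (T * push (lenProj m)) := lext fun x => rfl
  change push _ ∈ morBar D o n m
  rw [h]
  exact morBar_mul (push_lenProj n) (morBar_mul hT (push_lenProj m))

theorem exists_gram (k : ℕ) : ∃ T ∈ wordMor D o 2 k, ∀ w w', T (bv w) w' =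
    if w.length = k ∧ w'.length = 2 ∧ (w'.map (z2Gen d)).prod = (w.map (z2Gen d)).prod then 1 else 0 := by
  classical
  obtain ⟨U, hU, ha⟩ := exists_morBar_adj (wordProd_mem (D := D) (o := o) 2)
  refine ⟨_, pull_mem (morBar_mul hU (wordProd_mem k)), fun w w' => ?_⟩
  rw [emul_apply, emul_apply, lenProj_apply, lenProj_bv]
  by_cases hw : w.length = k
  · rw [if_pos hw]
    have h : (genL' d ∘ₗ (U * wordProd d k ∘ₗ genL' d) ∘ₗ genL d) (bv w) w' =
        U (bv [(w.map (z2Gen d)).prod]) (w'.map (z2Gen d)) := by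
      change U (wordProd d k (genL' d (genL d (bv w)))) (w'.map (z2Gen d)) = _
      rw [genL_bv, genL'_bv, wordProd_bv, if_pos hw]
    rw [h, ha, lcomp_apply, genL'_bv, wordProd_bv]
    by_cases hw' : w'.length = 2
    · rw [if_pos hw', if_pos hw', single_apply]; simp [hw, hw', apply_ite star]
    · simp [hw']
  · simp [hw]

theorem prod_two (a b c e : Fin d) : (([a, b] : List (Fin d)).map (z2Gen d)).prod = (([c, e] : List (Fin d)).map (z2Gen d)).prod ↔
    (a = b ∧ c = e) ∨ (a = c ∧ b = e) := by
  rw [← (redWord_injective d).eq_iff, redWord_prod, redWord_prod]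
  simp only [reduce, List.foldr, act, id]
  split_ifs with h1 h2 h2 <;> simp <;> grind

theorem cup_mem : (insertPair 0 * lenProj 0 : Op (Fin d)) ∈ wordMor D o 2 0 := by
  obtain ⟨T, hT, h⟩ := exists_gram (D := D) (o := o) 0
  convert hT
  refine op_ext fun w => fext fun w' => ?_
  rw [h, emul_apply, lenProj_bv]
  by_cases hw : w.length = 0
  · obtain rfl := List.length_eq_zero_iff.1 hw
    have h2 := insertPair_bv ([] : List (Fin d)) []
    rw [length_nil, nil_append] at h2
    rw [if_pos hw, h2, finsetSum_apply]
    by_cases hw' : w'.length = 2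
    · obtain ⟨c, e, rfl⟩ := List.length_eq_two.1 hw'
      have h3 := prod_two c e c c
      rw [show (([c, c] : List (Fin d)).map (z2Gen d)).prod = 1 by
        rw [← (redWord_injective d).eq_iff, redWord_prod, redWord_one]; simp [reduce, act]] at h3
      simp only [hw, hw', true_and, List.map_nil, List.prod_nil, h3, single_apply, nil_append]
      by_cases hce : c = e
      · simp [hce]
      · have : ∀ x, ¬ (x = c ∧ x = e) := fun x hx => hce (hx.1.symm.trans hx.2)
        simp [hce, Ne.symm hce, this]
    · rw [if_neg (by simp [hw']), sum_eq_zero]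
      exact fun c _ => single_eq_of_ne fun e => hw' (by rw [e]; rfl)
  · simp [hw]

theorem contractPair_comm : (lenProj 0 * contractPair 0 : Op (Fin d)) = contractPair 0 * lenProj 2 :=
  op_ext fun w => by
    rw [emul_apply, emul_apply, lenProj_bv]
    match w with
    | [] => rw [contractPair_bv_short (by simp)]; simp
    | [_] => rw [contractPair_bv_short (by simp)]; simp
    | a :: b :: w =>
      have h := contractPair_bv ([] : List (Fin d)) w a b
      rw [length_nil, nil_append] at h
      rw [h, apply_ite (lenProj 0), nil_append, lenProj_bv]
      by_cases hw : w = []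
      · subst hw; simp [h]
      · rw [if_neg (c := (a :: b :: w).length = 2) (by simpa using hw)]; simp [hw]

theorem cap_mem : (contractPair 0 * lenProj 2 : Op (Fin d)) ∈ wordMor D o 0 2 :=
  contractPair_comm ▸ wordMor_adj cup_mem ((insertPair_adj 0).mul (lenProj_adj 0))

theorem diag_mem : (diagPair 0 * lenProj 2 : Op (Fin d)) ∈ wordMor D o 2 2 := by
  obtain ⟨T, hT, h⟩ := exists_gram (D := D) (o := o) 2
  have h0 := wordMor_mul (D := D) (o := o) cup_mem cap_mem
  have h1 := (wordMor D o 2 2).add_mem ((wordMor D o 2 2).add_mem (lenProj_mem 2)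
    ((wordMor D o 2 2).smul_mem (-1) hT)) h0
  convert h1
  refine op_ext fun w => fext fun w' => ?_
  rw [ladd_apply, ladd_apply, lsmul_apply, fadd_apply,
    fadd_apply, fsmul_apply, h, smul_eq_mul, neg_one_mul, ← sub_eq_add_neg, emul_apply, emul_apply, emul_apply, emul_apply, lenProj_bv]
  by_cases hw : w.length = 2
  · obtain ⟨a, b, rfl⟩ := List.length_eq_two.1 hw
    have h2 := diagPair_bv ([] : List (Fin d)) [] a b
    have h3 := contractPair_bv ([] : List (Fin d)) [] a b
    have h4 := insertPair_bv ([] : List (Fin d)) []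
    rw [length_nil, nil_append] at h2 h3 h4
    rw [if_pos hw, h2, h3]
    by_cases hw' : w'.length = 2
    · obtain ⟨c, e, rfl⟩ := List.length_eq_two.1 hw'
      simp only [hw, hw', true_and, prod_two]
      by_cases hab : a = b
      · subst hab
        rw [if_pos rfl, if_pos rfl, nil_append, lenProj_bv, if_pos (c := ([] : List (Fin d)).length = 0) rfl, h4, finsetSum_apply]
        simp only [single_apply, nil_append]
        by_cases hce : c = e
        · subst hce; simp
        · have : ∀ x, ¬ (x = c ∧ x = e) := fun x hx => hce (hx.1.symm.trans hx.2)
          simp [this, hce]; grind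
      · simp [hab, single_apply]; grind
    · have hne : ∀ c c' : Fin d, w' ≠ [c, c'] := fun c c' e => hw' (by rw [e]; rfl)
      rw [if_neg (c := _ ∧ _) (by simp [hw'])]
      split_ifs
      · rw [nil_append, lenProj_bv, if_pos (c := ([] : List (Fin d)).length = 0) rfl, h4, finsetSum_apply, sum_eq_zero]
        · simp
        · exact fun c _ => single_eq_of_ne (hne _ _)
      · simp [single_eq_of_ne (hne _ _)]
  · simp [hw]

end WordMor

section WordVectors

universe w

variable {I : Type w} {Pi : SimpleGraph I} {d : ℕ} (D : Displacement Pi d) [Pi.LocallyFinite] (o : I)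

def constOp : (𝓥 (Fin d)) →ₗ[ℂ] Op (Fin d) := LinearMap.smulRightₗ (lapply [])

theorem constOp_apply (f v : 𝓥 (Fin d)) : constOp f v = v [] • f := rfl

theorem constOp_bv (f : 𝓥 (Fin d)) : constOp f (bv []) = f := by
  rw [constOp_apply, Finsupp.single_eq_same, one_smul]

theorem mul_constOp (S : Op (Fin d)) (f : 𝓥 (Fin d)) : S * constOp f = constOp (S f) :=
  lext fun v => by rw [emul_apply, constOp_apply, constOp_apply, map_smul]

/-- The vectors of a given length that belong to the path category. -/
def wordVec (n : ℕ) : Submodule ℂ (𝓥 (Fin d)) := (wordMor D o n 0).comap constOp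

variable {D o} {n m : ℕ} {v : 𝓥 (Fin d)}

theorem wordVec_apply (hv : v ∈ wordVec D o n) {w : List (Fin d)} (hw : w.length ≠ n) : v w = 0 := by
  have h : push (constOp v) (bv []) (w.map (z2Gen d)) = 0 :=
    morBar_apply (D := D) (o := o) (m := 0) hv (by rwa [length_map])
  rwa [← List.map_nil (f := z2Gen d), push_bv, genL_apply, constOp_bv] at h

theorem lenProj_wordVec (hv : v ∈ wordVec D o n) (k : ℕ) : lenProj k v = if k = n then v else 0 := by
  ext w
  rw [lenProj_apply]
  by_cases hk : k = n
  · subst hk; rw [if_pos rfl, ite_eq_left_iff]; exact fun h => (wordVec_apply hv h).symm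
  · rw [if_neg hk]
    split_ifs with h
    · exact wordVec_apply hv (h ▸ hk)
    · rfl

theorem wordVec_map {S : Op (Fin d)} (hS : S * lenProj m ∈ wordMor D o n m) (hv : v ∈ wordVec D o m) :
    S v ∈ wordVec D o n := by
  change constOp _ ∈ wordMor D o n 0
  have := wordMor_mul hS hv
  rwa [mul_constOp, emul_apply, lenProj_wordVec hv, if_pos rfl] at this

theorem wordVec_short {S : Op (Fin d)} (h : ∀ l : List (Fin d), l.length = n → S (bv l) = 0)
    (hv : v ∈ wordVec D o n) : S v = 0 := by
  have h1 : S * lenProj n = 0 := op_ext fun l => by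
    rw [emul_apply, lenProj_bv]
    split_ifs with hl
    exacts [h l hl, map_zero S]
  have := lcongr_fun h1 v
  rwa [emul_apply, lenProj_wordVec hv, if_pos rfl] at this

theorem pairClosed_wordVec : PairClosed (⨆ n, wordVec D o n) := by
  have key : ∀ S : Op (Fin d), (∀ n, ∀ v ∈ wordVec D o n, S v ∈ ⨆ n, wordVec D o n) →
      ∀ f ∈ ⨆ n, wordVec D o n, S f ∈ ⨆ n, wordVec D o n := fun S h f hf =>
    (iSup_le (fun n v hv => h n v hv) : _ ≤ (⨆ n, wordVec D o n).comap S) hf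
  have mem : ∀ {n v}, v ∈ wordVec D o n → v ∈ ⨆ n, wordVec D o n := fun {n _} h =>
    Submodule.mem_iSup_of_mem n h
  refine ⟨mem (n := 0) ?_, fun f hf n => ?_, fun r => key _ fun n v hv => ?_, fun r => key _ fun n v hv => ?_,
    fun r => key _ fun n v hv => ?_⟩
  · have h : constOp (bv []) = (lenProj 0 : Op (Fin d)) := op_ext fun l => by
      rw [constOp_apply, lenProj_bv]
      cases l <;> simp
    change constOp (bv []) ∈ wordMor D o 0 0
    exact h ▸ lenProj_mem 0
  · have h : f.filter (fun l => l.length = n) = lenProj n f := fext fun l => by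
      rw [lenProj_apply, filter_apply]
    rw [h]
    refine key _ (fun m v hv => ?_) f hf
    rw [lenProj_wordVec hv]
    split_ifs
    exacts [mem hv, zero_mem _]
  · by_cases h : r ≤ n
    · obtain ⟨s, rfl⟩ := Nat.exists_eq_add_of_le h
      rw [← zero_add s] at hv
      refine mem (wordVec_map (n := r + (2 + s)) (m := r + (0 + s)) ?_ hv)
      rw [insertPair_mul_lenProj]
      exact wordMor_blockTen (lenProj_mem r) (wordMor_blockTen cup_mem (lenProj_mem s))
    · rw [wordVec_short (fun l hl => insertPair_bv_short (by omega)) hv]; exact zero_mem _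
  · by_cases h : r + 2 ≤ n
    · obtain ⟨s, rfl⟩ := Nat.exists_eq_add_of_le h
      rw [add_assoc] at hv
      refine mem (wordVec_map (n := r + (0 + s)) (m := r + (2 + s)) ?_ hv)
      rw [contractPair_mul_lenProj]
      exact wordMor_blockTen (lenProj_mem r) (wordMor_blockTen cap_mem (lenProj_mem s))
    · rw [wordVec_short (fun l hl => contractPair_bv_short (by omega)) hv]; exact zero_mem _
  · by_cases h : r + 2 ≤ n
    · obtain ⟨s, rfl⟩ := Nat.exists_eq_add_of_le h
      rw [add_assoc] at hv
      refine mem (wordVec_map (n := r + (2 + s)) (m := r + (2 + s)) ?_ hv)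
      rw [diagPair_mul_lenProj]
      exact wordMor_blockTen (lenProj_mem r) (wordMor_blockTen diag_mem (lenProj_mem s))
    · rw [wordVec_short (fun l hl => diagPair_bv_short (by omega)) hv]; exact zero_mem _

theorem mem_wordVec (hv : v ∈ fixedVectors (𝓗 d).u)
    (hn : ∀ w : List (Fin d), w.length ≠ n → v w = 0) : v ∈ wordVec D o n := by
  have h : ∀ f ∈ ⨆ n, wordVec D o n, lenProj n f ∈ wordVec D o n := fun f hf =>
    (iSup_le (fun m v hv => show lenProj n v ∈ _ by
      rw [lenProj_wordVec hv]
      split_ifs with h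
      · exact h ▸ hv
      · exact zero_mem _) : _ ≤ (wordVec D o n).comap (lenProj n)) hf
  have h1 := h v (fixedVectors_le pairClosed_wordVec hv)
  convert h1
  ext w
  rw [lenProj_apply]
  split_ifs with hw
  · rfl
  · exact hn w hw

theorem contractPair_catL (f : 𝓥 (Fin d)) (c : Fin d) {x : List (Fin d)} (hx : x.length = n) :
    contractPair n (catL (n + 1) (tens f (bv [c]))) x = f (x ++ [c]) := by
  induction f using induction_linear with
  | zero => simp
  | add f g h h' => simp only [map_add, ladd_apply, fadd_apply, h, h']
  | single z a =>
    rw [← mul_one a, ← smul_eq_mul, ← smul_single]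
    simp only [map_smul, lsmul_apply, fsmul_apply]
    congr 1
    rw [tens_ev, catL_ev]
    by_cases hz : z.length = n + 1
    · obtain ⟨y, e, rfl⟩ : ∃ y e, z = y ++ [e] :=
        (eq_nil_or_concat' z).resolve_left (by rintro rfl; simp at hz)
      have hy : y.length = n := by simpa using hz
      have h := contractPair_bv y [] e c
      rw [hy, append_nil] at h
      rw [if_pos hz, append_assoc]
      refine (congrArg (· x) h).trans ?_
      by_cases hec : e = c
      · subst hec; simp [single_apply]
      · rw [if_neg hec, single_eq_of_ne fun h => hec (by simpa using (append_inj' h rfl).2.symm)]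
        rfl
    · rw [if_neg hz, map_zero, single_eq_of_ne fun h => hz (by rw [← h]; simp [hx])]; rfl

theorem exists_unrotate (m : ℕ) : ∀ {n v}, v ∈ wordVec D o (n + m) → ∃ T ∈ wordMor D o n m,
    ∀ x y : List (Fin d), x.length = n → y.length = m → T (bv y) x = v (x ++ y.reverse) := by
  induction m with
  | zero =>
    refine fun {n v} hv => ⟨constOp v, hv, fun x y _ hy => ?_⟩
    rw [List.length_eq_zero_iff.1 hy, constOp_bv, List.reverse_nil, append_nil]
  | succ m ih =>
    intro n v hv
    rw [show n + (m + 1) = n + 1 + m by omega] at hv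
    obtain ⟨T, hT, h⟩ := ih hv
    have h2 := wordMor_blockTen (lenProj_mem (D := D) (o := o) n) (wordMor_blockTen cap_mem (lenProj_mem 0))
    rw [← contractPair_mul_lenProj] at h2
    have h4 := wordMor_blockTen hT (lenProj_mem (D := D) (o := o) 1)
    rw [show n + 1 + 1 = n + (2 + 0) from rfl] at h4
    refine ⟨_, wordMor_mul h2 h4, fun x y hx hy => ?_⟩
    obtain ⟨y, c, rfl⟩ : ∃ z e, y = z ++ [e] :=
      (eq_nil_or_concat' y).resolve_left (by rintro rfl; simp at hy)
    have hy' : y.length = m := by simpa using hy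
    rw [emul_apply, blockTen_bv _ _ _ _ hy', lenProj_bv, if_pos (c := [c].length = 1) rfl,
      emul_apply]
    have h3 : lenProj (n + (2 + 0)) (catL (n + 1) (tens (T (bv y)) (bv [c]))) =
        catL (n + 1) (tens (T (bv y)) (bv [c])) := fext fun l => by
      rw [lenProj_apply, catL_apply, tens_apply]
      split_ifs with h4 h5 h5
      · rfl
      · rfl
      · rw [single_eq_of_ne fun h => h4 ?_, mul_zero]
        have := congrArg List.length h
        rw [length_drop] at this
        simp at this; omega
      · rfl
    rw [h3, contractPair_catL _ _ hx, h _ _ (by simp [hx]) hy']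
    simp

theorem mem_wordMor_of_eqv {S S' : Op (Fin d)}
    (h : Eqv (wordMat (𝓗 d).u) (wordMat (𝓗 d).u) S S') (n m : ℕ) :
    lenProj n * S * lenProj m ∈ wordMor D o n m := by
  have e : ∀ {n} {x : List (Fin d)} (h : x.length = n), ∃ s : Fin n → Fin d, ofFn s = x := fun {n x} h => by
    subst h; exact ⟨x.get, ofFn_get x⟩
  have hι : ∀ n, Eqv (tpow (𝓗 d).u n) (wordMat (𝓗 d).u)
      (𝓜 ofFn) (lcomapDomain ofFn List.ofFn_injective) := fun n =>
    Eqv.of_injective List.ofFn_injective (fun _ _ => (wordMat_ofFn _ _ _ _).symm)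
      (fun a b hb => wordMat_len _ fun h => hb (e (by rw [← h, length_ofFn])))
      fun a b hb => wordMat_len _ fun h => hb (e (by rw [h, length_ofFn]))
  have hT := ((hι n).symm.comp (h.comp (hι m))).mtx_mem
  rw [hyper_mem_intertwiners_iff] at hT
  obtain ⟨T, hT', hv⟩ := exists_unrotate (D := D) (o := o) m
    (mem_wordVec hT fun w hw => rotate_apply_length _ hw)
  have h1 := wordMor_mul (wordMor_mul (lenProj_mem n) hT') (lenProj_mem m)
  convert h1 using 1
  refine op_ext fun y => fext fun x => ?_
  rw [emul_apply, emul_apply, emul_apply, emul_apply, lenProj_apply, lenProj_apply, lenProj_bv]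
  split_ifs with hx hy
  · rw [hv x y hx hy]
    obtain ⟨s, rfl⟩ := e hx
    obtain ⟨t, rfl⟩ := e hy
    rw [rotate_apply]
    change _ = S (𝓜 ofFn (single t 1)) (ofFn s)
    rw [lmapDomain_apply, mapDomain_single]
  · simp
  · rfl

end WordVectors

section Profiles

variable {d : ℕ} {A : Type*} [Ring A] {U : Fin d → Fin d → A}

/-- The lengths of the reduced words of a tuple of group elements. -/
def profile (G : 𝓦 d) : List ℕ := G.map fun g => (redWord d g).length

theorem length_flatMap_redWord (G : 𝓦 d) : (G.flatMap (redWord d)).length = (profile G).sum := by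
  rw [List.length_flatMap, profile]

theorem wordMat_flatMap {G H : 𝓦 d} (h : profile G = profile H) :
    wordMat (groupMat U) G H = wordMat U (G.flatMap (redWord d)) (H.flatMap (redWord d)) := by
  induction G generalizing H with
  | nil => cases H <;> simp_all [profile]
  | cons g G ih =>
    cases H with
    | nil => simp [profile] at h
    | cons k H =>
      obtain ⟨h1, h2⟩ := List.cons.inj h
      rw [wordMat_cons_cons, ih h2, flatMap_cons, flatMap_cons, wordMat_append _ _ _ h1]; rfl

theorem wordMat_of_profile {G H : 𝓦 d} (h : profile G ≠ profile H) :
    wordMat (groupMat U) G H = 0 := by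
  induction G generalizing H with
  | nil => cases H <;> simp_all [profile]
  | cons g G ih =>
    cases H with
    | nil => simp
    | cons k H =>
      rw [wordMat_cons_cons]
      by_cases h1 : (redWord d g).length = (redWord d k).length
      · rw [ih fun h2 => h (congrArg₂ List.cons h1 h2), mul_zero]
      · rw [groupMat_of_length h1, zero_mul]

theorem exists_flatMap (hU : FreeRel id U) {G : 𝓦 d} {w : List (Fin d)}
    (h : wordMat U (G.flatMap (redWord d)) w ≠ 0) :
    ∃ H : 𝓦 d, profile H = profile G ∧ H.flatMap (redWord d) = w := by
  induction G generalizing w with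
  | nil => exact ⟨[], rfl, by cases w <;> simp_all⟩
  | cons g G ih =>
    have hl : (redWord d g).length ≤ w.length := by
      rw [← not_imp_comm.1 (wordMat_len U) h, flatMap_cons, length_append]; omega
    obtain ⟨a, b, ha, rfl⟩ := exists_split hl
    rw [flatMap_cons, wordMat_append _ _ _ ha.symm] at h
    obtain ⟨H, h1, rfl⟩ := ih (right_ne_zero_of_mul h)
    have hr : Reduced id a := not_imp_comm.1 (wordMat_of_reduced hU (reduced_redWord d g)) (left_ne_zero_of_mul h)
    refine ⟨(a.map (z2Gen d)).prod :: H, ?_, ?_⟩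
    · rw [profile, map_cons, redWord_of_reduced d hr, ha]; exact congrArg _ h1
    · rw [flatMap_cons, redWord_of_reduced d hr]

theorem flatMap_redWord_injective {G H : 𝓦 d} (h : profile G = profile H)
    (h' : G.flatMap (redWord d) = H.flatMap (redWord d)) : G = H := by
  induction G generalizing H with
  | nil => cases H <;> simp_all [profile]
  | cons g G ih =>
    cases H with
    | nil => simp [profile] at h
    | cons k H =>
      obtain ⟨h1, h2⟩ := List.cons.inj h
      obtain ⟨h3, h4⟩ := append_inj h' h1
      rw [redWord_injective d h3, ih h2 h4]

variable (κ : List ℕ)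

/-- Replacing tuples of a given profile by the concatenation of their reduced words. -/
def flatten : LinOp (𝓦 d) (List (Fin d)) :=
  𝓜 (fun G : {G : 𝓦 d // profile G = κ} => G.1.flatMap (redWord d)) ∘ₗ
    lcomapDomain Subtype.val val_injective

theorem flatten_subtype_injective : Inj
    (fun G : {G : 𝓦 d // profile G = κ} => G.1.flatMap (redWord d)) := fun G H h =>
  sext (flatMap_redWord_injective (G.2.trans H.2.symm) h)

def unflatten : LinOp (List (Fin d)) (𝓦 d) :=
  𝓜 Subtype.val ∘ₗ lcomapDomain
    (fun G : {G : 𝓦 d // profile G = κ} => G.1.flatMap (redWord d)) (flatten_subtype_injective κ)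

theorem eqv_flatten {A : Type*} [Ring A] [StarRing A] [Algebra ℂ A] [StarModule ℂ A] {U : Fin d → Fin d → A}
    (hU : FreeRel id U) : Eqv (wordMat (groupMat U)) (wordMat U) (flatten κ) (unflatten κ) := by
  have h0 : ∀ {U : Fin d → Fin d → A}, FreeRel id U → ∀ (G : {G : 𝓦 d // profile G = κ}) (w : List (Fin d)),
      w ∉ Set.range (fun G : {G : 𝓦 d // profile G = κ} => G.1.flatMap (redWord d)) →
      wordMat U (G.1.flatMap (redWord d)) w = 0 := fun hU G w hw => by_contra fun h => by
    obtain ⟨H, h1, h2⟩ := exists_flatMap hU h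
    exact hw ⟨⟨H, h1.trans G.2⟩, h2⟩
  have h1 : Eqv (fun G H : {G : 𝓦 d // profile G = κ} => wordMat (groupMat U) G.1 H.1)
      (wordMat (groupMat U)) (𝓜 Subtype.val)
      (lcomapDomain Subtype.val val_injective) :=
    Eqv.of_injective val_injective (fun _ _ => rfl)
      (fun G H hH => wordMat_of_profile fun e => hH ⟨⟨H, e.symm.trans G.2⟩, rfl⟩)
      fun G H hH => wordMat_of_profile fun e => hH ⟨⟨H, e.trans G.2⟩, rfl⟩
  have h2 := Eqv.of_injective (V := fun G H : {G : 𝓦 d // profile G = κ} => wordMat (groupMat U) G.1 H.1)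
    (W := wordMat U) (flatten_subtype_injective κ) (fun G H => wordMat_flatMap (G.2.trans H.2.symm))
    (fun G w hw => h0 hU G w hw)
    fun G w hw => by rw [← wordMat_swap]; exact h0 hU.swap G w hw
  exact h2.comp h1.symm

theorem flatten_bv (G : 𝓦 d) :
    flatten κ (bv G) = if profile G = κ then bv (G.flatMap (redWord d)) else 0 := by
  rw [flatten, lcomp_apply]
  split_ifs with h
  · have : (lcomapDomain Subtype.val val_injective : LinOp _ {G : 𝓦 d // profile G = κ}) (bv G) =
        ev ⟨G, h⟩ := fext fun H => by
      simp [single_apply, ext_iff]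
    rw [this, lmapDomain_apply, mapDomain_single]
  · have : (lcomapDomain Subtype.val val_injective : LinOp _ {G : 𝓦 d // profile G = κ}) (bv G) =
        0 := fext fun H => single_eq_of_ne fun e => h (e ▸ H.2)
    rw [this, map_zero]

theorem unflatten_apply (f : 𝓥 (Fin d)) (G : 𝓦 d) :
    unflatten κ f G = if profile G = κ then f (G.flatMap (redWord d)) else 0 := by
  split_ifs with h
  exacts [mapDomain_apply val_injective _ (⟨G, h⟩ : {G : 𝓦 d // profile G = κ}),
    Finsupp.mapDomain_of_notMem_range _ _ fun ⟨H, hH⟩ => h (hH ▸ H.2)]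

def pieces (d : ℕ) : List ℕ → LinOp (List (Fin d)) (𝓦 d)
  | [] => genL d ∘ₗ lenProj 0
  | k :: κ => blockTen k 1 (wordProd d k) (pieces d κ)

theorem pieces_flatMap (G : 𝓦 d) : pieces d (profile G) (bv (G.flatMap (redWord d))) = bv G := by
  induction G with
  | nil =>
    change genL d (lenProj 0 (bv [])) = bv []
    rw [lenProj_bv, if_pos (c := ([] : List (Fin d)).length = 0) rfl, genL_bv]; rfl
  | cons g G ih =>
    change blockTen (redWord d g).length 1 (wordProd d (redWord d g).length) (pieces d (profile G))
      (bv (redWord d g ++ G.flatMap (redWord d))) = _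
    rw [blockTen_bv _ _ _ _ rfl, ih, wordProd_bv, if_pos rfl, prod_redWord, catL_tens_bv (n := 1) _ rfl]; rfl

end Profiles

section Fullness

universe w

variable {I : Type w} {Pi : SimpleGraph I} {d : ℕ} {D : Displacement Pi d} [Pi.LocallyFinite] {o : I}

theorem pieces_mem (κ : List ℕ) : pieces d κ ∘ₗ genL' d ∈ morBar D o κ.length κ.sum := by
  induction κ with
  | nil => exact push_lenProj_zero
  | cons k κ ih =>
    have h := morBar_blockTen (wordProd_mem k) ih
    rw [blockTen_genL'] at h
    rwa [length_cons, Nat.add_comm κ.length]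

theorem unflatten_comp_mem {S S' : Op (Z2Free d)} (h : Eqv (wordMat (redMat d)) (wordMat (redMat d)) S S')
    (κ l : List ℕ) : (unflatten κ ∘ₗ flatten κ) * S * (unflatten l ∘ₗ flatten l) ∈
      morBar D o κ.length l.length := by
  have hf := fun κ => eqv_flatten κ (hyper_freeRel d)
  have h0 := mem_wordMor_of_eqv (D := D) (o := o) ((hf κ).comp (h.comp (hf l).symm)) κ.sum l.sum
  obtain ⟨Z, hZ, ha⟩ := exists_morBar_adj (pieces_mem (D := D) (o := o) l)
  have h1 := morBar_mul (pieces_mem (D := D) (o := o) κ) (morBar_mul h0 hZ)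
  have e1 : (pieces d κ ∘ₗ lenProj κ.sum) ∘ₗ flatten κ = unflatten κ ∘ₗ flatten κ := linOp_ext fun G => by
    rw [lcomp_apply, lcomp_apply, lcomp_apply, flatten_bv]
    split_ifs with h
    · subst h
      rw [lenProj_bv, if_pos (length_flatMap_redWord G), pieces_flatMap]
      ext H
      rw [unflatten_apply, single_apply, single_apply]
      by_cases hG : G = H
      · subst hG; simp
      · rw [if_neg hG]
        split_ifs with h2 h3
        · exact absurd (flatMap_redWord_injective h2.symm h3) hG
        · rfl
        · rfl
    · simp
  have e2 : unflatten l ∘ₗ lenProj l.sum ∘ₗ genL' d ∘ₗ Z = unflatten l ∘ₗ flatten l :=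
    linOp_ext fun G => fext fun H => by
      rw [lcomp_apply, lcomp_apply, lcomp_apply, lcomp_apply, unflatten_apply, unflatten_apply]
      split_ifs with h
      · subst h
        rw [lenProj_apply, if_pos (length_flatMap_redWord H), genL'_apply, ha, lcomp_apply, genL'_bv,
          pieces_flatMap, flatten_bv, single_apply]
        by_cases hG : H = G
        · subst hG; simp
        · rw [if_neg hG]
          split_ifs with h2
          · rw [single_eq_of_ne fun h3 => hG (flatMap_redWord_injective h2.symm h3)]; simp
          · simp
      · rfl
  convert h1 using 1
  rw [← e1, ← e2]
  refine lext fun x => ?_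
  exact congrArg _ (lcongr_fun genL'_genL _).symm

theorem unflatten_flatten_bv (κ : List ℕ) (G : 𝓦 d) :
    (unflatten κ ∘ₗ flatten κ) (bv G) = if profile G = κ then bv G else 0 := by
  ext H
  rw [lcomp_apply, unflatten_apply, flatten_bv]
  split_ifs with h1 h2 h2
  · rw [single_apply, single_apply]
    exact if_congr ⟨fun h => flatMap_redWord_injective (h2.trans h1.symm) h, fun h => h ▸ rfl⟩ rfl rfl
  · rfl
  · grind
  · rfl

theorem mem_morBar_of_eqv {n m : ℕ} {S S' : Op (Z2Free d)} (h : Eqv (wordMat (redMat d)) (wordMat (redMat d)) S S')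
    (hS : {G | S (bv G) ≠ 0}.Finite) (hS' : {G | S' (bv G) ≠ 0}.Finite)
    (hm : ∀ G, S (bv G) ≠ 0 → G.length = m) (hn : ∀ G, S' (bv G) ≠ 0 → G.length = n) :
    S ∈ morBar D o n m := by
  have key : ∀ {S : Op (Z2Free d)} (hS : {G | S (bv G) ≠ 0}.Finite),
      S * ∑ κ ∈ hS.toFinset.image profile, (unflatten κ ∘ₗ flatten κ) = S := fun {S} hS => op_ext fun G => by
    rw [emul_apply, lsum_apply]
    simp only [unflatten_flatten_bv]
    rw [Finset.sum_ite_eq]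
    split_ifs with h
    · rfl
    · by_contra h0
      rw [map_zero] at h0
      exact h (mem_image_of_mem _ (hS.mem_toFinset.2 (Ne.symm h0)))
  have hP : ∀ s : Finset (List ℕ), OpAdj (∑ κ ∈ s, (unflatten κ ∘ₗ flatten κ) : Op (Z2Free d))
      (∑ κ ∈ s, (unflatten κ ∘ₗ flatten κ)) := fun s G H => by
    have hf := Eqv.sum s fun κ => (eqv_flatten (d := d) κ (hyper_freeRel d)).symm.comp (eqv_flatten κ (hyper_freeRel d))
    exact hf.adj_apply G H
  have ha : OpAdj S' S := fun G H => h.symm.adj_apply G H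
  have h2 : (∑ κ ∈ hS'.toFinset.image profile, (unflatten κ ∘ₗ flatten κ)) * S = S := by
    have := ha.mul (hP (hS'.toFinset.image profile))
    rw [key hS'] at this
    exact this.symm.ext ha.symm
  have e : (∑ κ ∈ hS'.toFinset.image profile, (unflatten κ ∘ₗ flatten κ)) * S *
      ∑ κ ∈ hS.toFinset.image profile, (unflatten κ ∘ₗ flatten κ) = S := by rw [h2]; exact key hS
  refine (congrArg (· ∈ morBar D o n m) e).mp ?_
  rw [sum_mul, sum_mul]
  refine Submodule.sum_mem _ fun κ hκ => ?_
  rw [mul_sum]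
  refine Submodule.sum_mem _ fun l hl => ?_
  obtain ⟨G, hG, rfl⟩ := Finset.mem_image.1 hκ
  obtain ⟨H, hH, rfl⟩ := Finset.mem_image.1 hl
  have h3 := unflatten_comp_mem (D := D) (o := o) h (profile G) (profile H)
  rwa [show (profile G).length = n from (length_map _).trans (hn G (hS'.mem_toFinset.1 hG)),
    show (profile H).length = m from (length_map _).trans (hm H (hS.mem_toFinset.1 hH))] at h3

theorem Realization.w'_bar {X : PlanarObj Pi} (r : Realization D o X) (i : X.ι) :
    r.w' i ∘ₗ bar D o (X.p i) = r.w' i := by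
  have h := (r.eqv i).symm
  have h1 := h.comp (eqv_bar D o (hyper_freeRel d) (X.mem i) (X.selfAdj i))
  rw [r.bar_w] at h1
  exact h1.symm.unique h.symm

theorem Realization.exists_lin {X Y : PlanarObj Pi} (r : Realization D o X) (s : Realization D o Y)
    {M : LinOp r.Z.ι s.Z.ι} {M' : LinOp s.Z.ι r.Z.ι} (hM : Eqv r.Z.U s.Z.U M M') :
    ∃ T ∈ PlanarObj.homs X Y, r.lin s T = M := by
  have hfin : ∀ {X Y : PlanarObj Pi} (r : Realization D o X) (s : Realization D o Y) (M : LinOp r.Z.ι s.Z.ι) j i G,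
      (s.w j ∘ₗ M ∘ₗ r.w' i) (bv G) ≠ 0 → bar D o (X.p i) (bv G) ≠ 0 := fun r s M j i G h h0 => h (by
    rw [← r.w'_bar, lcomp_apply, lcomp_apply, lcomp_apply, h0, map_zero, map_zero, map_zero])
  have hlen : ∀ {X : PlanarObj Pi} i (G : 𝓦 d), bar D o (X.p i) (bv G) ≠ 0 → G.length = X.n i := fun {X} i G =>
    not_imp_comm.1 (bar_apply_of_length D o (mor_le_bim Pi _ _ (X.mem i)))
  have h : ∀ j i, ∃ T ∈ Mor Pi (Y.n j) (X.n i), bar D o T = s.w j ∘ₗ M ∘ₗ r.w' i := fun j i =>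
    mem_morBar_of_eqv ((s.eqv j).comp (hM.comp (r.eqv i).symm))
      ((finite_bar D o (X.mem i)).subset fun G => hfin r s M j i G)
      ((finite_bar D o (Y.mem j)).subset fun G => hfin s r M' i j G)
      (fun G hG => hlen i G (hfin r s M j i G hG)) fun G hG => hlen j G (hfin s r M' i j G hG)
  choose T hT hbar using h
  have hmem : T ∈ PlanarObj.homs X Y := fun j i => by
    refine ⟨hT j i, bar_injective D o (mor_mul Pi (Y.mem j) (hT j i)) (hT j i) ?_,
      bar_injective D o (mor_mul Pi (hT j i) (X.mem i)) (hT j i) ?_⟩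
    · rw [bar_mul D o (mor_le_bim Pi _ _ (Y.mem j)) (mor_le_bim Pi _ _ (hT j i)), hbar]
      change (bar D o (Y.p j) ∘ₗ s.w j) ∘ₗ _ = _
      rw [s.bar_w]
    · rw [bar_mul D o (mor_le_bim Pi _ _ (hT j i)) (mor_le_bim Pi _ _ (X.mem i)), hbar]
      change s.w j ∘ₗ M ∘ₗ r.w' i ∘ₗ bar D o (X.p i) = _
      rw [r.w'_bar]
  exact ⟨T, hmem, s.ext_left fun j => r.ext_right fun i => (w_lin_w' hmem j i).trans (hbar j i)⟩

instance realize_full : (realize D o).Full where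
  map_surjective {X Y} f := by
    obtain ⟨T, hT, h⟩ := (realization D o X).exists_lin (realization D o Y) (URep.eqv f.2)
    exact ⟨⟨T, hT⟩, URep.toLin_ext ((toLin_realize D o _).trans h)⟩

end Fullness

section PartialIsometries

variable {A : Type} [Ring A] [StarRing A] [Bialgebra ℂ A] [StarModule ℂ A]

open Matrix
open scoped ComplexOrder

theorem intertwiners_conjTranspose {X Y : URep A} {T : Matrix Y.ι X.ι ℂ} (hT : T ∈ intertwiners X.U Y.U) :
    Tᴴ ∈ intertwiners Y.U X.U := by have := (URep.eqv hT).symm.mtx_mem; rwa [mtx_ofMtx] at this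

theorem exists_inv_sqrt {ι : Type} [Fintype ι] [DecidableEq ι] {U : ι → ι → A} {D : Matrix ι ι ℂ}
    (hD : D.PosSemidef) (hU : D ∈ intertwiners U U) : ∃ E : Matrix ι ι ℂ, E ∈ intertwiners U U ∧
      Eᴴ = E ∧ E * E * E * D = E ∧ E * (E * D * E) = E ∧ D * (E * D * E) = D := by
  have hs : IsSelfAdjoint D := hD.1
  let f : ℝ → ℝ := fun x => if 0 < x then (Real.sqrt x)⁻¹ else 0
  have hc : ∀ g : ℝ → ℝ, ContinuousOn g (spectrum ℝ D) := fun g =>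
    (Set.Finite.continuousOn (Matrix.finite_real_spectrum) g)
  have hp : ∀ x ∈ spectrum ℝ D, 0 ≤ x := fun x hx => by
    obtain ⟨i, rfl⟩ := (hD.1.spectrum_real_eq_range_eigenvalues ▸ hx : x ∈ Set.range hD.1.eigenvalues)
    exact hD.eigenvalues_nonneg i
  have hmul : ∀ g h : ℝ → ℝ, cfc g D * cfc h D = cfc (fun x => g x * h x) D := fun g h =>
    (cfc_mul g h D (hc g) (hc h)).symm
  have hmulD : ∀ g : ℝ → ℝ, cfc g D * D = cfc (fun x => g x * x) D := fun g => by
    rw [← hmul g fun x => x, cfc_id' ℝ D hs]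
  have hsq : ∀ x : ℝ, 0 < x → (Real.sqrt x)⁻¹ * (Real.sqrt x)⁻¹ * x = 1 := fun x hx => by
    rw [← mul_inv, Real.mul_self_sqrt hx.le, inv_mul_cancel₀ hx.ne']
  have hcomm : ∀ M : Matrix ι ι ℂ, D * M = M * D → cfc f D * M = M * cfc f D := fun M hM =>
    hs.commute_cfc (𝕜 := ℝ) hM f
  have hDmul : ∀ g : ℝ → ℝ, D * cfc g D = cfc (fun x => x * g x) D := fun g => by
    rw [← hmul (fun x => x) g, cfc_id' ℝ D hs]
  refine ⟨cfc f D, fun k i => ?_, ?_, ?_, ?_, ?_⟩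
  · rw [← sub_eq_zero, ← Module.forall_dual_apply_eq_zero_iff ℂ]
    intro φ
    have h := congrFun (congrFun (hcomm (Matrix.of fun i j => φ (U i j)) (by
      ext k i
      have := congrArg φ (hU k i)
      simpa [mmul_apply, mul_comm] using this)) k) i
    simpa [mmul_apply, sub_eq_zero, mul_comm] using h
  · exact (cfc_predicate f D : IsSelfAdjoint _)
  · rw [hmul, hmul, hmulD]
    refine cfc_congr fun x hx => ?_
    obtain h | h := (hp x hx).eq_or_lt
    · simp [f, ← h]
    · simp only [f, if_pos h]; linear_combination (Real.sqrt x)⁻¹ * hsq x h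
  · rw [hmulD, hmul, hmul]
    refine cfc_congr fun x hx => ?_
    obtain h | h := (hp x hx).eq_or_lt
    · simp [f, ← h]
    · simp only [f, if_pos h]; linear_combination (Real.sqrt x)⁻¹ * hsq x h
  · rw [hmulD, hmul, hDmul]
    refine (cfc_congr fun x hx => ?_).trans (cfc_id' ℝ D hs)
    obtain h | h := (hp x hx).eq_or_lt
    · simp [f, ← h]
    · simp only [f, if_pos h]; linear_combination x * hsq x h

theorem exists_partialIsometries (R : URep A) {α : Type} [DecidableEq α] (Y : α → URep A)
    (T : ∀ a, Matrix (Y a).ι R.ι ℂ) (hT : ∀ a, T a ∈ intertwiners R.U (Y a).U) (t : Finset α) :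
    ∃ w : ∀ a, Matrix (Y a).ι R.ι ℂ, (∀ a, w a ∈ intertwiners R.U (Y a).U) ∧
      (∀ a ∈ t, w a * (w a)ᴴ * w a = w a) ∧ (∀ a ∈ t, ∀ b ∈ t, a ≠ b → w a * (w b)ᴴ = 0) ∧
      ∀ a ∈ t, T a * (1 - ∑ b ∈ t, (w b)ᴴ * w b) = 0 := by
  induction t using Finset.induction_on with
  | empty => exact ⟨fun _ => 0, fun _ => zero_mem _, by simp, by simp, by simp⟩
  | insert i t hi ih =>
    obtain ⟨w, hw, h1, h2, h3⟩ := ih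
    set q := 1 - ∑ b ∈ t, (w b)ᴴ * w b with hq
    have hwq : ∀ a ∈ t, w a * q = 0 := fun a ha => by
      rw [hq, Matrix.mul_sub, mmul_one, Matrix.mul_sum, Finset.sum_eq_single_of_mem a ha,
        ← mmul_assoc, h1 a ha, sub_self]
      exact fun b hb hab => by rw [← mmul_assoc, h2 a ha b hb hab.symm, Matrix.zero_mul]
    have hqq : q * q = q := by
      nth_rewrite 1 [hq]
      rw [Matrix.sub_mul, Matrix.one_mul, Matrix.sum_mul, sum_eq_zero fun a ha => ?_, sub_zero]
      rw [mmul_assoc, hwq a ha, Matrix.mul_zero]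
    have hqH : qᴴ = q := by simp [hq, conjTranspose_sum]
    have hqU : q ∈ intertwiners R.U R.U := (intertwiners _ _).sub_mem (intertwiners_one _)
      (sum_mem fun b _ => intertwiners_mul (intertwiners_conjTranspose (hw b)) (hw b))
    set B := T i * q with hB
    have hBU : B ∈ intertwiners R.U (Y i).U := intertwiners_mul (hT i) hqU
    have hBq : B * q = B := by rw [hB, mmul_assoc, hqq]
    clear_value B
    set D := Bᴴ * B with hD
    obtain ⟨E, hE, hEH, h4, h5, h6⟩ := exists_inv_sqrt (posSemidef_conjTranspose_mul_self B)
      (intertwiners_mul (intertwiners_conjTranspose hBU) hBU)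
    rw [← hD] at h4 h5 h6
    have hEq : E * q = E := by rw [← h4, mmul_assoc, hD, mmul_assoc Bᴴ, hBq]
    have hqE : q * E = E := by
      have := congrArg conjTranspose hEq
      rwa [conjTranspose_mul, hEH, hqH] at this
    set s := E * D * E with hs
    have hBs : B * s = B := by
      have hDs : Bᴴ * (B * s) = D := (mmul_assoc _ _ _).symm.trans h6
      have : (B - B * s)ᴴ * (B - B * s) = 0 := by
        rw [conjTranspose_sub, conjTranspose_mul, Matrix.sub_mul, mmul_assoc, Matrix.mul_sub, hDs,
          ← hD, sub_self, Matrix.mul_zero, sub_self]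
      exact (sub_eq_zero.1 (conjTranspose_mul_self_eq_zero.1 this)).symm
    have hqs : q * s = s := by rw [hs, ← mmul_assoc, ← mmul_assoc, hqE]
    have hBE : (B * E)ᴴ * (B * E) = s := by
      rw [conjTranspose_mul, hEH, hs, hD]; simp only [mmul_assoc]
    have hne : ∀ a ∈ t, a ≠ i := fun a ha e => hi (e ▸ ha)
    have hsum : 1 - ∑ b ∈ insert i t, (update w i (B * E) b)ᴴ * update w i (B * E) b =
        q - s := by
      have : ∑ b ∈ t, (update w i (B * E) b)ᴴ * update w i (B * E) b =
          ∑ b ∈ t, (w b)ᴴ * w b := sum_congr rfl fun a ha => by rw [update_of_ne (hne a ha)]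
      rw [sum_insert hi, update_self, hBE, this, hq, sub_sub, add_comm]
    have hz : ∀ a ∈ t, w a * (B * E)ᴴ = 0 := fun a ha => by
      rw [conjTranspose_mul, hEH, ← hqE, ← mmul_assoc, ← mmul_assoc, hwq a ha,
        Matrix.zero_mul, Matrix.zero_mul]
    refine ⟨update w i (B * E), fun a => ?_, fun a ha => ?_, fun a ha b hb hab => ?_, fun a ha => ?_⟩
    · by_cases h : a = i
      · subst h; rw [update_self]; exact intertwiners_mul hBU hE
      · rw [update_of_ne h]; exact hw a
    · obtain rfl | ha' := Finset.mem_insert.1 ha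
      · rw [update_self, mmul_assoc, hBE, mmul_assoc, hs, h5]
      · rw [update_of_ne (hne a ha'), h1 a ha']
    · obtain rfl | ha' := Finset.mem_insert.1 ha <;> obtain rfl | hb' := Finset.mem_insert.1 hb
      · exact absurd rfl hab
      · rw [update_self, update_of_ne (hne b hb'), ← conjTranspose_eq_zero,
          conjTranspose_mul, conjTranspose_conjTranspose, hz b hb']
      · rw [update_self, update_of_ne (hne a ha'), hz a ha']
      · rw [update_of_ne (hne a ha'), update_of_ne (hne b hb'), h2 a ha' b hb' hab]
    · rw [hsum, Matrix.mul_sub]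
      obtain rfl | ha' := Finset.mem_insert.1 ha
      · rw [← hqs, ← mmul_assoc, ← hB, hBs, sub_self]
      · rw [← hqs, ← mmul_assoc, h3 a ha', Matrix.zero_mul, sub_self]

theorem average_mem {h : A →ₗ[ℂ] ℂ} (hs : ∀ a : A, Coalgebra.comul (R := ℂ) (star a) = star (Coalgebra.comul (R := ℂ) a))
    (hinv : ∀ a, rid ℂ A (h.lTensor A (Coalgebra.comul (R := ℂ) a)) = h a • 1) (R Y : URep A) (j : R.ι)
    (y : Y.ι) : (Matrix.of fun b l => star (h (R.U l j * star (Y.U b y)))) ∈ intertwiners R.U Y.U := by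
  set M : Matrix R.ι Y.ι ℂ := Matrix.of fun l b => h (R.U l j * star (Y.U b y)) with hM
  have key : Matrix.of R.U * M.map (algebraMap ℂ A) * (Matrix.of Y.U)ᴴ = M.map (algebraMap ℂ A) := by
    ext l b
    have := hinv (R.U l j * star (Y.U b y))
    rw [Bialgebra.comul_mul, hs, R.comul_U, Y.comul_U, star_sum, Finset.sum_mul_sum] at this
    simp only [TensorProduct.star_tmul, tmul_mul_tmul, map_sum, lTensor_tmul, rid_tmul] at this
    rw [sum_comm] at this
    simpa [mmul_apply, sum_mul, hM, Algebra.smul_def, ← Algebra.commutes, mul_assoc] using this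
  refine intertwiners_conjTranspose (X := Y) (Y := R) (T := M) (URep.intertwiners_iff_map_mul.2 ?_)
  rw [← key, mmul_assoc, Y.mul_unitary, mmul_one, key]

theorem exists_decomposition {h : A →ₗ[ℂ] ℂ}
    (hs : ∀ a : A, Coalgebra.comul (R := ℂ) (star a) = star (Coalgebra.comul (R := ℂ) a))
    (hinv : ∀ a, rid ℂ A (h.lTensor A (Coalgebra.comul (R := ℂ) a)) = h a • 1) (h1 : h 1 = 1)
    {κ : Type} (Y : κ → URep A)
    (hY : Submodule.span ℂ (Set.range fun p : Σ k, (Y k).ι × (Y k).ι => (Y p.1).U p.2.1 p.2.2) = ⊤) (R : URep A) :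
    ∃ (α : Type) (_ : Fintype α) (_ : DecidableEq α) (k : α → κ) (w : ∀ a, Matrix (Y (k a)).ι R.ι ℂ),
      (∀ a, w a ∈ intertwiners R.U (Y (k a)).U) ∧ (∀ a, w a * (w a)ᴴ * w a = w a) ∧
      (∀ a b, a ≠ b → w a * (w b)ᴴ = 0) ∧ ∑ a, (w a)ᴴ * w a = 1 := by
  classical
  choose c hc using fun k j => Finsupp.mem_span_range_iff_exists_finsupp.1 (hY.ge (mem_top (x := R.U k j)))
  let t : Finset ((Σ k, (Y k).ι) × R.ι) := Finset.univ.biUnion fun k => Finset.univ.biUnion fun j =>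
    (c k j).support.image fun p => (⟨p.1, p.2.2⟩, j)
  obtain ⟨w, hw, h2, h3, h4⟩ := exists_partialIsometries R (fun a : (Σ k, (Y k).ι) × R.ι => Y a.1.1)
    (fun a => Matrix.of fun b l => star (h (R.U l a.2 * star ((Y a.1.1).U b a.1.2))))
    (fun a => average_mem hs hinv R _ _ _) t
  refine ⟨t, inferInstance, inferInstance, fun a => a.1.1.1, fun a => w a, fun a => hw a, fun a => h2 a a.2,
    fun a b hab => h3 a a.2 b b.2 fun e => hab (sext e), ?_⟩
  rw [Finset.sum_coe_sort t fun a => (w a)ᴴ * w a]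
  refine (sub_eq_zero.1 (Matrix.ext fun k m => ?_)).symm
  set q := 1 - ∑ a ∈ t, (w a)ᴴ * w a
  have e1 : ∀ (p : Σ k, (Y k).ι × (Y k).ι) j, (⟨p.1, p.2.2⟩, j) ∈ t → ∑ l, star (q l m) * h (R.U l j * star ((Y p.1).U p.2.1 p.2.2)) = 0 :=
    fun p j hp => by
      have := congrArg star (congrFun (congrFun (h4 _ hp) p.2.1) m)
      rw [mmul_apply, star_sum] at this
      simpa [mul_comm] using this
  have e2 : ∀ j, ∑ l, star (q l m) * h (R.U l j * star (R.U k j)) = 0 := fun j => by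
    rw [← hc k j, Finsupp.sum, star_sum]
    simp only [mul_sum, map_sum, star_smul, mul_smul_comm, map_smul, smul_eq_mul]
    rw [sum_comm]
    refine sum_eq_zero fun p hp => ?_
    rw [sum_congr rfl fun l _ => mul_left_comm _ _ _, ← mul_sum, e1 p j, mul_zero]
    exact Finset.mem_biUnion.2 ⟨k, mem_univ _, Finset.mem_biUnion.2 ⟨j, mem_univ _,
      mem_image_of_mem _ hp⟩⟩
  have e3 : ∑ j, ∑ l, star (q l m) * h (R.U l j * star (R.U k j)) = star (q k m) := by
    rw [sum_comm]
    simp only [← mul_sum, ← map_sum, R.unitary_left]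
    simp [apply_ite h, h1]
  rw [sum_eq_zero fun j _ => e2 j] at e3
  exact star_eq_zero.1 e3.symm

end PartialIsometries

section EssentialSurjectivity

open Matrix
open FreeStar (gen star_gen word word_cons)

theorem fund_comul_star {d : ℕ} (a : (𝓗 d).O) :
    Coalgebra.comul (R := ℂ) (star a) = star (Coalgebra.comul (R := ℂ) a) :=
  (𝓗 d).comulHom_star a

theorem span_wordMat (d : ℕ) : Submodule.span ℂ (Set.range fun p : List (Fin d) × List (Fin d) =>
    wordMat (𝓗 d).u p.1 p.2) = ⊤ := by
  have hg : ∀ g, UnivAlg.mk (𝓗 d).rels (gen g) = (𝓗 d).u g.1.1 g.1.2 := by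
    rintro ⟨⟨i, j⟩, _ | _⟩
    · rfl
    · rw [← hyper_star]
      exact (congrArg _ (star_gen ((i, j), false)).symm).trans (UnivAlg.mk_star _ _)
  refine eq_top_iff.2 fun a _ => ?_
  obtain ⟨a, rfl⟩ := UnivAlg.mk_surjective _ a
  have ha : a ∈ Submodule.span ℂ (Set.range (word (X := Fin d))) := FreeStar.span_word ▸ mem_top
  refine span_induction (p := fun a _ => UnivAlg.mk (𝓗 d).rels a ∈ _) ?_ ?_ ?_ ?_ ha
  · rintro _ ⟨l, rfl⟩
    refine subset_span ⟨(l.map fun g => g.1.1, l.map fun g => g.1.2), ?_⟩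
    induction l with
    | nil => exact (map_one _).symm
    | cons g l ih => rw [word_cons, map_mul, ← ih, hg]; rfl
  · rw [map_zero]; exact zero_mem _
  · intro a b _ _ ha hb; rw [map_add]; exact add_mem ha hb
  · intro c a _ ha; rw [map_smul]; exact smul_mem _ c ha

theorem exists_invariant (d : ℕ) : ∃ h : (𝓗 d).O →ₗ[ℂ] ℂ, h 1 = 1 ∧ ∀ a,
    rid ℂ (𝓗 d).O (h.lTensor (𝓗 d).O (Coalgebra.comul (R := ℂ) a)) =
      h a • 1 := by
  obtain ⟨P, h, hP, hh⟩ := exists_haar (fixedVectors_pairClosed (hyper_freeRel d))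
  refine ⟨h, ?_, fun a => ?_⟩
  · have := hh [] []
    rw [hP.fix _ (fixedVectors_pairClosed (hyper_freeRel d)).unit] at this
    simpa using this
  have ha := (span_wordMat d).ge (mem_top (x := a))
  induction ha using span_induction with
  | zero => simp
  | add a b _ _ ha hb => rw [map_add, map_add, map_add, ha, hb, map_add, add_smul]
  | smul c a _ ha => rw [map_smul, map_smul, map_smul, ha, map_smul, smul_assoc]
  | mem a ha =>
    obtain ⟨⟨x, y⟩, rfl⟩ := ha
    dsimp only
    by_cases hxy : x.length = y.length
    · obtain ⟨n, hn⟩ : ∃ n, x.length = n := ⟨_, rfl⟩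
      obtain ⟨pl, hU, hinj, hlen, hex⟩ : ∃ pl : ((𝓗 d).fund.pow n).ι → List (Fin d),
          (∀ a b, ((𝓗 d).fund.pow n).U a b = wordMat (𝓗 d).u (pl a) (pl b)) ∧
          Inj pl ∧ (∀ a, (pl a).length = n) ∧ ∀ l, l.length = n → ∃ a, pl a = l :=
        ⟨_, URep.pow_U _ n, URep.powList_injective _ n, URep.length_powList _ n, by
          rintro l rfl
          exact (𝓗 d).fund.exists_powList l⟩
      obtain ⟨a, rfl⟩ := hex x hn
      obtain ⟨b, rfl⟩ := hex y (hxy ▸ hn)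
      rw [hh, ← hU, ((𝓗 d).fund.pow n).comul_U, map_sum, map_sum, ← hP.mem (bv (pl b)) (pl a), coact,
        linearCombination_apply, Finsupp.sum]
      have hsupp : (P (bv (pl b))).support ⊆ Finset.univ.image pl := fun l hl => by
        obtain ⟨c, rfl⟩ := hex l (by
          by_contra hl'
          refine Finsupp.mem_support_iff.1 hl (hP.length _ _ ?_)
          rwa [hlen])
        exact mem_image_of_mem _ (mem_univ c)
      rw [Finset.sum_subset hsupp fun l _ hl => by rw [Finsupp.notMem_support_iff.1 hl, zero_smul],
        Finset.sum_image fun _ _ _ _ h => hinj h]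
      refine sum_congr rfl fun c _ => ?_
      rw [lTensor_tmul, rid_tmul, hU, hU, hh]
    · rw [wordMat_len _ hxy]; simp

end EssentialSurjectivity

section EssentialImage

open Matrix Realization

universe w

variable {d : ℕ} {I : Type w} {Pi : SimpleGraph I} (D : Displacement Pi d) [Pi.LocallyFinite] (o : I)

theorem Realization.eqv_ident {X : PlanarObj Pi} (r s : Realization D o X) :
    Eqv r.Z.U s.Z.U (∑ i, s.w' i ∘ₗ r.w i) (∑ i, r.w' i ∘ₗ s.w i) :=
  Eqv.sum _ fun i => (s.eqv i).symm.comp (r.eqv i)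

theorem Realization.ident_comp {X : PlanarObj Pi} (r s : Realization D o X) :
    (∑ i, r.w' i ∘ₗ s.w i) ∘ₗ ∑ i, s.w' i ∘ₗ r.w i = lid := by
  classical
  refine Eq.trans ?_ r.sum
  rw [finset_sum_comp]
  refine sum_congr rfl fun i _ => ?_
  rw [comp_finset_sum, sum_eq_single i]
  · calc _ = r.w' i ∘ₗ (s.w i ∘ₗ s.w' i) ∘ₗ r.w i := rfl
      _ = _ := by rw [s.proj, r.bar_w]
  · intro j _ hj
    calc _ = r.w' i ∘ₗ (s.w i ∘ₗ s.w' j) ∘ₗ r.w j := rfl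
      _ = 0 := by rw [s.orth i j hj.symm, zero_comp, comp_zero]
  · simp

def Realization.iso {X : PlanarObj Pi} (r s : Realization D o X) : r.Z ≅ s.Z :=
  URep.isoOf r.Z s.Z _ _ (eqv_ident D o r s) (ident_comp D o r s) (ident_comp D o s r)

theorem Realization.iso_adj {X : PlanarObj Pi} (r s : Realization D o X) :
    URep.IsAdj (r.iso D o s).hom (r.iso D o s).inv := URep.isoOf_adj _ _ _

theorem ofMtx_comp {α β γ : Type*} [Fintype β] [Finite γ] (M : Matrix γ β ℂ) (N : Matrix β α ℂ) :
    ofMtx M ∘ₗ ofMtx N = ofMtx (M * N) :=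
  mtx_injective (by rw [mtx_comp, mtx_ofMtx, mtx_ofMtx, mtx_ofMtx])

theorem lcomapDomain_lmapDomain {α β : Type*} {f : α → β} (hf : Inj f) :
    (lcomapDomain f hf : LinOp β α) ∘ₗ 𝓜 f = lid :=
  lext fun x => fext fun a => mapDomain_apply hf x a

theorem lcomapDomain_ev {α β : Type*} {f : α → β} (hf : Inj f) {b : β} (hb : b ∉ Set.range f) :
    (lcomapDomain f hf : LinOp β α) (ev b) = 0 :=
  fext fun a => single_eq_of_ne fun e => hb ⟨a, e⟩

theorem exists_tupleReps (d : ℕ) : ∃ (Y : ℕ → URep (𝓗 d).O) (f : ∀ n, (Y n).ι → 𝓦 d)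
    (hf : ∀ n, Inj (f n)), (∀ n, Eqv (Y n).U (wordMat (redMat d)) (𝓜 (f n))
      (lcomapDomain (f n) (hf n))) ∧ (∀ n a, (f n a).length = n) ∧
    Submodule.span ℂ (Set.range fun p : Σ k, (Y k).ι × (Y k).ι => (Y p.1).U p.2.1 p.2.2) = ⊤ := by
  choose Y f hf hU h1 h2 hs hn using fun n => exists_tupleRep
    ((List.finite_length_eq (Fin d) n).image (List.map (z2Gen d))) (n := n)
    (by rintro _ ⟨l, hl, rfl⟩; exact (length_map _).trans hl)
  refine ⟨Y, f, hf, fun n => Eqv.of_injective (hf n) (hU n) (h1 n) (h2 n), hn, ?_⟩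
  rw [eq_top_iff, ← span_wordMat, Submodule.span_le]
  rintro _ ⟨⟨x, y⟩, rfl⟩
  by_cases hxy : x.length = y.length
  · obtain ⟨a, ha⟩ := hs x.length ⟨x, rfl, rfl⟩
    obtain ⟨b, hb⟩ := hs x.length ⟨y, hxy.symm, rfl⟩
    refine subset_span ⟨⟨x.length, a, b⟩, ?_⟩
    refine (hU _ _ _).trans ?_
    rw [ha, hb]
    clear ha hb a b
    induction x generalizing y with
    | nil => cases y <;> rfl
    | cons i x ih => cases y with
      | nil => rfl
      | cons j y =>
        exact congrArg₂ (· * ·) (groupMat_gen _ _) (ih y (Nat.succ.inj hxy))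
  · dsimp only; rw [wordMat_len _ hxy]; exact zero_mem _

theorem exists_realization_of_rep (R : URep (𝓗 d).O) :
    ∃ (X : PlanarObj Pi) (r : Realization D o X), r.Z = R := by
  obtain ⟨h, h1, hinv⟩ := exists_invariant d
  obtain ⟨Y, f, hf, he, hlen, hY⟩ := exists_tupleReps d
  obtain ⟨α, _, _, k, w, hw, hw1, hw2, hw3⟩ := exists_decomposition fund_comul_star hinv h1 Y hY R
  let W : ∀ a, LinOp R.ι (𝓦 d) := fun a => 𝓜 (f (k a)) ∘ₗ ofMtx (w a)
  let W' : ∀ a, LinOp (𝓦 d) R.ι := fun a =>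
    ofMtx (w a)ᴴ ∘ₗ lcomapDomain (f (k a)) (hf (k a))
  have hW : ∀ a, Eqv R.U (wordMat (redMat d)) (W a) (W' a) := fun a => (he (k a)).comp (URep.eqv (hw a))
  have hW1 : ∀ a, W' a ∘ₗ W a = ofMtx ((w a)ᴴ * w a) := fun a => by
    calc _ = ofMtx (w a)ᴴ ∘ₗ (lcomapDomain (f (k a)) (hf (k a)) ∘ₗ
          𝓜 (f (k a))) ∘ₗ ofMtx (w a) := rfl
      _ = _ := by rw [lcomapDomain_lmapDomain, id_comp, ofMtx_comp]
  have hW2 : ∀ a b, a ≠ b → W a ∘ₗ W' b = 0 := fun a b hab => by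
    calc _ = 𝓜 (f (k a)) ∘ₗ (ofMtx (w a) ∘ₗ ofMtx (w b)ᴴ) ∘ₗ
          lcomapDomain (f (k b)) (hf (k b)) := rfl
      _ = 0 := by
        rw [ofMtx_comp, hw2 a b hab]
        have : ofMtx (0 : Matrix (Y (k a)).ι (Y (k b)).ι ℂ) = 0 := mtx_injective (mtx_ofMtx _)
        rw [this, zero_comp, comp_zero]
  have hW3 : ∀ a, (W a ∘ₗ W' a) ∘ₗ W a = W a := fun a => by
    rw [comp_assoc, hW1, comp_assoc, ofMtx_comp, ← mmul_assoc, hw1]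
  have hP : ∀ a, Eqv (wordMat (redMat d)) (wordMat (redMat d)) (W a ∘ₗ W' a) (W a ∘ₗ W' a) := fun a =>
    (hW a).comp (hW a).symm
  have hr : ∀ a G, (W a ∘ₗ W' a) (bv G) ≠ 0 → G ∈ Set.range (f (k a)) := fun a G hG => by
    by_contra h
    exact hG (by
      change W a (ofMtx (w a)ᴴ (lcomapDomain (f (k a)) (hf (k a)) (ev G))) = 0
      rw [lcomapDomain_ev _ h, map_zero, map_zero])
  have hfin : ∀ a, {G | (W a ∘ₗ W' a) (bv G) ≠ 0}.Finite := fun a => (Set.finite_range (f (k a))).subset (hr a)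
  have hl : ∀ a G, (W a ∘ₗ W' a) (bv G) ≠ 0 → G.length = k a := fun a G hG => by
    obtain ⟨i, rfl⟩ := hr a G hG
    exact hlen _ _
  choose p hp hb using fun a => mem_morBar_of_eqv (D := D) (o := o) (hP a) (hfin a) (hfin a) (hl a) (hl a)
  have hB := fun a => mor_le_bim Pi _ _ (hp a)
  have hadj : ∀ a, OpAdj (p a) (p a) := fun a => by
    obtain ⟨p', h'⟩ := exists_morAdj D (hp a)
    have : p' = p a := bar_injective D o h'.mem' (hp a) ((bar_adj D o h'.adj).symm.ext fun G H => by
      rw [hb]; exact (hP a).adj_apply _ _)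
    exact this ▸ h'.adj
  exact ⟨{
    ι := α
    n := k
    p := p
    mem := hp
    idem := fun a => bar_injective D o (mor_mul Pi (hp a) (hp a)) (hp a) (by
      rw [bar_mul D o (hB a) (hB a), hb]
      change (W a ∘ₗ W' a) ∘ₗ W a ∘ₗ W' a = _
      rw [← comp_assoc, hW3])
    selfAdj := hadj }, {
    Z := R
    w := W
    w' := W'
    eqv := hW
    sum := by
      simp only [hW1]
      refine mtx_injective ?_
      rw [mtx_id, ← hw3]
      ext i j
      simp [mtx, ofMtx, Matrix.sum_apply]
    proj := fun a => (hb a).symm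
    orth := hW2 }, rfl⟩

instance realize_essSurj : (realize D o).EssSurj where
  mem_essImage R := by
    obtain ⟨X, r, rfl⟩ := exists_realization_of_rep D o R
    exact ⟨X, ⟨(realization D o X).iso D o r⟩⟩

end EssentialImage

section PathObject

open Realization

universe w

variable {d : ℕ} {I : Type w} {Pi : SimpleGraph I} (D : Displacement Pi d) [Pi.LocallyFinite] (o : I)

theorem homMat_pathGraph_bv (l : List I) : homMat Pi pathGraph (bv l) = bv l ∨ homMat Pi pathGraph (bv l) = 0 := by
  classical
  by_cases hl : l.length = 2
  · obtain ⟨a, b, rfl⟩ := List.length_eq_two.1 hl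
    rw [homMat_pathGraph Pi]
    split_ifs with h
    exacts [.inl rfl, .inr rfl]
  · exact .inr (homMat_of_length Pi hl)

def pathObj (Pi : SimpleGraph I) [Pi.LocallyFinite] : PlanarObj Pi where
  ι := Unit
  n _ := 1
  p _ := homMat Pi pathGraph
  mem _ := subset_span ⟨_, isL_pathGraph, rfl⟩
  idem _ := op_ext fun l => by
    obtain h | h := homMat_pathGraph_bv (Pi := Pi) l
    · rw [emul_apply, h, h]
    · rw [emul_apply, h, map_zero]
  selfAdj _ i j := by
    classical
    by_cases e : i = j
    · subst e; obtain h | h := homMat_pathGraph_bv (Pi := Pi) i <;> simp [h]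
    · have key : ∀ {i j : List I}, i ≠ j → homMat Pi pathGraph (bv j) i = 0 := fun {i j} e => by
        obtain h | h := homMat_pathGraph_bv (Pi := Pi) j
        · rw [h, single_eq_of_ne e]
        · rw [h]; rfl
      rw [key e, key (Ne.symm e), star_zero]

theorem pathObj_isPathObj : (pathObj Pi).IsPathObj where
  card := rfl
  n_eq _ := rfl
  p_pair _ a b := (homMat_pathGraph Pi a b).trans (by congr)
  p_other _ _ h := homMat_of_length Pi h

theorem single_z2Gen_injective (d : ℕ) : Inj fun i : Fin d => [z2Gen d i] := fun i j h =>
  (List.cons.inj (map_z2Gen_injective d (a₁ := [i]) (a₂ := [j]) h)).1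

theorem eqv_fund (d : ℕ) : Eqv (𝓗 d).fund.U (wordMat (redMat d))
    (𝓜 fun i : Fin d => [z2Gen d i])
    (lcomapDomain (fun i : Fin d => [z2Gen d i]) (single_z2Gen_injective d)) := by
  have key : ∀ V : Z2Free d → Z2Free d → (𝓗 d).O,
      (∀ g h, (redWord d g).length ≠ (redWord d h).length → V g h = 0) → ∀ i b,
        b ∉ Set.range (fun i : Fin d => [z2Gen d i]) → wordMat V [z2Gen d i] b = 0 := by
    intro V hV i b hb
    obtain _ | ⟨g, _ | ⟨g', b⟩⟩ := b
    · rfl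
    · rw [wordMat_cons_cons, hV, zero_mul]
      intro e
      rw [redWord_gen] at e
      obtain ⟨j, hj⟩ := List.length_eq_one_iff.1 e.symm
      exact hb ⟨j, congrArg (fun g => [g]) (redWord_injective d (by rw [hj, redWord_gen]))⟩
    · exact wordMat_len _ (by simp)
  refine Eqv.of_injective _ (fun i j => ?_) (key _ fun g h hgh => groupMat_of_length hgh) fun i b hb => ?_
  · exact ((mul_one _).trans (groupMat_gen _ _)).symm
  · rw [← wordMat_swap]; exact key _ (fun g h hgh => groupMat_of_length hgh.symm) i b hb

theorem single_comp (d : ℕ) : (𝓜 fun i : Fin d => [z2Gen d i]) ∘ₗ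
    (lcomapDomain (fun i : Fin d => [z2Gen d i]) (single_z2Gen_injective d)) = push (lenProj 1) := by
  refine linOp_ext fun G => ?_
  rw [lcomp_apply]
  by_cases hG : ∃ w : List (Fin d), w.map (z2Gen d) = G
  · obtain ⟨w, rfl⟩ := hG
    refine Eq.trans ?_ (push_bv _ w).symm
    rw [lenProj_bv]
    split_ifs with hw
    · obtain ⟨i, rfl⟩ := List.length_eq_one_iff.1 hw
      have e : (ev (List.map (z2Gen d) [i]) : 𝓦 d →₀ ℂ) =
          𝓜 (fun i : Fin d => [z2Gen d i]) (ev i) := by rw [lmapDomain_apply, mapDomain_single]; rfl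
      rw [genL_bv]
      refine (congrArg _ ((congrArg _ e).trans (lcongr_fun
        (lcomapDomain_lmapDomain (single_z2Gen_injective d)) _))).trans e.symm
    · rw [lcomapDomain_ev, map_zero, map_zero]
      rintro ⟨i, hi⟩
      exact hw ((length_map _).symm.trans (congrArg List.length hi).symm)
  · push Not at hG
    rw [lcomapDomain_ev (single_z2Gen_injective d) (fun ⟨i, hi⟩ => hG [i] hi), map_zero]
    refine (?_ : push (lenProj 1) (bv G) = 0).symm
    rw [push_eq, lcomp_apply, lcomp_apply, genL'_of_not_mem hG, map_zero, map_zero]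

def fundRealization : Realization D o (pathObj Pi) where
  Z := (𝓗 d).fund
  w _ := 𝓜 fun i : Fin d => [z2Gen d i]
  w' _ := lcomapDomain (fun i : Fin d => [z2Gen d i]) (single_z2Gen_injective d)
  eqv _ := eqv_fund d
  sum := (Fintype.sum_unique (ι := Unit) _).trans (lcomapDomain_lmapDomain _)
  proj _ := (single_comp d).trans bar_pathGraph.symm
  orth _ _ h := absurd rfl h

/-- The unitary tensor category of a regular tree. -/
theorem exists_tree_equivalence {I : Type*} (Pi : SimpleGraph I) [Pi.LocallyFinite] (hT : Pi.IsTree)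
    (hR : Pi.IsRegularOfDegree d) : (∀ i j, ZeroCellEquiv Pi i j) ∧
      ∃ (F : PlanarObj Pi ⥤ URep (𝓗 d).O) (_ : F.Monoidal), IsUnitaryTensorEquivalence F ∧
        ∃ E : PlanarObj Pi, E.IsPathObj ∧ ∃ α : F.obj E ≅ (𝓗 d).fund, URep.IsAdj α.hom α.inv := by
  obtain ⟨D⟩ := nonempty_displacement hT hR
  obtain ⟨o⟩ := hT.1.nonempty
  let _ := (realizeCore D o).toMonoidal
  exact ⟨D.zeroCellEquiv, realize D o, inferInstance,
    ⟨{ }, realize_additive D o, realize_linear D o, fun X Y f g h => realize_adj D o f g h,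
      realizeUnit_adj D o, realizeMu_adj D o⟩,
    pathObj Pi, pathObj_isPathObj, (realization D o _).iso D o (fundRealization D o), iso_adj D o _ _⟩

end PathObject

end PlanarQ

end

theorem mainTheorem8 (d : ℕ) :
    -- the planar quantization of the free group is the dual of `H⁺(J)`
    (∃ Φ : (PlanarQ.planarQuantization (PlanarQ.freeGens d)).O ≃ₐc[ℂ]
          (PlanarQ.twistedHyperoctahedral d).O,
        (∀ a, Φ (star a) = star (Φ a)) ∧
        ∀ s t : Fin d ⊕ Fin d,
          Φ ((PlanarQ.planarQuantization (PlanarQ.freeGens d)).u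
            (PlanarQ.freeGenMem d s) (PlanarQ.freeGenMem d t)) =
          (PlanarQ.twistedHyperoctahedral d).u s t) ∧
    -- the planar quantization of the free product of groups of order two is the dual of `H⁺(d)`
    (∃ Φ : (PlanarQ.planarQuantization (PlanarQ.z2Gens d)).O ≃ₐc[ℂ]
          (PlanarQ.hyperoctahedral d).O,
        (∀ a, Φ (star a) = star (Φ a)) ∧
        ∀ s t : Fin d,
          Φ ((PlanarQ.planarQuantization (PlanarQ.z2Gens d)).u
            (PlanarQ.z2GenMem d s) (PlanarQ.z2GenMem d t)) =
          (PlanarQ.hyperoctahedral d).u s t) ∧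
    -- the unitary tensor category of the `d`-regular tree
    (∀ (I : Type*) (Pi : SimpleGraph I) [Pi.LocallyFinite],
        Pi.IsTree → Pi.IsRegularOfDegree d →
        (∀ i j, PlanarQ.ZeroCellEquiv Pi i j) ∧
        ∃ (F : PlanarQ.PlanarObj Pi ⥤ PlanarQ.URep (PlanarQ.hyperoctahedral d).O)
          (_ : F.Monoidal),
          PlanarQ.IsUnitaryTensorEquivalence F ∧
          ∃ E : PlanarQ.PlanarObj Pi, E.IsPathObj ∧
            ∃ α : F.obj E ≅ (PlanarQ.hyperoctahedral d).fund,
              PlanarQ.URep.IsAdj α.hom α.inv) ∧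
    -- the morphisms between the tensor powers of the fundamental representation
    (∀ n m : ℕ,
        PlanarQ.intertwiners (PlanarQ.tpow (PlanarQ.hyperoctahedral d).u m)
            (PlanarQ.tpow (PlanarQ.hyperoctahedral d).u n) =
          Submodule.span ℂ {T | ∃ p : Setoid (Fin n ⊕ Fin m), PlanarQ.IsNoncrossingEven p ∧
            T = PlanarQ.partitionMatrix d p}) := by
  exact ⟨PlanarQ.planarQuantization_freeGroup d, PlanarQ.planarQuantization_z2Free d,
    fun _ Pi _ hT hR => PlanarQ.exists_tree_equivalence Pi hT hR,
    fun n m => PlanarQ.intertwiners_eq_span d n m⟩
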